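/- All complexes are graded by $\mathbb{Z}$ with differentials of degree $-1$; DG algebras are unital and associative, possibly unbounded, and tensor products and permutations of factors follow the Koszul sign rule. Let $p$ be a prime, $G=\mathbb{Z}/p\mathbb{Z}$, let $R$ be a perfect field of characteristic $p$, and $R'=W_2(R)$ the ring of Witt vectors of length $2$, so that $R=R'/p$. *Resolution data.* Multiplicative resolution data $\nu=\langle\overline P_\bullet,I_\bullet\rangle$ for $G$ consist of two DG algebras over $\mathbb{Z}$ on which $G$ acts by DG algebra automorphisms, such that: (i) $\overline P_\bullet$ is acyclic, $\overline P_i=0$ for $i<0$, $\overline P_0=\mathbb{Z}\cdot 1$ is free of rank one, and $\overline P_i$ is a projective $\mathbb{Z}[G]$-module for $i>0$ (so $\overline P_\bullet$ is the cone of the augmentation $P_\bullet\to\mathbb{Z}$ of a projective resolution of $\mathbb{Z}$); (ii) $I_i=0$ for $i>0$, all the $I_i$ are projective (that is, $\mathbb{Z}$-free and injective relatively to $\mathbb{Z}$) $\mathbb{Z}[G]$-modules, and the unit $\mathbb{Z}\to I_\bullet$ is injective, with image $\operatorname{Ker}(d:I_0\to I_{-1})$, and a quasiisomorphism. Fix such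 data $\nu$. *Cyclic powers.* For a DG algebra $A_\bullet$ over $R$ let $E_\bullet=A_\bullet^{\otimes_R p}$, with $G$ permuting the factors cyclically, let $\check C_\bullet=(E_\bullet\otimes_{\mathbb{Z}}\overline P_\bullet\otimes_{\mathbb{Z}} I_\bullet)^G$ (diagonal action, total complex formed with direct sums), and let $F^m\check C_n\subset\check C_n$ consist of the invariants that lie in the sum of the $E_j\otimes\overline P_b\otimes I_c$ with $j\le -mp$ and $j+b+c=n$. This is a decreasing filtration by subcomplexes, compatible with the product. Put $$Z_n=\{z\in F^{-n}\check C_n : dz\in F^{1-n}\check C_{n-1}\},\qquad B_n=F^{2-n}\check C_n+d(F^{1-n}\check C_{n+1}),$$ and let $C_\bullet(A_\bullet)$ be the DG algebra with terms $C_n(A_\bullet)=Z_n/B_n$ (the filtered truncation $\tau^F_{[0,1]}\check C_\bullet$), regarded as a DG algebra over $R$ by letting $r\in R$ act as multiplication by $r^p$. *Augmentations.* An augmentation is a family of DG algebra maps $a=a_A:C_\bullet(A_\bullet)\to A_\bullet$ over $R$, defined for all DG algebras $A_\bullet$ over $R$ and functorial in $A_\bullet$, that are surjective in every degree, for which the class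 of $z\in Z_n$ goes to $0$ if and only if $z\in F^{1-n}\check C_n+d(F^{-n}\check C_{n+1})$ (so $a$ identifies $\tau^F_{[0,0]}\check C_\bullet$ with $A_\bullet$), and such that $a([v^{\otimes p}\otimes 1\otimes 1])=v$ for $v\in A_0$ with $dv=0$. **Proposition.** An augmentation exists. Moreover, for every augmentation $a$ and every DG algebra $A_\bullet$ over $R$: if there is a DG algebra $A'_\bullet$ over $R'$ with all the terms $A'_n$ flat over $R'$ and with an isomorphism of DG algebras $A'_\bullet/p\cong A_\bullet$ over $R$, then there exist a DG algebra $\widetilde C^l_\bullet(A_\bullet)$ over $R$ and a DG algebra map $l:\widetilde C^l_\bullet(A_\bullet)\to C_\bullet(A_\bullet)$ over $R$ such that the composition $$\widetilde C^l_\bullet(A_\bullet)\xrightarrow{\ l\ }C_\bullet(A_\bullet)\xrightarrow{\ a\ }A_\bullet$$ is a quasiisomorphism. -/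

import Mathlib

open scoped TensorProduct DirectSum

universe u v w

namespace CyclicPower

/-- The sign `(-1) ^ c` of a parity `c`. -/
def koszul (k : Type u) [Ring k] (c : ZMod 2) : k := if c = 0 then 1 else -1

section koszul

variable (k : Type u) [CommRing k]

lemma koszul_zero : koszul k 0 = 1 := if_pos rfl

lemma koszul_one : koszul k 1 = -1 := if_neg (by decide)

lemma zmod_two_cases (a : ZMod 2) : a = 0 ∨ a = 1 := by
  revert a; decide

lemma koszul_add (a b : ZMod 2) : koszul k (a + b) = koszul k a * koszul k b := by
  rcases zmod_two_cases a with rfl | rfl <;> rcases zmod_two_cases b with rfl | rfl <;>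
    simp [koszul_zero, koszul_one, show (1 + 1 : ZMod 2) = 0 from rfl]

lemma koszul_mul_self (a : ZMod 2) : koszul k a * koszul k a = 1 := by
  rcases zmod_two_cases a with rfl | rfl <;> simp [koszul_zero, koszul_one]

lemma koszul_cast (a : ZMod 2) : ((koszul ℤ a : ℤ) : k) = koszul k a := by
  rcases zmod_two_cases a with rfl | rfl <;> simp [koszul_zero, koszul_one]

lemma koszul_sum {ι : Type*} (t : Finset ι) (c : ι → ZMod 2) :
    koszul k (∑ i ∈ t, c i) = ∏ i ∈ t, koszul k (c i) := by
  classical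
  induction t using Finset.induction_on with
  | empty => exact koszul_zero k
  | insert i t hi ih => rw [Finset.sum_insert hi, Finset.prod_insert hi, koszul_add, ih]

end koszul

lemma negOnePow_eq_koszul (i : ℤ) : ((i.negOnePow : ℤˣ) : ℤ) = koszul ℤ (i : ZMod 2) := by
  rcases Int.even_or_odd i with h | h
  · rw [Int.negOnePow_even i h]
    have : (i : ZMod 2) = 0 := by
      rw [ZMod.intCast_zmod_eq_zero_iff_dvd]; exact_mod_cast h.two_dvd
    rw [this]; rfl
  · rw [Int.negOnePow_odd i h]
    obtain ⟨m, rfl⟩ := h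
    have : ((2 * m + 1 : ℤ) : ZMod 2) = 1 := by
      push_cast
      have h2 : (2 : ZMod 2) = 0 := by decide
      rw [h2]; ring
    rw [this]; rfl

/-- A unital associative differential superalgebra on the `k`-module `V`: the grading is remembered
only modulo `2`, through the projections `par 0`, `par 1` onto the even and odd parts. -/
structure SuperDG (k : Type u) [CommRing k] (V : Type v) [AddCommGroup V] [Module k V] where
  mul : V →ₗ[k] V →ₗ[k] V
  one : V
  par : ZMod 2 → V →ₗ[k] V
  d : V →ₗ[k] V
  par_sum : ∀ x, ∑ e, par e x = x
  par_par : ∀ e f x, par e (par f x) = if e = f then par f x else 0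
  par_mul : ∀ e f x y, par e x = x → par f y = y → par (e + f) (mul x y) = mul x y
  par_one : par 0 one = one
  par_d : ∀ e x, par e x = x → par (e + 1) (d x) = d x
  mul_assoc : ∀ x y z, mul (mul x y) z = mul x (mul y z)
  one_mul : ∀ x, mul one x = x
  mul_one : ∀ x, mul x one = x
  d_d : ∀ x, d (d x) = 0
  leibniz : ∀ e x y, par e x = x → d (mul x y) = mul (d x) y + koszul k e • mul x (d y)

/-- A unital associative differential algebra on the `k`-module `V`, the Koszul signs being
recorded by the involution `s`, which is `(-1) ^ i` on elements of degree `i`. -/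
structure SignedDG (k : Type u) [CommRing k] (V : Type v) [AddCommGroup V] [Module k V] where
  mul : V →ₗ[k] V →ₗ[k] V
  one : V
  s : V →ₗ[k] V
  d : V →ₗ[k] V
  mul_assoc : ∀ x y z, mul (mul x y) z = mul x (mul y z)
  one_mul : ∀ x, mul one x = x
  mul_one : ∀ x, mul x one = x
  s_mul : ∀ x y, s (mul x y) = mul (s x) (s y)
  s_one : s one = one
  s_s : ∀ x, s (s x) = x
  d_d : ∀ x, d (d x) = 0
  d_s : ∀ x, d (s x) = - s (d x)
  leibniz : ∀ x y, d (mul x y) = mul (d x) y + mul (s x) (d y)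

namespace SuperDG

variable {k : Type u} [CommRing k] {V : Type v} [AddCommGroup V] [Module k V]

/-- The parity involution. -/
def s (S : SuperDG k V) : V →ₗ[k] V := S.par 0 - S.par 1

variable (S : SuperDG k V)

lemma par_add (x : V) : S.par 0 x + S.par 1 x = x := by
  have := S.par_sum x
  rwa [show (Finset.univ : Finset (ZMod 2)) = {0, 1} from rfl, Finset.sum_pair (by decide)] at this

lemma par_idem (e : ZMod 2) (x : V) : S.par e (S.par e x) = S.par e x := by
  simp [S.par_par]

lemma par_of_ne {e f : ZMod 2} (h : e ≠ f) {x : V} (hx : S.par f x = x) : S.par e x = 0 := by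
  rw [← hx, S.par_par, if_neg h]

lemma s_of_par {e : ZMod 2} {x : V} (hx : S.par e x = x) : S.s x = koszul k e • x := by
  rw [s, LinearMap.sub_apply]
  rcases zmod_two_cases e with rfl | rfl
  · rw [hx, S.par_of_ne (by decide) hx, koszul_zero, sub_zero, one_smul]
  · rw [hx, S.par_of_ne (by decide) hx, koszul_one, zero_sub, neg_one_smul]

lemma par_s (e : ZMod 2) (x : V) : S.par e (S.s x) = S.s (S.par e x) := by
  rw [S.s_of_par (S.par_idem e x), s, LinearMap.sub_apply, map_sub, S.par_par, S.par_par]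
  rcases zmod_two_cases e with rfl | rfl
  · rw [koszul_zero, if_pos rfl, if_neg (by decide), sub_zero, one_smul]
  · rw [koszul_one, if_pos rfl, if_neg (by decide), zero_sub, neg_one_smul]

lemma s_s (x : V) : S.s (S.s x) = x := by
  rw [← S.par_add (S.s (S.s x)), par_s, par_s, par_s, par_s, S.s_of_par (S.par_idem 0 x),
    S.s_of_par (S.par_idem 1 x), map_smul, map_smul, S.s_of_par (S.par_idem 0 x),
    S.s_of_par (S.par_idem 1 x), smul_smul, smul_smul, koszul_mul_self, koszul_mul_self,
    one_smul, one_smul, S.par_add]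

/-- The parity of `∑ e_j f_i` over `i < j`: the sign in the product of two tensors whose factors
have the parities `e` and `f` is `(-1) ^ crossing e f`. -/
def crossing {n : ℕ} (e f : Fin n → ZMod 2) : ZMod 2 :=
  ∑ j, ∑ i, if i < j then e j * f i else 0

/-- The parity of the number of pairs of odd factors whose order is reversed by `τ`. -/
def inversions {n : ℕ} (τ : Equiv.Perm (Fin n)) (e : Fin n → ZMod 2) : ZMod 2 :=
  ∑ j, ∑ i, if i < j ∧ τ j < τ i then e i * e j else 0

/-- The product on the `n`-fold tensor power:
`(a₁ ⊗ ⋯ ⊗ aₙ)(b₁ ⊗ ⋯ ⊗ bₙ) = (-1) ^ (∑_{i < j} |aⱼ||bᵢ|) a₁b₁ ⊗ ⋯ ⊗ aₙbₙ`. -/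
noncomputable def powMul (n : ℕ) :
    (⨂[k] _ : Fin n, V) →ₗ[k] (⨂[k] _ : Fin n, V) →ₗ[k] (⨂[k] _ : Fin n, V) :=
  ∑ e : Fin n → ZMod 2, ∑ f : Fin n → ZMod 2, koszul k (crossing e f) •
    PiTensorProduct.map₂ (fun l => S.mul.compl₁₂ (S.par (e l)) (S.par (f l)))

/-- The differential on the `n`-fold tensor power:
`d (a₁ ⊗ ⋯ ⊗ aₙ) = ∑ⱼ (-1) ^ (∑_{i < j} |aᵢ|) a₁ ⊗ ⋯ ⊗ d aⱼ ⊗ ⋯ ⊗ aₙ`. -/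
noncomputable def powD (n : ℕ) : (⨂[k] _ : Fin n, V) →ₗ[k] (⨂[k] _ : Fin n, V) :=
  ∑ j : Fin n, PiTensorProduct.map
    (fun l => if l < j then S.s else if l = j then S.d else LinearMap.id)

/-- The action of a permutation `τ` on the `n`-fold tensor power, with the Koszul sign: the factor
in place `i` is moved to the place `τ i`. -/
noncomputable def powPerm (n : ℕ) (τ : Equiv.Perm (Fin n)) :
    (⨂[k] _ : Fin n, V) →ₗ[k] (⨂[k] _ : Fin n, V) :=
  ∑ e : Fin n → ZMod 2, koszul k (inversions τ e) •
    ((PiTensorProduct.reindex k (fun _ => V) τ).toLinearMap ∘ₗ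
      PiTensorProduct.map (fun l => S.par (e l)))

/-- The parity involution on the `n`-fold tensor power. -/
noncomputable def powS (n : ℕ) : (⨂[k] _ : Fin n, V) →ₗ[k] (⨂[k] _ : Fin n, V) :=
  PiTensorProduct.map (fun _ => S.s)

lemma pow_ext {n : ℕ} {M : Type w} [AddCommGroup M] [Module k M]
    {f g : (⨂[k] _ : Fin n, V) →ₗ[k] M}
    (h : ∀ (e : Fin n → ZMod 2) (a : Fin n → V), (∀ l, S.par (e l) (a l) = a l) →
      f (PiTensorProduct.tprod k a) = g (PiTensorProduct.tprod k a)) : f = g := by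
  apply PiTensorProduct.ext
  ext a
  have : a = fun l => ∑ e : ZMod 2, S.par e (a l) := by
    funext l; rw [S.par_sum]
  simp only [LinearMap.compMultilinearMap_apply]
  rw [this, MultilinearMap.map_sum, map_sum, map_sum]
  exact Finset.sum_congr rfl fun e _ => h e _ fun l => S.par_idem _ _

section eval

variable {n : ℕ} {e f : Fin n → ZMod 2} {a b : Fin n → V}

lemma powMul_tprod (ha : ∀ l, S.par (e l) (a l) = a l) (hb : ∀ l, S.par (f l) (b l) = b l) :
    S.powMul n (PiTensorProduct.tprod k a) (PiTensorProduct.tprod k b) =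
      koszul k (crossing e f) • PiTensorProduct.tprod k (fun l => S.mul (a l) (b l)) := by
  simp only [powMul, LinearMap.sum_apply, LinearMap.smul_apply, PiTensorProduct.map₂_tprod_tprod,
    LinearMap.compl₁₂_apply]
  rw [Finset.sum_eq_single e, Finset.sum_eq_single f]
  · simp only [ha, hb]
  · intro f' _ hf
    obtain ⟨l, hl⟩ := Function.ne_iff.mp hf
    rw [MultilinearMap.map_coord_zero _ l, smul_zero]
    rw [S.par_of_ne hl (hb l), map_zero]
  · simp
  · intro e' _ he
    obtain ⟨l, hl⟩ := Function.ne_iff.mp he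
    refine Finset.sum_eq_zero fun f' _ => ?_
    rw [MultilinearMap.map_coord_zero _ l, smul_zero]
    rw [S.par_of_ne hl (ha l), map_zero, LinearMap.zero_apply]
  · simp

lemma powPerm_tprod (τ : Equiv.Perm (Fin n)) (ha : ∀ l, S.par (e l) (a l) = a l) :
    S.powPerm n τ (PiTensorProduct.tprod k a) =
      koszul k (inversions τ e) • PiTensorProduct.tprod k (fun l => a (τ.symm l)) := by
  simp only [powPerm, LinearMap.sum_apply, LinearMap.smul_apply, LinearMap.comp_apply,
    PiTensorProduct.map_tprod, LinearEquiv.coe_coe, PiTensorProduct.reindex_tprod]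
  rw [Finset.sum_eq_single e]
  · simp only [ha]
  · intro e' _ he
    obtain ⟨l, hl⟩ := Function.ne_iff.mp he
    rw [MultilinearMap.map_coord_zero _ (τ l), smul_zero]
    rw [Equiv.symm_apply_apply, S.par_of_ne hl (ha l)]
  · simp

lemma powS_tprod (ha : ∀ l, S.par (e l) (a l) = a l) :
    S.powS n (PiTensorProduct.tprod k a) =
      koszul k (∑ l, e l) • PiTensorProduct.tprod k a := by
  rw [powS, PiTensorProduct.map_tprod, koszul_sum k, ← MultilinearMap.map_smul_univ]
  congr 1; funext l; exact S.s_of_par (ha l)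

lemma powD_tprod (ha : ∀ l, S.par (e l) (a l) = a l) :
    S.powD n (PiTensorProduct.tprod k a) =
      ∑ j, koszul k (∑ i, if i < j then e i else 0) •
        PiTensorProduct.tprod k (Function.update a j (S.d (a j))) := by
  simp only [powD, LinearMap.sum_apply, PiTensorProduct.map_tprod]
  refine Finset.sum_congr rfl fun j _ => ?_
  rw [koszul_sum k, ← MultilinearMap.map_smul_univ]
  congr 1; funext l
  by_cases h1 : l < j
  · rw [if_pos h1, if_pos h1, S.s_of_par (ha l), Function.update_of_ne h1.ne]
  · rw [if_neg h1, if_neg h1]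
    by_cases h2 : l = j
    · subst h2; rw [if_pos rfl, Function.update_self, koszul_zero k, one_smul]
    · rw [if_neg h2, Function.update_of_ne h2, koszul_zero k, one_smul]; rfl

end eval

section signs

variable {n : ℕ}

lemma crossing_add_left (e e' f : Fin n → ZMod 2) :
    crossing (e + e') f = crossing e f + crossing e' f := by
  simp only [crossing, ← Finset.sum_add_distrib]
  refine Finset.sum_congr rfl fun j _ => Finset.sum_congr rfl fun i _ => ?_
  split_ifs <;> simp [add_mul]

lemma crossing_add_right (e f f' : Fin n → ZMod 2) :
    crossing e (f + f') = crossing e f + crossing e f' := by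
  simp only [crossing, ← Finset.sum_add_distrib]
  refine Finset.sum_congr rfl fun j _ => Finset.sum_congr rfl fun i _ => ?_
  split_ifs <;> simp [mul_add]

lemma crossing_zero_left (f : Fin n → ZMod 2) : crossing 0 f = 0 := by simp [crossing]

lemma crossing_zero_right (e : Fin n → ZMod 2) : crossing e 0 = 0 := by simp [crossing]

lemma crossing_single_left (j : Fin n) (f : Fin n → ZMod 2) :
    crossing (Pi.single j 1) f = ∑ i, if i < j then f i else 0 := by
  rw [crossing, Finset.sum_eq_single j]
  · simp
  · intro b _ hb; simp [hb]
  · simp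

lemma crossing_single_right (e : Fin n → ZMod 2) (i : Fin n) :
    crossing e (Pi.single i 1) = ∑ j, if i < j then e j else 0 := by
  rw [crossing]
  refine Finset.sum_congr rfl fun j _ => ?_
  rw [Finset.sum_eq_single i]
  · simp
  · intro b _ hb; simp [hb]
  · simp

lemma sum_trichotomy (e : Fin n → ZMod 2) (j : Fin n) :
    ∑ l, e l = (∑ i, if i < j then e i else 0) + e j + ∑ i, if j < i then e i else 0 := by
  have : e j = ∑ i, if i = j then e i else 0 := by simp
  rw [this, ← Finset.sum_add_distrib, ← Finset.sum_add_distrib]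
  refine Finset.sum_congr rfl fun i _ => ?_
  rcases lt_trichotomy i j with h | h | h
  · simp [h, h.ne, h.le]
  · simp [h]
  · simp [h, h.ne', h.le]

lemma sum_lt_single (e : Fin n → ZMod 2) (i j : Fin n) :
    (∑ x, if x < j then (e + Pi.single i 1 : Fin n → ZMod 2) x else 0) =
      (∑ x, if x < j then e x else 0) + if i < j then 1 else 0 := by
  have : (if i < j then 1 else 0 : ZMod 2) =
      ∑ x, if x < j then (Pi.single i 1 : Fin n → ZMod 2) x else 0 := by
    rw [Finset.sum_eq_single i]
    · simp
    · intro b _ hb; simp [hb]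
    · simp
  rw [this, ← Finset.sum_add_distrib]
  refine Finset.sum_congr rfl fun x _ => ?_
  split_ifs <;> simp

lemma sum_add_single (e : Fin n → ZMod 2) (i : Fin n) :
    (∑ x, (e + Pi.single i 1 : Fin n → ZMod 2) x) = (∑ x, e x) + 1 := by
  simp [Finset.sum_add_distrib]

/-- The parity of a product of permuted homogeneous tensors. -/
lemma crossing_perm (τ : Equiv.Perm (Fin n)) (e f : Fin n → ZMod 2) :
    crossing e f + inversions τ (e + f) =
      inversions τ e + inversions τ f + crossing (fun l => e (τ.symm l)) (fun l => f (τ.symm l)) := by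
  have hc : crossing (fun l => e (τ.symm l)) (fun l => f (τ.symm l)) =
      ∑ j, ∑ i, if τ i < τ j then e j * f i else 0 := by
    rw [crossing, ← Equiv.sum_comp τ]
    refine Finset.sum_congr rfl fun j _ => ?_
    rw [← Equiv.sum_comp τ]
    simp
  have hi : inversions τ (e + f) = inversions τ e + inversions τ f +
      ((∑ j, ∑ i, if i < j ∧ τ j < τ i then e j * f i else 0) +
        ∑ j, ∑ i, if j < i ∧ τ i < τ j then e j * f i else 0) := by
    rw [Finset.sum_comm (f := fun j i => if j < i ∧ τ i < τ j then e j * f i else 0)]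
    simp only [inversions, ← Finset.sum_add_distrib]
    refine Finset.sum_congr rfl fun j _ => Finset.sum_congr rfl fun i _ => ?_
    split_ifs
    · simp only [Pi.add_apply]; ring
    · simp
  rw [hc, hi, add_left_comm]
  congr 1
  rw [crossing]
  simp only [← Finset.sum_add_distrib]
  refine Finset.sum_congr rfl fun j _ => Finset.sum_congr rfl fun i _ => ?_
  have h2 : ∀ x : ZMod 2, x + x = 0 := by decide
  rcases lt_trichotomy i j with h | h | h
  · rcases lt_trichotomy (τ i) (τ j) with h' | h' | h'
    · simp [h, h', h.not_gt, h'.not_gt]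
    · exact absurd (τ.injective h') h.ne
    · simp [h, h', h.not_gt, h'.not_gt, h2]
  · subst h; simp
  · rcases lt_trichotomy (τ i) (τ j) with h' | h' | h'
    · simp [h, h', h.not_gt, h'.not_gt]
    · exact absurd (τ.injective h') h.ne'
    · simp [h, h', h.not_gt, h'.not_gt]

/-- The parity of a differential of permuted homogeneous tensors. -/
lemma inversions_single (τ : Equiv.Perm (Fin n)) (e : Fin n → ZMod 2) (j : Fin n) :
    (∑ i, if i < j then e i else 0) + inversions τ (e + Pi.single j 1) =
      inversions τ e + ∑ i, if i < τ j then e (τ.symm i) else 0 := by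
  have h := crossing_perm τ (Pi.single j 1) e
  have h1 : (fun l => (Pi.single j 1 : Fin n → ZMod 2) (τ.symm l)) = Pi.single (τ j) 1 := by
    funext l
    by_cases hl : l = τ j
    · subst hl; simp
    · have : τ.symm l ≠ j := fun h => hl (by rw [← h]; simp)
      simp [hl, this]
  have h0 : inversions τ (Pi.single j 1) = 0 := by
    refine Finset.sum_eq_zero fun a _ => Finset.sum_eq_zero fun b _ => ?_
    split_ifs with hab
    · by_cases hb : b = j
      · subst hb; simp [hab.1.ne']
      · simp [hb]
    · rfl
  rwa [h1, h0, crossing_single_left, crossing_single_left, add_comm (Pi.single j 1) e,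
    zero_add] at h

end signs

section power

variable {n : ℕ} {e f : Fin n → ZMod 2} {a b : Fin n → V}

lemma par_mul_pi (ha : ∀ l, S.par (e l) (a l) = a l) (hb : ∀ l, S.par (f l) (b l) = b l) :
    ∀ l, S.par ((e + f) l) (S.mul (a l) (b l)) = S.mul (a l) (b l) :=
  fun l => S.par_mul _ _ _ _ (ha l) (hb l)

lemma par_update (ha : ∀ l, S.par (e l) (a l) = a l) (j : Fin n) :
    ∀ l, S.par ((e + Pi.single j 1 : Fin n → ZMod 2) l) (Function.update a j (S.d (a j)) l) =
      Function.update a j (S.d (a j)) l := by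
  intro l
  by_cases h : l = j
  · subst h; simpa using S.par_d _ _ (ha l)
  · simpa [h] using ha l

lemma powMul_assoc (x y z : ⨂[k] _ : Fin n, V) :
    S.powMul n (S.powMul n x y) z = S.powMul n x (S.powMul n y z) := by
  have h1 : ∀ (e : Fin n → ZMod 2) (a : Fin n → V), (∀ l, S.par (e l) (a l) = a l) →
      ∀ y z, S.powMul n (S.powMul n (PiTensorProduct.tprod k a) y) z =
        S.powMul n (PiTensorProduct.tprod k a) (S.powMul n y z) := by
    intro e a ha y z
    have h2 : ∀ (f : Fin n → ZMod 2) (b : Fin n → V), (∀ l, S.par (f l) (b l) = b l) →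
      S.powMul n (S.powMul n (PiTensorProduct.tprod k a) (PiTensorProduct.tprod k b)) =
        S.powMul n (PiTensorProduct.tprod k a) ∘ₗ (S.powMul n (PiTensorProduct.tprod k b)) := by
      intro f b hb
      refine S.pow_ext fun g c hc => ?_
      rw [LinearMap.comp_apply, S.powMul_tprod ha hb, map_smul, LinearMap.smul_apply,
        S.powMul_tprod (S.par_mul_pi ha hb) hc, S.powMul_tprod hb hc, map_smul,
        S.powMul_tprod ha (S.par_mul_pi hb hc), smul_smul, smul_smul, ← koszul_add, ← koszul_add,
        crossing_add_left, crossing_add_right]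
      simp only [S.mul_assoc]
      congr 2; ring
    have h3 : (S.powMul n ∘ₗ S.powMul n (PiTensorProduct.tprod k a)) =
        (LinearMap.llcomp k _ _ _ (S.powMul n (PiTensorProduct.tprod k a))) ∘ₗ S.powMul n := by
      refine S.pow_ext fun f b hb => ?_
      exact h2 f b hb
    exact LinearMap.congr_fun (LinearMap.congr_fun h3 y) z
  have h4 : (((S.powMul n).flip z) ∘ₗ ((S.powMul n).flip y)) =
      (S.powMul n).flip (S.powMul n y z) := S.pow_ext fun e a ha => h1 e a ha y z
  exact LinearMap.congr_fun h4 x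

lemma powOne_mul (x : ⨂[k] _ : Fin n, V) :
    S.powMul n (PiTensorProduct.tprod k fun _ => S.one) x = x := by
  have : S.powMul n (PiTensorProduct.tprod k fun _ => S.one) = LinearMap.id := by
    refine S.pow_ext fun f b hb => ?_
    rw [S.powMul_tprod (e := 0) (fun _ => S.par_one) hb, crossing_zero_left, koszul_zero, one_smul]
    simp only [S.one_mul]; rfl
  exact LinearMap.congr_fun this x

lemma powMul_one (x : ⨂[k] _ : Fin n, V) :
    S.powMul n x (PiTensorProduct.tprod k fun _ => S.one) = x := by
  have : (S.powMul n).flip (PiTensorProduct.tprod k fun _ => S.one) = LinearMap.id := by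
    refine S.pow_ext fun f b hb => ?_
    rw [LinearMap.flip_apply, S.powMul_tprod (f := 0) hb (fun _ => S.par_one), crossing_zero_right,
      koszul_zero, one_smul]
    simp only [S.mul_one]; rfl
  exact LinearMap.congr_fun this x

lemma ext_bilin {M : Type w} [AddCommGroup M] [Module k M]
    {F G : (⨂[k] _ : Fin n, V) →ₗ[k] (⨂[k] _ : Fin n, V) →ₗ[k] M}
    (h : ∀ (e f : Fin n → ZMod 2) (a b : Fin n → V), (∀ l, S.par (e l) (a l) = a l) →
      (∀ l, S.par (f l) (b l) = b l) →
      F (PiTensorProduct.tprod k a) (PiTensorProduct.tprod k b) =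
        G (PiTensorProduct.tprod k a) (PiTensorProduct.tprod k b))
    (x y : ⨂[k] _ : Fin n, V) : F x y = G x y := by
  have : F = G := S.pow_ext fun e a ha => S.pow_ext fun f b hb => h e f a b ha hb
  rw [this]

lemma powS_mul (x y : ⨂[k] _ : Fin n, V) :
    S.powS n (S.powMul n x y) = S.powMul n (S.powS n x) (S.powS n y) := by
  refine S.ext_bilin (F := (S.powMul n).compr₂ (S.powS n))
    (G := (S.powMul n).compl₁₂ (S.powS n) (S.powS n)) ?_ x y
  intro e f a b ha hb
  rw [LinearMap.compr₂_apply, LinearMap.compl₁₂_apply, S.powMul_tprod ha hb, map_smul,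
    S.powS_tprod (S.par_mul_pi ha hb), S.powS_tprod ha, S.powS_tprod hb]
  simp only [map_smul, LinearMap.smul_apply, S.powMul_tprod ha hb, smul_smul, ← koszul_add,
    Pi.add_apply, Finset.sum_add_distrib]
  congr 2; ring

lemma powS_powS (x : ⨂[k] _ : Fin n, V) : S.powS n (S.powS n x) = x := by
  have : S.powS n ∘ₗ S.powS n = LinearMap.id := by
    refine S.pow_ext fun e a ha => ?_
    rw [LinearMap.comp_apply, S.powS_tprod ha, map_smul, S.powS_tprod ha, smul_smul,
      koszul_mul_self, one_smul]; rfl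
  exact LinearMap.congr_fun this x

lemma powS_one :
    S.powS n (PiTensorProduct.tprod k fun _ => S.one) = PiTensorProduct.tprod k fun _ => S.one := by
  rw [S.powS_tprod (e := 0) fun _ => S.par_one]
  simp [koszul_zero]

lemma powD_powS (x : ⨂[k] _ : Fin n, V) : S.powD n (S.powS n x) = - S.powS n (S.powD n x) := by
  have : S.powD n ∘ₗ S.powS n = - (S.powS n ∘ₗ S.powD n) := by
    refine S.pow_ext fun e a ha => ?_
    rw [LinearMap.neg_apply, LinearMap.comp_apply, LinearMap.comp_apply, S.powS_tprod ha, map_smul,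
      S.powD_tprod ha, map_sum, Finset.smul_sum, ← Finset.sum_neg_distrib]
    refine Finset.sum_congr rfl fun j _ => ?_
    rw [map_smul, S.powS_tprod (S.par_update ha j), smul_smul, smul_smul, ← neg_smul]
    rw [sum_add_single, koszul_add, koszul_one]
    congr 1
    ring
  exact LinearMap.congr_fun this x

lemma powD_powD (x : ⨂[k] _ : Fin n, V) : S.powD n (S.powD n x) = 0 := by
  have : S.powD n ∘ₗ S.powD n = 0 := by
    refine S.pow_ext fun e a ha => ?_
    have h : ∀ i, S.powD n (PiTensorProduct.tprod k (Function.update a i (S.d (a i)))) =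
        ∑ j, koszul k (∑ x, if x < j then (e + Pi.single i 1 : Fin n → ZMod 2) x else 0) •
          PiTensorProduct.tprod k (Function.update (Function.update a i (S.d (a i))) j
            (S.d (Function.update a i (S.d (a i)) j))) := fun i => S.powD_tprod (S.par_update ha i)
    rw [LinearMap.comp_apply, LinearMap.zero_apply, S.powD_tprod ha, map_sum]
    simp only [map_smul, h, Finset.smul_sum, smul_smul]
    rw [← Finset.sum_product']
    refine Finset.sum_involution (fun x _ => (x.2, x.1)) ?_ ?_ (by simp) (by simp)
    · rintro ⟨i, j⟩ -
      by_cases hij : i = j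
      · subst hij
        simp [S.d_d]
      · simp only [sum_lt_single]
        rw [Function.update_of_ne hij, Function.update_of_ne (Ne.symm hij),
          Function.update_comm hij, ← add_smul]
        convert zero_smul k _
        rcases lt_or_gt_of_ne hij with h | h
        · simp only [h, h.not_gt, if_true, if_false, koszul_add, koszul_one, koszul_zero]; ring
        · simp only [h, h.not_gt, if_true, if_false, koszul_add, koszul_one, koszul_zero]; ring
    · rintro ⟨i, j⟩ - hne heq
      obtain rfl : j = i := (Prod.ext_iff.mp heq).1
      apply hne
      simp [S.d_d]
  exact LinearMap.congr_fun this x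

lemma powD_mul (x y : ⨂[k] _ : Fin n, V) :
    S.powD n (S.powMul n x y) = S.powMul n (S.powD n x) y + S.powMul n (S.powS n x) (S.powD n y) := by
  refine S.ext_bilin (F := (S.powMul n).compr₂ (S.powD n))
    (G := (S.powMul n).compl₁₂ (S.powD n) LinearMap.id +
      (S.powMul n).compl₁₂ (S.powS n) (S.powD n)) ?_ x y
  intro e f a b ha hb
  simp only [LinearMap.add_apply, LinearMap.compr₂_apply, LinearMap.compl₁₂_apply,
    LinearMap.id_apply]
  rw [S.powMul_tprod ha hb, map_smul, S.powD_tprod (S.par_mul_pi ha hb), S.powD_tprod ha,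
    S.powS_tprod ha, S.powD_tprod hb, map_sum, LinearMap.sum_apply, map_sum, Finset.smul_sum,
    ← Finset.sum_add_distrib]
  refine Finset.sum_congr rfl fun j _ => ?_
  rw [map_smul, map_smul, LinearMap.smul_apply, map_smul, LinearMap.smul_apply,
    S.powMul_tprod (S.par_update ha j) hb, S.powMul_tprod ha (S.par_update hb j),
    S.leibniz _ _ _ (ha j), MultilinearMap.map_update_add, MultilinearMap.map_update_smul]
  have h1 : (fun l => S.mul (Function.update a j (S.d (a j)) l) (b l)) =
      Function.update (fun l => S.mul (a l) (b l)) j (S.mul (S.d (a j)) (b j)) := by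
    funext l
    by_cases h : l = j
    · subst h; simp
    · simp [h]
  have h2 : (fun l => S.mul (a l) (Function.update b j (S.d (b j)) l)) =
      Function.update (fun l => S.mul (a l) (b l)) j (S.mul (a j) (S.d (b j))) := by
    funext l
    by_cases h : l = j
    · subst h; simp
    · simp [h]
  have h3 : (∑ i, if i < j then (e + f) i else 0) =
      (∑ i, if i < j then e i else 0) + ∑ i, if i < j then f i else 0 := by
    rw [← Finset.sum_add_distrib]
    refine Finset.sum_congr rfl fun x _ => ?_
    split_ifs <;> simp
  rw [h1, h2, h3]
  simp only [smul_add, smul_smul]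
  rw [crossing_add_left, crossing_add_right, crossing_single_left, crossing_single_right,
    sum_trichotomy e j]
  congr 2
  · simp only [koszul_add]; ring
  · simp only [koszul_add]
    have h4 := koszul_mul_self k (∑ i, if j < i then e i else 0)
    linear_combination (- koszul k (crossing e f) * koszul k (∑ i, if i < j then e i else 0) *
      koszul k (∑ i, if i < j then f i else 0) * koszul k (e j)) * h4

lemma powPerm_mul (τ : Equiv.Perm (Fin n)) (x y : ⨂[k] _ : Fin n, V) :
    S.powPerm n τ (S.powMul n x y) = S.powMul n (S.powPerm n τ x) (S.powPerm n τ y) := by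
  refine S.ext_bilin (F := (S.powMul n).compr₂ (S.powPerm n τ))
    (G := (S.powMul n).compl₁₂ (S.powPerm n τ) (S.powPerm n τ)) ?_ x y
  intro e f a b ha hb
  rw [LinearMap.compr₂_apply, LinearMap.compl₁₂_apply, S.powMul_tprod ha hb, map_smul,
    S.powPerm_tprod τ (S.par_mul_pi ha hb), S.powPerm_tprod τ ha, S.powPerm_tprod τ hb, map_smul,
    map_smul, LinearMap.smul_apply,
    S.powMul_tprod (fun l => ha (τ.symm l)) (fun l => hb (τ.symm l)), smul_smul, smul_smul,
    smul_smul, ← koszul_add, ← koszul_add, ← koszul_add, crossing_perm]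
  congr 2; ring

lemma powPerm_one (τ : Equiv.Perm (Fin n)) :
    S.powPerm n τ (PiTensorProduct.tprod k fun _ => S.one) =
      PiTensorProduct.tprod k fun _ => S.one := by
  rw [S.powPerm_tprod (e := 0) τ fun _ => S.par_one]
  simp [inversions, koszul_zero]

lemma powPerm_powS (τ : Equiv.Perm (Fin n)) (x : ⨂[k] _ : Fin n, V) :
    S.powPerm n τ (S.powS n x) = S.powS n (S.powPerm n τ x) := by
  have : S.powPerm n τ ∘ₗ S.powS n = S.powS n ∘ₗ S.powPerm n τ := by
    refine S.pow_ext fun e a ha => ?_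
    rw [LinearMap.comp_apply, LinearMap.comp_apply, S.powS_tprod ha, map_smul,
      S.powPerm_tprod τ ha, map_smul, S.powS_tprod (fun l => ha (τ.symm l)), smul_smul, smul_smul,
      mul_comm, Equiv.sum_comp τ.symm e]
  exact LinearMap.congr_fun this x

lemma powPerm_powD (τ : Equiv.Perm (Fin n)) (x : ⨂[k] _ : Fin n, V) :
    S.powPerm n τ (S.powD n x) = S.powD n (S.powPerm n τ x) := by
  have : S.powPerm n τ ∘ₗ S.powD n = S.powD n ∘ₗ S.powPerm n τ := by
    refine S.pow_ext fun e a ha => ?_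
    rw [LinearMap.comp_apply, LinearMap.comp_apply, S.powD_tprod ha, map_sum,
      S.powPerm_tprod τ ha, map_smul, S.powD_tprod (fun l => ha (τ.symm l)), Finset.smul_sum]
    symm
    rw [← Equiv.sum_comp τ]
    refine Finset.sum_congr rfl fun j _ => ?_
    symm
    rw [map_smul, S.powPerm_tprod τ (S.par_update ha j), smul_smul, smul_smul, ← koszul_add,
      ← koszul_add, inversions_single, Equiv.symm_apply_apply]
    congr 2
    funext l
    by_cases h : l = τ j
    · subst h; simp
    · have : τ.symm l ≠ j := fun h' => h (by rw [← h']; simp)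
      simp [h, this]
  exact LinearMap.congr_fun this x

end power

variable (k V) in
/-- The `n`-fold tensor power of a module. -/
def TPow (n : ℕ) : Type (max u v) := ⨂[k] _ : Fin n, V

noncomputable instance (n : ℕ) : AddCommGroup (TPow k V n) :=
  inferInstanceAs (AddCommGroup (⨂[k] _ : Fin n, V))

noncomputable instance (n : ℕ) : Module k (TPow k V n) :=
  inferInstanceAs (Module k (⨂[k] _ : Fin n, V))

variable (k) in
/-- The pure tensor `a₁ ⊗ ⋯ ⊗ aₙ`. -/
noncomputable def pureTensor {n : ℕ} (a : Fin n → V) : TPow k V n := PiTensorProduct.tprod k a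

/-- The `n`-fold tensor power of a differential superalgebra. -/
noncomputable def pow (n : ℕ) : SignedDG k (TPow k V n) where
  mul := S.powMul n
  one := pureTensor k fun _ => S.one
  s := S.powS n
  d := S.powD n
  mul_assoc := S.powMul_assoc
  one_mul := S.powOne_mul
  mul_one := S.powMul_one
  s_mul := S.powS_mul
  s_one := S.powS_one
  s_s := S.powS_powS
  d_d := S.powD_powD
  d_s := S.powD_powS
  leibniz := S.powD_mul

end SuperDG

/-- The tensor product `V ⊗ U` over the integers, with the module structure coming from `V`. -/
def Tens (V : Type v) (U : Type w) [AddCommGroup V] [AddCommGroup U] :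
    Type (max v w) := V ⊗[ℤ] U

noncomputable instance (V : Type v) (U : Type w) [AddCommGroup V] [AddCommGroup U] :
    AddCommGroup (Tens V U) := inferInstanceAs (AddCommGroup (V ⊗[ℤ] U))

noncomputable instance (k : Type u) [CommRing k] (V : Type v) (U : Type w) [AddCommGroup V]
    [Module k V] [AddCommGroup U] :
    Module k (Tens V U) := inferInstanceAs (Module k (V ⊗[ℤ] U))

/-- The pure tensor `t ⊗ q`. -/
def tens {V : Type v} {U : Type w} [AddCommGroup V] [AddCommGroup U] (t : V) (q : U) :
    Tens V U := t ⊗ₜ[ℤ] q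

namespace SignedDG

variable {k : Type u} [CommRing k] {V : Type v} [AddCommGroup V] [Module k V]
  {U : Type w} [AddCommGroup U]

/-- The `e`-th power of the involution `s`. -/
def sPow (L : SignedDG k V) (e : ZMod 2) : V →ₗ[k] V := if e = 0 then LinearMap.id else L.s

section

variable (L : SignedDG k V)

lemma sPow_zero (x : V) : L.sPow 0 x = x := by simp [sPow]

lemma sPow_one (x : V) : L.sPow 1 x = L.s x := by simp [sPow]

lemma sPow_add (e f : ZMod 2) (x : V) : L.sPow (e + f) x = L.sPow e (L.sPow f x) := by
  rcases zmod_two_cases e with rfl | rfl <;> rcases zmod_two_cases f with rfl | rfl <;>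
    simp [sPow_zero, sPow_one, show (1 + 1 : ZMod 2) = 0 from rfl, L.s_s]

lemma sPow_mul (e : ZMod 2) (x y : V) :
    L.sPow e (L.mul x y) = L.mul (L.sPow e x) (L.sPow e y) := by
  rcases zmod_two_cases e with rfl | rfl <;> simp [sPow_zero, sPow_one, L.s_mul]

lemma sPow_unit (e : ZMod 2) : L.sPow e L.one = L.one := by
  rcases zmod_two_cases e with rfl | rfl <;> simp [sPow_zero, sPow_one, L.s_one]

lemma sPow_s (e : ZMod 2) (x : V) : L.sPow e (L.s x) = L.s (L.sPow e x) := by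
  rcases zmod_two_cases e with rfl | rfl <;> simp [sPow_zero, sPow_one]

lemma d_sPow (e : ZMod 2) (x : V) : L.d (L.sPow e x) = koszul k e • L.sPow e (L.d x) := by
  rcases zmod_two_cases e with rfl | rfl <;>
    simp [sPow_zero, sPow_one, L.d_s, koszul_zero, koszul_one]

end

/-- The product `(t ⊗ q)(t' ⊗ q') = (-1) ^ (|q||t'|) tt' ⊗ qq'` on a tensor product. -/
noncomputable def tensorMul (L : SignedDG k V) (B : SuperDG ℤ U) :
    (V ⊗[ℤ] U) →ₗ[k] (V ⊗[ℤ] U) →ₗ[k] (V ⊗[ℤ] U) :=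
  ∑ e : ZMod 2, TensorProduct.AlgebraTensorModule.homTensorHomMap ℤ k k V U V U ∘ₗ
    TensorProduct.AlgebraTensorModule.map (L.mul.compl₂ (L.sPow e)) (B.mul ∘ₗ B.par e)

/-- The differential `d (t ⊗ q) = d t ⊗ q + (-1) ^ |t| t ⊗ d q` on a tensor product. -/
noncomputable def tensorD (L : SignedDG k V) (B : SuperDG ℤ U) :
    (V ⊗[ℤ] U) →ₗ[k] (V ⊗[ℤ] U) :=
  TensorProduct.AlgebraTensorModule.map L.d LinearMap.id +
    TensorProduct.AlgebraTensorModule.map L.s B.d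

/-- The parity involution on a tensor product. -/
noncomputable def tensorS (L : SignedDG k V) (B : SuperDG ℤ U) :
    (V ⊗[ℤ] U) →ₗ[k] (V ⊗[ℤ] U) :=
  TensorProduct.AlgebraTensorModule.map L.s B.s

section

variable (L : SignedDG k V) (B : SuperDG ℤ U)

lemma tensor_ext {M : Type*} [AddCommGroup M] [Module k M] {F G : (V ⊗[ℤ] U) →ₗ[k] M}
    (h : ∀ t e q, B.par e q = q → F (t ⊗ₜ q) = G (t ⊗ₜ q)) : F = G := by
  apply TensorProduct.AlgebraTensorModule.ext
  intro t q
  rw [← B.par_add q, TensorProduct.tmul_add, map_add, map_add, h _ _ _ (B.par_idem 0 q),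
    h _ _ _ (B.par_idem 1 q)]

lemma tensor_ext_bilin {M : Type*} [AddCommGroup M] [Module k M]
    {F G : (V ⊗[ℤ] U) →ₗ[k] (V ⊗[ℤ] U) →ₗ[k] M}
    (h : ∀ t e q t' e' q', B.par e q = q → B.par e' q' = q' →
      F (t ⊗ₜ q) (t' ⊗ₜ q') = G (t ⊗ₜ q) (t' ⊗ₜ q')) (x y : V ⊗[ℤ] U) : F x y = G x y := by
  have : F = G := tensor_ext B fun t e q hq => tensor_ext B fun t' e' q' hq' =>
    h t e q t' e' q' hq hq'
  rw [this]

variable {B}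

lemma tensorMul_tmul {e : ZMod 2} {q : U} (hq : B.par e q = q) (t t' : V) (q' : U) :
    L.tensorMul B (t ⊗ₜ q) (t' ⊗ₜ q') = L.mul t (L.sPow e t') ⊗ₜ[ℤ] B.mul q q' := by
  simp only [tensorMul, LinearMap.sum_apply, LinearMap.comp_apply,
    TensorProduct.AlgebraTensorModule.map_tmul,
    TensorProduct.AlgebraTensorModule.homTensorHomMap_apply, LinearMap.compl₂_apply]
  rw [Finset.sum_eq_single e]
  · rw [hq]
  · intro e' _ he
    rw [B.par_of_ne he hq, map_zero, LinearMap.zero_apply, TensorProduct.tmul_zero]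
  · simp

lemma tensorS_tmul (t : V) (q : U) : L.tensorS B (t ⊗ₜ q) = L.s t ⊗ₜ[ℤ] B.s q := rfl

lemma tensorD_tmul (t : V) (q : U) :
    L.tensorD B (t ⊗ₜ q) = L.d t ⊗ₜ[ℤ] q + L.s t ⊗ₜ[ℤ] B.d q := rfl

lemma tmul_koszul (e : ZMod 2) (t : V) (q : U) :
    t ⊗ₜ[ℤ] (koszul ℤ e • q) = koszul k e • (t ⊗ₜ[ℤ] q) := by
  rcases zmod_two_cases e with rfl | rfl
  · rw [koszul_zero, koszul_zero, one_smul, one_smul]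
  · rw [koszul_one, koszul_one, neg_one_smul, neg_one_smul, TensorProduct.tmul_neg]

variable (B)

lemma tensorMul_assoc (x y z : V ⊗[ℤ] U) :
    L.tensorMul B (L.tensorMul B x y) z = L.tensorMul B x (L.tensorMul B y z) := by
  have h1 : ∀ t e q, B.par e q = q → ∀ y z, L.tensorMul B (L.tensorMul B (t ⊗ₜ q) y) z =
      L.tensorMul B (t ⊗ₜ q) (L.tensorMul B y z) := by
    intro t e q hq y z
    refine tensor_ext_bilin B (F := L.tensorMul B ∘ₗ L.tensorMul B (t ⊗ₜ q))
      (G := (LinearMap.llcomp k _ _ _ (L.tensorMul B (t ⊗ₜ q))) ∘ₗ L.tensorMul B) ?_ y z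
    intro t' e' q' t'' e'' q'' hq' hq''
    change L.tensorMul B (L.tensorMul B (t ⊗ₜ q) (t' ⊗ₜ q')) (t'' ⊗ₜ q'') =
      L.tensorMul B (t ⊗ₜ q) (L.tensorMul B (t' ⊗ₜ q') (t'' ⊗ₜ q''))
    rw [L.tensorMul_tmul hq, L.tensorMul_tmul (B.par_mul _ _ _ _ hq hq'), L.tensorMul_tmul hq',
      L.tensorMul_tmul hq, L.mul_assoc, B.mul_assoc, sPow_mul, sPow_add]
  have h4 : (((L.tensorMul B).flip z) ∘ₗ ((L.tensorMul B).flip y)) =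
      (L.tensorMul B).flip (L.tensorMul B y z) := tensor_ext B fun t e q hq => h1 t e q hq y z
  exact LinearMap.congr_fun h4 x

lemma tensorOne_mul (x : V ⊗[ℤ] U) : L.tensorMul B (L.one ⊗ₜ B.one) x = x := by
  have : L.tensorMul B (L.one ⊗ₜ B.one) = LinearMap.id := tensor_ext B fun t e q _ => by
    rw [L.tensorMul_tmul B.par_one, L.one_mul, B.one_mul, sPow_zero]; rfl
  exact LinearMap.congr_fun this x

lemma tensorMul_one (x : V ⊗[ℤ] U) : L.tensorMul B x (L.one ⊗ₜ B.one) = x := by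
  have : (L.tensorMul B).flip (L.one ⊗ₜ B.one) = LinearMap.id := tensor_ext B fun t e q hq => by
    rw [LinearMap.flip_apply, L.tensorMul_tmul hq, sPow_unit, L.mul_one, B.mul_one]; rfl
  exact LinearMap.congr_fun this x

lemma s_superMul (x y : U) : B.s (B.mul x y) = B.mul (B.s x) (B.s y) := by
  have h : ∀ e f x y, B.par e x = x → B.par f y = y → B.s (B.mul x y) = B.mul (B.s x) (B.s y) := by
    intro e f x y hx hy
    rw [B.s_of_par hx, B.s_of_par hy, B.s_of_par (B.par_mul _ _ _ _ hx hy), koszul_add, map_smul,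
      map_smul, LinearMap.smul_apply, smul_smul, mul_comm]
  rw [← B.par_add x, ← B.par_add y]
  simp only [map_add, LinearMap.add_apply]
  rw [h _ _ _ _ (B.par_idem 0 x) (B.par_idem 0 y), h _ _ _ _ (B.par_idem 0 x) (B.par_idem 1 y),
    h _ _ _ _ (B.par_idem 1 x) (B.par_idem 0 y), h _ _ _ _ (B.par_idem 1 x) (B.par_idem 1 y)]

lemma tensorS_mul (x y : V ⊗[ℤ] U) :
    L.tensorS B (L.tensorMul B x y) = L.tensorMul B (L.tensorS B x) (L.tensorS B y) := by
  refine tensor_ext_bilin B (F := (L.tensorMul B).compr₂ (L.tensorS B))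
    (G := (L.tensorMul B).compl₁₂ (L.tensorS B) (L.tensorS B)) ?_ x y
  intro t e q t' e' q' hq hq'
  rw [LinearMap.compr₂_apply, LinearMap.compl₁₂_apply, L.tensorMul_tmul hq, tensorS_tmul,
    tensorS_tmul, tensorS_tmul, L.tensorMul_tmul (e := e) (by rw [B.par_s, hq]), L.s_mul, sPow_s,
    s_superMul]

lemma tensorS_one : L.tensorS B (L.one ⊗ₜ B.one) = L.one ⊗ₜ B.one := by
  rw [tensorS_tmul, L.s_one, B.s_of_par B.par_one, koszul_zero, one_smul]

lemma tensorS_tensorS (x : V ⊗[ℤ] U) : L.tensorS B (L.tensorS B x) = x := by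
  have : L.tensorS B ∘ₗ L.tensorS B = LinearMap.id := tensor_ext B fun t e q hq => by
    rw [LinearMap.comp_apply, tensorS_tmul, tensorS_tmul, L.s_s, B.s_s]; rfl
  exact LinearMap.congr_fun this x

lemma super_d_s (q : U) : B.d (B.s q) = - B.s (B.d q) := by
  have h : ∀ e q, B.par e q = q → B.d (B.s q) = - B.s (B.d q) := by
    intro e q hq
    rw [B.s_of_par hq, B.s_of_par (B.par_d _ _ hq), map_smul, koszul_add, koszul_one, mul_neg_one,
      neg_smul, neg_neg]
  rw [← B.par_add q]
  simp only [map_add]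
  rw [h _ _ (B.par_idem 0 q), h _ _ (B.par_idem 1 q), neg_add]

lemma tensorD_tensorS (x : V ⊗[ℤ] U) :
    L.tensorD B (L.tensorS B x) = - L.tensorS B (L.tensorD B x) := by
  have : L.tensorD B ∘ₗ L.tensorS B = - (L.tensorS B ∘ₗ L.tensorD B) :=
    tensor_ext B fun t e q hq => by
      rw [LinearMap.neg_apply, LinearMap.comp_apply, LinearMap.comp_apply, tensorS_tmul,
        tensorD_tmul, tensorD_tmul, map_add, tensorS_tmul, tensorS_tmul, L.d_s, super_d_s,
        TensorProduct.neg_tmul, TensorProduct.tmul_neg, neg_add]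
  exact LinearMap.congr_fun this x

lemma tensorD_tensorD (x : V ⊗[ℤ] U) : L.tensorD B (L.tensorD B x) = 0 := by
  have : L.tensorD B ∘ₗ L.tensorD B = 0 := tensor_ext B fun t e q hq => by
    rw [LinearMap.comp_apply, tensorD_tmul, map_add, tensorD_tmul, tensorD_tmul, L.d_d, B.d_d,
      L.d_s, TensorProduct.neg_tmul, TensorProduct.zero_tmul, TensorProduct.tmul_zero]
    simp
  exact LinearMap.congr_fun this x

lemma tensorD_mul (x y : V ⊗[ℤ] U) :
    L.tensorD B (L.tensorMul B x y) =
      L.tensorMul B (L.tensorD B x) y + L.tensorMul B (L.tensorS B x) (L.tensorD B y) := by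
  refine tensor_ext_bilin B (F := (L.tensorMul B).compr₂ (L.tensorD B))
    (G := (L.tensorMul B).compl₁₂ (L.tensorD B) LinearMap.id +
      (L.tensorMul B).compl₁₂ (L.tensorS B) (L.tensorD B)) ?_ x y
  intro t e q t' e' q' hq hq'
  have hs : B.par e (B.s q) = B.s q := by rw [B.par_s, hq]
  simp only [LinearMap.add_apply, LinearMap.compr₂_apply, LinearMap.compl₁₂_apply,
    LinearMap.id_apply]
  rw [L.tensorMul_tmul hq, tensorD_tmul, tensorD_tmul, tensorD_tmul, tensorS_tmul, map_add,
    LinearMap.add_apply, map_add, L.tensorMul_tmul hq, L.tensorMul_tmul (B.par_d _ _ hq),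
    L.tensorMul_tmul hs, L.tensorMul_tmul hs, L.leibniz, L.s_mul, B.leibniz _ _ _ hq,
    B.s_of_par hq, d_sPow, add_comm e 1, sPow_add, sPow_one, sPow_s, TensorProduct.add_tmul,
    TensorProduct.tmul_add]
  simp only [map_smul, LinearMap.smul_apply, tmul_koszul (k := k), ← TensorProduct.smul_tmul']
  abel

/-- The tensor product of differential algebras. -/
noncomputable def tensor : SignedDG k (Tens V U) where
  mul := L.tensorMul B
  one := tens L.one B.one
  s := L.tensorS B
  d := L.tensorD B
  mul_assoc := L.tensorMul_assoc B
  one_mul := L.tensorOne_mul B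
  mul_one := L.tensorMul_one B
  s_mul := L.tensorS_mul B
  s_one := L.tensorS_one B
  s_s := L.tensorS_tensorS B
  d_d := L.tensorD_tensorD B
  d_s := L.tensorD_tensorS B
  leibniz := L.tensorD_mul B

end

end SignedDG

/-- A unital associative differential graded algebra over `k`, with the grading by all integers and
the homological convention: the differential has degree `-1`. The equalities between degrees are
explicit arguments of the product and of the axioms. -/
structure DGAlgebra (k : Type u) [CommRing k] where
  X : ℤ → Type v
  [addCommGroup : ∀ i, AddCommGroup (X i)]
  [module : ∀ i, Module k (X i)]
  d : ∀ i j, X i →ₗ[k] X j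
  mul : ∀ i j n, i + j = n → X i →ₗ[k] X j →ₗ[k] X n
  one : X 0
  shape : ∀ i j, j + 1 ≠ i → d i j = 0
  d_d : ∀ i j l x, d j l (d i j x) = 0
  mul_assoc : ∀ i j l ij jl n (hij : i + j = ij) (hjl : j + l = jl) (h : ij + l = n)
    (h' : i + jl = n) (x : X i) (y : X j) (z : X l),
    mul ij l n h (mul i j ij hij x y) z = mul i jl n h' x (mul j l jl hjl y z)
  one_mul : ∀ i (x : X i), mul 0 i i (zero_add i) one x = x
  mul_one : ∀ i (x : X i), mul i 0 i (add_zero i) x one = x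
  leibniz : ∀ i j n i' j' n' (h : i + j = n) (h₁ : i' + j = n') (h₂ : i + j' = n')
    (_ : n' + 1 = n) (x : X i) (y : X j),
    d n n' (mul i j n h x y) =
      mul i' j n' h₁ (d i i' x) y + i.negOnePow • mul i j' n' h₂ x (d j j' y)

namespace DGAlgebra

attribute [instance] DGAlgebra.addCommGroup DGAlgebra.module

section

variable {k : Type u} [CommRing k]

/-- A morphism of DG algebras. -/
structure Hom (A : DGAlgebra.{u, v} k) (B : DGAlgebra.{u, w} k) where
  f : ∀ i, A.X i →ₗ[k] B.X i
  map_d : ∀ i j x, f j (A.d i j x) = B.d i j (f i x)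
  map_mul : ∀ i j n (h : i + j = n) x y, f n (A.mul i j n h x y) = B.mul i j n h (f i x) (f j y)
  map_one : f 0 A.one = B.one

/-- The composition of morphisms of DG algebras. -/
def Hom.comp {A B C : DGAlgebra.{u, v} k} (g : B.Hom C) (f : A.Hom B) : A.Hom C where
  f i := g.f i ∘ₗ f.f i
  map_d i j x := by simp [f.map_d, g.map_d]
  map_mul i j n h x y := by simp [f.map_mul, g.map_mul]
  map_one := by simp [f.map_one, g.map_one]

/-- The complex of `k`-modules underlying a DG algebra. -/
noncomputable def toComplex (A : DGAlgebra.{u, v} k) : ChainComplex (ModuleCat.{v} k) ℤ where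
  X i := ModuleCat.of k (A.X i)
  d i j := ModuleCat.ofHom (A.d i j)
  shape i j h := by rw [A.shape i j h]; rfl
  d_comp_d' i j l _ _ := by ext x; exact A.d_d i j l x

/-- The map of complexes underlying a morphism of DG algebras. -/
noncomputable def Hom.toComplex {A B : DGAlgebra.{u, v} k} (f : A.Hom B) :
    A.toComplex ⟶ B.toComplex where
  f i := ModuleCat.ofHom (f.f i)
  comm' i j _ := by ext x; exact (f.map_d i j x).symm

end

section restrictScalars

variable {k : Type u} {k' : Type u} [CommRing k] [CommRing k']

/-- The DG algebra over `k` obtained from a DG algebra over `k'` by restriction of scalars along a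
ring homomorphism `φ : k → k'`; an element `r` of `k` acts as `φ r`. -/
noncomputable def restrictScalars (φ : k →+* k') (A : DGAlgebra.{u, v} k') :
    DGAlgebra.{u, v} k :=
  letI := fun i => Module.compHom (A.X i) φ
  { X := A.X
    d := fun i j =>
      { toFun := A.d i j
        map_add' := (A.d i j).map_add
        map_smul' := fun r => (A.d i j).map_smul (φ r) }
    mul := fun i j n h => LinearMap.mk₂ k (fun x y => A.mul i j n h x y)
      (fun x x' y => by rw [map_add, LinearMap.add_apply])
      (fun r x y => (by
        rw [map_smul, LinearMap.smul_apply] :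
          A.mul i j n h (φ r • x) y = φ r • A.mul i j n h x y))
      (fun x y y' => by rw [map_add])
      (fun r x y => (A.mul i j n h x).map_smul (φ r) y)
    one := A.one
    shape := fun i j h => by
      ext x
      exact LinearMap.congr_fun (A.shape i j h) x
    d_d := A.d_d
    mul_assoc := A.mul_assoc
    one_mul := A.one_mul
    mul_one := A.mul_one
    leibniz := A.leibniz }

end restrictScalars

end DGAlgebra

/-- A differential algebra with a decreasing filtration by graded subcomplexes, compatible with the
product: `F i n` is the part of degree `n` of the `i`-th term of the filtration. -/
structure FilteredDG (k : Type u) [CommRing k] (W : Type v) [AddCommGroup W] [Module k W]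
    extends SignedDG k W where
  F : ℤ → ℤ → Submodule k W
  anti : ∀ i j n, i ≤ j → F j n ≤ F i n
  s_mem : ∀ i n, ∀ x ∈ F i n, s x = n.negOnePow • x
  d_mem : ∀ i n n', n' + 1 = n → ∀ x ∈ F i n, d x ∈ F i n'
  mul_mem : ∀ i j n m, ∀ x ∈ F i n, ∀ y ∈ F j m, mul x y ∈ F (i + j) (n + m)
  one_mem : one ∈ F 0 0

namespace FilteredDG

variable {k : Type u} [CommRing k] {W : Type v} [AddCommGroup W] [Module k W]

section

variable (E : FilteredDG k W)

/-- The terms of the filtered truncation in degrees at least `0`: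
`F⁻ⁿ Eₙ ∩ d⁻¹ (F¹⁻ⁿ Eₙ₋₁)` in degree `n`. -/
def Z (n : ℤ) : Submodule k W := E.F (-n) n ⊓ (E.F (1 - n) (n - 1)).comap E.d

/-- The terms of the kernel of the filtered truncation in degrees at most `1`:
`F²⁻ⁿ Eₙ + d (F¹⁻ⁿ Eₙ₊₁)` in degree `n`. -/
def B (n : ℤ) : Submodule k W := E.F (2 - n) n ⊔ (E.F (1 - n) (n + 1)).map E.d

lemma mem_F {i j n m : ℤ} (h : j ≤ i) (h' : n = m) {x : W} (hx : x ∈ E.F i n) : x ∈ E.F j m := by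
  subst h'; exact E.anti _ _ _ h hx

lemma d_mem_Z {i j : ℤ} (h : j + 1 = i) {x : W} (hx : x ∈ E.Z i) : E.d x ∈ E.Z j := by
  obtain ⟨-, h2⟩ := hx
  refine ⟨E.mem_F (by omega) (by omega) h2, ?_⟩
  rw [SetLike.mem_coe, Submodule.mem_comap, E.d_d]; exact zero_mem _

lemma d_mem_B {i j : ℤ} (h : j + 1 = i) {x : W} (hx : x ∈ E.B i) : E.d x ∈ E.B j := by
  obtain ⟨a, ha, b, ⟨c, -, rfl⟩, rfl⟩ := Submodule.mem_sup.mp hx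
  rw [map_add, E.d_d, add_zero]
  refine Submodule.mem_sup_right ⟨a, E.mem_F (by omega) (by omega) ha, rfl⟩

lemma leibniz_F {i n : ℤ} {x : W} (hx : x ∈ E.F i n) (y : W) :
    E.d (E.mul x y) = E.mul (E.d x) y + n.negOnePow • E.mul x (E.d y) := by
  rw [E.leibniz, E.s_mem _ _ _ hx, Units.smul_def, Units.smul_def, map_zsmul, LinearMap.smul_apply]

lemma mul_mem_F {i j l a b c : ℤ} {x y : W} (hx : x ∈ E.F i a) (hy : y ∈ E.F j b)
    (h : l ≤ i + j) (h' : a + b = c) : E.mul x y ∈ E.F l c :=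
  E.mem_F h h' (E.mul_mem _ _ _ _ _ hx _ hy)

lemma smul_units_mem {N : Submodule k W} (e : ℤˣ) {x : W} (hx : x ∈ N) : e • x ∈ N := by
  rw [Units.smul_def]; exact zsmul_mem hx _

lemma mul_mem_Z {i j n : ℤ} (h : i + j = n) {x y : W} (hx : x ∈ E.Z i) (hy : y ∈ E.Z j) :
    E.mul x y ∈ E.Z n := by
  refine ⟨E.mul_mem_F hx.1 hy.1 (by omega) h, ?_⟩
  rw [SetLike.mem_coe, Submodule.mem_comap, E.leibniz_F hx.1]
  exact add_mem (E.mul_mem_F hx.2 hy.1 (by omega) (by omega))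
    (smul_units_mem _ (E.mul_mem_F hx.1 hy.2 (by omega) (by omega)))

lemma mul_mem_B_right {i j n : ℤ} (h : i + j = n) {x y : W} (hx : x ∈ E.Z i) (hy : y ∈ E.B j) :
    E.mul x y ∈ E.B n := by
  obtain ⟨a, ha, b, ⟨c, hc, rfl⟩, rfl⟩ := Submodule.mem_sup.mp hy
  rw [map_add]
  refine add_mem (Submodule.mem_sup_left (E.mul_mem_F hx.1 ha (by omega) h)) ?_
  have : E.mul x (E.d c) = i.negOnePow • (E.d (E.mul x c) - E.mul (E.d x) c) := by
    rw [E.leibniz_F hx.1, add_sub_cancel_left, smul_smul, Int.units_mul_self, one_smul]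
  rw [this]
  refine smul_units_mem _ (sub_mem (Submodule.mem_sup_right ⟨_, ?_, rfl⟩)
    (Submodule.mem_sup_left ?_))
  · exact E.mul_mem_F hx.1 hc (by omega) (by omega)
  · exact E.mul_mem_F hx.2 hc (by omega) (by omega)

lemma mul_mem_B_left {i j n : ℤ} (h : i + j = n) {x y : W} (hx : x ∈ E.B i) (hy : y ∈ E.Z j) :
    E.mul x y ∈ E.B n := by
  obtain ⟨a, ha, b, ⟨c, hc, rfl⟩, rfl⟩ := Submodule.mem_sup.mp hx
  rw [map_add, LinearMap.add_apply]
  refine add_mem (Submodule.mem_sup_left (E.mul_mem_F ha hy.1 (by omega) h)) ?_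
  have : E.mul (E.d c) y = E.d (E.mul c y) - (i + 1).negOnePow • E.mul c (E.d y) := by
    rw [E.leibniz_F hc, add_sub_cancel_right]
  rw [this]
  refine sub_mem (Submodule.mem_sup_right ⟨_, ?_, rfl⟩)
    (smul_units_mem _ (Submodule.mem_sup_left ?_))
  · exact E.mul_mem_F hc hy.1 (by omega) (by omega)
  · exact E.mul_mem_F hc hy.2 (by omega) (by omega)

lemma one_mem_Z : E.one ∈ E.Z 0 := by
  refine ⟨E.mem_F (by omega) rfl E.one_mem, ?_⟩
  rw [SetLike.mem_coe, Submodule.mem_comap]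
  have h := E.leibniz_F E.one_mem E.one
  rw [E.one_mul, E.one_mul, E.mul_one, Int.negOnePow_zero, one_smul, left_eq_add] at h
  rw [h]; exact zero_mem _

/-- The terms of the filtered truncation `τ_{[0,1]}`. -/
abbrev Q (n : ℤ) : Type v := E.Z n ⧸ (E.B n).submoduleOf (E.Z n)

/-- The class in the filtered truncation. -/
def cls {n : ℤ} (x : W) (hx : x ∈ E.Z n) : E.Q n := Submodule.Quotient.mk ⟨x, hx⟩

lemma cls_eq_iff {n : ℤ} {x y : W} (hx : x ∈ E.Z n) (hy : y ∈ E.Z n) :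
    E.cls x hx = E.cls y hy ↔ x - y ∈ E.B n :=
  Submodule.Quotient.eq _

/-- The differential of the filtered truncation. -/
noncomputable def dQ (i j : ℤ) : E.Q i →ₗ[k] E.Q j :=
  if h : j + 1 = i then
    Submodule.mapQ _ _ (E.d.restrict fun _ hx => E.d_mem_Z h hx) fun _ hx => E.d_mem_B h hx
  else 0

lemma dQ_cls {i j : ℤ} (h : j + 1 = i) (x : W) (hx : x ∈ E.Z i) :
    E.dQ i j (E.cls x hx) = E.cls (E.d x) (E.d_mem_Z h hx) := by
  rw [dQ, dif_pos h]; rfl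

lemma cls_congr {n : ℤ} {x y : W} (hx : x ∈ E.Z n) (hy : y ∈ E.Z n) (h : x = y) :
    E.cls x hx = E.cls y hy := by subst h; rfl

/-- The product of two cycles, in the filtered truncation. -/
noncomputable def mulZ (i j n : ℤ) (h : i + j = n) : E.Z i →ₗ[k] E.Z j →ₗ[k] E.Q n :=
  LinearMap.mk₂ k (fun x y => E.cls (E.mul x.1 y.1) (E.mul_mem_Z h x.2 y.2))
    (fun x x' y => E.cls_congr _ (add_mem (E.mul_mem_Z h x.2 y.2) (E.mul_mem_Z h x'.2 y.2))
      (show E.mul (x.1 + x'.1) y.1 = E.mul x.1 y.1 + E.mul x'.1 y.1 by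
        rw [map_add, LinearMap.add_apply]))
    (fun r x y => E.cls_congr _ (Submodule.smul_mem _ _ (E.mul_mem_Z h x.2 y.2))
      (show E.mul (r • x.1) y.1 = r • E.mul x.1 y.1 by
        rw [map_smul, LinearMap.smul_apply]))
    (fun x y y' => E.cls_congr _ (add_mem (E.mul_mem_Z h x.2 y.2) (E.mul_mem_Z h x.2 y'.2))
      (map_add (E.mul x.1) _ _))
    (fun r x y => E.cls_congr _ (Submodule.smul_mem _ _ (E.mul_mem_Z h x.2 y.2))
      (map_smul (E.mul x.1) _ _))

/-- The product of a class and a cycle, in the filtered truncation. -/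
noncomputable def mulQZ (i j n : ℤ) (h : i + j = n) : E.Q i →ₗ[k] E.Z j →ₗ[k] E.Q n :=
  Submodule.liftQ ((E.B i).submoduleOf (E.Z i)) (E.mulZ i j n h) fun _ hx =>
    LinearMap.ext fun y =>
      (Submodule.Quotient.mk_eq_zero ((E.B n).submoduleOf (E.Z n))).mpr
        (E.mul_mem_B_left h hx y.2)

/-- The product on the filtered truncation. -/
noncomputable def mulQ (i j n : ℤ) (h : i + j = n) : E.Q i →ₗ[k] E.Q j →ₗ[k] E.Q n :=
  (Submodule.liftQ ((E.B j).submoduleOf (E.Z j)) (E.mulQZ i j n h).flip fun _ hy =>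
    LinearMap.ext fun q => Submodule.Quotient.induction_on _ q fun x =>
      (Submodule.Quotient.mk_eq_zero ((E.B n).submoduleOf (E.Z n))).mpr
        (E.mul_mem_B_right h x.2 hy)).flip

lemma mulQ_cls {i j n : ℤ} (h : i + j = n) (x y : W) (hx : x ∈ E.Z i) (hy : y ∈ E.Z j) :
    E.mulQ i j n h (E.cls x hx) (E.cls y hy) = E.cls (E.mul x y) (E.mul_mem_Z h hx hy) := rfl

variable {E} in
lemma Q_ind {n : ℤ} {P : E.Q n → Prop} (h : ∀ x hx, P (E.cls x hx)) (q : E.Q n) : P q := by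
  induction q using Submodule.Quotient.induction_on with
  | H x => exact h x.1 x.2

/-- The filtered truncation `τ_{[0,1]}` of a filtered differential algebra, as a DG algebra. -/
noncomputable def trunc : DGAlgebra.{u, v} k where
  X := E.Q
  d := E.dQ
  mul := E.mulQ
  one := E.cls E.one E.one_mem_Z
  shape i j h := dif_neg h
  d_d i j l := Q_ind fun x hx => by
    by_cases h : j + 1 = i
    · by_cases h' : l + 1 = j
      · rw [E.dQ_cls h, E.dQ_cls h']
        exact (Submodule.Quotient.mk_eq_zero _).mpr (by
          change E.d (E.d x) ∈ E.B l
          rw [E.d_d]; exact zero_mem _)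
      · rw [dQ, dif_neg h']; rfl
    · rw [show E.dQ i j = 0 from dif_neg h, LinearMap.zero_apply, map_zero]
  mul_assoc i j l ij jl n hij hjl h h' x y z := by
    induction x using Q_ind with | h x hx =>
    induction y using Q_ind with | h y hy =>
    induction z using Q_ind with | h z hz =>
    simp only [mulQ_cls, E.mul_assoc]
  one_mul i := Q_ind fun x hx => by simp only [mulQ_cls, E.one_mul]
  mul_one i := Q_ind fun x hx => by simp only [mulQ_cls, E.mul_one]
  leibniz i j n i' j' n' h h₁ h₂ hn x y := by
    induction x using Q_ind with | h x hx =>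
    induction y using Q_ind with | h y hy =>
    rw [mulQ_cls, E.dQ_cls hn, E.dQ_cls (by omega : i' + 1 = i), E.dQ_cls (by omega : j' + 1 = j),
      mulQ_cls, mulQ_cls]
    exact E.cls_congr _ _ (E.leibniz_F hx.1 y)

end

end FilteredDG

/-- The differential superalgebra over `ℤ` underlying a differential superalgebra over `k`. -/
def SuperDG.toInt {k : Type u} [CommRing k] {V : Type v} [AddCommGroup V] [Module k V]
    (S : SuperDG k V) : @SuperDG ℤ _ V _ (AddCommGroup.toIntModule V) where
  mul := AddMonoidHom.toIntLinearMap
    { toFun := fun x => (S.mul x).toAddMonoidHom.toIntLinearMap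
      map_zero' := LinearMap.ext fun y => by
        change S.mul 0 y = 0
        rw [map_zero, LinearMap.zero_apply]
      map_add' := fun x x' => LinearMap.ext fun y => by
        change S.mul (x + x') y = S.mul x y + S.mul x' y
        rw [map_add, LinearMap.add_apply] }
  one := S.one
  par := fun e => (S.par e).toAddMonoidHom.toIntLinearMap
  d := S.d.toAddMonoidHom.toIntLinearMap
  par_sum := S.par_sum
  par_par := S.par_par
  par_mul := S.par_mul
  par_one := S.par_one
  par_d := S.par_d
  mul_assoc := S.mul_assoc
  one_mul := S.one_mul
  mul_one := S.mul_one
  d_d := S.d_d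
  leibniz := fun e x y hx => (S.leibniz e x y hx).trans
    (congrArg (S.mul (S.d x) y + ·) (by
      rw [← koszul_cast k, Int.cast_smul_eq_zsmul]; rfl))

namespace DGAlgebra

variable {k : Type u} [CommRing k] (A : DGAlgebra.{u, v} k)

/-- The direct sum of the components of a DG algebra. -/
abbrev Tot : Type v := ⨁ i, A.X i

/-- The inclusion of a component. -/
noncomputable def ι (i : ℤ) : A.X i →ₗ[k] A.Tot := DirectSum.lof k ℤ A.X i

variable {A}

lemma tot_ext {M : Type*} [AddCommMonoid M] [Module k M] {F G : A.Tot →ₗ[k] M}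
    (h : ∀ i x, F (A.ι i x) = G (A.ι i x)) : F = G :=
  DirectSum.linearMap_ext k fun i => LinearMap.ext fun x => h i x

lemma tot_ext_bilin {M : Type*} [AddCommMonoid M] [Module k M] {F G : A.Tot →ₗ[k] A.Tot →ₗ[k] M}
    (h : ∀ i j x y, F (A.ι i x) (A.ι j y) = G (A.ι i x) (A.ι j y)) : F = G :=
  tot_ext fun i x => tot_ext fun j y => h i j x y

variable (A)

/-- The product on the direct sum of the components. -/
noncomputable def totMul : A.Tot →ₗ[k] A.Tot →ₗ[k] A.Tot :=
  DirectSum.toModule k ℤ _ fun i => (DirectSum.toModule k ℤ _ fun j =>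
    ((A.mul i j (i + j) rfl).compr₂ (A.ι (i + j))).flip).flip

/-- The differential on the direct sum of the components. -/
noncomputable def totD : A.Tot →ₗ[k] A.Tot :=
  DirectSum.toModule k ℤ _ fun i => A.ι (i - 1) ∘ₗ A.d i (i - 1)

/-- The projection of the direct sum of the components to its even or odd part. -/
noncomputable def totPar (e : ZMod 2) : A.Tot →ₗ[k] A.Tot :=
  DirectSum.toModule k ℤ _ fun i => if (i : ZMod 2) = e then A.ι i else 0

lemma totMul_ι {i j n : ℤ} (h : i + j = n) (x : A.X i) (y : A.X j) :
    A.totMul (A.ι i x) (A.ι j y) = A.ι n (A.mul i j n h x y) := by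
  subst h
  simp [totMul, ι, DirectSum.toModule_lof]

lemma totD_ι {i j : ℤ} (h : j + 1 = i) (x : A.X i) : A.totD (A.ι i x) = A.ι j (A.d i j x) := by
  obtain rfl : j = i - 1 := by omega
  simp [totD, ι, DirectSum.toModule_lof]

lemma totPar_ι (e : ZMod 2) (i : ℤ) (x : A.X i) :
    A.totPar e (A.ι i x) = if (i : ZMod 2) = e then A.ι i x else 0 := by
  simp only [totPar, ι, DirectSum.toModule_lof]
  split_ifs <;> rfl

lemma totPar_totPar (e f : ZMod 2) (x : A.Tot) :
    A.totPar e (A.totPar f x) = if e = f then A.totPar f x else 0 := by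
  have : A.totPar e ∘ₗ A.totPar f = if e = f then A.totPar f else 0 := by
    refine tot_ext fun i x => ?_
    rw [LinearMap.comp_apply, totPar_ι]
    by_cases h : (i : ZMod 2) = f
    · rw [if_pos h, totPar_ι, h]
      by_cases h' : f = e
      · rw [if_pos h', if_pos h'.symm, totPar_ι, if_pos h]
      · rw [if_neg h', if_neg (Ne.symm h')]; rfl
    · rw [if_neg h, map_zero]
      split_ifs
      · rw [totPar_ι, if_neg h]
      · rfl
  have := LinearMap.congr_fun this x
  rw [LinearMap.comp_apply] at this
  rw [this]; split_ifs <;> rfl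

/-- The differential superalgebra given by the direct sum of the components of a DG algebra. -/
noncomputable def super : SuperDG k A.Tot where
  mul := A.totMul
  one := A.ι 0 A.one
  par := A.totPar
  d := A.totD
  par_sum x := by
    have : ∑ e, A.totPar e = LinearMap.id := tot_ext fun i x => by
      simp [totPar_ι]
    simpa using LinearMap.congr_fun this x
  par_par := A.totPar_totPar
  par_mul e f x y hx hy := by
    have : (A.totMul.compl₁₂ (A.totPar e) (A.totPar f)).compr₂ (A.totPar (e + f)) =
        A.totMul.compl₁₂ (A.totPar e) (A.totPar f) := tot_ext_bilin fun i j x y => by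
      simp only [LinearMap.compr₂_apply, LinearMap.compl₁₂_apply, totPar_ι]
      split_ifs with h h'
      · rw [A.totMul_ι rfl, totPar_ι, if_pos (by rw [← h, ← h', Int.cast_add])]
      all_goals simp
    have := LinearMap.congr_fun (LinearMap.congr_fun this x) y
    simpa only [LinearMap.compr₂_apply, LinearMap.compl₁₂_apply, hx, hy] using this
  par_one := by rw [totPar_ι, if_pos (by simp)]
  par_d e x hx := by
    have : A.totPar (e + 1) ∘ₗ A.totD ∘ₗ A.totPar e = A.totD ∘ₗ A.totPar e := tot_ext fun i x => by
      simp only [LinearMap.comp_apply, totPar_ι]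
      split_ifs with h
      · have h2 : (((i - 1 : ℤ)) : ZMod 2) = e + 1 := by
          rw [Int.cast_sub, h, Int.cast_one, CharTwo.sub_eq_add]
        rw [A.totD_ι (sub_add_cancel i 1), totPar_ι, if_pos h2]
      · simp
    have := LinearMap.congr_fun this x
    simpa only [LinearMap.comp_apply, hx] using this
  mul_assoc x y z := by
    have h1 : ∀ i x y z, A.totMul (A.totMul (A.ι i x) y) z =
        A.totMul (A.ι i x) (A.totMul y z) := by
      intro i x y z
      have : A.totMul ∘ₗ A.totMul (A.ι i x) =
          (LinearMap.llcomp k _ _ _ (A.totMul (A.ι i x))) ∘ₗ A.totMul :=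
        tot_ext_bilin fun j l y z => by
          change A.totMul (A.totMul (A.ι i x) (A.ι j y)) (A.ι l z) =
            A.totMul (A.ι i x) (A.totMul (A.ι j y) (A.ι l z))
          rw [A.totMul_ι rfl, A.totMul_ι rfl, A.totMul_ι rfl, A.totMul_ι (add_assoc i j l).symm,
            A.mul_assoc]
      exact LinearMap.congr_fun (LinearMap.congr_fun this y) z
    have h2 : A.totMul.flip z ∘ₗ A.totMul.flip y = A.totMul.flip (A.totMul y z) :=
      tot_ext fun i x => h1 i x y z
    exact LinearMap.congr_fun h2 x
  one_mul x := by
    have : A.totMul (A.ι 0 A.one) = LinearMap.id := tot_ext fun i x => by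
      rw [A.totMul_ι (zero_add i), A.one_mul]; rfl
    exact LinearMap.congr_fun this x
  mul_one x := by
    have : A.totMul.flip (A.ι 0 A.one) = LinearMap.id := tot_ext fun i x => by
      rw [LinearMap.flip_apply, A.totMul_ι (add_zero i), A.mul_one]; rfl
    exact LinearMap.congr_fun this x
  d_d x := by
    have : A.totD ∘ₗ A.totD = 0 := tot_ext fun i x => by
      rw [LinearMap.comp_apply, A.totD_ι (sub_add_cancel i 1), A.totD_ι (sub_add_cancel _ 1),
        A.d_d, map_zero]; rfl
    exact LinearMap.congr_fun this x
  leibniz e x y hx := by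
    have : (A.totMul.compl₁₂ (A.totPar e) LinearMap.id).compr₂ A.totD =
        A.totMul.compl₁₂ (A.totD ∘ₗ A.totPar e) LinearMap.id +
          koszul k e • A.totMul.compl₁₂ (A.totPar e) A.totD := tot_ext_bilin fun i j x y => by
      simp only [LinearMap.compr₂_apply, LinearMap.compl₁₂_apply, LinearMap.add_apply,
        LinearMap.smul_apply, LinearMap.comp_apply, LinearMap.id_apply, totPar_ι]
      split_ifs with h
      · have hs : ∀ z : A.X (i + j - 1), i.negOnePow • z = koszul k e • z := fun z => by
          rw [Units.smul_def, negOnePow_eq_koszul, h, ← koszul_cast k, Int.cast_smul_eq_zsmul]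
        rw [A.totMul_ι rfl, A.totD_ι (sub_add_cancel (i + j) 1),
          A.totD_ι (sub_add_cancel i 1), A.totD_ι (sub_add_cancel j 1),
          A.totMul_ι (by omega : i - 1 + j = i + j - 1),
          A.totMul_ι (by omega : i + (j - 1) = i + j - 1),
          A.leibniz i j (i + j) (i - 1) (j - 1) (i + j - 1) rfl (by omega) (by omega) (by omega),
          map_add, hs, map_smul]
      · simp
    have := LinearMap.congr_fun (LinearMap.congr_fun this x) y
    simpa only [LinearMap.compr₂_apply, LinearMap.compl₁₂_apply, LinearMap.add_apply,
        LinearMap.smul_apply, LinearMap.comp_apply, LinearMap.id_apply, hx] using this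

/-- The differential superalgebra over `ℤ` given by the direct sum of the components of a DG
algebra. -/
noncomputable def superInt : @SuperDG ℤ _ A.Tot _ (AddCommGroup.toIntModule A.Tot) :=
  A.super.toInt

/-- The elements of degree `i` in the direct sum of the components. -/
noncomputable def deg (i : ℤ) : Submodule k A.Tot := LinearMap.range (A.ι i)

variable {A}

lemma par_of_deg {i : ℤ} {x : A.Tot} (hx : x ∈ A.deg i) : A.super.par (i : ZMod 2) x = x := by
  obtain ⟨x, rfl⟩ := hx
  exact (A.totPar_ι _ _ _).trans (if_pos rfl)

lemma mul_deg {i j n : ℤ} (h : i + j = n) {x y : A.Tot} (hx : x ∈ A.deg i) (hy : y ∈ A.deg j) :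
    A.super.mul x y ∈ A.deg n := by
  obtain ⟨x, rfl⟩ := hx
  obtain ⟨y, rfl⟩ := hy
  exact ⟨_, (A.totMul_ι h x y).symm⟩

lemma d_deg {i j : ℤ} (h : j + 1 = i) {x : A.Tot} (hx : x ∈ A.deg i) : A.super.d x ∈ A.deg j := by
  obtain ⟨x, rfl⟩ := hx
  exact ⟨_, (A.totD_ι h x).symm⟩

lemma one_deg : A.super.one ∈ A.deg 0 := ⟨_, rfl⟩

lemma par_of_deg_int {i : ℤ} {x : A.Tot} (hx : x ∈ A.deg i) :
    A.superInt.par (i : ZMod 2) x = x := par_of_deg hx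

lemma mul_deg_int {i j n : ℤ} (h : i + j = n) {x y : A.Tot} (hx : x ∈ A.deg i)
    (hy : y ∈ A.deg j) : A.superInt.mul x y ∈ A.deg n := mul_deg h hx hy

lemma d_deg_int {i j : ℤ} (h : j + 1 = i) {x : A.Tot} (hx : x ∈ A.deg i) :
    A.superInt.d x ∈ A.deg j := d_deg h hx

lemma one_deg_int : A.superInt.one ∈ A.deg 0 := one_deg

end DGAlgebra

section functoriality

variable {k : Type u} [CommRing k]

/-- A morphism of differential superalgebras. -/
structure SuperDG.Hom {V : Type v} [AddCommGroup V] [Module k V] {V' : Type w} [AddCommGroup V']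
    [Module k V'] (S : SuperDG k V) (S' : SuperDG k V') where
  f : V →ₗ[k] V'
  map_mul : ∀ x y, f (S.mul x y) = S'.mul (f x) (f y)
  map_one : f S.one = S'.one
  map_d : ∀ x, f (S.d x) = S'.d (f x)
  map_par : ∀ e x, f (S.par e x) = S'.par e (f x)

/-- A morphism of differential algebras with signs. -/
structure SignedDG.Hom {V : Type v} [AddCommGroup V] [Module k V] {V' : Type w} [AddCommGroup V']
    [Module k V'] (L : SignedDG k V) (L' : SignedDG k V') where
  f : V →ₗ[k] V'
  map_mul : ∀ x y, f (L.mul x y) = L'.mul (f x) (f y)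
  map_one : f L.one = L'.one
  map_d : ∀ x, f (L.d x) = L'.d (f x)
  map_s : ∀ x, f (L.s x) = L'.s (f x)

variable {V : Type v} [AddCommGroup V] [Module k V] {V' : Type w} [AddCommGroup V'] [Module k V']

/-- The identity morphism. -/
def SignedDG.Hom.id (L : SignedDG k V) : L.Hom L :=
  ⟨LinearMap.id, fun _ _ => rfl, rfl, fun _ => rfl, fun _ => rfl⟩

/-- The identity morphism. -/
def SuperDG.Hom.id (L : SuperDG k V) : L.Hom L :=
  ⟨LinearMap.id, fun _ _ => rfl, rfl, fun _ => rfl, fun _ _ => rfl⟩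

/-- The action of a permutation of the factors on the tensor power, as a morphism. -/
noncomputable def SuperDG.permHom (S : SuperDG k V) {n : ℕ} (τ : Equiv.Perm (Fin n)) :
    (S.pow n).Hom (S.pow n) where
  f := S.powPerm n τ
  map_mul := S.powPerm_mul τ
  map_one := S.powPerm_one τ
  map_d := S.powPerm_powD τ
  map_s := S.powPerm_powS τ

section

variable {S : SuperDG k V} {S' : SuperDG k V'} (φ : S.Hom S') (n : ℕ)

/-- The tensor power of a linear map. -/
noncomputable def tpowMap (f : V →ₗ[k] V') : (⨂[k] _ : Fin n, V) →ₗ[k] (⨂[k] _ : Fin n, V') :=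
  PiTensorProduct.map fun _ => f

lemma SuperDG.Hom.par_eq {e : ZMod 2} {x : V} (hx : S.par e x = x) :
    S'.par e (φ.f x) = φ.f x := by rw [← φ.map_par, hx]

lemma tpowMap_tprod (f : V →ₗ[k] V') (a : Fin n → V) :
    tpowMap n f (PiTensorProduct.tprod k a) = PiTensorProduct.tprod k fun l => f (a l) :=
  PiTensorProduct.map_tprod _ _

/-- The tensor power of a morphism. -/
noncomputable def SuperDG.Hom.pow : (S.pow n).Hom (S'.pow n) where
  f := tpowMap n φ.f
  map_mul x y := by
    refine S.ext_bilin (F := (S.powMul n).compr₂ (tpowMap n φ.f))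
      (G := (S'.powMul n).compl₁₂ (tpowMap n φ.f) (tpowMap n φ.f)) ?_ x y
    intro e f a b ha hb
    rw [LinearMap.compr₂_apply, LinearMap.compl₁₂_apply, S.powMul_tprod ha hb, map_smul,
      tpowMap_tprod, tpowMap_tprod, tpowMap_tprod,
      S'.powMul_tprod (fun l => φ.par_eq (ha l)) (fun l => φ.par_eq (hb l))]
    simp only [φ.map_mul]
  map_one := by
    refine (tpowMap_tprod n φ.f _).trans ?_
    simp only [φ.map_one]; rfl
  map_d x := by
    have : tpowMap n φ.f ∘ₗ S.powD n = S'.powD n ∘ₗ tpowMap n φ.f := by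
      refine S.pow_ext fun e a ha => ?_
      rw [LinearMap.comp_apply, LinearMap.comp_apply, tpowMap_tprod, S.powD_tprod ha,
        S'.powD_tprod (fun l => φ.par_eq (ha l)), map_sum]
      refine Finset.sum_congr rfl fun j _ => ?_
      rw [map_smul, tpowMap_tprod]
      congr 2; funext l
      by_cases h : l = j
      · subst h; simp [φ.map_d]
      · simp [h]
    exact LinearMap.congr_fun this x
  map_s x := by
    have : tpowMap n φ.f ∘ₗ S.powS n = S'.powS n ∘ₗ tpowMap n φ.f := by
      refine S.pow_ext fun e a ha => ?_
      rw [LinearMap.comp_apply, LinearMap.comp_apply, tpowMap_tprod, S.powS_tprod ha,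
        S'.powS_tprod (fun l => φ.par_eq (ha l)), map_smul, tpowMap_tprod]
    exact LinearMap.congr_fun this x

end

section

variable {L : SignedDG k V} {L' : SignedDG k V'} (φ : L.Hom L') {U : Type*} [AddCommGroup U]
  {U' : Type*} [AddCommGroup U'] {B : SuperDG ℤ U} {B' : SuperDG ℤ U'} (ψ : B.Hom B')

/-- The tensor product of two linear maps. -/
noncomputable def tensMap (f : V →ₗ[k] V') (g : U →ₗ[ℤ] U') : (V ⊗[ℤ] U) →ₗ[k] (V' ⊗[ℤ] U') :=
  TensorProduct.AlgebraTensorModule.map f g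

lemma tensMap_tmul (f : V →ₗ[k] V') (g : U →ₗ[ℤ] U') (t : V) (q : U) :
    tensMap f g (t ⊗ₜ[ℤ] q) = f t ⊗ₜ[ℤ] g q := rfl

lemma SignedDG.Hom.map_sPow (e : ZMod 2) (x : V) : φ.f (L.sPow e x) = L'.sPow e (φ.f x) := by
  rcases zmod_two_cases e with rfl | rfl <;> simp [SignedDG.sPow_zero, SignedDG.sPow_one, φ.map_s]

lemma SuperDG.Hom.map_s (x : U) : ψ.f (B.s x) = B'.s (ψ.f x) := by
  simp [SuperDG.s, ψ.map_par]

/-- The tensor product of two morphisms. -/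
noncomputable def SignedDG.Hom.tensor : (L.tensor B).Hom (L'.tensor B') where
  f := tensMap φ.f ψ.f
  map_mul x y := by
    refine SignedDG.tensor_ext_bilin B (F := (L.tensorMul B).compr₂ (tensMap φ.f ψ.f))
      (G := (L'.tensorMul B').compl₁₂ (tensMap φ.f ψ.f) (tensMap φ.f ψ.f)) ?_ x y
    intro t e q t' e' q' hq hq'
    rw [LinearMap.compr₂_apply, LinearMap.compl₁₂_apply, L.tensorMul_tmul hq, tensMap_tmul,
      tensMap_tmul, tensMap_tmul, L'.tensorMul_tmul (ψ.par_eq hq), φ.map_mul, ψ.map_mul,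
      φ.map_sPow]
  map_one := by
    change φ.f L.one ⊗ₜ[ℤ] ψ.f B.one = L'.one ⊗ₜ[ℤ] B'.one
    rw [φ.map_one, ψ.map_one]
  map_d x := by
    have : tensMap φ.f ψ.f ∘ₗ L.tensorD B = L'.tensorD B' ∘ₗ tensMap φ.f ψ.f := by
      refine SignedDG.tensor_ext B fun t e q hq => ?_
      rw [LinearMap.comp_apply, LinearMap.comp_apply, SignedDG.tensorD_tmul, map_add, tensMap_tmul,
        tensMap_tmul, tensMap_tmul, SignedDG.tensorD_tmul, φ.map_d, φ.map_s, ψ.map_d]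
    exact LinearMap.congr_fun this x
  map_s x := by
    have : tensMap φ.f ψ.f ∘ₗ L.tensorS B = L'.tensorS B' ∘ₗ tensMap φ.f ψ.f := by
      refine SignedDG.tensor_ext B fun t e q hq => ?_
      rw [LinearMap.comp_apply, LinearMap.comp_apply, SignedDG.tensorS_tmul, tensMap_tmul,
        tensMap_tmul, SignedDG.tensorS_tmul, φ.map_s, ψ.map_s]
    exact LinearMap.congr_fun this x

end

/-- The map of differential superalgebras given by a morphism of DG algebras. -/
noncomputable def DGAlgebra.Hom.super {A : DGAlgebra.{u, v} k} {B : DGAlgebra.{u, w} k}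
    (φ : A.Hom B) : A.super.Hom B.super :=
  have hι : ∀ i x, DirectSum.lmap φ.f (A.ι i x) = B.ι i (φ.f i x) :=
    fun i x => DirectSum.lmap_lof φ.f i x
  { f := DirectSum.lmap φ.f
    map_mul := fun x y => by
      have : A.totMul.compr₂ (DirectSum.lmap φ.f) =
          B.totMul.compl₁₂ (DirectSum.lmap φ.f) (DirectSum.lmap φ.f) :=
        DGAlgebra.tot_ext_bilin fun i j x y => by
          rw [LinearMap.compr₂_apply, LinearMap.compl₁₂_apply, A.totMul_ι rfl, hι, hι, hι,
            B.totMul_ι rfl, φ.map_mul]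
      exact LinearMap.congr_fun (LinearMap.congr_fun this x) y
    map_one := (hι 0 A.one).trans (congrArg (B.ι 0) φ.map_one)
    map_d := fun x => by
      have : DirectSum.lmap φ.f ∘ₗ A.totD = B.totD ∘ₗ DirectSum.lmap φ.f :=
        DGAlgebra.tot_ext fun i x => by
          rw [LinearMap.comp_apply, LinearMap.comp_apply, hι, A.totD_ι (sub_add_cancel i 1), hι,
            B.totD_ι (sub_add_cancel i 1), φ.map_d]
      exact LinearMap.congr_fun this x
    map_par := fun e x => by
      have : DirectSum.lmap φ.f ∘ₗ A.totPar e = B.totPar e ∘ₗ DirectSum.lmap φ.f :=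
        DGAlgebra.tot_ext fun i x => by
          rw [LinearMap.comp_apply, LinearMap.comp_apply, hι, A.totPar_ι, B.totPar_ι]
          split_ifs
          · rw [hι]
          · rw [map_zero]
      exact LinearMap.congr_fun this x }

lemma DGAlgebra.Hom.super_deg {A : DGAlgebra.{u, v} k} {B : DGAlgebra.{u, w} k}
    (φ : A.Hom B) {i : ℤ} {x : A.Tot} (hx : x ∈ A.deg i) : φ.super.f x ∈ B.deg i := by
  obtain ⟨x, rfl⟩ := hx
  exact ⟨_, (DirectSum.lmap_lof φ.f i x).symm⟩

end functoriality

section tensors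

variable {k : Type u} [CommRing k] {V : Type v} [AddCommGroup V] [Module k V]
  {U : Type w} [AddCommGroup U]

lemma SignedDG.sPow_of_s (L : SignedDG k V) {ε : ZMod 2} {t : V} (ht : L.s t = koszul k ε • t)
    (e : ZMod 2) : L.sPow e t = koszul k (e * ε) • t := by
  rcases zmod_two_cases e with rfl | rfl
  · rw [L.sPow_zero, zero_mul, koszul_zero, one_smul]
  · rw [L.sPow_one, _root_.one_mul, ht]

lemma tens_smul (c : k) (t : V) (q : U) : tens (c • t) q = c • tens t q := rfl

lemma tens_add (t t' : V) (q : U) : tens (t + t') q = tens t q + tens t' q :=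
  TensorProduct.add_tmul t t' q

lemma zero_tens (q : U) : tens (0 : V) q = 0 := TensorProduct.zero_tmul V q

lemma tens_zero (t : V) : tens t (0 : U) = 0 := TensorProduct.tmul_zero U t

lemma tens_induction {P : Tens V U → Prop} (zero : P 0) (tens : ∀ t q, P (tens t q))
    (add : ∀ x y, P x → P y → P (x + y)) (z : Tens V U) : P z :=
  TensorProduct.induction_on z zero tens add

variable (k) in
lemma tens_koszul (e : ZMod 2) (t : V) (q : U) :
    tens t (koszul ℤ e • q) = koszul k e • tens t q :=
  SignedDG.tmul_koszul (k := k) e t q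

variable (L : SignedDG k V) (B : SuperDG ℤ U)

lemma tensor_mul {e : ZMod 2} {q : U} (hq : B.par e q = q) (t t' : V) (q' : U) :
    (L.tensor B).mul (tens t q) (tens t' q') = tens (L.mul t (L.sPow e t')) (B.mul q q') :=
  L.tensorMul_tmul hq t t' q'

lemma tensor_mul_of_s {e ε : ZMod 2} {q : U} (hq : B.par e q = q) (t : V) {t' : V}
    (ht' : L.s t' = koszul k ε • t') (q' : U) :
    (L.tensor B).mul (tens t q) (tens t' q') =
      koszul k (e * ε) • tens (L.mul t t') (B.mul q q') := by
  rw [tensor_mul L B hq, L.sPow_of_s ht', map_smul, tens_smul]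

lemma tensor_d (t : V) (q : U) :
    (L.tensor B).d (tens t q) = tens (L.d t) q + tens (L.s t) (B.d q) := rfl

lemma tensor_s {e ε : ZMod 2} {t : V} {q : U} (ht : L.s t = koszul k ε • t)
    (hq : B.par e q = q) : (L.tensor B).s (tens t q) = koszul k (ε + e) • tens t q := by
  change tens (L.s t) (B.s q) = _
  rw [ht, B.s_of_par hq, tens_koszul k, tens_smul, smul_smul, koszul_add, mul_comm]

lemma koszul_smul_eq (n : ℤ) (x : V) : koszul k (n : ZMod 2) • x = n.negOnePow • x := by
  rw [Units.smul_def, negOnePow_eq_koszul, ← koszul_cast k, Int.cast_smul_eq_zsmul]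

end tensors

/-- A morphism of differential superalgebras, over the integers. -/
def SuperDG.Hom.toInt {k : Type u} [CommRing k] {V : Type v} [AddCommGroup V] [Module k V]
    {V' : Type w} [AddCommGroup V'] [Module k V'] {S : SuperDG k V} {S' : SuperDG k V'}
    (φ : S.Hom S') :
    @SuperDG.Hom ℤ _ V _ (AddCommGroup.toIntModule V) V' _ (AddCommGroup.toIntModule V')
      S.toInt S'.toInt where
  f := φ.f.toAddMonoidHom.toIntLinearMap
  map_mul := φ.map_mul
  map_one := φ.map_one
  map_d := φ.map_d
  map_par := φ.map_par

/-- The map of differential superalgebras over the integers given by a morphism of DG algebras. -/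
noncomputable def DGAlgebra.Hom.superInt {k : Type u} [CommRing k] {A : DGAlgebra.{u, v} k}
    {B : DGAlgebra.{u, w} k} (φ : A.Hom B) :
    @SuperDG.Hom ℤ _ A.Tot _ (AddCommGroup.toIntModule A.Tot) B.Tot _
      (AddCommGroup.toIntModule B.Tot) A.superInt B.superInt :=
  φ.super.toInt

/-- An additive map, as a linear map over the integers. -/
def intLin {M : Type v} {N : Type w} [AddCommGroup M] [AddCommGroup N] [Module ℤ M] [Module ℤ N]
    (f : M →+ N) : M →ₗ[ℤ] N :=
  { f with
    map_smul' := fun m x => by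
      have := map_intCast_smul f ℤ ℤ m x
      rwa [Int.cast_id] at this }

/-- The cyclic group of order `p`, with the generator `ofAdd 1`. -/
abbrev Cyc (p : ℕ) : Type := Multiplicative (ZMod p)

/-- Multiplicative resolution data for the cyclic group `G = ℤ/p`: a resolution of the trivial
module `ℤ` by projective `ℤ[G]`-modules, given by its cone `P` (so `P` is acyclic, `P₀ = ℤ`, and
`Pᵢ` is projective for `i ≥ 1`), and a coresolution `I` of `ℤ` by modules that are injective
relatively to `ℤ` (that is, projective over `ℤ[G]`), in degrees `≤ 0`; both are unital associative
DG algebras on which `G` acts by automorphisms. -/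
structure ResolutionData (p : ℕ) where
  P : DGAlgebra.{0, u} ℤ
  I : DGAlgebra.{0, u} ℤ
  ρP : ∀ i, Representation ℤ (Cyc p) (P.X i)
  ρI : ∀ i, Representation ℤ (Cyc p) (I.X i)
  ρP_d : ∀ g i j x, ρP j g (P.d i j x) = P.d i j (ρP i g x)
  ρI_d : ∀ g i j x, ρI j g (I.d i j x) = I.d i j (ρI i g x)
  ρP_mul : ∀ g i j n (h : i + j = n) x y,
    ρP n g (P.mul i j n h x y) = P.mul i j n h (ρP i g x) (ρP j g y)
  ρI_mul : ∀ g i j n (h : i + j = n) x y,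
    ρI n g (I.mul i j n h x y) = I.mul i j n h (ρI i g x) (ρI j g y)
  ρP_one : ∀ g, ρP 0 g P.one = P.one
  ρI_one : ∀ g, ρI 0 g I.one = I.one
  P_bounded : ∀ i, i < 0 → Subsingleton (P.X i)
  P_zero : Function.Bijective fun m : ℤ => m • P.one
  P_projective : ∀ i, 0 < i → Module.Projective (MonoidAlgebra ℤ (Cyc p)) (ρP i).asModule
  P_acyclic : ∀ i (x : P.X i), P.d i (i - 1) x = 0 → ∃ y : P.X (i + 1), P.d (i + 1) i y = x
  I_bounded : ∀ i, 0 < i → Subsingleton (I.X i)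
  I_projective : ∀ i, Module.Projective (MonoidAlgebra ℤ (Cyc p)) (ρI i).asModule
  I_unit : Function.Injective fun m : ℤ => m • I.one
  I_exact_zero : ∀ x : I.X 0, I.d 0 (-1) x = 0 → ∃ m : ℤ, m • I.one = x
  I_exact : ∀ i (x : I.X i), i < 0 → I.d i (i - 1) x = 0 → ∃ y : I.X (i + 1), I.d (i + 1) i y = x

section Cech

variable {p : ℕ} {k : Type u} [CommRing k]

namespace ResolutionData

variable (ν : ResolutionData.{u} p)

/-- The action of an element of the group on `P`. -/
noncomputable def homP (g : Cyc p) : ν.P.Hom ν.P where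
  f i := @intLin _ _ _ _ (ν.P.module i) (ν.P.module i) (ν.ρP i g).toAddMonoidHom
  map_d i j x := ν.ρP_d g i j x
  map_mul i j n h x y := ν.ρP_mul g i j n h x y
  map_one := ν.ρP_one g

/-- The action of an element of the group on `I`. -/
noncomputable def homI (g : Cyc p) : ν.I.Hom ν.I where
  f i := @intLin _ _ _ _ (ν.I.module i) (ν.I.module i) (ν.ρI i g).toAddMonoidHom
  map_d i j x := ν.ρI_d g i j x
  map_mul i j n h x y := ν.ρI_mul g i j n h x y
  map_one := ν.ρI_one g

end ResolutionData

namespace DGAlgebra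

variable (p) (A : DGAlgebra.{u, v} k)

/-- The terms of the tensor power `A ⊗ ⋯ ⊗ A` (`p` factors): the part of degree `n`. -/
noncomputable def powDeg (n : ℤ) : Submodule k (SuperDG.TPow k A.Tot p) :=
  Submodule.span k {t | ∃ (i : Fin p → ℤ) (a : Fin p → A.Tot), (∀ l, a l ∈ A.deg (i l)) ∧
    ∑ l, i l = n ∧ t = SuperDG.pureTensor k a}

variable {p A}

lemma powDeg_mul {i j n : ℤ} (h : i + j = n) {x y : SuperDG.TPow k A.Tot p}
    (hx : x ∈ A.powDeg p i) (hy : y ∈ A.powDeg p j) :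
    (A.super.pow p).mul x y ∈ A.powDeg p n := by
  induction hx using Submodule.span_induction with
  | zero => rw [map_zero, LinearMap.zero_apply]; exact zero_mem _
  | add x x' _ _ hx hx' => rw [map_add, LinearMap.add_apply]; exact add_mem hx hx'
  | smul r x _ hx => rw [map_smul, LinearMap.smul_apply]; exact Submodule.smul_mem _ _ hx
  | mem x hx =>
    induction hy using Submodule.span_induction with
    | zero => rw [map_zero]; exact zero_mem _
    | add x x' _ _ hx hx' => rw [map_add]; exact add_mem hx hx'
    | smul r x _ hx => rw [map_smul]; exact Submodule.smul_mem _ _ hx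
    | mem y hy =>
      obtain ⟨e, a, ha, hi, rfl⟩ := hx
      obtain ⟨f, b, hb, hj, rfl⟩ := hy
      have := A.super.powMul_tprod (fun l => par_of_deg (ha l)) (fun l => par_of_deg (hb l))
      refine (congrArg (· ∈ A.powDeg p n) this).mpr (Submodule.smul_mem _ _ (Submodule.subset_span
        ⟨fun l => e l + f l, _, fun l => mul_deg rfl (ha l) (hb l), ?_, rfl⟩))
      rw [Finset.sum_add_distrib, hi, hj, h]

lemma powDeg_d {i j : ℤ} (h : j + 1 = i) {x : SuperDG.TPow k A.Tot p}
    (hx : x ∈ A.powDeg p i) : (A.super.pow p).d x ∈ A.powDeg p j := by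
  induction hx using Submodule.span_induction with
  | zero => rw [map_zero]; exact zero_mem _
  | add x x' _ _ hx hx' => rw [map_add]; exact add_mem hx hx'
  | smul r x _ hx => rw [map_smul]; exact Submodule.smul_mem _ _ hx
  | mem x hx =>
    obtain ⟨e, a, ha, hi, rfl⟩ := hx
    have := A.super.powD_tprod (fun l => par_of_deg (ha l))
    refine (congrArg (· ∈ A.powDeg p j) this).mpr (sum_mem fun m _ =>
      Submodule.smul_mem _ _ (Submodule.subset_span ⟨e - Pi.single m 1, _, fun l => ?_, ?_, rfl⟩))
    · by_cases hl : l = m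
      · subst hl
        simpa using d_deg (sub_add_cancel _ 1) (ha l)
      · simpa [hl] using ha l
    · simp only [Pi.sub_apply, Finset.sum_sub_distrib, hi, Finset.sum_pi_single', Finset.mem_univ,
        if_true]
      omega

lemma powDeg_s {i : ℤ} {x : SuperDG.TPow k A.Tot p} (hx : x ∈ A.powDeg p i) :
    (A.super.pow p).s x = koszul k (i : ZMod 2) • x := by
  induction hx using Submodule.span_induction with
  | zero => rw [map_zero, smul_zero]
  | add x x' _ _ hx hx' => rw [map_add, smul_add, hx, hx']
  | smul r x _ hx => rw [map_smul, hx, smul_comm]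
  | mem x hx =>
    obtain ⟨e, a, ha, hi, rfl⟩ := hx
    have := A.super.powS_tprod (fun l => par_of_deg (ha l))
    rw [← Int.cast_sum, hi] at this
    exact this

lemma powDeg_one : (A.super.pow p).one ∈ A.powDeg p 0 :=
  Submodule.subset_span ⟨0, _, fun _ => one_deg, by simp, rfl⟩

variable (A) (ν : ResolutionData.{u} p)

/-- The direct sum of the terms of the complex `A ⊗ ⋯ ⊗ A ⊗ P ⊗ I`. -/
noncomputable abbrev CechTot : Type (max u v) :=
  Tens (Tens (SuperDG.TPow k A.Tot p) ν.P.Tot) ν.I.Tot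

/-- The differential algebra `A ⊗ ⋯ ⊗ A ⊗ P ⊗ I`. -/
noncomputable def cechSigned : SignedDG k (A.CechTot ν) :=
  ((A.super.pow p).tensor ν.P.superInt).tensor ν.I.superInt

/-- The diagonal action of the generator of the group on `A ⊗ ⋯ ⊗ A ⊗ P ⊗ I`: the factors of the
tensor power of `A` are permuted cyclically. -/
noncomputable def cechAction : (A.cechSigned ν).Hom (A.cechSigned ν) :=
  ((A.super.permHom (finRotate p)).tensor (ν.homP (.ofAdd 1)).superInt).tensor
    (ν.homI (.ofAdd 1)).superInt

/-- The `m`-th term of the filtration, in degree `n`: it is spanned by the tensors `t ⊗ x ⊗ y` of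
degree `n` such that the degree `j` of `t` satisfies `j ≤ - m p`. -/
noncomputable def cechFil (m n : ℤ) : Submodule k (A.CechTot ν) :=
  Submodule.span k {w | ∃ j b c, ∃ t ∈ A.powDeg p j, ∃ x ∈ ν.P.deg b, ∃ y ∈ ν.I.deg c,
    j ≤ -m * p ∧ j + b + c = n ∧ w = tens (tens t x) y}

variable {A ν}

lemma cechFil_anti {i j n : ℤ} (h : i ≤ j) : A.cechFil ν j n ≤ A.cechFil ν i n := by
  refine Submodule.span_mono ?_
  rintro w ⟨d, b, c, t, ht, x, hx, y, hy, h1, h2, rfl⟩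
  refine ⟨d, b, c, t, ht, x, hx, y, hy, h1.trans ?_, h2, rfl⟩
  have : (0 : ℤ) ≤ p := by positivity
  nlinarith

lemma cechFil_s {i n : ℤ} {w : A.CechTot ν} (hw : w ∈ A.cechFil ν i n) :
    (A.cechSigned ν).s w = n.negOnePow • w := by
  rw [← koszul_smul_eq (k := k)]
  induction hw using Submodule.span_induction with
  | zero => rw [map_zero, smul_zero]
  | add x x' _ _ hx hx' => rw [map_add, smul_add, hx, hx']
  | smul r x _ hx => rw [map_smul, hx, smul_comm]
  | mem w hw =>
    obtain ⟨d, b, c, t, ht, x, hx, y, hy, h1, h2, rfl⟩ := hw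
    have h := tensor_s _ ν.I.superInt (tensor_s _ ν.P.superInt (powDeg_s ht) (par_of_deg_int hx))
      (par_of_deg_int hy)
    rw [← Int.cast_add, ← Int.cast_add, h2] at h
    exact h

lemma cechFil_d {i n n' : ℤ} (h : n' + 1 = n) {w : A.CechTot ν} (hw : w ∈ A.cechFil ν i n) :
    (A.cechSigned ν).d w ∈ A.cechFil ν i n' := by
  induction hw using Submodule.span_induction with
  | zero => rw [map_zero]; exact zero_mem _
  | add x x' _ _ hx hx' => rw [map_add]; exact add_mem hx hx'
  | smul r x _ hx => rw [map_smul]; exact Submodule.smul_mem _ _ hx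
  | mem w hw =>
    obtain ⟨d, b, c, t, ht, x, hx, y, hy, h1, h2, rfl⟩ := hw
    have e1 : (A.cechSigned ν).d (tens (tens t x) y) =
        (tens (tens ((A.super.pow p).d t) x) y +
          koszul k (d : ZMod 2) • tens (tens t (ν.P.superInt.d x)) y) +
        koszul k ((d : ZMod 2) + (b : ZMod 2)) • tens (tens t x) (ν.I.superInt.d y) := by
      refine (tensor_d _ _ _ _).trans ?_
      rw [tensor_s _ ν.P.superInt (powDeg_s ht) (par_of_deg_int hx), tens_smul, tensor_d, powDeg_s ht,
        tens_smul]
      exact congrArg (· + _) (TensorProduct.add_tmul _ _ _)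
    rw [e1]
    refine add_mem (add_mem ?_ (Submodule.smul_mem _ _ ?_)) (Submodule.smul_mem _ _ ?_)
    · exact Submodule.subset_span ⟨d - 1, b, c, _, powDeg_d (by omega) ht, x, hx, y, hy, by omega,
        by omega, rfl⟩
    · exact Submodule.subset_span ⟨d, b - 1, c, t, ht, _, d_deg_int (by omega) hx, y, hy, by omega,
        by omega, rfl⟩
    · exact Submodule.subset_span ⟨d, b, c - 1, t, ht, x, hx, _, d_deg_int (by omega) hy, by omega,
        by omega, rfl⟩

lemma cechFil_mul {i j n m : ℤ} {w z : A.CechTot ν} (hw : w ∈ A.cechFil ν i n)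
    (hz : z ∈ A.cechFil ν j m) : (A.cechSigned ν).mul w z ∈ A.cechFil ν (i + j) (n + m) := by
  induction hw using Submodule.span_induction with
  | zero => rw [map_zero, LinearMap.zero_apply]; exact zero_mem _
  | add x x' _ _ hx hx' => rw [map_add, LinearMap.add_apply]; exact add_mem hx hx'
  | smul r x _ hx => rw [map_smul, LinearMap.smul_apply]; exact Submodule.smul_mem _ _ hx
  | mem w hw =>
    induction hz using Submodule.span_induction with
    | zero => rw [map_zero]; exact zero_mem _
    | add x x' _ _ hx hx' => rw [map_add]; exact add_mem hx hx'
    | smul r x _ hx => rw [map_smul]; exact Submodule.smul_mem _ _ hx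
    | mem z hz =>
      obtain ⟨d, b, c, t, ht, x, hx, y, hy, h1, h2, rfl⟩ := hw
      obtain ⟨d', b', c', t', ht', x', hx', y', hy', h1', h2', rfl⟩ := hz
      have e1 := tensor_mul_of_s _ ν.I.superInt (par_of_deg_int hy) (tens t x)
        (tensor_s _ ν.P.superInt (powDeg_s ht') (par_of_deg_int hx')) y'
      rw [tensor_mul_of_s _ ν.P.superInt (par_of_deg_int hx) _ (powDeg_s ht'), tens_smul] at e1
      refine (congrArg (· ∈ A.cechFil ν (i + j) (n + m)) e1).mpr (Submodule.smul_mem _ _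
        (Submodule.smul_mem _ _ (Submodule.subset_span ⟨d + d', b + b', c + c', _,
          powDeg_mul rfl ht ht', _, mul_deg_int rfl hx hx', _, mul_deg_int rfl hy hy', ?_, by omega, rfl⟩)))
      rw [neg_add, add_mul]; exact add_le_add h1 h1'

lemma cechFil_one : (A.cechSigned ν).one ∈ A.cechFil ν 0 0 :=
  Submodule.subset_span ⟨0, 0, 0, _, powDeg_one, _, one_deg_int, _, one_deg_int, by simp, by simp, rfl⟩

variable (A ν)

/-- The Tate complex of the tensor power of `A`: the invariants in `A ⊗ ⋯ ⊗ A ⊗ P ⊗ I`, with the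
filtration induced by the filtration of `A ⊗ ⋯ ⊗ A`. -/
noncomputable def cech : FilteredDG k (A.CechTot ν) where
  toSignedDG := A.cechSigned ν
  F m n := A.cechFil ν m n ⊓ LinearMap.eqLocus (A.cechAction ν).f LinearMap.id
  anti _ _ _ h := inf_le_inf_right _ (cechFil_anti h)
  s_mem _ _ _ hx := cechFil_s hx.1
  d_mem i n n' h x hx := ⟨cechFil_d h hx.1, by
    rw [SetLike.mem_coe, LinearMap.mem_eqLocus, (A.cechAction ν).map_d, hx.2]; rfl⟩
  mul_mem i j n m x hx y hy := ⟨cechFil_mul hx.1 hy.1, by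
    rw [SetLike.mem_coe, LinearMap.mem_eqLocus, (A.cechAction ν).map_mul, hx.2, hy.2]; rfl⟩
  one_mem := ⟨cechFil_one, (A.cechAction ν).map_one⟩

end DGAlgebra

end Cech

namespace FilteredDG

variable {k : Type u} [CommRing k] {W : Type v} [AddCommGroup W] [Module k W]
  {W' : Type w} [AddCommGroup W'] [Module k W']

/-- A morphism of filtered differential algebras. -/
structure Hom (E : FilteredDG k W) (E' : FilteredDG k W') extends
    SignedDG.Hom E.toSignedDG E'.toSignedDG where
  map_F : ∀ i n, ∀ x ∈ E.F i n, f x ∈ E'.F i n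

variable {E : FilteredDG k W} {E' : FilteredDG k W'} (φ : E.Hom E')

lemma Hom.map_Z {n : ℤ} {x : W} (hx : x ∈ E.Z n) : φ.f x ∈ E'.Z n := by
  refine ⟨φ.map_F _ _ _ hx.1, ?_⟩
  rw [SetLike.mem_coe, Submodule.mem_comap, ← φ.map_d]
  exact φ.map_F _ _ _ hx.2

lemma Hom.map_B {n : ℤ} {x : W} (hx : x ∈ E.B n) : φ.f x ∈ E'.B n := by
  obtain ⟨a, ha, b, ⟨c, hc, rfl⟩, rfl⟩ := Submodule.mem_sup.mp hx
  rw [map_add, φ.map_d]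
  exact add_mem (Submodule.mem_sup_left (φ.map_F _ _ _ ha))
    (Submodule.mem_sup_right ⟨_, φ.map_F _ _ _ hc, rfl⟩)

/-- The map on filtered truncations. -/
noncomputable def Hom.mapQ (n : ℤ) : E.Q n →ₗ[k] E'.Q n :=
  Submodule.mapQ _ _ (φ.f.restrict fun _ hx => φ.map_Z hx) fun _ hx => φ.map_B hx

lemma Hom.mapQ_cls {n : ℤ} (x : W) (hx : x ∈ E.Z n) :
    φ.mapQ n (E.cls x hx) = E'.cls (φ.f x) (φ.map_Z hx) := rfl

/-- The functoriality of the filtered truncation. -/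
noncomputable def Hom.trunc : E.trunc.Hom E'.trunc where
  f := φ.mapQ
  map_d i j := Q_ind fun x hx => by
    change φ.mapQ j (E.dQ i j _) = E'.dQ i j (φ.mapQ i _)
    by_cases h : j + 1 = i
    · rw [E.dQ_cls h, φ.mapQ_cls, φ.mapQ_cls, E'.dQ_cls h]
      exact E'.cls_congr _ _ (φ.map_d x)
    · rw [show E.dQ i j = 0 from dif_neg h, show E'.dQ i j = 0 from dif_neg h,
        LinearMap.zero_apply, LinearMap.zero_apply, map_zero]
  map_mul i j n h x y := by
    induction x using Q_ind with | h x hx =>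
    induction y using Q_ind with | h y hy =>
    exact E'.cls_congr _ _ (φ.map_mul x y)
  map_one := E'.cls_congr _ _ φ.map_one

end FilteredDG

/-- Functoriality of the restriction of scalars. -/
noncomputable def DGAlgebra.Hom.restrictScalars {k k' : Type u} [CommRing k] [CommRing k']
    (φ : k →+* k') {A B : DGAlgebra.{u, v} k'} (f : A.Hom B) :
    (A.restrictScalars φ).Hom (B.restrictScalars φ) where
  f i := letI := Module.compHom (A.X i) φ; letI := Module.compHom (B.X i) φ
    { toFun := f.f i
      map_add' := (f.f i).map_add
      map_smul' := fun r => (f.f i).map_smul (φ r) }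
  map_d := f.map_d
  map_mul := f.map_mul
  map_one := f.map_one

namespace DGAlgebra

section

variable {p : ℕ} {k : Type u} [CommRing k] (ν : ResolutionData.{u} p)

section

variable {A B : DGAlgebra.{u, v} k} (φ : A.Hom B)

/-- Functoriality of the algebra `A ⊗ ⋯ ⊗ A ⊗ P ⊗ I`. -/
noncomputable def Hom.cechSigned : (A.cechSigned ν).Hom (B.cechSigned ν) :=
  ((φ.super.pow p).tensor (SuperDG.Hom.id _)).tensor (SuperDG.Hom.id _)

lemma Hom.pow_deg {n : ℤ} {t : SuperDG.TPow k A.Tot p} (ht : t ∈ A.powDeg p n) :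
    (φ.super.pow p).f t ∈ B.powDeg p n := by
  induction ht using Submodule.span_induction with
  | zero => rw [map_zero]; exact zero_mem _
  | add x x' _ _ hx hx' => rw [map_add]; exact add_mem hx hx'
  | smul r x _ hx => rw [map_smul]; exact Submodule.smul_mem _ _ hx
  | mem x hx =>
    obtain ⟨e, a, ha, hi, rfl⟩ := hx
    exact Submodule.subset_span ⟨e, _, fun l => φ.super_deg (ha l), hi,
      tpowMap_tprod p φ.super.f a⟩

lemma Hom.cech_fil {m n : ℤ} {w : A.CechTot ν} (hw : w ∈ A.cechFil ν m n) :
    (φ.cechSigned ν).f w ∈ B.cechFil ν m n := by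
  induction hw using Submodule.span_induction with
  | zero => rw [map_zero]; exact zero_mem _
  | add x x' _ _ hx hx' => rw [map_add]; exact add_mem hx hx'
  | smul r x _ hx => rw [map_smul]; exact Submodule.smul_mem _ _ hx
  | mem w hw =>
    obtain ⟨d, b, c, t, ht, x, hx, y, hy, h1, h2, rfl⟩ := hw
    exact Submodule.subset_span ⟨d, b, c, _, φ.pow_deg ht, x, hx, y, hy, h1, h2, rfl⟩

lemma Hom.pow_perm (τ : Equiv.Perm (Fin p)) (t : SuperDG.TPow k A.Tot p) :
    (φ.super.pow p).f (A.super.powPerm p τ t) = B.super.powPerm p τ ((φ.super.pow p).f t) := by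
  have : tpowMap p φ.super.f ∘ₗ A.super.powPerm p τ =
      B.super.powPerm p τ ∘ₗ tpowMap p φ.super.f := by
    refine A.super.pow_ext fun e a ha => ?_
    rw [LinearMap.comp_apply, LinearMap.comp_apply, tpowMap_tprod, A.super.powPerm_tprod τ ha,
      B.super.powPerm_tprod τ (fun l => φ.super.par_eq (ha l)), map_smul, tpowMap_tprod]
  exact LinearMap.congr_fun this t

lemma Hom.cech_action (w : A.CechTot ν) :
    (φ.cechSigned ν).f ((A.cechAction ν).f w) = (B.cechAction ν).f ((φ.cechSigned ν).f w) := by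
  induction w using tens_induction with
  | zero => simp only [map_zero]
  | add x y hx hy => rw [map_add, map_add, map_add, map_add, hx, hy]
  | tens w y =>
    induction w using tens_induction with
    | zero => rw [zero_tens]; simp only [map_zero]
    | add x y hx hy => rw [tens_add, map_add, map_add, map_add, map_add, hx, hy]
    | tens t x =>
      exact congrArg (fun z => tens (tens z _) _) (φ.pow_perm (finRotate p) t)

/-- Functoriality of the Tate complex. -/
noncomputable def Hom.cech : (A.cech ν).Hom (B.cech ν) where
  toHom := φ.cechSigned ν
  map_F i n x hx := ⟨φ.cech_fil ν hx.1, by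
    have h : (A.cechAction ν).f x = x := hx.2
    change (B.cechAction ν).f ((φ.cechSigned ν).f x) = (φ.cechSigned ν).f x
    rw [← φ.cech_action, h]⟩

end

variable (A : DGAlgebra.{u, v} k)

/-- The class of `v ⊗ ⋯ ⊗ v ⊗ 1 ⊗ 1` for an element `v` of degree `0`. -/
noncomputable def cechPow (x : A.X 0) : A.CechTot ν :=
  tens (tens (SuperDG.pureTensor k fun _ => A.ι 0 x) ν.P.superInt.one) ν.I.superInt.one

lemma cechPow_mem (x : A.X 0) (hx : A.d 0 (-1) x = 0) : A.cechPow ν x ∈ (A.cech ν).Z 0 := by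
  have ht : SuperDG.pureTensor k (fun _ => A.ι 0 x) ∈ A.powDeg p 0 :=
    Submodule.subset_span ⟨0, _, fun _ => ⟨x, rfl⟩, by simp, rfl⟩
  have hpar : ∀ l : Fin p, A.super.par ((0 : Fin p → ZMod 2) l) (A.ι 0 x) = A.ι 0 x :=
    fun _ => by simpa using par_of_deg (⟨x, rfl⟩ : A.ι 0 x ∈ A.deg 0)
  have h1 : ∀ {k : Type} [CommRing k] (P : DGAlgebra.{0, u} k), P.superInt.d P.superInt.one = 0 := by
    intro k _ P
    have h := P.superInt.leibniz 0 P.superInt.one P.superInt.one P.superInt.par_one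
    rw [P.superInt.one_mul, P.superInt.one_mul, P.superInt.mul_one, koszul_zero, one_smul,
      left_eq_add] at h
    exact h
  have hd : (A.cechSigned ν).d (A.cechPow ν x) = 0 := by
    have h2 : (A.super.pow p).d (SuperDG.pureTensor k fun _ => A.ι 0 x) = 0 := by
      refine (A.super.powD_tprod hpar).trans (Finset.sum_eq_zero fun j _ => ?_)
      rw [MultilinearMap.map_coord_zero _ j, smul_zero]
      rw [Function.update_self]
      refine (A.totD_ι (by norm_num : (-1 : ℤ) + 1 = 0) x).trans ?_
      rw [hx, map_zero]
    refine (tensor_d _ _ _ _).trans ?_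
    rw [tensor_d, h2, h1 ν.P, h1 ν.I, zero_tens, tens_zero, tens_zero, add_zero,
      add_zero, zero_tens]
  refine ⟨⟨?_, ?_⟩, ?_⟩
  · exact Submodule.subset_span ⟨0, 0, 0, _, ht, _, one_deg_int, _, one_deg_int, by simp, by simp,
      rfl⟩
  · have h2 : A.super.powPerm p (finRotate p) (PiTensorProduct.tprod k fun _ => A.ι 0 x) =
        PiTensorProduct.tprod k fun _ => A.ι 0 x := by
      rw [A.super.powPerm_tprod _ hpar]
      simp [SuperDG.inversions, koszul_zero]
    change tens (tens _ _) _ = tens (tens _ _) _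
    rw [(ν.homP _).superInt.map_one, (ν.homI _).superInt.map_one]
    exact congrArg (fun z => tens (tens z _) _) h2
  · rw [SetLike.mem_coe, Submodule.mem_comap]
    exact hd ▸ zero_mem _

end

section

variable (p : ℕ) {R : Type u} [CommRing R] [ExpChar R p] (ν : ResolutionData.{u} p)

/-- The cyclic-power DG algebra of a DG algebra `A` over a perfect ring of characteristic `p`. The
truncated Tate complex fits into a quasiexact sequence that ends with the Frobenius twist of `A`;
since the ring is perfect, pulling back along `A → A⁽¹⁾` amounts to letting scalars act through the
Frobenius map. -/
noncomputable def cyclic (A : DGAlgebra.{u, u} R) : DGAlgebra.{u, u} R :=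
  (A.cech ν).trunc.restrictScalars (frobenius R p)

/-- Functoriality of the cyclic-power DG algebra. -/
noncomputable def Hom.cyclic {A B : DGAlgebra.{u, u} R} (φ : A.Hom B) :
    (A.cyclic p ν).Hom (B.cyclic p ν) :=
  (φ.cech ν).trunc.restrictScalars (frobenius R p)

/-- The class in the cyclic-power DG algebra of an element of the Tate complex. -/
noncomputable def cyclicCls (A : DGAlgebra.{u, u} R) (n : ℤ) (z : (A.cech ν).Z n) :
    (A.cyclic p ν).X n :=
  (A.cech ν).cls z.1 z.2

end

end DGAlgebra

/-- The augmentations of the cyclic-power DG algebras: the functorial surjective maps of DG algebras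
`C(A) → A` that identify the filtered truncation `τ_{[0,0]}` of the Tate complex with the Frobenius
twist of `A`, normalized by the condition that the class of `v ⊗ ⋯ ⊗ v` goes to `v`. -/
structure Augmentation (p : ℕ) (R : Type u) [CommRing R] [ExpChar R p] (ν : ResolutionData.{u} p)
    where
  a : ∀ A : DGAlgebra.{u, u} R, (A.cyclic p ν).Hom A
  natural : ∀ (A B : DGAlgebra.{u, u} R) (φ : A.Hom B) (n : ℤ) (x : (A.cyclic p ν).X n),
    (a B).f n ((φ.cyclic p ν).f n x) = φ.f n ((a A).f n x)
  surjective : ∀ (A : DGAlgebra.{u, u} R) (n : ℤ), Function.Surjective ((a A).f n)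
  ker : ∀ (A : DGAlgebra.{u, u} R) (n : ℤ) (z : (A.cech ν).Z n),
    (a A).f n (A.cyclicCls p ν n z) = 0 ↔
      z.1 ∈ (A.cech ν).F (1 - n) n ⊔ ((A.cech ν).F (-n) (n + 1)).map (A.cech ν).d
  normalized : ∀ (A : DGAlgebra.{u, u} R) (v : A.X 0) (hv : A.d 0 (-1) v = 0),
    (a A).f 0 (A.cyclicCls p ν 0 ⟨A.cechPow ν v, A.cechPow_mem ν v hv⟩) = v

/-- The reductions of a DG algebra `A'` over the ring `W₂(R)` of Witt vectors of length two: the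
maps of DG algebras `A' → A` that induce an isomorphism from `A' / p` to the DG algebra `A` over
`R`. -/
structure Reduction {p : ℕ} [Fact p.Prime] {R : Type u} [CommRing R]
    (A' : DGAlgebra.{u, v} (TruncatedWittVector p 2 R)) (A : DGAlgebra.{u, v} R) where
  π : ∀ n, A'.X n →+ A.X n
  map_smul : ∀ n (w : TruncatedWittVector p 2 R) x, π n (w • x) = w.coeff 0 • π n x
  map_d : ∀ i j x, π j (A'.d i j x) = A.d i j (π i x)
  map_mul : ∀ i j n (h : i + j = n) x y, π n (A'.mul i j n h x y) = A.mul i j n h (π i x) (π j y)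
  map_one : π 0 A'.one = A.one
  surjective : ∀ n, Function.Surjective (π n)
  ker : ∀ n x, π n x = 0 ↔ ∃ y, x = (p : TruncatedWittVector p 2 R) • y

end CyclicPower

set_option linter.unusedSectionVars false

namespace CyclicPower

section contraction

noncomputable instance divisibleBy_finsupp_rat (S : Type u) : DivisibleBy (S →₀ ℚ) ℤ where
  div x n := (n : ℚ)⁻¹ • x
  div_zero x := by simp
  div_cancel {n} x hn := by
    rw [← Int.cast_smul_eq_zsmul ℚ, smul_smul, mul_inv_cancel₀ (by exact_mod_cast hn), one_smul]

/-- A surjection onto a subgroup of a projective abelian group splits. -/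
lemma exists_section_submodule {X Y : Type u} [AddCommGroup X] [AddCommGroup Y]
    [Module.Projective ℤ Y] (S : Submodule ℤ Y) (f : X →ₗ[ℤ] S) (hf : Function.Surjective f) :
    ∃ s : S →ₗ[ℤ] X, ∀ y, f (s y) = y := by
  let c : (S →₀ ℤ) →ₗ[ℤ] S := Finsupp.linearCombination ℤ id
  have hc : Function.Surjective c := fun y => ⟨Finsupp.single y 1, by simp [c]⟩
  let e : (S →₀ ℤ) →ₗ[ℤ] (S →₀ ℚ) := Finsupp.mapRange.linearMap (Algebra.linearMap ℤ ℚ)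
  have he : Function.Injective e :=
    Finsupp.mapRange_injective _ (by simp) (algebraMap ℤ ℚ).injective_int
  let K := (LinearMap.ker c).map e
  have : DivisibleBy ((S →₀ ℚ) ⧸ K) ℤ :=
    Function.Surjective.divisibleBy K.mkQ K.mkQ_surjective fun x n => map_zsmul K.mkQ n x
  have hker : LinearMap.ker c ≤ LinearMap.ker (K.mkQ ∘ₗ e) := fun x hx => by
    rw [LinearMap.mem_ker, LinearMap.comp_apply, Submodule.mkQ_apply, Submodule.Quotient.mk_eq_zero]
    exact ⟨x, hx, rfl⟩
  have hg : ∃ g : S →ₗ[ℤ] ((S →₀ ℚ) ⧸ K), ∀ x, g (c x) = K.mkQ (e x) := by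
    refine ⟨(LinearMap.ker c).liftQ (K.mkQ ∘ₗ e) hker ∘ₗ
      (c.quotKerEquivOfSurjective hc).symm.toLinearMap, fun x => ?_⟩
    have : (c.quotKerEquivOfSurjective hc).symm (c x) = (LinearMap.ker c).mkQ x := by
      rw [LinearEquiv.symm_apply_eq]; rfl
    simp [this]
  obtain ⟨g, hg⟩ := hg
  obtain ⟨G, hG⟩ := (Module.Baer.of_divisible ((S →₀ ℚ) ⧸ K)).extension_property
    S.subtype S.injective_subtype g
  obtain ⟨H, hH⟩ := Module.projective_lifting_property K.mkQ G K.mkQ_surjective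
  have hr : ∀ y : S, ∃ x, e x = H y ∧ c x = y := by
    intro y
    obtain ⟨x, rfl⟩ := hc y
    have h1 : K.mkQ (H (c x : S)) = K.mkQ (e x) := by
      rw [← hg, ← hG, ← hH]; rfl
    rw [Submodule.mkQ_apply, Submodule.mkQ_apply, Submodule.Quotient.eq] at h1
    obtain ⟨z, hz, hz'⟩ := h1
    refine ⟨x + z, by rw [map_add, hz']; abel, by rw [map_add, LinearMap.mem_ker.mp hz, add_zero]⟩
  choose r hr hr' using hr
  let t : S →ₗ[ℤ] (S →₀ ℤ) := AddMonoidHom.toIntLinearMap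
    (AddMonoidHom.mk' r fun x y => he (by rw [map_add, hr, hr, hr]; simp))
  obtain ⟨q, hq⟩ := Module.projective_lifting_property f c hf
  exact ⟨q ∘ₗ t, fun y => (LinearMap.congr_fun hq (r y)).trans (hr' y)⟩

/-- Exactness at the middle term of a sequence `X → Y → Z` of abelian groups with `Y` and `Z`
projective is witnessed by an additive map `Y → X`. -/
lemma exists_section_of_exact {X Y Z : Type u} [AddCommGroup X] [AddCommGroup Y] [AddCommGroup Z]
    [Module.Projective ℤ Y] [Module.Projective ℤ Z] (f : X →+ Y) (g : Y →+ Z)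
    (hgf : ∀ x, g (f x) = 0) (h : ∀ y, g y = 0 → ∃ x, f x = y) :
    ∃ s : Y →+ X, ∀ y, g y = 0 → f (s y) = y := by
  let g' := g.toIntLinearMap
  obtain ⟨t, ht⟩ := exists_section_submodule (LinearMap.range g') g'.rangeRestrict
    g'.surjective_rangeRestrict
  let f' : X →ₗ[ℤ] LinearMap.ker g' := f.toIntLinearMap.codRestrict _ hgf
  obtain ⟨q, hq⟩ := exists_section_submodule (LinearMap.ker g') f' fun y => by
    obtain ⟨x, hx⟩ := h y y.2
    exact ⟨x, Subtype.ext hx⟩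
  have hp : ∀ y, (LinearMap.id - t ∘ₗ g'.rangeRestrict : Y →ₗ[ℤ] Y) y ∈ LinearMap.ker g' := by
    intro y
    have := congrArg Subtype.val (ht (g'.rangeRestrict y))
    simp only [LinearMap.mem_ker, LinearMap.sub_apply, map_sub, LinearMap.id_apply,
      LinearMap.comp_apply]
    rw [sub_eq_zero]; exact this.symm
  refine ⟨(q ∘ₗ LinearMap.codRestrict _ _ hp).toAddMonoidHom, fun y hy => ?_⟩
  have h1 := congrArg Subtype.val (hq (LinearMap.codRestrict _ _ hp y))
  refine h1.trans ?_
  have : g'.rangeRestrict y = 0 := Subtype.ext hy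
  simp [this]

section trace

variable {G : Type} [Group G] {X : Type u} [AddCommGroup X] [iX : Module ℤ X]
  (ρ : Representation ℤ G X)

lemma projective_int_of_projective (h : Module.Projective (MonoidAlgebra ℤ G) ρ.asModule) :
    @Module.Projective ℤ _ X _ (AddCommGroup.toIntModule X) := by
  obtain ⟨s, hs⟩ := h.out
  have h1 : @Module.Projective ℤ _ (ρ.asModule →₀ MonoidAlgebra ℤ G) _
      (AddCommGroup.toIntModule _) := by
    have h2 : Module.Projective ℤ (ρ.asModule →₀ MonoidAlgebra ℤ G) := inferInstance
    convert h2
  obtain rfl : iX = AddCommGroup.toIntModule X := Subsingleton.elim _ _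
  let i : X →+ (ρ.asModule →₀ MonoidAlgebra ℤ G) :=
    AddMonoidHom.mk' (fun x => s (ρ.asModuleEquiv.symm x)) fun x y => by rw [map_add, map_add]
  let r : (ρ.asModule →₀ MonoidAlgebra ℤ G) →+ X :=
    AddMonoidHom.mk' (fun x => ρ.asModuleEquiv (Finsupp.linearCombination _ id x)) fun x y => by
      rw [map_add, map_add]
  exact @Module.Projective.of_split ℤ _ X _ (AddCommGroup.toIntModule X) _ _
    (AddCommGroup.toIntModule _) h1 i.toIntLinearMap r.toIntLinearMap
    (LinearMap.ext fun x => hs _)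

variable (G) in
/-- The coefficient of an element of the group ring, as an additive map. -/
noncomputable def groupRingCoeff (g : G) : MonoidAlgebra ℤ G →+ ℤ :=
  AddMonoidHom.mk' (fun a => a.coeff g) fun _ _ => rfl

omit [Group G] in
lemma groupRingCoeff_apply (g : G) (a : MonoidAlgebra ℤ G) : groupRingCoeff G g a = a.coeff g := rfl

/-- The trace form of projectivity over the group ring of a finite group. -/
lemma exists_trace_eq_one [Fintype G] (h : Module.Projective (MonoidAlgebra ℤ G) ρ.asModule) :
    ∃ π : X →+ X, ∀ x, ∑ g : G, ρ g (π (ρ g⁻¹ x)) = x := by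
  obtain ⟨s, hs⟩ := h.out
  let E := ρ.asModuleEquiv
  let c (g : G) : (ρ.asModule →₀ MonoidAlgebra ℤ G) →+ X :=
    Finsupp.liftAddHom fun y => (zmultiplesHom X (E y)).comp
      (groupRingCoeff G g)
  have hc : ∀ g x, ρ g (c 1 (MonoidAlgebra.single g⁻¹ (1 : ℤ) • x)) =
      Finsupp.liftAddHom (fun y => (zmultiplesHom X (ρ g (E y))).comp
      (groupRingCoeff G g)) x := by
    intro g x
    induction x using Finsupp.induction_linear with
    | zero => simp
    | add x y hx hy => rw [smul_add, map_add, map_add, hx, hy, map_add]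
    | single y a =>
      rw [Finsupp.smul_single]
      simp only [c, Finsupp.liftAddHom_apply_single, AddMonoidHom.comp_apply, groupRingCoeff_apply,
        zmultiplesHom_apply, smul_eq_mul, map_zsmul]
      congr 1
      rw [MonoidAlgebra.coeff_single_mul_eq_mul_coeff g fun m _ => by
        rw [inv_mul_eq_one, eq_comm], one_mul]
  refine ⟨(c 1).comp (s.toAddMonoidHom.comp E.symm.toAddMonoidHom), fun x => ?_⟩
  have h1 : ∀ g, ρ g (c 1 (s (E.symm (ρ g⁻¹ x)))) = Finsupp.liftAddHom (fun y =>
      (zmultiplesHom X (ρ g (E y))).comp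
      (groupRingCoeff G g)) (s (E.symm x)) := by
    intro g
    rw [← hc, ρ.asModuleEquiv_symm_map_rho, map_smul]; rfl
  refine (Finset.sum_congr rfl fun g _ => h1 g).trans ?_
  have h2 : ∀ z : ρ.asModule →₀ MonoidAlgebra ℤ G, ∑ g, Finsupp.liftAddHom (fun y =>
      (zmultiplesHom X (ρ g (E y))).comp
      (groupRingCoeff G g)) z =
      E (Finsupp.linearCombination _ id z) := by
    intro z
    induction z using Finsupp.induction_linear with
    | zero => simp
    | add x y hx hy => simp only [map_add, Finset.sum_add_distrib, hx, hy]
    | single y a =>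
      rw [Finsupp.linearCombination_single, id, ρ.asModuleEquiv_map_smul]
      simp only [Finsupp.liftAddHom_apply_single, AddMonoidHom.comp_apply, groupRingCoeff_apply,
        zmultiplesHom_apply]
      have ha : a = ∑ g, MonoidAlgebra.single g (a.coeff g) := by
        ext g; simp [MonoidAlgebra.coeff_sum]
      conv_rhs => rw [ha]
      simp [map_sum, Representation.asAlgebraHom_single, E]
      exact Finset.sum_congr rfl fun g _ => (int_smul_eq_zsmul _ _ _).symm
  rw [h2, hs]; exact E.apply_symm_apply x

end trace

end contraction

end CyclicPower

namespace CyclicPower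

/-- The iterates of an additive map. -/
def iter {Y : Type*} [AddCommGroup Y] (ς : Y →+ Y) (i : ℕ) : Y →+ Y :=
  ((show AddMonoid.End Y from ς) ^ i : AddMonoid.End Y)

section iter

variable {Y : Type*} [AddCommGroup Y] (ς : Y →+ Y)

lemma iter_succ (i : ℕ) (x : Y) : iter ς (i + 1) x = ς (iter ς i x) := by
  rw [iter, pow_succ']; rfl

lemma iter_add (i j : ℕ) (x : Y) : iter ς (i + j) x = iter ς i (iter ς j x) := by
  rw [iter, pow_add]; rfl

variable {ς}

lemma iter_of_fix {x : Y} (hx : ς x = x) (i : ℕ) : iter ς i x = x := by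
  induction i with
  | zero => rfl
  | succ i ih => rw [iter_succ, ih, hx]

lemma iter_mem {S : AddSubgroup Y} (h : ∀ z ∈ S, ς z ∈ S) (i : ℕ) {z : Y} (hz : z ∈ S) :
    iter ς i z ∈ S := by
  induction i with
  | zero => exact hz
  | succ i ih => rw [iter_succ]; exact h _ ih

lemma iter_cancel {p : ℕ} (hς : ∀ x, iter ς p x = x) {i : ℕ} (hi : i ∈ Finset.range p) (x : Y) :
    iter ς i (iter ς (p - i) x) = x := by
  rw [← iter_add, Nat.add_sub_cancel' (Finset.mem_range.mp hi).le, hς]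

end iter

namespace DGAlgebra

section totMap

variable {k : Type u} [CommRing k] (A : DGAlgebra.{u, v} k)

lemma tot_induction {P : A.Tot → Prop} (hι : ∀ i x, P (A.ι i x))
    (add : ∀ x y, P x → P y → P (x + y)) (x : A.Tot) : P x :=
  DirectSum.induction_on x (by simpa using hι 0 0) hι add

lemma tot_add_hom_ext {M : Type*} [AddMonoid M] {F G : A.Tot →+ M}
    (h : ∀ i x, F (A.ι i x) = G (A.ι i x)) : F = G :=
  DirectSum.addHom_ext h

/-- The additive map of degree `r` given by its components. -/
noncomputable def totMap (r : ℤ) (f : ∀ i, A.X i →+ A.X (i + r)) : A.Tot →+ A.Tot :=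
  DirectSum.toAddMonoid fun i => (A.ι (i + r)).toAddMonoidHom.comp (f i)

variable {A}

lemma totMap_ι {r : ℤ} (f : ∀ i, A.X i →+ A.X (i + r)) (i : ℤ) (x : A.X i) :
    A.totMap r f (A.ι i x) = A.ι (i + r) (f i x) :=
  DirectSum.toAddMonoid_of _ i x

lemma totMap_deg {r : ℤ} (f : ∀ i, A.X i →+ A.X (i + r)) (i : ℤ) {x : A.Tot} (hx : x ∈ A.deg i) :
    A.totMap r f x ∈ A.deg (i + r) := by
  obtain ⟨x, rfl⟩ := hx
  exact ⟨_, (totMap_ι f i x).symm⟩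

lemma superInt_s_deg {i : ℤ} {x : A.Tot} (hx : x ∈ A.deg i) :
    A.superInt.s x = i.negOnePow • x := by
  rw [A.superInt.s_of_par (par_of_deg_int hx), ← negOnePow_eq_koszul, Units.smul_def]

/-- An additive map of degree `r` commutes with the parity involution up to the sign of `r`. -/
lemma map_s_of_deg {r : ℤ} (f : A.Tot →+ A.Tot) (hf : ∀ i, ∀ x ∈ A.deg i, f x ∈ A.deg (i + r))
    (x : A.Tot) : f (A.superInt.s x) = r.negOnePow • A.superInt.s (f x) := by
  induction x using A.tot_induction with
  | hι i x =>
    have hx : A.ι i x ∈ A.deg i := ⟨x, rfl⟩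
    rw [superInt_s_deg hx, superInt_s_deg (hf i _ hx), Units.smul_def, map_zsmul, ← Units.smul_def,
      smul_smul, Int.negOnePow_add, _root_.mul_comm, _root_.mul_assoc, Int.units_mul_self,
      _root_.mul_one]
  | add x y hx hy => rw [map_add, map_add, map_add, map_add, smul_add, hx, hy]

lemma superInt_d_ι {i j : ℤ} (h : j + 1 = i) (x : A.X i) :
    A.superInt.d (A.ι i x) = A.ι j (A.d i j x) := A.totD_ι h x

lemma Hom.superInt_ι {B : DGAlgebra.{u, w} k} (φ : A.Hom B) (i : ℤ) (x : A.X i) :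
    φ.superInt.f (A.ι i x) = B.ι i (φ.f i x) :=
  DirectSum.lmap_lof φ.f i x

end totMap

end DGAlgebra

lemma sum_cyc {p : ℕ} [NeZero p] {M : Type*} [AddCommMonoid M] (F : Cyc p → M) :
    ∑ g, F g = ∑ i ∈ Finset.range p, F (.ofAdd 1 ^ i) := by
  refine (Finset.sum_nbij' (fun i => (Multiplicative.ofAdd (1 : ZMod p)) ^ i)
    (fun g => (Multiplicative.toAdd g).val) (by simp) (by simp [ZMod.val_lt]) ?_ ?_ (by simp)).symm
  · intro i hi
    rw [toAdd_pow, toAdd_ofAdd, nsmul_one, ZMod.val_cast_of_lt (Finset.mem_range.mp hi)]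
  · intro g _
    apply Multiplicative.toAdd.injective
    simp

lemma cyc_inv {p : ℕ} {i : ℕ} (hi : i ≤ p) :
    ((Multiplicative.ofAdd (1 : ZMod p)) ^ i)⁻¹ = Multiplicative.ofAdd (1 : ZMod p) ^ (p - i) := by
  rw [inv_eq_iff_mul_eq_one, ← pow_add, Nat.add_sub_cancel' hi]
  apply Multiplicative.toAdd.injective
  simp

namespace ResolutionData

variable {p : ℕ} (ν : ResolutionData.{u} p)

/-- The action of the generator on `P`. -/
noncomputable def σP : ν.P.Tot →+ ν.P.Tot := (ν.homP (.ofAdd 1)).superInt.f.toAddMonoidHom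

/-- The action of the generator on `I`. -/
noncomputable def σI : ν.I.Tot →+ ν.I.Tot := (ν.homI (.ofAdd 1)).superInt.f.toAddMonoidHom

lemma σP_ι (i : ℤ) (x : ν.P.X i) : ν.σP (ν.P.ι i x) = ν.P.ι i (ν.ρP i (.ofAdd 1) x) :=
  (ν.homP (.ofAdd 1)).superInt_ι i x

lemma σI_ι (i : ℤ) (x : ν.I.X i) : ν.σI (ν.I.ι i x) = ν.I.ι i (ν.ρI i (.ofAdd 1) x) :=
  (ν.homI (.ofAdd 1)).superInt_ι i x

lemma σP_iter_ι (n : ℕ) (i : ℤ) (x : ν.P.X i) :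
    iter ν.σP n (ν.P.ι i x) = ν.P.ι i (ν.ρP i (.ofAdd 1 ^ n) x) := by
  induction n with
  | zero => rw [pow_zero, map_one]; rfl
  | succ n ih => rw [iter_succ, ih, σP_ι, pow_succ', map_mul]; rfl

lemma σI_iter_ι (n : ℕ) (i : ℤ) (x : ν.I.X i) :
    iter ν.σI n (ν.I.ι i x) = ν.I.ι i (ν.ρI i (.ofAdd 1 ^ n) x) := by
  induction n with
  | zero => rw [pow_zero, map_one]; rfl
  | succ n ih => rw [iter_succ, ih, σI_ι, pow_succ', map_mul]; rfl

lemma cyc_pow_self : (Multiplicative.ofAdd (1 : ZMod p)) ^ p = 1 := by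
  apply Multiplicative.toAdd.injective
  simp

lemma σP_iter (x : ν.P.Tot) : iter ν.σP p x = x := by
  have : iter ν.σP p = .id _ := ν.P.tot_add_hom_ext fun i x => by
    rw [σP_iter_ι, cyc_pow_self, map_one]; rfl
  exact DFunLike.congr_fun this x

lemma σI_iter (x : ν.I.Tot) : iter ν.σI p x = x := by
  have : iter ν.σI p = .id _ := ν.I.tot_add_hom_ext fun i x => by
    rw [σI_iter_ι, cyc_pow_self, map_one]; rfl
  exact DFunLike.congr_fun this x

lemma σP_deg {i : ℤ} {x : ν.P.Tot} (hx : x ∈ ν.P.deg i) : ν.σP x ∈ ν.P.deg i := by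
  obtain ⟨x, rfl⟩ := hx; exact ⟨_, (ν.σP_ι i x).symm⟩

lemma σI_deg {i : ℤ} {x : ν.I.Tot} (hx : x ∈ ν.I.deg i) : ν.σI x ∈ ν.I.deg i := by
  obtain ⟨x, rfl⟩ := hx; exact ⟨_, (ν.σI_ι i x).symm⟩

section
variable [Fact p.Prime]

lemma P_projective_int (i : ℤ) : @Module.Projective ℤ _ (ν.P.X i) _ (AddCommGroup.toIntModule _) := by
  rcases lt_trichotomy i 0 with h | rfl | h
  · have := ν.P_bounded i h
    infer_instance
  · exact Module.Projective.of_equiv (LinearEquiv.ofBijective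
      (AddMonoidHom.toIntLinearMap (zmultiplesHom _ ν.P.one)) ν.P_zero)
  · exact projective_int_of_projective _ (ν.P_projective i h)

lemma I_projective_int (i : ℤ) : @Module.Projective ℤ _ (ν.I.X i) _ (AddCommGroup.toIntModule _) :=
  projective_int_of_projective _ (ν.I_projective i)

end

end ResolutionData

namespace DGAlgebra

/-- A complex of projective abelian groups is contractible wherever it is exact. -/
lemma exists_contraction (X : DGAlgebra.{0, u} ℤ)
    (hX : ∀ i, @Module.Projective ℤ _ (X.X i) _ (AddCommGroup.toIntModule _)) (S : ℤ → Prop)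
    (hS : ∀ i, S i → ∀ x : X.X i, X.d i (i - 1) x = 0 → ∃ y : X.X (i + 1), X.d (i + 1) i y = x) :
    ∃ H : X.Tot →+ X.Tot, (∀ i, ∀ x ∈ X.deg i, H x ∈ X.deg (i + 1)) ∧
      (∀ i, ∀ x ∈ X.deg i, ¬ S i → H x = 0) ∧
      (∀ i, ∀ x ∈ X.deg (i + 1), S (i + 1) → S i → X.superInt.d (H x) + H (X.superInt.d x) = x) ∧
      (∀ i, ∀ x ∈ X.deg (i + 1), S i → X.superInt.d (H (X.superInt.d x)) = X.superInt.d x) := by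
  classical
  have hs : ∀ i, S i → ∃ s : X.X i →+ X.X (i + 1), ∀ x, X.d i (i - 1) x = 0 →
      X.d (i + 1) i (s x) = x := fun i hi =>
    have := hX i
    have := hX (i - 1)
    exists_section_of_exact (X.d (i + 1) i).toAddMonoidHom (X.d i (i - 1)).toAddMonoidHom
      (fun x => X.d_d _ _ _ x) (hS i hi)
  let s (i : ℤ) : X.X i →+ X.X (i + 1) := if hi : S i then (hs i hi).choose else 0
  have hs1 : ∀ i, S i → ∀ x, X.d i (i - 1) x = 0 → X.d (i + 1) i (s i x) = x := fun i hi => by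
    simp only [s, dif_pos hi]; exact (hs i hi).choose_spec
  have hs0 : ∀ i, ¬ S i → s i = 0 := fun i hi => dif_neg hi
  let t (i j : ℤ) (h : j + 1 = i) : X.X j →+ X.X i := h ▸ s j
  let q (i : ℤ) : X.X i →+ X.X i :=
    AddMonoidHom.id _ - (t i (i - 1) (sub_add_cancel i 1)).comp (X.d i (i - 1)).toAddMonoidHom
  have hq : ∀ i x, q (i + 1) x = x - s i (X.d (i + 1) i x) := by
    intro i x
    have : ∀ j (h : j + 1 = i + 1) (y : X.X (i + 1)),
        t (i + 1) j h (X.d (i + 1) j y) = s i (X.d (i + 1) i y) := by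
      intro j h y
      obtain rfl : j = i := by omega
      rfl
    exact congrArg (x - ·) (this _ _ x)
  have hqz : ∀ i x, X.d i (i - 1) x = 0 → q i x = x := by
    intro i x hx
    change x - t i (i - 1) _ (X.d i (i - 1) x) = x
    rw [hx, map_zero, sub_zero]
  have hd : ∀ i x, X.superInt.d (X.ι (i + 1) x) = X.ι i (X.d (i + 1) i x) :=
    fun i x => superInt_d_ι rfl x
  have hH : ∀ i x, X.totMap 1 (fun i => (s i).comp (q i)) (X.ι i x) = X.ι (i + 1) (s i (q i x)) :=
    fun i x => totMap_ι _ i x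
  refine ⟨X.totMap 1 fun i => (s i).comp (q i), fun i x hx => totMap_deg _ i hx, ?_, ?_, ?_⟩
  · rintro i _ ⟨x, rfl⟩ hi
    rw [hH, hs0 i hi, AddMonoidHom.zero_apply, map_zero]
  · rintro i _ ⟨x, rfl⟩ hi hi'
    have e : X.d (i + 1) (i + 1 - 1) (q (i + 1) x) = 0 := by
      rw [hq, map_sub, add_sub_cancel_right, hs1 i hi' _ (X.d_d _ _ _ _), sub_self]
    rw [hH, hd, hs1 _ hi _ e, hd, hH, ← map_add, hqz i _ (X.d_d _ _ _ _), hq, sub_add_cancel]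
  · rintro i _ ⟨x, rfl⟩ hi
    rw [hd, hH, hd, hqz i _ (X.d_d _ _ _ _), hs1 _ hi _ (X.d_d _ _ _ _)]

/-- The additive map of degree `0` whose components realize the identity as a trace. -/
lemma exists_trace_map {p : ℕ} [NeZero p] (X : DGAlgebra.{0, u} ℤ)
    (ρ : ∀ i, Representation ℤ (Cyc p) (X.X i)) (S : ℤ → Prop) (σ : X.Tot →+ X.Tot)
    (hσ : ∀ (n : ℕ) i x, iter σ n (X.ι i x) = X.ι i (ρ i (.ofAdd 1 ^ n) x))
    (hS : ∀ i, S i → Module.Projective (MonoidAlgebra ℤ (Cyc p)) (ρ i).asModule) :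
    ∃ π : X.Tot →+ X.Tot, (∀ i, ∀ x ∈ X.deg i, π x ∈ X.deg i) ∧
      (∀ i, ∀ x ∈ X.deg i, ¬ S i → π x = 0) ∧
      (∀ i, ∀ x ∈ X.deg i, S i →
        ∑ i ∈ Finset.range p, iter σ i (π (iter σ (p - i) x)) = x) := by
  classical
  let π (i : ℤ) : X.X i →+ X.X i := if hi : S i then (exists_trace_eq_one (ρ i) (hS i hi)).choose else 0
  have hπ : ∀ i x, DirectSum.map π (X.ι i x) = X.ι i (π i x) := fun i x => DirectSum.map_of _ _ _
  refine ⟨DirectSum.map π, ?_, ?_, ?_⟩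
  · rintro i _ ⟨x, rfl⟩
    exact ⟨_, (hπ i x).symm⟩
  · rintro i _ ⟨x, rfl⟩ hi
    rw [hπ, show π i = 0 from dif_neg hi, AddMonoidHom.zero_apply, map_zero]
  · rintro i _ ⟨x, rfl⟩ hi
    have h1 : ∑ g : Cyc p, ρ i g (π i (ρ i g⁻¹ x)) = x := by
      simp only [π, dif_pos hi]
      exact (exists_trace_eq_one (ρ i) (hS i hi)).choose_spec x
    rw [sum_cyc] at h1
    conv_rhs => rw [← h1, map_sum]
    refine Finset.sum_congr rfl fun n hn => ?_
    rw [hσ, hπ, hσ, cyc_inv (Finset.mem_range.mp hn).le]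

end DGAlgebra

namespace ResolutionData

variable {p : ℕ}

/-- Contractions of `P` and `I`, and maps whose traces are the identity. -/
structure Ops (ν : ResolutionData.{u} p) where
  hP : ν.P.Tot →+ ν.P.Tot
  πP : ν.P.Tot →+ ν.P.Tot
  hI : ν.I.Tot →+ ν.I.Tot
  πI : ν.I.Tot →+ ν.I.Tot
  ε : ν.I.Tot →+ ℤ
  hP_deg : ∀ i, ∀ x ∈ ν.P.deg i, hP x ∈ ν.P.deg (i + 1)
  πP_deg : ∀ i, ∀ x ∈ ν.P.deg i, πP x ∈ ν.P.deg i
  hI_deg : ∀ i, ∀ x ∈ ν.I.deg i, hI x ∈ ν.I.deg (i + 1)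
  πI_deg : ∀ i, ∀ x ∈ ν.I.deg i, πI x ∈ ν.I.deg i
  d_hP : ∀ x, ν.P.superInt.d (hP x) + hP (ν.P.superInt.d x) = x
  tr_πP : ∀ i, ∀ x ∈ ν.P.deg i, i ≠ 0 →
    ∑ i ∈ Finset.range p, iter ν.σP i (πP (iter ν.σP (p - i) x)) = x
  πP_zero : ∀ x ∈ ν.P.deg 0, πP x = 0
  d_hI : ∀ x, ν.I.superInt.d (hI x) + hI (ν.I.superInt.d x) = x - ε x • ν.I.superInt.one
  tr_πI : ∀ x, ∑ i ∈ Finset.range p, iter ν.σI i (πI (iter ν.σI (p - i) x)) = x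
  ε_deg : ∀ i, ∀ x ∈ ν.I.deg i, i ≠ 0 → ε x = 0
  ε_one : ε ν.I.superInt.one = 1
  εP : ν.P.Tot →+ ℤ
  εP_one : εP ν.P.superInt.one = 1
  εP_smul : ∀ x ∈ ν.P.deg 0, εP x • ν.P.superInt.one = x

lemma exists_ops [Fact p.Prime] (ν : ResolutionData.{u} p) : Nonempty ν.Ops := by
  have := NeZero.mk (Fact.out : p.Prime).ne_zero
  obtain ⟨hP, hP1, -, hP2, -⟩ := ν.P.exists_contraction ν.P_projective_int (fun _ => True)
    fun i _ => ν.P_acyclic i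
  obtain ⟨hI, hI1, hI0, hI2, hI3⟩ := ν.I.exists_contraction ν.I_projective_int (fun i => i ≠ 0)
    fun i hi x hx => by
      rcases lt_or_gt_of_ne hi with h | h
      · exact ν.I_exact i x h hx
      · have := ν.I_bounded i h
        exact ⟨0, Subsingleton.elim _ _⟩
  obtain ⟨πP, πP1, πP2, πP3⟩ := ν.P.exists_trace_map ν.ρP (fun i => i ≠ 0) ν.σP ν.σP_iter_ι
    fun i hi => by
      rcases lt_or_gt_of_ne hi with h | h
      · have := ν.P_bounded i h
        have : Subsingleton (ν.ρP i).asModule := this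
        infer_instance
      · exact ν.P_projective i h
  obtain ⟨πI, πI1, -, πI3⟩ := ν.I.exists_trace_map ν.ρI (fun _ => True) ν.σI ν.σI_iter_ι
    fun i _ => ν.I_projective i
  have hε : ∀ x : ν.I.X 0, ∃ m : ℤ, m • ν.I.superInt.one =
      ν.I.ι 0 x - hI (ν.I.superInt.d (ν.I.ι 0 x)) := by
    intro x
    have hm : ν.I.ι 0 x ∈ ν.I.deg (-1 + 1) := ⟨x, rfl⟩
    have h1 := hI3 (-1) _ hm (by decide)
    have h2 : hI (ν.I.superInt.d (ν.I.ι 0 x)) ∈ ν.I.deg 0 := by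
      have := hI1 (-1) _ (DGAlgebra.d_deg_int (by decide) (⟨x, rfl⟩ : ν.I.ι 0 x ∈ ν.I.deg 0))
      rwa [show (-1 : ℤ) + 1 = 0 from rfl] at this
    obtain ⟨y, hy⟩ := h2
    rw [← hy] at h1 ⊢
    have h3 : ν.I.d 0 (-1) (x - y) = 0 := by
      rw [DGAlgebra.superInt_d_ι (by decide : (-1 : ℤ) + 1 = 0),
        DGAlgebra.superInt_d_ι (by decide : (-1 : ℤ) + 1 = 0)] at h1
      rw [map_sub, DirectSum.of_injective (β := ν.I.X) (-1) h1, sub_self]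
    obtain ⟨m, hm⟩ := ν.I_exact_zero _ h3
    refine ⟨m, ?_⟩
    rw [← map_sub, ← hm]
    refine (map_zsmul (ν.I.ι 0) m ν.I.one).symm.trans ?_
    exact congrArg (ν.I.ι 0) (int_smul_eq_zsmul _ _ _).symm
  have hinj : Function.Injective fun m : ℤ => m • ν.I.superInt.one := by
    intro m n h
    have e := fun m : ℤ => map_zsmul (ν.I.ι 0) m ν.I.one
    exact ν.I_unit (DirectSum.of_injective (β := ν.I.X) 0 ((e m).trans (h.trans (e n).symm)))
  choose e he using hε
  let e' : ν.I.X 0 →+ ℤ := AddMonoidHom.mk' e fun x y => hinj <| by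
    change e (x + y) • _ = (e x + e y) • _
    rw [he, add_smul, he, he, map_add, map_add, map_add]; abel
  let ε : ν.I.Tot →+ ℤ := DirectSum.toAddMonoid fun i => if h : i = 0 then h ▸ e' else 0
  have hε0 : ∀ x, ε (ν.I.ι 0 x) = e x := fun x => by
    refine (DirectSum.toAddMonoid_of _ 0 x).trans ?_
    rw [dif_pos rfl]; rfl
  have hεi : ∀ i, ∀ x ∈ ν.I.deg i, i ≠ 0 → ε x = 0 := by
    rintro i _ ⟨x, rfl⟩ hi
    refine (DirectSum.toAddMonoid_of _ i x).trans ?_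
    rw [dif_neg hi]; rfl
  let f := AddEquiv.ofBijective (zmultiplesHom (ν.P.X 0) ν.P.one) ν.P_zero
  let εP : ν.P.Tot →+ ℤ := DirectSum.toAddMonoid fun i =>
    if h : i = 0 then h ▸ f.symm.toAddMonoidHom else 0
  have hεP : ∀ x, εP (ν.P.ι 0 x) = f.symm x := fun x => by
    refine (DirectSum.toAddMonoid_of _ 0 x).trans ?_
    rw [dif_pos rfl]; rfl
  refine ⟨hP, πP, hI, πI, ε, hP1, πP1, hI1, πI1, fun x => ?_, πP3, fun x hx => πP2 0 x hx (by simp),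
    fun x => ?_, fun x => ?_, hεi, hinj ?_, εP, ?_, ?_⟩
  · induction x using DGAlgebra.tot_induction with
    | hι i x =>
      obtain ⟨j, rfl⟩ : ∃ j, j + 1 = i := ⟨i - 1, by omega⟩
      exact hP2 j _ ⟨x, rfl⟩ trivial trivial
    | add x y hx hy => conv_rhs => rw [← hx, ← hy]
                       simp only [map_add]; abel
  · induction x using DGAlgebra.tot_induction with
    | hι i x =>
      have hm : ν.I.ι i x ∈ ν.I.deg i := ⟨x, rfl⟩
      by_cases hi : i = 0
      · subst hi
        rw [hI0 0 _ hm (by simp), map_zero, zero_add, hε0, he, sub_sub_cancel]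
      · rw [hεi i _ hm hi, zero_smul, sub_zero]
        by_cases hi' : i = 1
        · subst hi'
          have := ν.I_bounded 1 one_pos
          rw [Subsingleton.elim x 0]; simp
        · obtain ⟨j, rfl⟩ : ∃ j, j + 1 = i := ⟨i - 1, by omega⟩
          exact hI2 j _ hm hi (by omega)
    | add x y hx hy =>
      rw [map_add, map_add, map_add, map_add, map_add, add_smul, add_sub_add_comm, ← hx, ← hy]; abel
  · induction x using DGAlgebra.tot_induction with
    | hι i x => exact πI3 i _ ⟨x, rfl⟩ trivial
    | add x y hx hy => conv_rhs => rw [← hx, ← hy]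
                       simp only [map_add, Finset.sum_add_distrib]
  · change ε (ν.I.ι 0 ν.I.one) • _ = (1 : ℤ) • _
    rw [hε0, he, one_smul]
    have : ν.I.superInt.d ν.I.superInt.one = 0 := by
      have h := ν.I.superInt.leibniz 0 ν.I.superInt.one ν.I.superInt.one ν.I.superInt.par_one
      rw [ν.I.superInt.one_mul, ν.I.superInt.one_mul, ν.I.superInt.mul_one, koszul_zero, one_smul,
        left_eq_add] at h
      exact h
    change ν.I.superInt.one - hI (ν.I.superInt.d ν.I.superInt.one) = _
    rw [this, map_zero, sub_zero]
  · refine (hεP ν.P.one).trans (f.symm_apply_eq.mpr (one_zsmul _).symm)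
  · rintro _ ⟨x, rfl⟩
    rw [hεP]
    refine (map_zsmul (ν.P.ι 0) _ ν.P.one).symm.trans (congrArg (ν.P.ι 0) ?_)
    exact f.apply_symm_apply x

end ResolutionData

end CyclicPower

namespace CyclicPower

section TateOps

/-- A complex of abelian groups with a contraction `h`, a pair of commuting endomorphisms `α`, `β`
with zero products, and maps `r`, `s` that show that `Ker α = Im β` and `Ker β = Im α`. -/
structure TateOps (Y : Type u) [AddCommGroup Y] where
  deg : ℤ → AddSubgroup Y
  d : Y →+ Y
  h : Y →+ Y
  α : Y →+ Y
  β : Y →+ Y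
  r : Y →+ Y
  s : Y →+ Y
  d_deg : ∀ i j, j + 1 = i → ∀ x ∈ deg i, d x ∈ deg j
  h_deg : ∀ i j, i + 1 = j → ∀ x ∈ deg i, h x ∈ deg j
  α_deg : ∀ i, ∀ x ∈ deg i, α x ∈ deg i
  β_deg : ∀ i, ∀ x ∈ deg i, β x ∈ deg i
  r_deg : ∀ i, ∀ x ∈ deg i, r x ∈ deg i
  s_deg : ∀ i, ∀ x ∈ deg i, s x ∈ deg i
  d_d : ∀ x, d (d x) = 0
  d_h : ∀ x, d (h x) + h (d x) = x
  d_α : ∀ x, d (α x) = α (d x)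
  d_β : ∀ x, d (β x) = β (d x)
  α_β : ∀ x, α (β x) = 0
  β_α : ∀ x, β (α x) = 0
  β_r : ∀ x, α x = 0 → β (r x) = x
  α_s : ∀ x, β x = 0 → α (s x) = x

namespace TateOps

variable {Y : Type u} [AddCommGroup Y] (T : TateOps Y) {M : Type v} [AddCommGroup M]

/-- The exchange of `α` and `β`. -/
def swap : TateOps Y where
  deg := T.deg
  d := T.d
  h := T.h
  α := T.β
  β := T.α
  r := T.s
  s := T.r
  d_deg := T.d_deg
  h_deg := T.h_deg
  α_deg := T.β_deg
  β_deg := T.α_deg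
  r_deg := T.s_deg
  s_deg := T.r_deg
  d_d := T.d_d
  d_h := T.d_h
  d_α := T.d_β
  d_β := T.d_α
  α_β := T.β_α
  β_α := T.α_β
  β_r := T.α_s
  α_s := T.β_r

lemma d_h_of_cycle {x : Y} (hx : T.d x = 0) : T.d (T.h x) = x := by
  have := T.d_h x
  rwa [hx, map_zero, add_zero] at this

/-- The Tate cohomology of the group of cycles of degree `k` is `M / p` and the `p`-torsion of `M`,
by the maps `C` and `C'`. -/
structure Gen (p : ℕ) (k : ℤ) (C C' : M →+ Y) : Prop where
  deg : ∀ m, C m ∈ T.deg k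
  d_C : ∀ m, T.d (C m) = 0
  α_C : ∀ m, T.α (C m) = 0
  deg' : ∀ m, p • m = 0 → C' m ∈ T.deg k
  d_C' : ∀ m, p • m = 0 → T.d (C' m) = 0
  β_C' : ∀ m, p • m = 0 → T.β (C' m) = 0
  gen : ∀ z ∈ T.deg k, T.d z = 0 → T.α z = 0 → ∃ m, ∃ w ∈ T.deg k, T.d w = 0 ∧ z = C m + T.β w
  rel : ∀ m, ∀ w ∈ T.deg k, T.d w = 0 → C m = T.β w → ∃ m', m = p • m'
  gen' : ∀ w ∈ T.deg k, T.d w = 0 → T.β w = 0 →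
    ∃ m, p • m = 0 ∧ ∃ v ∈ T.deg k, T.d v = 0 ∧ w = C' m + T.α v

variable {T} {p : ℕ} {k : ℤ} {C C' C'' : M →+ Y}

lemma Gen.up {l : ℤ} (hl : k + 1 = l) (H : T.Gen p k C C') :
    T.swap.Gen p l (T.α.comp (T.h.comp C)) (T.β.comp (T.h.comp C')) where
  deg m := T.α_deg _ _ (T.h_deg _ _ hl _ (H.deg m))
  d_C m := by
    change T.d (T.α (T.h (C m))) = 0
    rw [T.d_α, T.d_h_of_cycle (H.d_C m), H.α_C]
  α_C m := T.β_α _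
  deg' m hm := T.β_deg _ _ (T.h_deg _ _ hl _ (H.deg' m hm))
  d_C' m hm := by
    change T.d (T.β (T.h (C' m))) = 0
    rw [T.d_β, T.d_h_of_cycle (H.d_C' m hm), H.β_C' m hm]
  β_C' m _ := T.α_β _
  gen z hz hdz hβ := by
    change T.β z = 0 at hβ
    change T.d z = 0 at hdz
    have e1 : T.α (T.s z) = z := T.α_s z hβ
    have h1 := T.s_deg _ _ hz
    obtain ⟨m, w, hw, hdw, e2⟩ := H.gen (T.d (T.s z)) (T.d_deg _ _ hl _ h1) (T.d_d _) (by
      rw [← T.d_α, e1, hdz])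
    refine ⟨m, T.s z - T.h (C m) - T.β (T.h w), sub_mem (sub_mem h1 (T.h_deg _ _ hl _ (H.deg m)))
      (T.β_deg _ _ (T.h_deg _ _ hl _ hw)), ?_, ?_⟩
    · change T.d _ = 0
      rw [map_sub, map_sub, T.d_β, T.d_h_of_cycle (H.d_C m), T.d_h_of_cycle hdw, e2]; abel
    · change z = T.α (T.h (C m)) + T.α _
      rw [map_sub, map_sub, T.α_β, e1]; abel
  rel m w hw hdw h := by
    change T.α (T.h (C m)) = T.α w at h
    change T.d w = 0 at hdw
    have e1 : T.β (T.r (T.h (C m) - w)) = T.h (C m) - w := T.β_r _ (by rw [map_sub, h, sub_self])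
    refine H.rel m (T.d (T.r (T.h (C m) - w))) (T.d_deg _ _ hl _ (T.r_deg _ _ (sub_mem
      (T.h_deg _ _ hl _ (H.deg m)) hw))) (T.d_d _) ?_
    rw [← T.d_β, e1, map_sub, T.d_h_of_cycle (H.d_C m), hdw, sub_zero]
  gen' w hw hdw hα := by
    change T.α w = 0 at hα
    change T.d w = 0 at hdw
    have e1 : T.β (T.r w) = w := T.β_r w hα
    have h1 := T.r_deg _ _ hw
    obtain ⟨m, hm, v, hv, hdv, e2⟩ := H.gen' (T.d (T.r w)) (T.d_deg _ _ hl _ h1) (T.d_d _) (by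
      rw [← T.d_β, e1, hdw])
    refine ⟨m, hm, T.r w - T.h (C' m) - T.α (T.h v), sub_mem (sub_mem h1
      (T.h_deg _ _ hl _ (H.deg' m hm))) (T.α_deg _ _ (T.h_deg _ _ hl _ hv)), ?_, ?_⟩
    · change T.d _ = 0
      rw [map_sub, map_sub, T.d_α, T.d_h_of_cycle (H.d_C' m hm), T.d_h_of_cycle hdv, e2]; abel
    · change w = T.β (T.h (C' m)) + T.β _
      rw [map_sub, map_sub, T.β_α, e1]; abel

lemma Gen.down {l : ℤ} (hl : l + 1 = k) (H : T.Gen p k C C') :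
    T.swap.Gen p l (T.d.comp (T.r.comp C)) (T.d.comp (T.s.comp C')) where
  deg m := T.d_deg _ _ hl _ (T.r_deg _ _ (H.deg m))
  d_C m := T.d_d _
  α_C m := by
    change T.β (T.d (T.r (C m))) = 0
    rw [← T.d_β, T.β_r _ (H.α_C m), H.d_C]
  deg' m hm := T.d_deg _ _ hl _ (T.s_deg _ _ (H.deg' m hm))
  d_C' m _ := T.d_d _
  β_C' m hm := by
    change T.α (T.d (T.s (C' m))) = 0
    rw [← T.d_α, T.α_s _ (H.β_C' m hm), H.d_C' m hm]
  gen z hz hdz hβ := by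
    change T.β z = 0 at hβ
    change T.d z = 0 at hdz
    have h1 := T.h_deg _ _ hl _ hz
    obtain ⟨m, w, hw, hdw, e2⟩ := H.gen (T.β (T.h z)) (T.β_deg _ _ h1) (by
      rw [T.d_β, T.d_h_of_cycle hdz, hβ]) (T.α_β _)
    have e3 : T.α (T.s (T.h z - T.r (C m) - w)) = T.h z - T.r (C m) - w := T.α_s _ (by
      rw [map_sub, map_sub, e2, T.β_r _ (H.α_C m)]; abel)
    refine ⟨m, T.d (T.s (T.h z - T.r (C m) - w)), T.d_deg _ _ hl _ (T.s_deg _ _ (sub_mem (sub_mem h1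
      (T.r_deg _ _ (H.deg m))) hw)), T.d_d _, ?_⟩
    change z = T.d (T.r (C m)) + T.α _
    rw [← T.d_α, e3, map_sub, map_sub, T.d_h_of_cycle hdz, hdw]; abel
  rel m w hw hdw h := by
    change T.d (T.r (C m)) = T.α w at h
    change T.d w = 0 at hdw
    refine H.rel m (T.r (C m) - T.α (T.h w)) (sub_mem (T.r_deg _ _ (H.deg m))
      (T.α_deg _ _ (T.h_deg _ _ hl _ hw))) ?_ ?_
    · rw [map_sub, T.d_α, T.d_h_of_cycle hdw, h, sub_self]
    · rw [map_sub, T.β_α, T.β_r _ (H.α_C m), sub_zero]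
  gen' w hw hdw hα := by
    change T.α w = 0 at hα
    change T.d w = 0 at hdw
    have h1 := T.h_deg _ _ hl _ hw
    obtain ⟨m, hm, v, hv, hdv, e2⟩ := H.gen' (T.α (T.h w)) (T.α_deg _ _ h1) (by
      rw [T.d_α, T.d_h_of_cycle hdw, hα]) (T.β_α _)
    have e3 : T.β (T.r (T.h w - T.s (C' m) - v)) = T.h w - T.s (C' m) - v := T.β_r _ (by
      rw [map_sub, map_sub, e2, T.α_s _ (H.β_C' m hm)]; abel)
    refine ⟨m, hm, T.d (T.r (T.h w - T.s (C' m) - v)), T.d_deg _ _ hl _ (T.r_deg _ _ (sub_mem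
      (sub_mem h1 (T.s_deg _ _ (H.deg' m hm))) hv)), T.d_d _, ?_⟩
    change w = T.d (T.s (C' m)) + T.β _
    rw [← T.d_β, e3, map_sub, map_sub, T.d_h_of_cycle hdw, hdv]; abel

lemma Gen.congr (H : T.Gen p k C C') (e : M →+ M) (h1 : ∀ m, p • m = 0 → T.β (C'' m) = 0)
    (h2 : ∀ m, p • m = 0 → C'' m ∈ T.deg k) (h3 : ∀ m, p • m = 0 → T.d (C'' m) = 0)
    (h : ∀ m, p • m = 0 → ∃ v ∈ T.deg k, T.d v = 0 ∧ C' m = C'' (e m) + T.α v) :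
    T.Gen p k C C'' where
  deg := H.deg
  d_C := H.d_C
  α_C := H.α_C
  deg' := h2
  d_C' := h3
  β_C' := h1
  gen := H.gen
  rel := H.rel
  gen' w hw hdw hβ := by
    obtain ⟨m, hm, v, hv, hdv, e1⟩ := H.gen' w hw hdw hβ
    obtain ⟨v', hv', hdv', e2⟩ := h m hm
    exact ⟨e m, by rw [← map_nsmul, hm, map_zero], v' + v, add_mem hv' hv, by
      rw [map_add, hdv, hdv', add_zero], by rw [e1, e2, map_add]; abel⟩

section

variable (f : Y →+ Y) (hf : ∀ x, p • x - T.β x = T.α (f x)) (hf' : ∀ x, T.α (f x) = f (T.α x))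
  (hfd : ∀ x, T.d (f x) = f (T.d x)) (hfk : ∀ i, ∀ x ∈ T.deg i, f x ∈ T.deg i)

include hf

lemma p_smul_eq (x : Y) : p • x = T.β x + T.α (f x) := by
  rw [← hf]; abel

include hf' hfd hfk

/-- Two steps up. -/
lemma Gen.up_up {l : ℤ} (hl : k + 2 = l) (H : T.Gen p k C C) :
    T.Gen p l (T.β.comp (T.h.comp (T.α.comp (T.h.comp C))))
      (T.β.comp (T.h.comp (T.α.comp (T.h.comp C)))) := by
  have H2 : T.Gen p l (T.β.comp (T.h.comp (T.α.comp (T.h.comp C))))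
      (T.α.comp (T.h.comp (T.β.comp (T.h.comp C)))) := (H.up rfl).up (by omega)
  have hα : ∀ m, p • m = 0 → T.β (T.β (T.h (T.α (T.h (C m))))) = 0 := fun m hm => by
    have := hf (T.β (T.h (T.α (T.h (C m)))))
    rw [hf', T.α_β, map_zero, sub_eq_zero] at this
    rw [← this, ← map_nsmul T.β, ← map_nsmul T.h, ← map_nsmul T.α, ← map_nsmul T.h, ← map_nsmul C, hm]
    simp
  refine H2.congr (AddMonoidHom.id M) hα (fun m _ => H2.deg m) (fun m _ => H2.d_C m) fun m hm => ?_
  have e1 : T.d (T.h (T.α (T.h (C m)))) = T.α (T.h (C m)) :=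
    T.d_h_of_cycle (by rw [T.d_α, T.d_h_of_cycle (H.d_C m), H.α_C])
  have hpT : p • T.h (C m) = 0 := by rw [← map_nsmul, ← map_nsmul, hm]; simp
  have hpX : p • T.h (T.α (T.h (C m))) = 0 := by
    rw [← map_nsmul, ← map_nsmul, hpT]; simp
  have e2 : T.β (T.h (C m)) = - T.d (f (T.h (T.α (T.h (C m))))) := by
    have := hf (T.h (C m))
    rw [hpT, zero_sub, hf', ← e1, ← hfd, neg_eq_iff_eq_neg] at this
    exact this
  have hX : T.h (T.α (T.h (C m))) ∈ T.deg l :=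
    T.h_deg (k + 1) _ (by omega) _ (T.α_deg _ _ (T.h_deg _ _ rfl _ (H.deg m)))
  refine ⟨T.d (T.h (f (T.h (T.α (T.h (C m)))))), T.d_deg _ _ rfl _ (T.h_deg _ _ rfl _ (hfk _ _ hX)),
    T.d_d _, ?_⟩
  change T.α (T.h (T.β (T.h (C m)))) = T.β (T.h (T.α (T.h (C m)))) + _
  have e3 := hf (T.h (T.α (T.h (C m))))
  rw [hpX, zero_sub] at e3
  have e4 := T.d_h (f (T.h (T.α (T.h (C m)))))
  rw [e2, map_neg, map_neg, neg_eq_iff_eq_neg.mp e3, eq_sub_of_add_eq' e4, map_sub]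
  abel

/-- Two steps down. -/
lemma Gen.down_down {l : ℤ} (hl : l + 2 = k) (H : T.Gen p k C C) :
    T.Gen p l (T.d.comp (T.s.comp (T.d.comp (T.r.comp C))))
      (T.d.comp (T.s.comp (T.d.comp (T.r.comp C)))) := by
  have H1 : T.swap.Gen p (k - 1) (T.d.comp (T.r.comp C)) (T.d.comp (T.s.comp C)) :=
    H.down (by omega)
  have H2 : T.Gen p l (T.d.comp (T.s.comp (T.d.comp (T.r.comp C))))
      (T.d.comp (T.r.comp (T.d.comp (T.s.comp C)))) := H1.down (by omega)
  have hp : ∀ m, p • m = 0 → ∀ g : Y →+ Y, p • g (C m) = 0 := fun m hm g => by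
    rw [← map_nsmul, ← map_nsmul, hm]; simp
  refine H2.congr (AddMonoidHom.id M) ?_ (fun m _ => H2.deg m) (fun m _ => H2.d_C m) fun m hm => ?_
  · intro m hm
    have e1 := p_smul_eq f hf (T.d (T.s (T.d (T.r (C m)))))
    have e2 := hp m hm (T.d.comp (T.s.comp (T.d.comp T.r)))
    have e3 := H2.α_C m
    change T.α (T.d (T.s (T.d (T.r (C m))))) = 0 at e3
    rw [hf', e3, map_zero, add_zero] at e1
    exact e1.symm.trans e2
  have hβC : T.β (C m) = 0 := H.β_C' m hm
  have e1 : T.β (T.r (C m)) = C m := T.β_r _ (H.α_C m)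
  have e2 : T.α (T.s (C m)) = C m := T.α_s _ hβC
  have e3 : T.α (f (T.r (C m))) = - C m := by
    rw [← hf, hp m hm T.r, e1, zero_sub]
  have e4 : T.β (T.r (T.s (C m) + f (T.r (C m)))) = T.s (C m) + f (T.r (C m)) :=
    T.β_r _ (by rw [map_add, e2, e3, add_neg_cancel])
  set b := T.r (T.s (C m) + f (T.r (C m))) with hb
  set y := T.s (T.d (T.r (C m))) with hy
  have e5 : T.α y = T.d (T.r (C m)) := T.α_s _ (by rw [← T.d_β, e1, H.d_C])
  set x' := T.r (T.d (T.s (C m))) with hx'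
  have e6 : T.β x' = T.d (T.s (C m)) := T.β_r _ (by rw [← T.d_α, e2, H.d_C])
  have e7 : T.β y = - T.α (f y) := by
    rw [← hf, hp m hm (T.s.comp (T.d.comp T.r)) |> (fun h => (h : p • y = 0)), zero_sub, neg_neg]
  have e8 : T.α (T.s (x' - y - T.d b)) = x' - y - T.d b := T.α_s _ (by
    rw [map_sub, map_sub, ← T.d_β, e4, e6, e7, hf', e5, map_add, hfd]; abel)
  have mC := H.deg m
  have mb : b ∈ T.deg k := T.r_deg _ _ (add_mem (T.s_deg _ _ mC) (hfk _ _ (T.r_deg _ _ mC)))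
  have my : y ∈ T.deg (k - 1) := T.s_deg _ _ (T.d_deg _ _ (by omega) _ (T.r_deg _ _ mC))
  have mx : x' ∈ T.deg (k - 1) := T.r_deg _ _ (T.d_deg _ _ (by omega) _ (T.s_deg _ _ mC))
  refine ⟨T.d (T.s (x' - y - T.d b)), T.d_deg _ _ (by omega) _ (T.s_deg _ _ (sub_mem (sub_mem mx my)
    (T.d_deg _ _ (by omega) _ mb))), T.d_d _, ?_⟩
  change T.d x' = T.d y + _
  rw [← T.d_α, e8, map_sub, map_sub, T.d_d]; abel

end

section

variable (h2 : ∀ x, T.α x + T.β x = 2 • x)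

include h2

/-- A single step up for `p = 2`. -/
lemma Gen.up_two {l : ℤ} (hl : k + 1 = l) (H : T.Gen 2 k C C) :
    T.swap.Gen 2 l (T.α.comp (T.h.comp C)) (T.α.comp (T.h.comp C)) := by
  have h0 : ∀ m : M, 2 • m = 0 → 2 • T.h (C m) = 0 := fun m hm => by
    rw [← map_nsmul, ← map_nsmul, hm]; simp
  have e : ∀ m : M, 2 • m = 0 → T.β (T.h (C m)) = - T.α (T.h (C m)) := fun m hm =>
    (neg_eq_of_add_eq_zero_right ((h2 _).trans (h0 m hm))).symm
  refine (H.up hl).congr (-AddMonoidHom.id M) (fun m hm => ?_) (fun m _ => (H.up hl).deg m)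
    (fun m _ => (H.up hl).d_C m) fun m hm => ⟨0, zero_mem _, map_zero _, ?_⟩
  · change T.α (T.α (T.h (C m))) = 0
    rw [← neg_neg (T.α (T.h (C m))), ← e m hm, map_neg, T.α_β, neg_zero]
  · change T.β (T.h (C m)) = T.α (T.h (C (- m))) + T.β 0
    rw [e m hm]; simp

/-- A single step down for `p = 2`. -/
lemma Gen.down_two {l : ℤ} (hl : l + 1 = k) (H : T.Gen 2 k C C) :
    T.swap.Gen 2 l (T.d.comp (T.r.comp C)) (T.d.comp (T.r.comp C)) := by
  have h0 : ∀ m : M, 2 • m = 0 → ∀ g : Y →+ Y, 2 • g (C m) = 0 := fun m hm g => by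
    rw [← map_nsmul, ← map_nsmul, hm]; simp
  have H1 := H.down hl
  refine H1.congr (-AddMonoidHom.id M) (fun m hm => ?_) (fun m _ => H1.deg m) (fun m _ => H1.d_C m)
    fun m hm => ?_
  · have := h2 (T.d (T.r (C m)))
    rw [h0 m hm (T.d.comp T.r) |> (fun h => (h : 2 • T.d (T.r (C m)) = 0))] at this
    have e := H1.α_C m
    change T.β (T.d (T.r (C m))) = 0 at e
    rwa [e, add_zero] at this
  · have e1 : T.β (T.r (C m)) = C m := T.β_r _ (H.α_C m)
    have e2 : T.α (T.s (C m)) = C m := T.α_s _ (H.β_C' m hm)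
    have e3 : T.α (T.r (C m)) = - C m := by
      have := h2 (T.r (C m))
      rw [h0 m hm T.r, e1] at this
      exact eq_neg_of_add_eq_zero_left this
    have e4 : T.β (T.r (T.s (C m) + T.r (C m))) = T.s (C m) + T.r (C m) := T.β_r _ (by
      rw [map_add, e2, e3, add_neg_cancel])
    refine ⟨T.d (T.r (T.s (C m) + T.r (C m))), T.d_deg _ _ hl _ (T.r_deg _ _ (add_mem
      (T.s_deg _ _ (H.deg m)) (T.r_deg _ _ (H.deg m)))), T.d_d _, ?_⟩
    change T.d (T.s (C m)) = T.d (T.r (C (- m))) + T.β _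
    rw [← T.d_β, e4]; simp

end

end TateOps

end TateOps

end CyclicPower

namespace CyclicPower

section traces

variable {Y : Type u} [AddCommGroup Y]

variable (p : ℕ) (ς π : AddMonoid.End Y)

/-- The norm of an automorphism of order `p`. -/
def powNorm : AddMonoid.End Y := ∑ i ∈ Finset.range p, ς ^ i

/-- The quotient of `p - ∑ ς ^ i` by `1 - ς`. -/
def powQuot : AddMonoid.End Y := ∑ i ∈ Finset.range p, ∑ j ∈ Finset.range i, ς ^ j

/-- The trace of an endomorphism. -/
def powTrace : AddMonoid.End Y := ∑ i ∈ Finset.range p, ς ^ i * π * ς ^ (p - i)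

/-- A right inverse of `1 - ς` on the kernel of the norm. -/
def powPrim : AddMonoid.End Y :=
  -∑ i ∈ Finset.range p, (∑ j ∈ Finset.range i, ς ^ j) * π * ς ^ (p - i)

variable {p ς π}

lemma sub_powNorm : (p : AddMonoid.End Y) - powNorm p ς = (1 - ς) * powQuot p ς := by
  rw [powNorm, powQuot, Finset.mul_sum]
  simp only [mul_neg_geom_sum]
  rw [Finset.sum_sub_distrib, Finset.sum_const, Finset.card_range, nsmul_one]

lemma powNorm_mul (h : ς ^ p = 1) : (1 - ς) * powNorm p ς = 0 := by
  rw [powNorm, mul_neg_geom_sum, h, sub_self]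

lemma mul_powNorm (h : ς ^ p = 1) : powNorm p ς * (1 - ς) = 0 := by
  rw [powNorm, geom_sum_mul_neg, h, sub_self]

lemma powNorm_eq_sum (h : ς ^ p = 1) : ∑ i ∈ Finset.range p, ς ^ (p - i) = powNorm p ς := by
  rw [powNorm]
  rcases p with _ | n
  · simp
  · rw [Finset.sum_range_succ', Finset.sum_range_succ', Nat.sub_zero, h, pow_zero,
      ← Finset.sum_range_reflect]
    congr 1
    refine Finset.sum_congr rfl fun i hi => ?_
    rw [Finset.mem_range] at hi
    congr 1; omega

lemma mul_powPrim (h : ς ^ p = 1) :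
    (1 - ς) * powPrim p ς π = powTrace p ς π - π * powNorm p ς := by
  rw [powPrim, mul_neg, Finset.mul_sum, powTrace, ← powNorm_eq_sum h, Finset.mul_sum,
    ← Finset.sum_sub_distrib, ← Finset.sum_neg_distrib]
  refine Finset.sum_congr rfl fun i _ => ?_
  rw [← mul_assoc, ← mul_assoc, mul_neg_geom_sum]
  noncomm_ring

lemma mul_powTrace (h : ς ^ p = 1) : ς * powTrace p ς π = powTrace p ς π * ς := by
  rcases p with _ | n
  · simp [powTrace]
  · rw [powTrace, Finset.mul_sum, Finset.sum_mul, Finset.sum_range_succ, Finset.sum_range_succ']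
    congr 1
    · refine Finset.sum_congr rfl fun i hi => ?_
      rw [Finset.mem_range] at hi
      rw [← mul_assoc, ← mul_assoc, ← pow_succ', mul_assoc _ (ς ^ _) ς, ← pow_succ]
      congr 2; omega
    · rw [← mul_assoc, ← mul_assoc, ← pow_succ', h, Nat.add_sub_cancel_left, pow_zero, Nat.sub_zero,
        h, one_mul, mul_one, pow_one]

end traces

section traceHoms

variable {Y : Type u} [AddCommGroup Y] (p : ℕ) (ς π : Y →+ Y)

/-- The norm of an automorphism of order `p`. -/
def normHom : Y →+ Y := powNorm p ς

/-- The quotient of `p - ∑ ς ^ i` by `1 - ς`. -/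
def quotHom : Y →+ Y := powQuot p ς

/-- The trace of an endomorphism. -/
def traceHom : Y →+ Y := powTrace p ς π

/-- A right inverse of `1 - ς` on the kernel of the norm. -/
def primHom : Y →+ Y := powPrim p ς π

variable {p ς π}

lemma pow_of_iter (h : ∀ x, iter ς p x = x) : (show AddMonoid.End Y from ς) ^ p = 1 :=
  DFunLike.ext _ _ h

lemma traceHom_apply (x : Y) : traceHom p ς π x =
    ∑ i ∈ Finset.range p, iter ς i (π (iter ς (p - i) x)) :=
  AddMonoidHom.finsetSum_apply _ _ _

lemma normHom_apply (x : Y) : normHom p ς x = ∑ i ∈ Finset.range p, iter ς i x :=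
  AddMonoidHom.finsetSum_apply _ _ _

/-- A trace is the norm of `π` on invariant elements. -/
lemma traceHom_of_fix {x : Y} (hx : ς x = x) : traceHom p ς π x = normHom p ς (π x) := by
  rw [traceHom_apply, normHom_apply]
  exact Finset.sum_congr rfl fun i _ => by rw [iter_of_fix hx]

lemma sub_normHom (x : Y) : p • x - normHom p ς x = quotHom p ς x - ς (quotHom p ς x) := by
  have := DFunLike.congr_fun (sub_powNorm (p := p) (ς := ς)) x
  rw [← nsmul_one] at this
  exact this

lemma sub_normHom' (h : ∀ x, iter ς p x = x) (x : Y) : normHom p ς x - ς (normHom p ς x) = 0 :=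
  DFunLike.congr_fun (powNorm_mul (pow_of_iter h)) x

lemma normHom_sub (h : ∀ x, iter ς p x = x) (x : Y) : normHom p ς (x - ς x) = 0 :=
  DFunLike.congr_fun (mul_powNorm (pow_of_iter h)) x

lemma sub_primHom (h : ∀ x, iter ς p x = x) (x : Y) :
    primHom p ς π x - ς (primHom p ς π x) = traceHom p ς π x - π (normHom p ς x) :=
  DFunLike.congr_fun (mul_powPrim (pow_of_iter h)) x

lemma map_traceHom_self (h : ∀ x, iter ς p x = x) (x : Y) :
    ς (traceHom p ς π x) = traceHom p ς π (ς x) :=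
  DFunLike.congr_fun (mul_powTrace (pow_of_iter h)) x

lemma traceHom_add (π' : Y →+ Y) : traceHom p ς (π + π') = traceHom p ς π + traceHom p ς π' :=
  AddMonoidHom.ext fun x => by
    simp only [AddMonoidHom.add_apply, traceHom_apply, map_add, Finset.sum_add_distrib]

lemma traceHom_sub (π' : Y →+ Y) : traceHom p ς (π - π') = traceHom p ς π - traceHom p ς π' :=
  AddMonoidHom.ext fun x => by
    simp only [AddMonoidHom.sub_apply, traceHom_apply, map_sub, Finset.sum_sub_distrib]

section

variable {Z : Type*} [AddCommGroup Z] {ς' : Z →+ Z} {F : Y →+ Z} (h : ∀ x, F (ς x) = ς' (F x))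

include h

lemma map_iter (i : ℕ) (x : Y) : F (iter ς i x) = iter ς' i (F x) := by
  induction i with
  | zero => rfl
  | succ i ih => rw [iter_succ, iter_succ, h, ih]

lemma map_normHom (x : Y) : F (normHom p ς x) = normHom p ς' (F x) := by
  rw [normHom_apply, normHom_apply, map_sum]
  exact Finset.sum_congr rfl fun i _ => map_iter h i x

end

lemma map_quotHom {F : Y →+ Y} (h : ∀ x, F (ς x) = ς (F x)) (x : Y) :
    F (quotHom p ς x) = quotHom p ς (F x) := by
  have hc : Commute (show AddMonoid.End Y from F) ς := DFunLike.ext _ _ h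
  exact DFunLike.congr_fun (Commute.sum_right _ _ _ fun i _ => Commute.sum_right _ _ _
    fun i _ => hc.pow_right i).eq x

lemma comp_traceHom {F : Y →+ Y} (h : ∀ x, F (ς x) = ς (F x)) (x : Y) :
    F (traceHom p ς π x) = traceHom p ς (F.comp π) x := by
  rw [traceHom_apply, traceHom_apply, map_sum]
  exact Finset.sum_congr rfl fun i _ => map_iter h i _

lemma traceHom_comp {F : Y →+ Y} (h : ∀ x, F (ς x) = ς (F x)) (x : Y) :
    traceHom p ς π (F x) = traceHom p ς (π.comp F) x := by
  rw [traceHom_apply, traceHom_apply]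
  exact Finset.sum_congr rfl fun i _ => by rw [← map_iter h]; rfl

lemma traceHom_mem {S S' : AddSubgroup Y} (h : ∀ z ∈ S, ς z ∈ S) (h' : ∀ z ∈ S', ς z ∈ S')
    (hπ : ∀ z ∈ S, π z ∈ S') {z : Y} (hz : z ∈ S) : traceHom p ς π z ∈ S' := by
  rw [traceHom_apply]
  exact sum_mem fun i _ => iter_mem h' _ (hπ _ (iter_mem h _ hz))

/-- The endomorphisms that preserve a subgroup. -/
def stabSubring (D : AddSubgroup Y) : Subring (AddMonoid.End Y) where
  carrier := {F | ∀ x ∈ D, F x ∈ D}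
  mul_mem' hF hG x hx := hF _ (hG x hx)
  one_mem' _ hx := hx
  add_mem' hF hG x hx := add_mem (hF x hx) (hG x hx)
  zero_mem' _ _ := D.zero_mem
  neg_mem' hF x hx := neg_mem (hF x hx)

lemma normHom_mem {D : AddSubgroup Y} (h : ∀ z ∈ D, ς z ∈ D) : ∀ z ∈ D, normHom p ς z ∈ D :=
  have hς : (show AddMonoid.End Y from ς) ∈ stabSubring D := h
  (sum_mem fun _ _ => pow_mem hς _ :
    (∑ i ∈ Finset.range p, (show AddMonoid.End Y from ς) ^ i) ∈ stabSubring D)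

lemma quotHom_mem {D : AddSubgroup Y} (h : ∀ z ∈ D, ς z ∈ D) : ∀ z ∈ D, quotHom p ς z ∈ D :=
  have hς : (show AddMonoid.End Y from ς) ∈ stabSubring D := h
  (sum_mem fun _ _ => sum_mem fun _ _ => pow_mem hς _ :
    (∑ i ∈ Finset.range p, ∑ j ∈ Finset.range i, (show AddMonoid.End Y from ς) ^ j) ∈ stabSubring D)

lemma primHom_mem {D : AddSubgroup Y} (h : ∀ z ∈ D, ς z ∈ D) (h' : ∀ z ∈ D, π z ∈ D) :
    ∀ z ∈ D, primHom p ς π z ∈ D :=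
  have hς : (show AddMonoid.End Y from ς) ∈ stabSubring D := h
  have hπ : (show AddMonoid.End Y from π) ∈ stabSubring D := h'
  neg_mem (sum_mem fun _ _ => mul_mem (mul_mem (sum_mem fun _ _ => pow_mem hς _) hπ) (pow_mem hς _) :
    (∑ i ∈ Finset.range p, (∑ j ∈ Finset.range i, (show AddMonoid.End Y from ς) ^ j) *
      (show AddMonoid.End Y from π) * (show AddMonoid.End Y from ς) ^ (p - i)) ∈ stabSubring D)

end traceHoms

section bi

variable {V V' V'' : Type*} [AddCommGroup V] [AddCommGroup V'] [AddCommGroup V'']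
  {U U' U'' : Type*} [AddCommGroup U] [AddCommGroup U'] [AddCommGroup U'']

/-- The tensor product of two additive maps. -/
noncomputable def bi (f : V →+ V') (g : U →+ U') : Tens V U →+ Tens V' U' :=
  (TensorProduct.map f.toIntLinearMap g.toIntLinearMap).toAddMonoidHom

/-- The evaluation of an integral functional on the second factor of a tensor product. -/
noncomputable def evalRight (g : U →+ ℤ) : Tens V U →+ V :=
  ((TensorProduct.rid ℤ V).toLinearMap ∘ₗ
    TensorProduct.map LinearMap.id g.toIntLinearMap).toAddMonoidHom

lemma evalRight_tens (g : U →+ ℤ) (t : V) (q : U) : evalRight g (tens t q) = g q • t :=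
  (TensorProduct.rid_tmul (R := ℤ) t (g q)).trans rfl

/-- Pairs of elements, as pure tensors. -/
noncomputable def tensHom : V →+ U →+ Tens V U :=
  AddMonoidHom.mk' (fun t => AddMonoidHom.mk' (tens t) (TensorProduct.tmul_add t))
    fun t t' => AddMonoidHom.ext fun q => TensorProduct.add_tmul t t' q

end bi

namespace ResolutionData

variable {p : ℕ} (ν : ResolutionData.{u} p)

/-- The tensor product `V ⊗ P ⊗ I`. -/
abbrev Y (V : Type*) [AddCommGroup V] := Tens (Tens V ν.P.Tot) ν.I.Tot

noncomputable def dP : ν.P.Tot →+ ν.P.Tot := ν.P.superInt.d.toAddMonoidHom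
noncomputable def sP : ν.P.Tot →+ ν.P.Tot := ν.P.superInt.s.toAddMonoidHom
noncomputable def dI : ν.I.Tot →+ ν.I.Tot := ν.I.superInt.d.toAddMonoidHom

section

variable {V V' V'' : Type*} [AddCommGroup V] [AddCommGroup V'] [AddCommGroup V'']

/-- The pure tensors, as a trilinear map. -/
noncomputable def pt : V →+ ν.P.Tot →+ ν.I.Tot →+ ν.Y V :=
  AddMonoidHom.mk' (fun t => AddMonoidHom.mk' (fun x => tensHom (tensHom t x)) fun x y => by
    rw [map_add, map_add]) fun t t' => AddMonoidHom.ext fun x => by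
      simp [map_add]

variable {ν}

lemma Y_induction {Q : ν.Y V → Prop} (pt : ∀ t x y, Q (ν.pt t x y))
    (add : ∀ w z, Q w → Q z → Q (w + z)) (z : ν.Y V) : Q z := by
  induction z using tens_induction with
  | zero => simpa using pt 0 0 0
  | add w z hw hz => exact add _ _ hw hz
  | tens w y =>
    induction w using tens_induction with
    | zero => rw [zero_tens]; simpa using pt 0 0 0
    | add w z hw hz => rw [tens_add]; exact add _ _ hw hz
    | tens t x => exact pt t x y

lemma Y_hom_ext {Z : Type*} [AddCommGroup Z] {F G : ν.Y V →+ Z}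
    (h : ∀ t x y, F (ν.pt t x y) = G (ν.pt t x y)) : F = G :=
  AddMonoidHom.ext fun z => by
    induction z using Y_induction with
    | pt t x y => exact h t x y
    | add w z hw hz => rw [map_add, map_add, hw, hz]

/-- The tensor product of three additive maps. -/
noncomputable def tri (f : V →+ V') (g : ν.P.Tot →+ ν.P.Tot) (e : ν.I.Tot →+ ν.I.Tot) :
    ν.Y V →+ ν.Y V' := bi (bi f g) e

@[simp] lemma tri_pt (f : V →+ V') (g : ν.P.Tot →+ ν.P.Tot) (e : ν.I.Tot →+ ν.I.Tot) (t : V) (x y) :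
    tri f g e (ν.pt t x y) = ν.pt (f t) (g x) (e y) := rfl

lemma tri_tri (f : V →+ V') (g e) (f' : V' →+ V'') (g' e') (z : ν.Y V) :
    tri f' g' e' (tri f g e z) = tri (f'.comp f) (g'.comp g) (e'.comp e) z := by
  have : (tri f' g' e').comp (tri f g e) = tri (ν := ν) (f'.comp f) (g'.comp g) (e'.comp e) :=
    Y_hom_ext fun t x y => rfl
  exact DFunLike.congr_fun this z

/-- The span of the pure tensors whose degrees satisfy `S`. -/
noncomputable def triDeg (gr : ℤ → AddSubgroup V) (S : ℤ → ℤ → ℤ → Prop) : AddSubgroup (ν.Y V) :=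
  AddSubgroup.closure {w | ∃ j b c, S j b c ∧ ∃ t ∈ gr j, ∃ x ∈ ν.P.deg b, ∃ y ∈ ν.I.deg c,
    w = ν.pt t x y}

lemma pt_mem_triDeg {gr : ℤ → AddSubgroup V} {S : ℤ → ℤ → ℤ → Prop} {j b c : ℤ} (h : S j b c)
    {t x y} (ht : t ∈ gr j) (hx : x ∈ ν.P.deg b) (hy : y ∈ ν.I.deg c) :
    ν.pt t x y ∈ triDeg gr S :=
  AddSubgroup.subset_closure ⟨j, b, c, h, t, ht, x, hx, y, hy, rfl⟩

/-- An additive map sends `triDeg` to a subgroup if it does so on the generators. -/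
lemma map_triDeg {Z : Type*} [AddCommGroup Z] {gr : ℤ → AddSubgroup V} {S : ℤ → ℤ → ℤ → Prop}
    (F : ν.Y V →+ Z) (N : AddSubgroup Z)
    (h : ∀ j b c, S j b c → 0 ≤ b → c ≤ 0 → ∀ t ∈ gr j, ∀ x ∈ ν.P.deg b, ∀ y ∈ ν.I.deg c,
      F (ν.pt t x y) ∈ N) {z : ν.Y V} (hz : z ∈ triDeg gr S) : F z ∈ N := by
  induction hz using AddSubgroup.closure_induction with
  | zero => rw [map_zero]; exact zero_mem _
  | add w z _ _ hw hz => rw [map_add]; exact add_mem hw hz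
  | neg w _ hw => rw [map_neg]; exact neg_mem hw
  | mem w hw =>
  obtain ⟨j, b, c, hS, t, ht, x, hx, y, hy, rfl⟩ := hw
  rcases lt_or_ge b 0 with hb | hb
  · obtain ⟨x, rfl⟩ := hx
    have := ν.P_bounded b hb
    rw [Subsingleton.elim x 0]
    simp only [map_zero, AddMonoidHom.zero_apply, zero_mem]
  rcases lt_or_ge 0 c with hc | hc
  · obtain ⟨y, rfl⟩ := hy
    have := ν.I_bounded c hc
    rw [Subsingleton.elim y 0]
    simp only [map_zero, zero_mem]
  exact h j b c hS hb hc t ht x hx y hy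

lemma tri_mem {gr : ℤ → AddSubgroup V} {S : ℤ → ℤ → ℤ → Prop} {gr' : ℤ → AddSubgroup V'}
    {S' : ℤ → ℤ → ℤ → Prop} {f : V →+ V'} {g e} (r₁ r₂ r₃ : ℤ)
    (hf : ∀ j, ∀ t ∈ gr j, f t ∈ gr' (j + r₁)) (hg : ∀ b, ∀ x ∈ ν.P.deg b, g x ∈ ν.P.deg (b + r₂))
    (he : ∀ c, ∀ y ∈ ν.I.deg c, e y ∈ ν.I.deg (c + r₃))
    (hS : ∀ j b c, S j b c → 0 ≤ b → c ≤ 0 → S' (j + r₁) (b + r₂) (c + r₃)) {z : ν.Y V}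
    (hz : z ∈ triDeg gr S) : tri f g e z ∈ triDeg (ν := ν) gr' S' :=
  map_triDeg _ _ (fun _ _ _ h hb hc _ ht _ hx _ hy => by
    rw [tri_pt]
    exact pt_mem_triDeg (hS _ _ _ h hb hc) (hf _ _ ht) (hg _ _ hx) (he _ _ hy)) hz

lemma triDeg_mono {gr : ℤ → AddSubgroup V} {S S' : ℤ → ℤ → ℤ → Prop}
    (hS : ∀ j b c, S j b c → 0 ≤ b → c ≤ 0 → S' j b c) : triDeg (ν := ν) gr S ≤ triDeg gr S' :=
  fun _ hz => map_triDeg (AddMonoidHom.id _) _ (fun _ _ _ h hb hc _ ht _ hx _ hy =>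
    pt_mem_triDeg (hS _ _ _ h hb hc) ht hx hy) hz

end

section props

variable {ν}

lemma dP_deg {i j : ℤ} (h : j + 1 = i) {x} (hx : x ∈ ν.P.deg i) : ν.dP x ∈ ν.P.deg j :=
  DGAlgebra.d_deg_int h hx

lemma dI_deg {i j : ℤ} (h : j + 1 = i) {x} (hx : x ∈ ν.I.deg i) : ν.dI x ∈ ν.I.deg j :=
  DGAlgebra.d_deg_int h hx

lemma sP_deg {i : ℤ} {x} (hx : x ∈ ν.P.deg i) : ν.sP x ∈ ν.P.deg i := by
  have := DGAlgebra.superInt_s_deg hx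
  change ν.P.superInt.s x ∈ _
  rw [this, Units.smul_def]; exact zsmul_mem hx _

lemma dP_dP (x) : ν.dP (ν.dP x) = 0 := ν.P.superInt.d_d x
lemma dI_dI (x) : ν.dI (ν.dI x) = 0 := ν.I.superInt.d_d x
lemma sP_sP (x) : ν.sP (ν.sP x) = x := ν.P.superInt.s_s x
lemma dP_sP (x) : ν.dP (ν.sP x) = - ν.sP (ν.dP x) := SignedDG.super_d_s ν.P.superInt x
lemma σP_dP (x) : ν.σP (ν.dP x) = ν.dP (ν.σP x) := (ν.homP (.ofAdd 1)).superInt.map_d x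
lemma σI_dI (x) : ν.σI (ν.dI x) = ν.dI (ν.σI x) := (ν.homI (.ofAdd 1)).superInt.map_d x
lemma σP_sP (x) : ν.σP (ν.sP x) = ν.sP (ν.σP x) := SuperDG.Hom.map_s (ν.homP (.ofAdd 1)).superInt x
lemma σP_one : ν.σP ν.P.superInt.one = ν.P.superInt.one := (ν.homP (.ofAdd 1)).superInt.map_one
lemma σI_one : ν.σI ν.I.superInt.one = ν.I.superInt.one := (ν.homI (.ofAdd 1)).superInt.map_one

lemma superInt_d_one (X : DGAlgebra.{0, u} ℤ) : X.superInt.d X.superInt.one = 0 := by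
  have h := X.superInt.leibniz 0 X.superInt.one X.superInt.one X.superInt.par_one
  rw [X.superInt.one_mul, X.superInt.one_mul, X.superInt.mul_one, koszul_zero, one_smul,
    left_eq_add] at h
  exact h

lemma dP_one : ν.dP ν.P.superInt.one = 0 := superInt_d_one _
lemma dI_one : ν.dI ν.I.superInt.one = 0 := superInt_d_one _

lemma sP_comm {f : ν.P.Tot →+ ν.P.Tot} (hf : ∀ i, ∀ x ∈ ν.P.deg i, f x ∈ ν.P.deg i) (x) :
    f (ν.sP x) = ν.sP (f x) := by
  have := DGAlgebra.map_s_of_deg (r := 0) f (fun i x hx => by rw [add_zero]; exact hf i x hx) x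
  rwa [Int.negOnePow_zero, one_smul] at this

lemma sP_anticomm {f : ν.P.Tot →+ ν.P.Tot} (hf : ∀ i, ∀ x ∈ ν.P.deg i, f x ∈ ν.P.deg (i + 1)) (x) :
    f (ν.sP x) = - ν.sP (f x) := by
  have := DGAlgebra.map_s_of_deg (r := 1) f hf x
  rwa [Int.negOnePow_one, Units.neg_smul, one_smul] at this

end props

section operators

variable {V V' : Type*} [AddCommGroup V] [AddCommGroup V']

variable (V) in
/-- The differential of the last two factors of `V ⊗ P ⊗ I`. -/
noncomputable def dY : ν.Y V →+ ν.Y V :=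
  tri (AddMonoidHom.id V) ν.dP (AddMonoidHom.id _) + tri (AddMonoidHom.id V) ν.sP ν.dI

variable {ν}

lemma dY_pt (t : V) (x y) :
    ν.dY V (ν.pt t x y) = ν.pt t (ν.dP x) y + ν.pt t (ν.sP x) (ν.dI y) := rfl

lemma dY_dY (z : ν.Y V) : ν.dY V (ν.dY V z) = 0 := by
  induction z using Y_induction with
  | pt t x y =>
    rw [dY_pt, map_add, dY_pt, dY_pt, dP_dP, dI_dI, dP_sP]; simp
  | add w z hw hz => rw [map_add, map_add, hw, hz, add_zero]

lemma tri_dY {f : V →+ V'} (z : ν.Y V) :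
    tri f (.id _) (.id _) (ν.dY V z) = ν.dY V' (tri f (.id _) (.id _) z) := by
  induction z using Y_induction with
  | pt t x y => rw [dY_pt, map_add]; rfl
  | add w z hw hz => simp only [map_add, hw, hz]

end operators

end ResolutionData

end CyclicPower

namespace CyclicPower

namespace ResolutionData

variable {p : ℕ} {ν : ResolutionData.{u} p}

section action

variable {V V' : Type*} [AddCommGroup V] [AddCommGroup V']

variable (ν) in
/-- The action of the generator on `V ⊗ P ⊗ I` when it acts on `V` by `f`. -/
noncomputable def τ (f : V →+ V) : ν.Y V →+ ν.Y V := tri f ν.σP ν.σI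

variable (f : V →+ V)

lemma τ_pt (t : V) (x y) : ν.τ f (ν.pt t x y) = ν.pt (f t) (ν.σP x) (ν.σI y) := rfl

lemma τ_iter_pt (i : ℕ) (t : V) (x y) :
    iter (ν.τ f) i (ν.pt t x y) = ν.pt (iter f i t) (iter ν.σP i x) (iter ν.σI i y) := by
  induction i with
  | zero => rfl
  | succ i ih => simp only [iter_succ, ih, τ_pt]

lemma τ_iter_apply (i : ℕ) (z : ν.Y V) :
    iter (ν.τ f) i z = tri (iter f i) (iter ν.σP i) (iter ν.σI i) z :=
  DFunLike.congr_fun (Y_hom_ext (τ_iter_pt f i)) z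

variable {f}

lemma τ_iter (hf : ∀ t, iter f p t = t) (z : ν.Y V) : iter (ν.τ f) p z = z := by
  induction z using Y_induction with
  | pt t x y => rw [τ_iter_pt, σP_iter, σI_iter, hf]
  | add w z hw hz => rw [map_add, hw, hz]

lemma dY_τ (z : ν.Y V) : ν.dY V (ν.τ f z) = ν.τ f (ν.dY V z) := by
  induction z using Y_induction with
  | pt t x y => rw [dY_pt, map_add, τ_pt, τ_pt, τ_pt, dY_pt, σP_dP, σI_dI, σP_sP]
  | add w z hw hz => simp only [map_add, hw, hz]

lemma traceHom_τ (hf : ∀ t, iter f p t = t) (O : ν.Ops) (z : ν.Y V) :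
    traceHom p (ν.τ f) (tri (.id V) (.id _) O.πI) z = z := by
  induction z using Y_induction with
  | add w z hw hz => rw [map_add, hw, hz]
  | pt t x y =>
  rw [traceHom_apply]
  simp only [τ_iter_pt, tri_pt, AddMonoidHom.id_apply]
  refine (Finset.sum_congr rfl fun i hi => ?_ : _ = ∑ i ∈ Finset.range p,
    ν.pt t x (iter ν.σI i (O.πI (iter ν.σI (p - i) y)))).trans ?_
  · rw [iter_cancel hf hi, iter_cancel ν.σP_iter hi]
  · rw [← map_sum, O.tr_πI]

lemma τ_mem {gr : ℤ → AddSubgroup V} (hf : ∀ j, ∀ t ∈ gr j, f t ∈ gr j) {S : ℤ → ℤ → ℤ → Prop}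
    {z : ν.Y V} (hz : z ∈ triDeg gr S) : ν.τ f z ∈ triDeg gr S :=
  tri_mem 0 0 0 (fun j t ht => by rw [add_zero]; exact hf j t ht)
    (fun b x hx => by rw [add_zero]; exact ν.σP_deg hx)
    (fun c y hy => by rw [add_zero]; exact ν.σI_deg hy)
    (fun j b c h _ _ => by simpa only [add_zero] using h) hz

variable (ν V) in
/-- The elements of `V ⊗ P ⊗ I` that have the degree `k` in `P ⊗ I`. -/
noncomputable abbrev dg (k : ℤ) : AddSubgroup (ν.Y V) := triDeg (fun _ => ⊤) fun _ b c => b + c = k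

lemma dY_triDeg {gr : ℤ → AddSubgroup V} {S S' : ℤ → ℤ → ℤ → Prop}
    (hP : ∀ j b c, S j b c → S' j (b - 1) c) (hI : ∀ j b c, S j b c → S' j b (c - 1))
    {z : ν.Y V} (hz : z ∈ triDeg gr S) : ν.dY V z ∈ triDeg gr S' := by
  refine map_triDeg (ν.dY V) _ (fun j b c h _ _ t ht x hx y hy => ?_) hz
  rw [dY_pt]
  exact add_mem (pt_mem_triDeg (hP _ _ _ h) ht (dP_deg (by omega) hx) hy)
    (pt_mem_triDeg (hI _ _ _ h) ht (sP_deg hx) (dI_deg (by omega) hy))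

/-- The operators on `V ⊗ P ⊗ I`, for an action of the group on `V`. -/
noncomputable def tateOps (O : ν.Ops) (f : V →+ V) (hf : ∀ t, iter f p t = t) : TateOps (ν.Y V) where
  deg := ν.dg V
  d := ν.dY V
  h := tri (.id V) O.hP (.id _)
  α := .id _ - ν.τ f
  β := normHom p (ν.τ f)
  r := tri (.id V) (.id _) O.πI
  s := primHom p (ν.τ f) (tri (.id V) (.id _) O.πI)
  d_deg i j h x hx := dY_triDeg (fun _ _ _ h' => by omega) (fun _ _ _ h' => by omega) hx
  h_deg i j h x hx := tri_mem 0 1 0 (fun _ _ _ => AddSubgroup.mem_top _) O.hP_deg (fun c y hy => by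
    rw [add_zero]; exact hy) (fun _ b c h _ _ => by omega) hx
  α_deg i x hx := sub_mem hx (τ_mem (fun _ _ _ => AddSubgroup.mem_top _) hx)
  β_deg i := normHom_mem fun x hx => τ_mem (fun _ _ _ => AddSubgroup.mem_top _) hx
  r_deg i x hx := tri_mem 0 0 0 (fun _ _ _ => AddSubgroup.mem_top _) (fun b x hx => by rw [add_zero]; exact hx)
    (fun c y hy => by rw [add_zero]; exact O.πI_deg _ _ hy) (fun _ b c h _ _ => by omega) hx
  s_deg i := primHom_mem (fun x hx => τ_mem (fun _ _ _ => AddSubgroup.mem_top _) hx) fun x hx =>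
    tri_mem 0 0 0 (fun _ _ _ => AddSubgroup.mem_top _) (fun b x hx => by rw [add_zero]; exact hx)
      (fun c y hy => by rw [add_zero]; exact O.πI_deg _ _ hy) (fun _ b c h _ _ => by omega) hx
  d_d := dY_dY
  d_h z := by
    induction z using Y_induction with
    | pt t x y =>
      rw [dY_pt, map_add]
      simp only [tri_pt, dY_pt, AddMonoidHom.id_apply]
      rw [sP_anticomm O.hP_deg]
      have : ν.pt t x y = ν.pt t (ν.dP (O.hP x) + O.hP (ν.dP x)) y :=
        congrArg (ν.pt t · y) (O.d_hP x).symm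
      rw [this]; simp; abel
    | add w z hw hz => rw [map_add, map_add, map_add, map_add, add_add_add_comm, hw, hz]
  d_α z := by rw [AddMonoidHom.sub_apply, map_sub, dY_τ]; rfl
  d_β := map_normHom dY_τ
  α_β := sub_normHom' (τ_iter hf)
  β_α := normHom_sub (τ_iter hf)
  β_r x hx := by
    rw [← traceHom_of_fix (sub_eq_zero.mp hx).symm, traceHom_τ hf]
  α_s x hx := (sub_primHom (τ_iter hf) x).trans (by rw [hx, map_zero, sub_zero, traceHom_τ hf])

end action

section base

variable {M : Type*} [AddCommGroup M] (O : ν.Ops)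

/-- The projection of `I` to the constants. -/
noncomputable def Ops.η : ν.I.Tot →+ ν.I.Tot := (zmultiplesHom _ ν.I.superInt.one).comp O.ε

lemma Ops.η_apply (y : ν.I.Tot) : O.η y = O.ε y • ν.I.superInt.one := rfl

lemma Ops.η_η (y : ν.I.Tot) : O.η (O.η y) = O.η y := by
  rw [η_apply, η_apply, map_zsmul, O.ε_one, smul_eq_mul, mul_one]

lemma Ops.η_deg (c : ℤ) (y : ν.I.Tot) (hy : y ∈ ν.I.deg c) : O.η y ∈ ν.I.deg c := by
  by_cases hc : c = 0
  · subst hc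
    exact zsmul_mem DGAlgebra.one_deg_int _
  · rw [η_apply, O.ε_deg c y hy hc, zero_smul]; exact zero_mem _

lemma Ops.hI_zero {y : ν.I.Tot} (hy : y ∈ ν.I.deg 0) : O.hI y = 0 := by
  obtain ⟨z, hz⟩ := O.hI_deg 0 y hy
  have := ν.I_bounded (0 + 1) (by norm_num)
  rw [← hz, Subsingleton.elim z 0, map_zero]

variable (M) in
/-- The homotopy that projects the part of `M ⊗ P ⊗ I` of positive degree in `P` to the constants in
`I`, before symmetrization. -/
noncomputable def Ops.θ : ν.Y M →+ ν.Y M := tri (.id M) (O.πP.comp ν.sP) O.hI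

variable (M) in
noncomputable def Ops.Θ : ν.Y M →+ ν.Y M := traceHom p (ν.τ (.id M)) (O.θ M)

variable (ν M) in
noncomputable def dP' : ν.Y M →+ ν.Y M := tri (.id M) ν.dP (.id _)

lemma Ops.dY_θ : (ν.dY M).comp (O.θ M) + (O.θ M).comp (ν.dY M) =
    ((ν.dP' M).comp (O.θ M) + (O.θ M).comp (ν.dP' M)) +
      (tri (.id M) O.πP (.id _) - tri (.id M) O.πP O.η) := Y_hom_ext fun t x y => by
  change ν.dY M (O.θ M (ν.pt t x y)) + O.θ M (ν.dY M (ν.pt t x y)) =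
    (ν.dP' M (O.θ M (ν.pt t x y)) + O.θ M (ν.dP' M (ν.pt t x y))) +
      (ν.pt t (O.πP x) y - ν.pt t (O.πP x) (O.η y))
  have e1 : ν.pt t (O.πP x) y - ν.pt t (O.πP x) (O.η y) =
      ν.pt t (O.πP x) (ν.dI (O.hI y)) + ν.pt t (O.πP x) (O.hI (ν.dI y)) := by
    rw [← map_sub, ← map_add, η_apply, ← O.d_hI]; rfl
  have e2 : O.πP (ν.sP (ν.sP x)) = ν.sP (O.πP (ν.sP x)) := sP_comm O.πP_deg _
  rw [e1, dY_pt, map_add]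
  simp only [θ, dP', tri_pt, dY_pt, AddMonoidHom.id_apply, AddMonoidHom.comp_apply]
  rw [← e2, sP_sP]; abel

variable (ν M) in
/-- The elements of degree `k` whose degree in `P` is at most `B`. -/
noncomputable abbrev dgLe (B k : ℤ) : AddSubgroup (ν.Y M) :=
  triDeg (fun _ => ⊤) fun _ b c => b ≤ B ∧ b + c = k

lemma sub_dY_Θ_mem {B k : ℤ} (hk : 0 ≤ k) (hB : k < B) {z : ν.Y M} (hz : z ∈ ν.dgLe M B k) :
    z - (ν.dY M (O.Θ M z) + O.Θ M (ν.dY M z)) ∈ ν.dgLe M (B - 1) k := by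
  have hτ : ∀ B : ℤ, ∀ z ∈ ν.dgLe M B k, ν.τ (.id M) z ∈ ν.dgLe M B k := fun B z hz =>
    τ_mem (fun _ _ _ => AddSubgroup.mem_top _) hz
  have e : ν.dY M (O.Θ M z) + O.Θ M (ν.dY M z) =
      (traceHom p (ν.τ (.id M)) ((ν.dP' M).comp (O.θ M) + (O.θ M).comp (ν.dP' M)) +
      (traceHom p (ν.τ (.id M)) (tri (.id M) O.πP (.id _)) -
      traceHom p (ν.τ (.id M)) (tri (.id M) O.πP O.η))) z := by
    rw [← traceHom_sub, ← traceHom_add, ← O.dY_θ, traceHom_add, AddMonoidHom.add_apply,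
      ← comp_traceHom dY_τ, ← traceHom_comp dY_τ]; rfl
  have e2 : ∀ a b c z : ν.Y M, z - (a + (b - c)) = (z - b) - a + c := fun a b c z => by abel
  rw [e]
  change z - (_ + (_ - _)) ∈ _
  rw [e2]
  refine add_mem (sub_mem ?_ ?_) ?_
  · refine map_triDeg (AddMonoidHom.id (ν.Y M) - traceHom p (ν.τ (.id M)) (tri (.id M) O.πP (.id _)))
      (ν.dgLe M (B - 1) k) (fun j b c h hb hc t ht x hx y hy => ?_) hz
    change ν.pt t x y - traceHom p (ν.τ (.id M)) _ (ν.pt t x y) ∈ _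
    have e3 : traceHom p (ν.τ (.id M)) (tri (.id M) O.πP (.id _)) (ν.pt t x y) =
        ν.pt t (∑ i ∈ Finset.range p, iter ν.σP i (O.πP (iter ν.σP (p - i) x))) y := by
      rw [traceHom_apply, map_sum, AddMonoidHom.finsetSum_apply]
      refine Finset.sum_congr rfl fun i hi => ?_
      rw [τ_iter_pt, tri_pt, τ_iter_pt]
      simp only [AddMonoidHom.id_apply]
      rw [iter_cancel ν.σI_iter hi, iter_of_fix rfl, iter_of_fix rfl]
    rw [e3]
    by_cases hb0 : b = 0
    · subst hb0
      rw [Finset.sum_eq_zero fun i _ => ?_, map_zero, AddMonoidHom.zero_apply, sub_zero]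
      · exact pt_mem_triDeg (j := j) ⟨by omega, h.2⟩ ht hx hy
      · have : iter ν.σP (p - i) x ∈ ν.P.deg 0 :=
          iter_mem (S := (ν.P.deg 0).toAddSubgroup) (fun z hz => ν.σP_deg hz) _ hx
        rw [O.πP_zero _ this, map_zero]
    · rw [O.tr_πP b x hx hb0, sub_self]; exact zero_mem _
  · refine traceHom_mem (hτ B) (hτ (B - 1)) (fun z hz => ?_) hz
    have hθ : ∀ B k l : ℤ, k + 1 = l → ∀ z ∈ ν.dgLe M B k, O.θ M z ∈ ν.dgLe M B l := fun B k l hl z hz =>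
      tri_mem 0 0 1 (fun _ _ _ => AddSubgroup.mem_top _) (fun b x hx => by
        rw [add_zero]; exact O.πP_deg _ _ (sP_deg hx)) O.hI_deg (fun _ b c h _ _ => by omega) hz
    have hd : ∀ B k l : ℤ, l + 1 = k → ∀ z ∈ ν.dgLe M B k, ν.dP' M z ∈ ν.dgLe M (B - 1) l :=
      fun B k l hl z hz => tri_mem 0 (-1) 0 (fun _ _ _ => AddSubgroup.mem_top _) (fun b x hx => dP_deg (by omega) hx)
        (fun c y hy => by rw [add_zero]; exact hy) (fun _ b c h _ _ => by omega) hz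
    exact add_mem (hd _ _ _ (by omega) _ (hθ _ k (k + 1) rfl z hz))
      (hθ _ (k - 1) _ (by omega) _ (hd _ k (k - 1) (by omega) _ hz))
  · refine traceHom_mem (hτ B) (hτ (B - 1)) (fun z hz => ?_) hz
    refine map_triDeg _ _ (fun j b c h hb hc t ht x hx y hy => ?_) hz
    rw [tri_pt]
    by_cases hc0 : c = 0
    · exact pt_mem_triDeg (j := j) (b := b) (c := c) ⟨by omega, h.2⟩ ht (O.πP_deg _ _ hx)
        (O.η_deg _ _ hy)
    · rw [O.η_apply, O.ε_deg c y hy hc0, zero_smul, map_zero]; exact zero_mem _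

lemma exists_dgLe {k : ℤ} {z : ν.Y M} (hz : z ∈ ν.dg M k) : ∃ n : ℕ, z ∈ ν.dgLe M (k + n) k := by
  have hm : ∀ {m n : ℕ}, m ≤ n → ν.dgLe M (k + m) k ≤ ν.dgLe M (k + n) k := fun h =>
    triDeg_mono fun _ b c h' _ _ => by omega
  induction hz using AddSubgroup.closure_induction with
  | zero => exact ⟨0, zero_mem _⟩
  | add w z _ _ hw hz =>
    obtain ⟨m, hw⟩ := hw
    obtain ⟨n, hz⟩ := hz
    exact ⟨max m n, add_mem (hm (le_max_left _ _) hw) (hm (le_max_right _ _) hz)⟩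
  | neg w _ hw =>
    obtain ⟨m, hw⟩ := hw
    exact ⟨m, neg_mem hw⟩
  | mem w hw =>
    obtain ⟨j, b, c, h, t, ht, x, hx, y, hy, rfl⟩ := hw
    exact ⟨(b - k).toNat, pt_mem_triDeg (j := j) ⟨by omega, h⟩ ht hx hy⟩

lemma Ops.τ_Θ (z : ν.Y M) : ν.τ (.id M) (O.Θ M z) = O.Θ M (ν.τ (.id M) z) :=
  map_traceHom_self (τ_iter fun _ => iter_of_fix rfl _) z

lemma exists_reduce {k : ℤ} (hk : 0 ≤ k) (n : ℕ) {z : ν.Y M} (hz : z ∈ ν.dgLe M (k + n) k)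
    (hτ : ν.τ (.id M) z = z) (hd : O.Θ M (ν.dY M z) = 0) :
    ∃ w ∈ ν.dg M (k + 1), ν.τ (.id M) w = w ∧ z - ν.dY M w ∈ ν.dgLe M k k := by
  induction n generalizing z with
  | zero => exact ⟨0, zero_mem _, map_zero _, by simpa using hz⟩
  | succ n ih =>
    have h1 := sub_dY_Θ_mem O hk (by omega) hz
    rw [hd, add_zero, show k + ((n + 1 : ℕ) : ℤ) - 1 = k + n by push_cast; ring] at h1
    have hτΘ : ν.τ (.id M) (O.Θ M z) = O.Θ M z := by rw [O.τ_Θ, hτ]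
    obtain ⟨w, hw, hw', hw''⟩ := ih h1 (by
        rw [map_sub, hτ, ← dY_τ, hτΘ]) (by
        rw [map_sub, dY_dY, sub_zero, hd])
    refine ⟨O.Θ M z + w, add_mem ?_ hw, by rw [map_add, hτΘ, hw'], by rwa [map_add, ← sub_sub]⟩
    refine traceHom_mem (S := ν.dg M k) (fun z hz => τ_mem (fun _ _ _ => AddSubgroup.mem_top _) hz)
      (fun z hz => τ_mem (fun _ _ _ => AddSubgroup.mem_top _) hz) (fun z hz => ?_)
      (triDeg_mono (fun _ _ _ h _ _ => h.2) hz)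
    exact tri_mem 0 0 1 (fun _ _ _ => AddSubgroup.mem_top _) (fun b x hx => by
        rw [add_zero]; exact O.πP_deg _ _ (sP_deg hx)) O.hI_deg (fun _ b c h _ _ => by omega) hz

variable (ν M) in
/-- The elements of degree `k` in `P` and `0` in `I`. -/
noncomputable abbrev dgP (k : ℤ) : AddSubgroup (ν.Y M) :=
  triDeg (fun _ => ⊤) fun _ b c => b = k ∧ c = 0

lemma η_of_dY_mem {z : ν.Y M} {k l : ℤ} (hz : z ∈ ν.dgP M k) (hd : ν.dY M z ∈ ν.dgP M l) :
    tri (.id M) (.id _) O.η z = z := by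
  have h0 : ∀ {k : ℤ} (g : ν.P.Tot →+ ν.P.Tot), ∀ z ∈ ν.dgP M k, tri (.id M) g O.hI z = 0 := by
    intro k g z hz
    refine (AddSubgroup.mem_bot (G := ν.Y M)).mp
      (map_triDeg _ ⊥ (fun j b c h _ _ t _ x _ y hy => ?_) hz)
    obtain rfl := h.2
    rw [tri_pt, O.hI_zero hy, map_zero]; exact zero_mem _
  have h1 : tri (.id M) ν.sP O.hI (ν.dY M z) = 0 := h0 _ _ hd
  have h2 : tri (.id M) (ν.sP.comp ν.dP) O.hI z = 0 := h0 _ _ hz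
  have h3 : tri (.id M) (.id _) (ν.dI.comp O.hI) z = 0 := by
    have : tri (.id M) (.id _) (ν.dI.comp O.hI) z =
      tri (.id M) (.id _) ν.dI (tri (.id M) (.id _) O.hI z) := by rw [tri_tri]; rfl
    rw [this, h0 _ _ hz, map_zero]
  have h4 : tri (.id M) ν.sP O.hI (ν.dY M z) = tri (.id M) (ν.sP.comp ν.dP) O.hI z +
      tri (.id M) (.id _) (O.hI.comp ν.dI) z := by
    change tri (.id M) ν.sP O.hI (tri _ _ _ z + tri _ _ _ z) = _
    rw [map_add, tri_tri, tri_tri]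
    congr 2
    exact Y_hom_ext fun t x y => by
      simp only [tri_pt, AddMonoidHom.comp_apply, AddMonoidHom.id_apply, sP_sP]
  rw [h1, h2, zero_add] at h4
  have h5 : z = tri (.id M) (.id _) (ν.dI.comp O.hI) z + tri (.id M) (.id _) (O.hI.comp ν.dI) z +
      tri (.id M) (.id _) O.η z := by
    clear h1 h2 h3 h4 hd hz
    induction z using Y_induction with
    | pt t x y =>
      simp only [tri_pt, AddMonoidHom.comp_apply, AddMonoidHom.id_apply, ← map_add]
      congr 1
      exact (eq_add_of_sub_eq (O.d_hI y).symm)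
    | add w z hw hz =>
      conv_lhs => rw [hw, hz]
      simp only [map_add]; abel
  rw [h3, ← h4, zero_add, zero_add] at h5
  exact h5.symm

/-- The element `m ⊗ 1 ⊗ 1`. -/
noncomputable def unitHom (ν : ResolutionData.{u} p) : M →+ ν.Y M :=
  AddMonoidHom.mk' (fun m => ν.pt m ν.P.superInt.one ν.I.superInt.one) fun m m' => by
    rw [map_add, AddMonoidHom.add_apply, AddMonoidHom.add_apply]

lemma unitHom_apply (m : M) : ν.unitHom m = ν.pt m ν.P.superInt.one ν.I.superInt.one := rfl

lemma exists_unitHom {z : ν.Y M} (hz : z ∈ ν.dgP M 0) : ∃ m, tri (.id M) (.id _) O.η z = ν.unitHom m := by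
  have : tri (.id M) (.id _) O.η z ∈ (ν.unitHom (M := M)).range := by
    refine map_triDeg _ _ (fun j b c h _ _ t _ x hx y hy => ?_) hz
    obtain ⟨rfl, rfl⟩ := h
    refine ⟨(O.εP x * O.ε y) • t, ?_⟩
    rw [unitHom_apply, tri_pt, O.η_apply, ← O.εP_smul x hx]
    simp [mul_smul, O.εP_one]
  obtain ⟨m, hm⟩ := this
  exact ⟨m, hm.symm⟩

include O in
lemma unitHom_injective : Function.Injective (ν.unitHom (M := M)) := by
  refine Function.LeftInverse.injective (g := fun z => evalRight O.εP (evalRight O.ε z)) fun m => ?_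
  change evalRight O.εP (evalRight O.ε (tens (tens m _) _)) = m
  rw [evalRight_tens, O.ε_one, one_smul, evalRight_tens, O.εP_one, one_smul]

/-- The preimage under the norm of an invariant element of degree `1` in `P`. -/
lemma exists_norm_eq {z : ν.Y M} (hz : z ∈ ν.dgP M 1) (hη : tri (.id M) (.id _) O.η z = z)
    (hτ : ν.τ (.id M) z = z) : ∃ x ∈ ν.dg M 1, normHom p (ν.τ (.id M)) x = z ∧ ∃ m, ν.dY M x = ν.unitHom m := by
  refine ⟨tri (.id M) O.πP O.η z, ?_, ?_, ?_⟩
  · exact tri_mem 0 0 0 (fun _ _ _ => AddSubgroup.mem_top _) (fun b x hx => by rw [add_zero]; exact O.πP_deg _ _ hx)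
      (fun b x hx => by rw [add_zero]; exact O.η_deg _ _ hx) (fun _ b c h _ _ => by omega) hz
  · rw [normHom_apply]
    have h1 : ∀ i ∈ Finset.range p, iter (ν.τ (.id M)) i (tri (.id M) O.πP O.η z) =
        tri (.id M) ((iter ν.σP i).comp (O.πP.comp (iter ν.σP (p - i)))) O.η z := by
      intro i _
      have : z = tri (.id M) (iter ν.σP (p - i)) O.η z := by
        conv_lhs => rw [← iter_of_fix hτ (p - i), ← hη, τ_iter_apply, tri_tri]
        congr 1
        exact Y_hom_ext fun t x y => by
          simp only [tri_pt, AddMonoidHom.comp_apply, AddMonoidHom.id_apply, O.η_apply]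
          rw [map_zsmul, iter_of_fix σI_one, iter_of_fix rfl]
      conv_lhs => rw [this, tri_tri, τ_iter_apply, tri_tri]
      congr 1
      exact Y_hom_ext fun t x y => by
          simp only [tri_pt, AddMonoidHom.comp_apply, AddMonoidHom.id_apply, O.η_η]
          rw [O.η_apply, map_zsmul, iter_of_fix σI_one, iter_of_fix rfl]
    rw [Finset.sum_congr rfl h1]
    conv_rhs => rw [← hη]
    rw [← sub_eq_zero, ← AddMonoidHom.finsetSum_apply, ← AddMonoidHom.sub_apply]
    refine (AddSubgroup.mem_bot (G := ν.Y M)).mp (map_triDeg _ ⊥ (fun j b c h _ _ t _ x hx y _ => ?_) hz)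
    rw [AddMonoidHom.sub_apply, AddMonoidHom.finsetSum_apply]
    simp only [tri_pt, AddMonoidHom.comp_apply, AddMonoidHom.id_apply]
    rw [← AddMonoidHom.finsetSum_apply, ← map_sum]
    rw [O.tr_πP b x hx (by omega), sub_self]
    exact zero_mem _
  · have h0 : ∀ g h, tri (.id M) g h (tri (.id M) O.πP O.η z) =
        tri (.id M) (g.comp O.πP) (h.comp O.η) z := fun g h => tri_tri _ _ _ _ _ _ z
    have h1 : tri (.id M) (ν.sP.comp O.πP) (ν.dI.comp O.η) = 0 := Y_hom_ext fun t x y => by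
      rw [tri_pt, AddMonoidHom.comp_apply ν.dI, O.η_apply, map_zsmul, dI_one, smul_zero, map_zero]
      rfl
    have h2 : tri (.id M) (.id _) O.η (tri (.id M) (ν.dP.comp O.πP) (.id _) z) =
        tri (.id M) (ν.dP.comp O.πP) O.η z := tri_tri _ _ _ _ _ _ z
    have h3 : ν.dY M (tri (.id M) O.πP O.η z) = tri (.id M) (.id _) O.η
        (tri (.id M) (ν.dP.comp O.πP) (.id _) z) := by
      rw [dY, AddMonoidHom.add_apply, h0, h0, h1, AddMonoidHom.zero_apply, add_zero, h2]; rfl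
    rw [h3]
    refine exists_unitHom O (tri_mem 0 (-1) 0 (fun _ _ _ => AddSubgroup.mem_top _) (fun b x hx => ?_)
      (fun b x hx => by rw [add_zero]; exact hx) (fun _ b c h _ _ => by omega) hz)
    exact dP_deg (by omega) (O.πP_deg _ _ hx)

lemma τ_unitHom (m : M) : ν.τ (.id M) (ν.unitHom m) = ν.unitHom m := by
  rw [unitHom_apply, τ_pt, σP_one, σI_one]; rfl

lemma dY_unitHom (m : M) : ν.dY M (ν.unitHom m) = 0 := by
  rw [unitHom_apply, dY_pt, dP_one, dI_one]; simp

lemma normHom_unitHom (m : M) : normHom p (ν.τ (.id M)) (ν.unitHom m) = p • ν.unitHom m := by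
  rw [normHom_apply]
  simp [iter_of_fix (τ_unitHom (ν := ν) m)]

lemma Θ_unitHom (m : M) : O.Θ M (ν.unitHom m) = 0 := by
  rw [Ops.Θ, traceHom_apply]
  refine Finset.sum_eq_zero fun i _ => ?_
  rw [iter_of_fix (τ_unitHom (ν := ν) m), unitHom_apply, Ops.θ, tri_pt,
    O.hI_zero DGAlgebra.one_deg_int, map_zero, map_zero]

lemma unitHom_mem (m : M) : ν.unitHom m ∈ ν.dgP M 0 :=
  pt_mem_triDeg (j := 0) ⟨rfl, rfl⟩ (AddSubgroup.mem_top _) DGAlgebra.one_deg_int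
    DGAlgebra.one_deg_int

include O in
lemma gen_unit_aux (T : TateOps (ν.Y M)) (hdeg : T.deg = ν.dg M) (hTd : T.d = ν.dY M)
    (fixT : ∀ z, T.α z = 0 ↔ ν.τ (.id M) z = z) (hTβ : T.β = normHom p (ν.τ (.id M))) :
    T.Gen p 0 ν.unitHom ν.unitHom := by
  have mem : ∀ {k z}, z ∈ T.deg k ↔ z ∈ ν.dg M k := fun {k z} => by rw [hdeg]
  have unit0 : ∀ m : M, ν.unitHom m ∈ T.deg 0 := fun m =>
    mem.mpr (triDeg_mono (fun _ b c h _ _ => by omega) (unitHom_mem m))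
  have unitd : ∀ m : M, T.d (ν.unitHom m) = 0 := fun m => by rw [hTd, dY_unitHom]
  have key : ∀ {k : ℤ}, 0 ≤ k → ∀ z ∈ T.deg k, T.α z = 0 → ∀ m, T.d z = ν.unitHom m →
      ∃ w ∈ T.deg (k + 1), T.α w = 0 ∧ z - T.d w ∈ ν.dgP M k ∧
        tri (.id M) (.id _) O.η (z - T.d w) = z - T.d w := by
    intro k hk z hz hα m hm
    obtain ⟨n, hn⟩ := exists_dgLe (mem.mp hz)
    rw [hTd] at hm
    obtain ⟨w, hw, hw', hw''⟩ := exists_reduce O hk n hn ((fixT z).mp hα) (by rw [hm, Θ_unitHom])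
    rw [hTd]
    have h1 : z - ν.dY M w ∈ ν.dgP M k := triDeg_mono (fun _ b c h _ _ => by omega) hw''
    refine ⟨w, mem.mpr hw, (fixT w).mpr hw', h1, η_of_dY_mem O h1 (l := 0) ?_⟩
    rw [map_sub, dY_dY, sub_zero, hm]
    exact unitHom_mem m
  have pM : ∀ m : M, T.β (ν.unitHom m) = p • ν.unitHom m := fun m => by
    rw [hTβ, normHom_unitHom]
  have norm1 : ∀ z, T.α z = 0 → z ∈ ν.dgP M 1 → tri (.id M) (.id _) O.η z = z →
      ∃ x ∈ T.deg 1, T.β x = z ∧ ∃ m, T.d x = ν.unitHom m := fun z hz h1 h2 => by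
    obtain ⟨x, hx, hx', m, hm⟩ := exists_norm_eq O h1 h2 ((fixT z).mp hz)
    exact ⟨x, mem.mpr hx, by rw [hTβ, hx'], m, by rw [hTd, hm]⟩
  have hαu : ∀ m : M, T.α (ν.unitHom m) = 0 := fun m => (fixT _).mpr (τ_unitHom m)
  clear hTd hTβ fixT mem hdeg
  refine ⟨unit0, unitd, fun m => ?_, fun m _ => unit0 m, fun m _ => unitd m, fun m hm => ?_,
    fun z hz hdz hα => ?_, fun m w hw hdw h => ?_, fun w hw hdw hβ => ?_⟩
  · exact hαu m
  · rw [pM, ← map_nsmul, hm, map_zero]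
  · obtain ⟨w, hw, hw1, hw2, hw3⟩ := key le_rfl z hz hα 0 (by rw [hdz, map_zero])
    obtain ⟨m, hm⟩ := exists_unitHom O hw2
    refine ⟨m, T.d (T.r w), T.d_deg (0 + 1) _ rfl _ (T.r_deg _ _ hw), T.d_d _, ?_⟩
    rw [← T.d_β, T.β_r _ hw1, ← hm, hw3, sub_add_cancel]
  · have e1 : T.d (T.β (T.h w)) = ν.unitHom m := by rw [T.d_β, T.d_h_of_cycle hdw, h]
    obtain ⟨u, hu, hu1, hu2, hu3⟩ := key zero_le_one _ (T.β_deg 1 _ (T.h_deg 0 1 rfl _ hw)) (T.α_β _)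
      m e1
    obtain ⟨x, -, hx, m', hm'⟩ := norm1 _ (by
      rw [map_sub, T.α_β, ← T.d_α, hu1, map_zero, sub_zero]) hu2 hu3
    refine ⟨m', unitHom_injective O ?_⟩
    rw [map_nsmul, ← pM, ← hm']
    rw [← T.d_β, hx, map_sub, T.d_d, e1, sub_zero]
  · have hd : T.d (T.β (T.h w)) = 0 := by rw [T.d_β, T.d_h_of_cycle hdw, hβ]
    obtain ⟨u, hu, hu1, hu2, hu3⟩ := key zero_le_one _ (T.β_deg 1 _ (T.h_deg 0 1 rfl _ hw)) (T.α_β _)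
      0 (by rw [hd, map_zero])
    obtain ⟨x, hx1, hβx, m, hdx⟩ := norm1 _ (by
      rw [map_sub, T.α_β, ← T.d_α, hu1, map_zero, sub_zero]) hu2 hu3
    have e2 : T.β (T.h w - T.d (T.r u) - x) = 0 := by
      rw [map_sub, map_sub, ← T.d_β, T.β_r _ hu1, hβx, sub_self]
    refine ⟨m, unitHom_injective O ?_, T.d (T.s (T.h w - T.d (T.r u) - x)), ?_, T.d_d _, ?_⟩
    · rw [map_nsmul, ← pM, ← hdx, ← T.d_β, hβx, map_sub, hd, T.d_d, sub_zero, map_zero]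
    · exact T.d_deg 1 _ rfl _ (T.s_deg _ _ (sub_mem (sub_mem (T.h_deg _ _ rfl _ hw)
        (T.d_deg _ _ rfl _ (T.r_deg _ _ hu))) hx1))
    · rw [← T.d_α, T.α_s _ e2, map_sub, map_sub, T.d_d, T.d_h_of_cycle hdw, hdx]; abel

/-- The generator in degree `0`. -/
lemma gen_unit :
    (tateOps O (.id M) (fun _ => iter_of_fix rfl _)).Gen p 0 ν.unitHom ν.unitHom :=
  gen_unit_aux O _ rfl rfl (fun z => (sub_eq_zero (a := z)).trans eq_comm) rfl

end base

end ResolutionData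

end CyclicPower

namespace CyclicPower

lemma TateOps.Gen.of_eq {Y : Type*} [AddCommGroup Y] {M : Type*} [AddCommGroup M] {T T' : TateOps Y}
    {p : ℕ} {k : ℤ} {C C' : M →+ Y} (H : T.Gen p k C C') (h1 : T'.deg = T.deg)
    (h2 : T'.d = T.d) (h3 : T'.α = T.α) (h4 : T'.β = T.β) : T'.Gen p k C C' where
  deg := by rw [h1]; exact H.deg
  d_C := by rw [h2]; exact H.d_C
  α_C := by rw [h3]; exact H.α_C
  deg' := by rw [h1]; exact H.deg'
  d_C' := by rw [h2]; exact H.d_C'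
  β_C' := by rw [h4]; exact H.β_C'
  gen := by rw [h1, h2, h3, h4]; exact H.gen
  rel := by rw [h1, h2, h4]; exact H.rel
  gen' := by rw [h1, h2, h3, h4]; exact H.gen'

lemma primHom_apply {Y : Type*} [AddCommGroup Y] {p : ℕ} {ς π : Y →+ Y} (x : Y) :
    primHom p ς π x = -∑ i ∈ Finset.range p, ∑ j ∈ Finset.range i,
      iter ς j (π (iter ς (p - i) x)) := by
  refine congrArg Neg.neg ((AddMonoidHom.finsetSum_apply _ _ _).trans ?_)
  exact Finset.sum_congr rfl fun i _ => AddMonoidHom.finsetSum_apply _ _ _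

lemma map_primHom {Y Z : Type*} [AddCommGroup Y] [AddCommGroup Z] {p : ℕ} {ς π : Y →+ Y}
    {ς' π' : Z →+ Z} {F : Y →+ Z} (h : ∀ x, F (ς x) = ς' (F x)) (h' : ∀ x, F (π x) = π' (F x))
    (x : Y) : F (primHom p ς π x) = primHom p ς' π' (F x) := by
  rw [primHom_apply, primHom_apply, map_neg, map_sum]
  congr 1
  refine Finset.sum_congr rfl fun i _ => ?_
  rw [map_sum]
  exact Finset.sum_congr rfl fun j _ => by rw [map_iter h, h', map_iter h]

/-- The multiplication by an integer. -/
def zs (V : Type*) [AddCommGroup V] (χ : ℤ) : V →+ V := DistribSMul.toAddMonoidHom V χ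

lemma zs_apply {V : Type*} [AddCommGroup V] (χ : ℤ) (t : V) : zs V χ t = χ • t := rfl

lemma iter_zs {V : Type*} [AddCommGroup V] (χ : ℤ) (i : ℕ) (t : V) :
    iter (zs V χ) i t = χ ^ i • t := by
  induction i with
  | zero => rw [pow_zero, one_smul]; rfl
  | succ i ih => rw [iter_succ, ih, zs_apply, smul_smul, pow_succ']

namespace ResolutionData

variable {p : ℕ} {ν : ResolutionData.{u} p} (O : ν.Ops)

/-- The operators on `V ⊗ P ⊗ I`, for the action of the generator on `V` by `χ`. -/
noncomputable def chiOps (V : Type*) [AddCommGroup V] {χ : ℤ} (hχ : χ ^ p = 1) :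
    TateOps (ν.Y V) :=
  tateOps O (zs V χ) fun t => by rw [iter_zs, hχ, one_smul]

section act

variable {M : Type*} [AddCommGroup M]

/-- The map `ℤ ⊗ P ⊗ I → M ⊗ P ⊗ I` given by an element of `M`. -/
noncomputable def act (m : M) : ν.Y ℤ →+ ν.Y M := tri (zmultiplesHom M m) (.id _) (.id _)

lemma act_pt (m : M) (n : ℤ) (x y) : act m (ν.pt n x y) = ν.pt (n • m) x y := rfl

variable (M) in
/-- The map `M → M ⊗ P ⊗ I` given by an element of `ℤ ⊗ P ⊗ I`. -/
noncomputable def actHom (c : ν.Y ℤ) : M →+ ν.Y M :=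
  AddMonoidHom.mk' (fun m => act m c) fun m m' => by
    induction c using Y_induction with
    | pt n x y => rw [act_pt, act_pt, act_pt, smul_add, map_add]; rfl
    | add w z hw hz => simp only [map_add, hw, hz]; abel

lemma actHom_apply (c : ν.Y ℤ) (m : M) : actHom M c m = act m c := rfl

lemma act_tri (m : M) (g e) (z : ν.Y ℤ) :
    act m (tri (.id _) g e z) = tri (.id _) g e (act m z) := by
  rw [act, tri_tri, tri_tri]; rfl

lemma act_dY (m : M) (z : ν.Y ℤ) : act m (ν.dY ℤ z) = ν.dY M (act m z) := by
  rw [dY, AddMonoidHom.add_apply, map_add, act_tri, act_tri]; rfl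

lemma act_τ (m : M) (χ : ℤ) (z : ν.Y ℤ) : act m (ν.τ (zs ℤ χ) z) = ν.τ (zs M χ) (act m z) := by
  rw [act, τ, τ, tri_tri, tri_tri]
  congr 1
  exact Y_hom_ext fun n x y => by
    simp [zs_apply, mul_smul]

variable {χ : ℤ} (hχ : χ ^ p = 1)

lemma act_d (m : M) (z : ν.Y ℤ) : act m ((chiOps O ℤ hχ).d z) = (chiOps O M hχ).d (act m z) :=
  act_dY m z

lemma act_h (m : M) (z : ν.Y ℤ) : act m ((chiOps O ℤ hχ).h z) = (chiOps O M hχ).h (act m z) :=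
  act_tri m _ _ z

lemma act_r (m : M) (z : ν.Y ℤ) : act m ((chiOps O ℤ hχ).r z) = (chiOps O M hχ).r (act m z) :=
  act_tri m _ _ z

lemma act_α (m : M) (z : ν.Y ℤ) : act m ((chiOps O ℤ hχ).α z) = (chiOps O M hχ).α (act m z) := by
  change act m (z - ν.τ _ z) = act m z - ν.τ _ (act m z)
  rw [map_sub, act_τ]

lemma act_β (m : M) (z : ν.Y ℤ) : act m ((chiOps O ℤ hχ).β z) = (chiOps O M hχ).β (act m z) :=
  map_normHom (act_τ m χ) z

lemma act_s (m : M) (z : ν.Y ℤ) : act m ((chiOps O ℤ hχ).s z) = (chiOps O M hχ).s (act m z) :=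
  map_primHom (act_τ m χ) (act_tri m _ _) z

/-- The Tate cohomology in degree `k`, with the coefficients in `M`, is given by the class `c`. -/
def GenAt (M : Type*) [AddCommGroup M] (k : ℤ) (c : ν.Y ℤ) : Prop :=
  (chiOps O M hχ).Gen p k (actHom M c) (actHom M c)

variable {O hχ} {k l : ℤ} {c : ν.Y ℤ}

lemma GenAt.up_up (hl : k + 2 = l) (H : GenAt O hχ M k c) : GenAt O hχ M l
    ((chiOps O ℤ hχ).β ((chiOps O ℤ hχ).h ((chiOps O ℤ hχ).α ((chiOps O ℤ hχ).h c)))) := by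
  have := TateOps.Gen.up_up (quotHom p (ν.τ (zs M χ))) (fun x => sub_normHom x)
    (fun x => (map_quotHom (F := (chiOps O M hχ).α) (fun x => by
      change ν.τ _ x - ν.τ _ _ = ν.τ _ _
      exact (map_sub _ _ _).symm) x)) (map_quotHom dY_τ) (fun i => quotHom_mem fun x hx =>
        τ_mem (fun _ _ _ => AddSubgroup.mem_top _) hx) hl H
  rw [GenAt]
  convert this using 1 <;> exact AddMonoidHom.ext fun m => by
    rw [actHom_apply, act_β, act_h, act_α, act_h]; rfl

lemma GenAt.down_down (hl : l + 2 = k) (H : GenAt O hχ M k c) : GenAt O hχ M l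
    ((chiOps O ℤ hχ).d ((chiOps O ℤ hχ).s ((chiOps O ℤ hχ).d ((chiOps O ℤ hχ).r c)))) := by
  have := TateOps.Gen.down_down (quotHom p (ν.τ (zs M χ))) (fun x => sub_normHom x)
    (fun x => (map_quotHom (F := (chiOps O M hχ).α) (fun x => by
      change ν.τ _ x - ν.τ _ _ = ν.τ _ _
      exact (map_sub _ _ _).symm) x)) (map_quotHom dY_τ) (fun i => quotHom_mem fun x hx =>
        τ_mem (fun _ _ _ => AddSubgroup.mem_top _) hx) hl H
  rw [GenAt]
  convert this using 1 <;> exact AddMonoidHom.ext fun m => by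
    rw [actHom_apply, act_d, act_s, act_d, act_r]; rfl

end act

section two

variable {ν : ResolutionData.{u} 2} {O : ν.Ops} {M : Type*} [AddCommGroup M] {χ : ℤ}
  {hχ : χ ^ 2 = 1} {k l : ℤ} {c : ν.Y ℤ}

lemma τ_neg (x : ν.Y M) : ν.τ (zs M (-χ)) x = - ν.τ (zs M χ) x := by
  induction x using Y_induction with
  | pt t x y => rw [τ_pt, τ_pt, zs_apply, zs_apply, neg_smul, map_neg]; rfl
  | add w z hw hz => rw [map_add, map_add, hw, hz, neg_add]

lemma chiOps_β_two (x : ν.Y M) : (chiOps O M hχ).β x = x + ν.τ (zs M χ) x := by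
  refine (normHom_apply x).trans ?_
  rw [Finset.sum_range_succ, Finset.sum_range_one]; rfl

lemma chiOps_α_add_β (x : ν.Y M) : (chiOps O M hχ).α x + (chiOps O M hχ).β x = 2 • x := by
  rw [chiOps_β_two, two_nsmul]
  change x - ν.τ _ x + _ = _
  abel

lemma swap_gen (hχ' : (-χ) ^ 2 = 1) {C C' : M →+ ν.Y M}
    (H : (chiOps O M hχ).swap.Gen 2 k C C') : (chiOps O M hχ').Gen 2 k C C' :=
  H.of_eq rfl rfl (AddMonoidHom.ext fun x => by
    refine Eq.trans ?_ (chiOps_β_two (O := O) (hχ := hχ) x).symm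
    change x - ν.τ _ x = _
    rw [τ_neg, sub_neg_eq_add]) (AddMonoidHom.ext fun x => by
    refine (chiOps_β_two (O := O) (hχ := hχ') x).trans ?_
    rw [τ_neg, ← sub_eq_add_neg]; rfl)

lemma GenAt.up_two (hχ' : (-χ) ^ 2 = 1) (hl : k + 1 = l) (H : GenAt O hχ M k c) :
    GenAt O hχ' M l ((chiOps O ℤ hχ).α ((chiOps O ℤ hχ).h c)) := by
  have := swap_gen hχ' (TateOps.Gen.up_two chiOps_α_add_β hl H)
  rw [GenAt]
  convert this using 1 <;> exact AddMonoidHom.ext fun m => by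
    rw [actHom_apply, act_α, act_h]; rfl

lemma GenAt.down_two (hχ' : (-χ) ^ 2 = 1) (hl : l + 1 = k) (H : GenAt O hχ M k c) :
    GenAt O hχ' M l ((chiOps O ℤ hχ).d ((chiOps O ℤ hχ).r c)) := by
  have := swap_gen hχ' (TateOps.Gen.down_two chiOps_α_add_β hl H)
  rw [GenAt]
  convert this using 1 <;> exact AddMonoidHom.ext fun m => by
    rw [actHom_apply, act_d, act_r]; rfl

end two

section seq

variable (ν) in
/-- The unit of `ℤ ⊗ P ⊗ I`. -/
noncomputable def unitY : ν.Y ℤ := ν.pt 1 ν.P.superInt.one ν.I.superInt.one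

lemma genAt_unit (M : Type*) [AddCommGroup M] : GenAt O (one_pow p) M 0 ν.unitY := by
  have e : zs M 1 = .id M := AddMonoidHom.ext fun m => one_smul ℤ m
  have h := (gen_unit (M := M) O).of_eq (T' := chiOps O M (one_pow p)) rfl rfl (by
    change _ - ν.τ _ = _ - ν.τ _
    rw [e]) (by
    change normHom p (ν.τ _) = normHom p (ν.τ _)
    rw [e])
  rw [GenAt]
  convert h using 1 <;> exact AddMonoidHom.ext fun m => by
    rw [actHom_apply, unitY, act_pt, one_smul]; rfl

/-- The sign by which the generator acts on the `p`-th tensor power of an element of degree `n`. -/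
def chi (p : ℕ) (n : ℤ) : ℤ := koszul ℤ ((n * (p - 1) : ℤ) : ZMod 2)

lemma chi_of_odd {p : ℕ} (hp : p % 2 = 1) (n : ℤ) : chi p n = 1 := by
  have : ((n * (p - 1) : ℤ) : ZMod 2) = 0 := by
    rw [ZMod.intCast_zmod_eq_zero_iff_dvd]
    exact Dvd.dvd.mul_left (by push_cast; omega) n
  rw [chi, this, koszul_zero]

lemma chi_two (n : ℤ) : chi 2 n = koszul ℤ (n : ZMod 2) := by
  rw [chi]; congr 2; push_cast; ring

lemma chi_pow [hp : Fact p.Prime] (n : ℤ) : chi p n ^ p = 1 := by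
  rcases hp.1.eq_two_or_odd with rfl | h
  · rw [chi_two, sq, koszul_mul_self]
  · rw [chi_of_odd h, one_pow]

/-- The existence of the class `c`. -/
lemma exists_genAt [hp : Fact p.Prime] (O : ν.Ops) (n : ℤ) : ∃ c : ν.Y ℤ,
    GenAt O (chi_pow n) ℤ (-n * (p - 1)) c ∧
      ∀ (M : Type w) [AddCommGroup M], GenAt O (chi_pow n) M (-n * (p - 1)) c := by
  suffices H : ∀ χ : ℤ, χ = chi p n → ∀ k, k = -n * ((p : ℤ) - 1) → ∀ hχ : χ ^ p = 1,
      ∃ c : ν.Y ℤ, GenAt O hχ ℤ k c ∧ ∀ (M : Type w) [AddCommGroup M], GenAt O hχ M k c from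
    H _ rfl _ rfl _
  intro χ hχ k hk hχ'
  rcases hp.1.eq_two_or_odd with rfl | h
  · have key : ∀ l : ℤ, ∀ h : koszul ℤ (l : ZMod 2) ^ 2 = 1, ∃ c : ν.Y ℤ, GenAt O h ℤ l c ∧
        ∀ (M : Type w) [AddCommGroup M], GenAt O h M l c := by
      have hneg : ∀ l m : ℤ, l + 1 = m →
          koszul ℤ (l : ZMod 2) = -koszul ℤ (m : ZMod 2) ∧
            koszul ℤ (m : ZMod 2) = -koszul ℤ (l : ZMod 2) := by
        rintro l m rfl
        push_cast
        rw [koszul_add, koszul_one]; simp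
      intro l
      induction l with
      | zero =>
        rw [show koszul ℤ (((0 : ℤ)) : ZMod 2) = 1 from koszul_zero ℤ]
        exact fun h => ⟨_, genAt_unit O ℤ, fun M _ => genAt_unit O M⟩
      | succ i ih =>
        rw [(hneg i (i + 1) rfl).2]
        intro h
        obtain ⟨c, h1, h2⟩ := ih (by rw [sq, koszul_mul_self])
        exact ⟨_, h1.up_two h rfl, fun M _ => (h2 M).up_two h rfl⟩
      | pred i ih =>
        rw [(hneg (-i - 1) (-i) (by ring)).1]
        intro h
        obtain ⟨c, h1, h2⟩ := ih (by rw [sq, koszul_mul_self])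
        exact ⟨_, h1.down_two h (by ring), fun M _ => (h2 M).down_two h (by ring)⟩
    have e : χ = koszul ℤ (k : ZMod 2) := by
      rw [hχ, chi_two, hk]
      congr 1
      push_cast
      rw [show (-(n : ZMod 2)) = n from ZMod.neg_eq_self_mod_two _]; ring
    subst e
    exact key k hχ'
  · rw [chi_of_odd h] at hχ
    subst hχ
    have key : ∀ l : ℤ, ∃ c : ν.Y ℤ, GenAt O hχ' ℤ (2 * l) c ∧
        ∀ (M : Type w) [AddCommGroup M], GenAt O hχ' M (2 * l) c := by
      intro l
      induction l with
      | zero => exact ⟨_, genAt_unit O ℤ, fun M _ => genAt_unit O M⟩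
      | succ i ih =>
        obtain ⟨c, h1, h2⟩ := ih
        exact ⟨_, h1.up_up (by ring), fun M _ => (h2 M).up_up (by ring)⟩
      | pred i ih =>
        obtain ⟨c, h1, h2⟩ := ih
        exact ⟨_, h1.down_down (by ring), fun M _ => (h2 M).down_down (by ring)⟩
    have e : k = 2 * (-n * ((p / 2 : ℕ) : ℤ)) := by
      rw [hk]
      have : (p : ℤ) - 1 = 2 * ((p / 2 : ℕ) : ℤ) := by omega
      rw [this]; ring
    subst e
    exact key _

/-- A choice of the classes `c`, with the unit in degree `0`. -/
lemma exists_gen_seq [hp : Fact p.Prime] (O : ν.Ops) : ∃ c : ℤ → ν.Y ℤ, c 0 = ν.unitY ∧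
    ∀ n, GenAt O (chi_pow n) ℤ (-n * (p - 1)) (c n) ∧
      ∀ (M : Type w) [AddCommGroup M], GenAt O (chi_pow n) M (-n * (p - 1)) (c n) := by
  choose c hc using exists_genAt.{u, w} O
  refine ⟨Function.update c 0 ν.unitY, Function.update_self _ _ _, fun n => ?_⟩
  rcases eq_or_ne n 0 with rfl | h
  · rw [Function.update_self]
    have e : ∀ χ : ℤ, χ = 1 → ∀ k : ℤ, k = 0 → ∀ hχ : χ ^ p = 1, GenAt O hχ ℤ k ν.unitY ∧
        ∀ (M : Type w) [AddCommGroup M], GenAt O hχ M k ν.unitY := by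
      rintro χ rfl k rfl hχ
      exact ⟨genAt_unit O ℤ, fun M _ => genAt_unit O M⟩
    exact e _ (by simp [chi, koszul_zero]) _ (by simp) _
  · rw [Function.update_of_ne h]
    exact hc n

end seq

end ResolutionData

end CyclicPower

namespace CyclicPower

/-- A graded complex with an action of the cyclic group of order `p` such that the terms of the
degree `n p` are the sums of a free module over the group ring and of a module on which the generator
acts by the sign `chi p n`, and the terms of the other degrees are free over the group ring. -/
structure CycData (p : ℕ) (V : Type v) [AddCommGroup V] (M : ℤ → Type w) [∀ n, AddCommGroup (M n)]
    where
  gr : ℤ → AddSubgroup V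
  σ : V →+ V
  dE : V →+ V
  sE : V →+ V
  pr : ℤ → V →+ V
  π : V →+ V
  j : ∀ n, M n →+ V
  q : ∀ n, V →+ M n
  σ_gr : ∀ n, ∀ x ∈ gr n, σ x ∈ gr n
  σ_iter : ∀ x, iter σ p x = x
  dE_gr : ∀ n, ∀ x ∈ gr n, dE x ∈ gr (n - 1)
  sE_gr : ∀ n, ∀ x ∈ gr n, sE x = koszul ℤ (n : ZMod 2) • x
  dE_dE : ∀ x, dE (dE x) = 0
  dE_sE : ∀ x, dE (sE x) = - sE (dE x)
  sE_sE : ∀ x, sE (sE x) = x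
  σ_dE : ∀ x, σ (dE x) = dE (σ x)
  σ_sE : ∀ x, σ (sE x) = sE (σ x)
  pr_self : ∀ n, ∀ x ∈ gr n, pr n x = x
  pr_ne : ∀ n m, n ≠ m → ∀ x ∈ gr n, pr m x = 0
  σ_pr : ∀ n x, σ (pr n x) = pr n (σ x)
  π_gr : ∀ n, ∀ x ∈ gr n, π x ∈ gr n
  tr_π : ∀ n : ℤ, ¬ (p : ℤ) ∣ n → ∀ x ∈ gr n, traceHom p σ π x = x
  tr_π_mul : ∀ n : ℤ, ∀ x ∈ gr (n * p), j n (q n x) + traceHom p σ π x = x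
  j_gr : ∀ n m, j n m ∈ gr (n * p)
  σ_j : ∀ n m, σ (j n m) = ResolutionData.chi p n • j n m
  q_σ : ∀ n x, q n (σ x) = ResolutionData.chi p n • q n x
  q_j : ∀ n m, q n (j n m) = m

open ResolutionData

namespace CycData

variable {p : ℕ} {V : Type v} [AddCommGroup V] {M : ℤ → Type w} [∀ n, AddCommGroup (M n)]
  (D : CycData p V M) (ν : ResolutionData.{u} p)

/-- The differential of `V ⊗ P ⊗ I`. -/
noncomputable def dW : ν.Y V →+ ν.Y V :=
  tri D.dE (.id _) (.id _) + (tri D.sE (.id _) (.id _)).comp (ν.dY V)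

/-- The elements of `V ⊗ P ⊗ I` of degree `n` whose degree in `V` is at most `J`. -/
noncomputable def GD (J n : ℤ) : AddSubgroup (ν.Y V) :=
  triDeg D.gr fun j b c => j ≤ J ∧ j + b + c = n

/-- The elements of `V ⊗ P ⊗ I` of degree `n` whose degree in `V` is `J`. -/
noncomputable def Tp (J n : ℤ) : AddSubgroup (ν.Y V) :=
  triDeg D.gr fun j b c => j = J ∧ j + b + c = n

/-- The invariants. -/
noncomputable def Inv : AddSubgroup (ν.Y V) := (AddMonoidHom.id _ - ν.τ D.σ).ker

/-- The invariant elements of degree `n` whose degree in `V` is at most `J`. -/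
noncomputable def GI (J n : ℤ) : AddSubgroup (ν.Y V) := D.GD ν J n ⊓ D.Inv ν

variable {ν}

lemma mem_Inv {z : ν.Y V} : z ∈ D.Inv ν ↔ ν.τ D.σ z = z := by
  rw [Inv, AddMonoidHom.mem_ker]
  exact (sub_eq_zero (a := z) (b := ν.τ D.σ z)).trans eq_comm

lemma dW_pt (t : V) (x y) : D.dW ν (ν.pt t x y) =
    ν.pt (D.dE t) x y + (ν.pt (D.sE t) (ν.dP x) y + ν.pt (D.sE t) (ν.sP x) (ν.dI y)) := by
  rw [dW, AddMonoidHom.add_apply, AddMonoidHom.comp_apply, dY_pt, map_add]; rfl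

lemma GD_mono {J J' n : ℤ} (h : J ≤ J') : D.GD ν J n ≤ D.GD ν J' n :=
  triDeg_mono fun _ _ _ h' _ _ => by omega

lemma GI_mono {J J' n : ℤ} (h : J ≤ J') : D.GI ν J n ≤ D.GI ν J' n :=
  inf_le_inf_right _ (D.GD_mono h)

lemma Tp_le {J n : ℤ} : D.Tp ν J n ≤ D.GD ν J n := triDeg_mono fun _ _ _ h' _ _ => by omega

lemma dW_GD {J n m : ℤ} (h : m + 1 = n) {z : ν.Y V} (hz : z ∈ D.GD ν J n) :
    D.dW ν z ∈ D.GD ν J m := by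
  refine map_triDeg _ _ (fun j b c h' _ _ t ht x hx y hy => ?_) hz
  rw [dW_pt, D.sE_gr _ t ht]
  exact add_mem (pt_mem_triDeg (j := j - 1) (b := b) (c := c) (by omega) (D.dE_gr _ t ht) hx hy)
    (add_mem (pt_mem_triDeg (j := j) (b := b - 1) (c := c) (by omega) (zsmul_mem ht _)
      (dP_deg (by omega) hx) hy) (pt_mem_triDeg (j := j) (b := b) (c := c - 1) (by omega)
        (zsmul_mem ht _) (sP_deg hx) (dI_deg (by omega) hy)))

lemma dW_dW (z : ν.Y V) : D.dW ν (D.dW ν z) = 0 := by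
  induction z using Y_induction with
  | pt t x y =>
    simp only [dW_pt, map_add, D.dE_dE, D.dE_sE, D.sE_sE, dP_dP, dI_dI, dP_sP, sP_sP, map_zero,
      map_neg, AddMonoidHom.neg_apply, AddMonoidHom.zero_apply]
    abel
  | add w z hw hz => simp only [map_add, hw, hz, add_zero]

lemma τ_dW (z : ν.Y V) : ν.τ D.σ (D.dW ν z) = D.dW ν (ν.τ D.σ z) := by
  induction z using Y_induction with
  | pt t x y => simp only [dW_pt, map_add, τ_pt, D.σ_dE, D.σ_sE, σP_dP, σP_sP, σI_dI]
  | add w z hw hz => simp only [map_add, hw, hz]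

lemma dW_Inv {z : ν.Y V} (hz : z ∈ D.Inv ν) : D.dW ν z ∈ D.Inv ν := by
  rw [mem_Inv] at hz ⊢
  rw [τ_dW, hz]

variable (ν) in
/-- The projection to the part whose degree in `V` is `J`. -/
noncomputable def top (J : ℤ) : ν.Y V →+ ν.Y V := tri (D.pr J) (.id _) (.id _)

lemma top_GD {J n : ℤ} {z : ν.Y V} (hz : z ∈ D.GD ν J n) :
    D.top ν J z ∈ D.Tp ν J n ∧ z - D.top ν J z ∈ D.GD ν (J - 1) n := by
  have hT : ∀ j b c, j ≤ J ∧ j + b + c = n → ∀ t ∈ D.gr j, ∀ x ∈ ν.P.deg b, ∀ y ∈ ν.I.deg c,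
      D.top ν J (ν.pt t x y) ∈ D.Tp ν J n ∧
        ν.pt t x y - D.top ν J (ν.pt t x y) ∈ D.GD ν (J - 1) n := by
    intro j b c h t ht x hx y hy
    rw [top, tri_pt]
    by_cases hj : j = J
    · subst hj
      rw [D.pr_self _ t ht]
      exact ⟨pt_mem_triDeg (j := j) ⟨rfl, h.2⟩ ht hx hy, by simp⟩
    · rw [D.pr_ne _ _ hj t ht, map_zero]
      refine ⟨by simp, ?_⟩
      rw [AddMonoidHom.zero_apply, AddMonoidHom.zero_apply, sub_zero]
      exact pt_mem_triDeg (j := j) (by omega) ht hx hy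
  exact ⟨map_triDeg _ _ (fun j b c h _ _ t ht x hx y hy => (hT j b c h t ht x hx y hy).1) hz,
    map_triDeg (AddMonoidHom.id _ - D.top ν J) _
      (fun j b c h _ _ t ht x hx y hy => (hT j b c h t ht x hx y hy).2) hz⟩

lemma top_Tp {J n : ℤ} {z : ν.Y V} (hz : z ∈ D.Tp ν J n) : D.top ν J z = z := by
  refine sub_eq_zero.mp ((AddSubgroup.mem_bot (G := ν.Y V)).mp
    (map_triDeg (D.top ν J - AddMonoidHom.id _) ⊥ (fun j b c h _ _ t ht x _ y _ => ?_) hz))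
  obtain ⟨rfl, -⟩ := h
  rw [AddMonoidHom.sub_apply, top, tri_pt, D.pr_self _ t ht]
  exact sub_eq_zero.mpr rfl

lemma top_lower {J n : ℤ} {z : ν.Y V} (hz : z ∈ D.GD ν (J - 1) n) : D.top ν J z = 0 := by
  refine (AddSubgroup.mem_bot (G := ν.Y V)).mp
    (map_triDeg _ ⊥ (fun j b c h _ _ t ht x _ y _ => ?_) hz)
  rw [top, tri_pt, D.pr_ne _ _ (by omega) t ht, map_zero]
  exact zero_mem _

lemma τ_top (J : ℤ) (z : ν.Y V) : ν.τ D.σ (D.top ν J z) = D.top ν J (ν.τ D.σ z) := by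
  rw [top, τ, tri_tri, tri_tri]
  congr 1
  exact Y_hom_ext fun t x y => by simp [D.σ_pr]

lemma top_Inv {J : ℤ} {z : ν.Y V} (hz : z ∈ D.Inv ν) : D.top ν J z ∈ D.Inv ν := by
  rw [mem_Inv] at hz ⊢
  rw [τ_top, hz]

lemma dY_Tp {J n m : ℤ} (h : m + 1 = n) {z : ν.Y V} (hz : z ∈ D.Tp ν J n) :
    ν.dY V z ∈ D.Tp ν J m :=
  dY_triDeg (fun _ _ _ _ => by omega) (fun _ _ _ _ => by omega) hz

lemma dW_Tp {J n m : ℤ} (h : m + 1 = n) {z : ν.Y V} (hz : z ∈ D.Tp ν J n) :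
    D.dW ν z - koszul ℤ (J : ZMod 2) • ν.dY V z ∈ D.GD ν (J - 1) m := by
  refine map_triDeg (D.dW ν - koszul ℤ (J : ZMod 2) • ν.dY V) _
    (fun j b c h' _ _ t ht x hx y hy => ?_) hz
  obtain ⟨rfl, h2⟩ := h'
  have e : (D.dW ν - koszul ℤ (j : ZMod 2) • ν.dY V) (ν.pt t x y) = ν.pt (D.dE t) x y := by
    rw [AddMonoidHom.sub_apply, AddMonoidHom.smul_apply, dW_pt, dY_pt, D.sE_gr _ t ht, map_zsmul,
      smul_add]
    simp
  rw [e]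
  exact pt_mem_triDeg (j := j - 1) (b := b) (c := c) (by omega) (D.dE_gr _ t ht) hx hy

lemma koszul_zsmul_self {Y : Type*} [AddCommGroup Y] (e : ZMod 2) (z : Y) :
    koszul ℤ e • koszul ℤ e • z = z := by
  rw [smul_smul, koszul_mul_self, one_smul]

lemma top_dW {J n : ℤ} {z : ν.Y V} (hz : z ∈ D.GD ν J n) :
    D.top ν J (D.dW ν z) = koszul ℤ (J : ZMod 2) • ν.dY V (D.top ν J z) := by
  obtain ⟨h1, h2⟩ := D.top_GD hz
  have h3 := D.top_lower (D.dW_GD (sub_add_cancel n 1) h2)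
  have h4 := D.top_lower (D.dW_Tp (sub_add_cancel n 1) h1)
  rw [map_sub, map_sub, sub_eq_zero] at h3
  rw [map_sub, sub_eq_zero, map_zsmul, D.top_Tp (D.dY_Tp (sub_add_cancel n 1) h1)] at h4
  rw [h3, h4]

lemma dY_top {J n : ℤ} {z : ν.Y V} (hz : z ∈ D.GD ν J n) (hd : D.dW ν z ∈ D.GD ν (J - 1) (n - 1)) :
    ν.dY V (D.top ν J z) = 0 := by
  have := D.top_dW hz
  rw [D.top_lower hd] at this
  rw [← koszul_zsmul_self (J : ZMod 2) (ν.dY V _), ← this, smul_zero]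

/-- A boundary in `P ⊗ I` is a boundary modulo the elements of lower degree in `V`. -/
lemma exists_dW {J n : ℤ} {y : ν.Y V} (hy : y ∈ D.Tp ν J (n + 1)) (hy' : y ∈ D.Inv ν) :
    ∃ y' ∈ D.GI ν J (n + 1), ν.dY V y - D.dW ν y' ∈ D.GD ν (J - 1) n := by
  refine ⟨koszul ℤ (J : ZMod 2) • y, zsmul_mem (show y ∈ D.GI ν J (n + 1) from ⟨D.Tp_le hy, hy'⟩) _, ?_⟩
  have := zsmul_mem (D.dW_Tp rfl hy) (koszul ℤ (J : ZMod 2))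
  rw [smul_sub, koszul_zsmul_self, ← map_zsmul] at this
  have := neg_mem this
  rwa [neg_sub] at this

lemma normHom_Inv (z : ν.Y V) : normHom p (ν.τ D.σ) z ∈ D.Inv ν :=
  (AddMonoidHom.mem_ker).mpr (sub_normHom' (τ_iter D.σ_iter) z)

lemma τ_Tp {J n : ℤ} {z : ν.Y V} (hz : z ∈ D.Tp ν J n) : ν.τ D.σ z ∈ D.Tp ν J n :=
  τ_mem D.σ_gr hz

lemma tri_Tp {J n : ℤ} {f : V →+ V} (hf : ∀ n, ∀ x ∈ D.gr n, f x ∈ D.gr n) {z : ν.Y V}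
    (hz : z ∈ D.Tp ν J n) : tri f (.id _) (.id _) z ∈ D.Tp ν J n :=
  tri_mem 0 0 0 (fun j t ht => by rw [add_zero]; exact hf j t ht)
    (fun b x hx => by rw [add_zero]; exact hx) (fun c y hy => by rw [add_zero]; exact hy)
    (fun j b c h _ _ => by simpa only [add_zero] using h) hz

lemma traceHom_tri (z : ν.Y V) : traceHom p (ν.τ D.σ) (tri D.π (.id _) (.id _)) z =
    tri (traceHom p D.σ D.π) (.id _) (.id _) z := by
  induction z using Y_induction with
  | add w z hw hz => rw [map_add, map_add, hw, hz]
  | pt t x y =>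
  rw [traceHom_apply, tri_pt, traceHom_apply, map_sum, AddMonoidHom.finsetSum_apply,
    AddMonoidHom.finsetSum_apply]
  refine Finset.sum_congr rfl fun i hi => ?_
  simp only [τ_iter_pt, tri_pt, AddMonoidHom.id_apply]
  rw [iter_cancel ν.σP_iter hi, iter_cancel ν.σI_iter hi]

/-- An invariant cycle that is a trace is the boundary of an invariant element. -/
lemma exists_trace_boundary (O : ν.Ops) {J n : ℤ} {z : ν.Y V} (hz : z ∈ D.Tp ν J n)
    (hz' : z ∈ D.Inv ν) (hd : ν.dY V z = 0) : ∃ y ∈ D.Tp ν J (n + 1), y ∈ D.Inv ν ∧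
      ν.dY V y = tri (traceHom p D.σ D.π) (.id _) (.id _) z := by
  let T := tateOps O D.σ D.σ_iter
  have hπ := D.tri_Tp D.π_gr hz
  have hdπ : ν.dY V (tri D.π (.id _) (.id _) z) = 0 := by rw [← tri_dY, hd, map_zero]
  have hh : tri (.id _) O.hP (.id _) (tri D.π (.id _) (.id _) z) ∈ D.Tp ν J (n + 1) :=
    tri_mem 0 1 0 (fun j t ht => by rw [add_zero]; exact ht) O.hP_deg
      (fun c y hy => by rw [add_zero]; exact hy) (fun _ _ _ h _ _ => by omega) hπ
  refine ⟨normHom p (ν.τ D.σ) (T.h (tri D.π (.id _) (.id _) z)),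
    normHom_mem (fun z hz => D.τ_Tp hz) _ hh, D.normHom_Inv _, ?_⟩
  rw [map_normHom dY_τ]
  have : ν.dY V (T.h (tri D.π (.id _) (.id _) z)) = tri D.π (.id _) (.id _) z :=
    T.d_h_of_cycle hdπ
  rw [this, ← traceHom_tri, traceHom_of_fix (D.mem_Inv.mp hz')]

/-- The reduction of the degree in `V` by one, if it is not divisible by `p`. -/
lemma exists_reduce_one (O : ν.Ops) {J n : ℤ} (hJ : ¬ (p : ℤ) ∣ J) {w : ν.Y V} (hw : w ∈ D.GI ν J n)
    (hd : D.dW ν w ∈ D.GD ν (J - 1) (n - 1)) :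
    ∃ y ∈ D.GI ν J (n + 1), w - D.dW ν y ∈ D.GI ν (J - 1) n := by
  obtain ⟨h1, h2⟩ := D.top_GD hw.1
  obtain ⟨y, hy, hy', e⟩ := D.exists_trace_boundary O h1 (D.top_Inv hw.2) (D.dY_top hw.1 hd)
  obtain ⟨y', hy1, hy2⟩ := D.exists_dW hy hy'
  have e2 : tri (traceHom p D.σ D.π) (.id _) (.id _) (D.top ν J w) = D.top ν J w := by
    refine sub_eq_zero.mp ((AddSubgroup.mem_bot (G := ν.Y V)).mp (map_triDeg
      (tri (traceHom p D.σ D.π) (.id _) (.id _) - AddMonoidHom.id _) ⊥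
        (fun j b c h _ _ t ht x _ y _ => ?_) h1))
    obtain ⟨rfl, -⟩ := h
    rw [AddMonoidHom.sub_apply, tri_pt, D.tr_π _ hJ t ht]
    exact sub_eq_zero.mpr rfl
  rw [e, e2] at hy2
  refine ⟨y', hy1, ?_, AddSubgroup.sub_mem (D.Inv ν) hw.2 (D.dW_Inv hy1.2)⟩
  have := add_mem h2 hy2
  rwa [sub_add_sub_cancel] at this

/-- The reduction of the degree in `V` to a multiple of `p`. -/
lemma exists_reduce_mul (O : ν.Ops) {J n m : ℤ} (h1 : (m - 1) * p ≤ J) (h2 : J < m * p) {w : ν.Y V}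
    (hw : w ∈ D.GI ν J n) (hd : D.dW ν w ∈ D.GD ν ((m - 1) * p) (n - 1)) :
    ∃ y ∈ D.GI ν J (n + 1), w - D.dW ν y ∈ D.GI ν ((m - 1) * p) n := by
  obtain ⟨i, hi⟩ := Int.le.dest h1
  induction i generalizing J w with
  | zero =>
    rw [Nat.cast_zero, add_zero] at hi
    exact ⟨0, zero_mem _, by rwa [map_zero, sub_zero, hi]⟩
  | succ i ih =>
    push_cast at hi
    have hJ : ¬ (p : ℤ) ∣ J := by
      rintro ⟨l, rfl⟩
      have hp : (0 : ℤ) < p := by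
        rcases Nat.eq_zero_or_pos p with h | h
        · simp only [h, Nat.cast_zero, mul_zero, zero_mul] at h2 h1; omega
        · exact_mod_cast h
      have h3 : m - 1 < l := by
        by_contra hl
        have : (p : ℤ) * l ≤ (m - 1) * p := by
          rw [mul_comm]; exact mul_le_mul_of_nonneg_right (by omega) hp.le
        omega
      have h4 : l < m := by
        rw [mul_comm] at h2
        exact lt_of_mul_lt_mul_right h2 hp.le
      omega
    obtain ⟨y, hy, hw'⟩ := D.exists_reduce_one O hJ hw (D.GD_mono (by omega) hd)
    obtain ⟨y', hy', hw''⟩ := ih (by omega) (by omega) hw' (by rwa [map_sub, dW_dW, sub_zero])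
      (by omega)
    exact ⟨y + y', add_mem hy (D.GI_mono (by omega) hy'), by rwa [map_add, ← sub_sub]⟩

section quotient

variable (O : ν.Ops) {n N : ℤ}

variable (ν n) in
/-- The projection to the non-free part in degree `n p`. -/
noncomputable def qY : ν.Y V →+ ν.Y (M n) := tri (D.q n) (.id _) (.id _)

variable (ν n) in
/-- The inclusion of the non-free part in degree `n p`. -/
noncomputable def jY : ν.Y (M n) →+ ν.Y V := tri (D.j n) (.id _) (.id _)

lemma qY_jY (z : ν.Y (M n)) : D.qY ν n (D.jY ν n z) = z := by
  rw [qY, jY, tri_tri]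
  conv_rhs => rw [← AddMonoidHom.id_apply _ z]
  congr 1
  exact Y_hom_ext fun t x y => by simp [D.q_j]

lemma qY_τ (z : ν.Y V) : D.qY ν n (ν.τ D.σ z) = ν.τ (zs (M n) (chi p n)) (D.qY ν n z) := by
  rw [qY, τ, τ, tri_tri, tri_tri]
  congr 1
  exact Y_hom_ext fun t x y => by simp [D.q_σ, zs_apply]

lemma jY_τ (z : ν.Y (M n)) : D.jY ν n (ν.τ (zs (M n) (chi p n)) z) = ν.τ D.σ (D.jY ν n z) := by
  rw [jY, τ, τ, tri_tri, tri_tri]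
  congr 1
  exact Y_hom_ext fun t x y => by simp [D.σ_j, zs_apply]

lemma jY_Tp {k : ℤ} (hk : k + n * p = N) {z : ν.Y (M n)} (hz : z ∈ ν.dg (M n) k) :
    D.jY ν n z ∈ D.Tp ν (n * p) N := by
  refine map_triDeg _ _ (fun j b c h _ _ t _ x hx y hy => ?_) hz
  rw [jY, tri_pt]
  exact pt_mem_triDeg (j := n * p) (by omega) (D.j_gr n t) hx hy

lemma qY_dg {k : ℤ} (hk : k + n * p = N) {z : ν.Y V} (hz : z ∈ D.Tp ν (n * p) N) :
    D.qY ν n z ∈ ν.dg (M n) k := by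
  refine map_triDeg _ _ (fun j b c h _ _ t _ x hx y hy => ?_) hz
  rw [qY, tri_pt]
  exact pt_mem_triDeg (j := n * p) (by omega) (AddSubgroup.mem_top _) hx hy

include O in
/-- An invariant element of filtration `n p` that is a cycle modulo lower terms is homologous, modulo
lower terms, to its non-free part. -/
lemma exists_reduce_jY {k : ℤ} (hk : k + n * p = N) {w : ν.Y V} (hw : w ∈ D.GI ν (n * p) N)
    (hd : D.dW ν w ∈ D.GD ν (n * p - 1) (N - 1)) {z₀ y₀ : ν.Y (M n)}
    (hy₀ : y₀ ∈ ν.dg (M n) (k + 1)) (hy₀' : ν.τ (zs (M n) (chi p n)) y₀ = y₀)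
    (he : D.qY ν n (D.top ν (n * p) w) = z₀ + ν.dY (M n) y₀) :
    ∃ y ∈ D.GI ν (n * p) (N + 1), w - D.jY ν n z₀ - D.dW ν y ∈ D.GD ν (n * p - 1) N := by
  obtain ⟨h1, h2⟩ := D.top_GD hw.1
  obtain ⟨y, hy, hy', e⟩ := D.exists_trace_boundary O h1 (D.top_Inv hw.2) (D.dY_top hw.1 hd)
  have e2 : D.jY ν n (D.qY ν n (D.top ν (n * p) w)) +
      tri (traceHom p D.σ D.π) (.id _) (.id _) (D.top ν (n * p) w) = D.top ν (n * p) w := by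
    refine sub_eq_zero.mp ((AddSubgroup.mem_bot (G := ν.Y V)).mp (map_triDeg
      ((D.jY ν n).comp (D.qY ν n) + tri (traceHom p D.σ D.π) (.id _) (.id _) - AddMonoidHom.id _) ⊥
        (fun j b c h _ _ t ht x _ y _ => ?_) h1))
    obtain ⟨rfl, -⟩ := h
    rw [AddMonoidHom.sub_apply, AddMonoidHom.add_apply, AddMonoidHom.comp_apply, jY, qY, tri_pt,
      tri_pt, tri_pt, AddMonoidHom.id_apply, AddMonoidHom.id_apply, AddMonoidHom.id_apply,
      AddMonoidHom.id_apply, AddMonoidHom.id_apply, ← AddMonoidHom.add_apply,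
      ← AddMonoidHom.add_apply, ← map_add, D.tr_π_mul _ t ht]
    exact sub_eq_zero.mpr rfl
  obtain ⟨y', hy1, hy2⟩ := D.exists_dW (add_mem (D.jY_Tp (by omega) hy₀) hy)
    (add_mem (D.mem_Inv.mpr (by rw [← jY_τ, hy₀'])) hy')
  refine ⟨y', hy1, ?_⟩
  have e3 : D.top ν (n * p) w = D.jY ν n z₀ + ν.dY V (D.jY ν n y₀ + y) := by
    rw [map_add, e, jY, ← tri_dY, ← add_assoc]
    change _ = (D.jY ν n z₀ + D.jY ν n (ν.dY _ y₀)) + _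
    rw [← map_add, ← he, e2]
  have := add_mem h2 hy2
  rw [e3] at this
  convert this using 1; abel

lemma qY_top_cycle {k : ℤ} (hk : k + n * p = N) {w : ν.Y V} (hw : w ∈ D.GI ν (n * p) N)
    (hd : D.dW ν w ∈ D.GD ν (n * p - 1) (N - 1)) :
    D.qY ν n (D.top ν (n * p) w) ∈ ν.dg (M n) k ∧ ν.dY _ (D.qY ν n (D.top ν (n * p) w)) = 0 ∧
      ν.τ (zs (M n) (chi p n)) (D.qY ν n (D.top ν (n * p) w)) = D.qY ν n (D.top ν (n * p) w) :=
  ⟨D.qY_dg hk (D.top_GD hw.1).1, by rw [qY, ← tri_dY, D.dY_top hw.1 hd, map_zero], by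
    rw [← qY_τ, D.mem_Inv.mp (D.top_Inv hw.2)]⟩

/-- A boundary of filtration `n p` in the non-free part. -/
lemma exists_dY_eq {k : ℤ} (hk : k + n * p = N) {z₀ : ν.Y (M n)} (hz₀ : z₀ ∈ ν.dg (M n) k) {y : ν.Y V}
    (hy : y ∈ D.GI ν (n * p) (N + 1)) (h : D.jY ν n z₀ - D.dW ν y ∈ D.GD ν (n * p - 1) N) :
    ∃ y₀ ∈ ν.dg (M n) (k + 1), ν.τ (zs (M n) (chi p n)) y₀ = y₀ ∧ z₀ = ν.dY (M n) y₀ := by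
  have h1 := D.top_lower h
  rw [map_sub, sub_eq_zero, D.top_Tp (D.jY_Tp hk hz₀), D.top_dW hy.1, ← map_zsmul] at h1
  refine ⟨D.qY ν n (koszul ℤ ((n * p : ℤ) : ZMod 2) • D.top ν (n * p) y),
    D.qY_dg (by omega) (zsmul_mem (D.top_GD hy.1).1 _), ?_, ?_⟩
  · rw [← qY_τ, map_zsmul, D.mem_Inv.mp (D.top_Inv hy.2)]
  · have h2 := congrArg (D.qY ν n) h1
    rw [qY_jY] at h2
    rw [h2, qY, tri_dY]

end quotient

end CycData

end CyclicPower

namespace CyclicPower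

open ResolutionData

/-- The elements `c n` represent generators of the Tate cohomology. -/
def ResolutionData.IsGenSeq {p : ℕ} [Fact p.Prime] {ν : ResolutionData.{u} p} (O : ν.Ops)
    (c : ℤ → ν.Y ℤ) : Prop :=
  ∀ n, GenAt O (chi_pow n) ℤ (-n * (p - 1)) (c n) ∧
    ∀ (M : Type w) [AddCommGroup M], GenAt O (chi_pow n) M (-n * (p - 1)) (c n)

namespace CycData

variable {p : ℕ} [Fact p.Prime] {V : Type v} [AddCommGroup V] {M : ℤ → Type w}
  [∀ n, AddCommGroup (M n)] (D : CycData p V M) {ν : ResolutionData.{u} p} {O : ν.Ops}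
  {c : ℤ → ν.Y ℤ} (hc : IsGenSeq.{u, w} O c)

/-- The elements of degree `n p` that the generator multiplies by the sign `chi p n`. -/
def Eig (n : ℤ) (t : V) : Prop := t ∈ D.gr (n * p) ∧ D.σ t = chi p n • t

lemma Eig_j (n : ℤ) (m : M n) : D.Eig n (D.j n m) := ⟨D.j_gr n m, D.σ_j n m⟩

lemma act_one (z : ν.Y ℤ) : act (1 : ℤ) z = z := by
  induction z using Y_induction with
  | pt n x y => rw [act_pt, smul_eq_mul, mul_one]
  | add w z hw hz => rw [map_add, hw, hz]

lemma deg_of_eq {n : ℤ} : -n * ((p : ℤ) - 1) + n * p = n := by ring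

section

include hc

lemma c_dg (n : ℤ) : c n ∈ ν.dg ℤ (-n * (p - 1)) := by
  have := (hc n).1.deg 1
  rwa [actHom_apply, act_one] at this

lemma dY_c (n : ℤ) : ν.dY ℤ (c n) = 0 := by
  have := (hc n).1.d_C 1
  rwa [actHom_apply, act_one] at this

lemma τ_c (n : ℤ) : ν.τ (zs ℤ (chi p n)) (c n) = c n := by
  have := (hc n).1.α_C 1
  rw [actHom_apply, act_one] at this
  exact (sub_eq_zero.mp this).symm

end

lemma tri_act {V V' : Type*} [AddCommGroup V] [AddCommGroup V'] (f : V →+ V') (g e) (t : V)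
    (z : ν.Y ℤ) : tri f g e (act t z) = act (f t) (tri (.id _) g e z) := by
  rw [act, act, tri_tri, tri_tri]
  congr 1
  exact Y_hom_ext fun t x y => by simp

lemma act_smul {V : Type*} [AddCommGroup V] (r : ℤ) (t : V) (z : ν.Y ℤ) :
    act (r • t) z = r • act t z := map_zsmul (actHom V z) r t

lemma act_τ_eig {n : ℤ} {t : V} (ht : D.Eig n t) (z : ν.Y ℤ) :
    ν.τ D.σ (act t z) = act t (ν.τ (zs ℤ (chi p n)) z) := by
  rw [τ, tri_act, ht.2, act, act, τ, tri_tri, tri_tri]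
  congr 1
  exact Y_hom_ext fun t x y => by simp [zs_apply, smul_smul, mul_comm]

lemma act_Tp {n k N : ℤ} (hk : k + n * p = N) {t : V} (ht : t ∈ D.gr (n * p)) {z : ν.Y ℤ}
    (hz : z ∈ ν.dg ℤ k) : act t z ∈ D.Tp ν (n * p) N := by
  refine map_triDeg _ _ (fun j b c h _ _ m _ x hx y hy => ?_) hz
  rw [act_pt]
  exact pt_mem_triDeg (j := n * p) (by omega) (zsmul_mem ht m) hx hy

/-- The class of `z` is the class of `t ⊗ c`, modulo lower terms. -/
def Rel (c : ℤ → ν.Y ℤ) (n : ℤ) (z : ν.Y V) (t : V) : Prop :=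
  ∃ y ∈ D.GI ν (n * p) (n + 1), z - act t (c n) - D.dW ν y ∈ D.GD ν (n * p - 1) n

variable {D} in
lemma Rel.add {n : ℤ} {z z' : ν.Y V} {t t' : V} (h : D.Rel c n z t) (h' : D.Rel c n z' t') :
    D.Rel c n (z + z') (t + t') := by
  obtain ⟨y, hy, h⟩ := h
  obtain ⟨y', hy', h'⟩ := h'
  refine ⟨y + y', add_mem hy hy', ?_⟩
  have := add_mem h h'
  convert this using 1
  rw [← actHom_apply, map_add, map_add, actHom_apply, actHom_apply]; abel

variable {D} in
lemma Rel.neg {n : ℤ} {z : ν.Y V} {t : V} (h : D.Rel c n z t) : D.Rel c n (-z) (-t) := by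
  obtain ⟨y, hy, h⟩ := h
  refine ⟨-y, neg_mem hy, ?_⟩
  have := neg_mem h
  convert this using 1
  rw [← actHom_apply, map_neg, map_neg, actHom_apply]; abel

variable {D} in
lemma Rel.sub {n : ℤ} {z z' : ν.Y V} {t t' : V} (h : D.Rel c n z t) (h' : D.Rel c n z' t') :
    D.Rel c n (z - z') (t - t') := by
  rw [sub_eq_add_neg, sub_eq_add_neg]; exact h.add h'.neg

lemma Rel_self (n : ℤ) (t : V) : D.Rel c n (act t (c n)) t :=
  ⟨0, zero_mem _, by rw [sub_self, map_zero, sub_zero]; exact zero_mem _⟩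

lemma Rel_zero_right {n : ℤ} {z : ν.Y V} :
    D.Rel c n z 0 ↔ ∃ y ∈ D.GI ν (n * p) (n + 1), z - D.dW ν y ∈ D.GD ν (n * p - 1) n := by
  have h : act (0 : V) (c n) = 0 := map_zero (actHom V (c n))
  rw [Rel, h, sub_zero]

lemma Rel_of_mem {n : ℤ} {z : ν.Y V} (hz : z ∈ D.GD ν (n * p - 1) n) : D.Rel c n z 0 :=
  D.Rel_zero_right.mpr ⟨0, zero_mem _, by rwa [map_zero, sub_zero]⟩

lemma Rel_dW {n : ℤ} {y : ν.Y V} (hy : y ∈ D.GI ν (n * p) (n + 1)) : D.Rel c n (D.dW ν y) 0 :=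
  D.Rel_zero_right.mpr ⟨y, hy, by rw [sub_self]; exact zero_mem _⟩

include hc

lemma act_GI {n : ℤ} {t : V} (ht : D.Eig n t) : act t (c n) ∈ D.GI ν (n * p) n :=
  ⟨D.Tp_le (D.act_Tp deg_of_eq ht.1 (c_dg hc n)), D.mem_Inv.mpr (by
    rw [D.act_τ_eig ht, τ_c hc])⟩

lemma dW_act {n : ℤ} {t : V} (ht : D.Eig n t) :
    D.dW ν (act t (c n)) ∈ D.GD ν (n * p - 1) (n - 1) := by
  have := D.dW_Tp (sub_add_cancel n 1) (D.act_Tp deg_of_eq ht.1 (c_dg hc n))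
  rwa [← act_dY, dY_c hc, map_zero, smul_zero, sub_zero] at this

/-- An invariant cycle in `P ⊗ I` is a multiple of the generator. -/
lemma exists_act_add {n : ℤ} {z : ν.Y (M n)} (hz : z ∈ ν.dg (M n) (-n * (p - 1)))
    (hd : ν.dY (M n) z = 0) (hτ : ν.τ (zs (M n) (chi p n)) z = z) :
    ∃ m, ∃ y ∈ ν.dg (M n) (-n * (p - 1) + 1), ν.τ (zs (M n) (chi p n)) y = y ∧
      z = act m (c n) + ν.dY (M n) y := by
  let T := chiOps O (M n) (chi_pow (p := p) n)
  obtain ⟨m, w, hw, hdw, e⟩ := ((hc n).2 (M n)).gen z hz hd (sub_eq_zero.mpr hτ.symm)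
  refine ⟨m, T.β (T.h w), T.β_deg _ _ (T.h_deg _ _ rfl _ hw),
    (sub_eq_zero.mp (T.α_β (T.h w))).symm, ?_⟩
  have e2 : T.d (T.β (T.h w)) = T.β w := by rw [T.d_β, T.d_h_of_cycle hdw]
  rw [e]
  exact congrArg (_ + ·) e2.symm

lemma exists_rel {n : ℤ} {z : ν.Y V} (hz : z ∈ D.GI ν (n * p) n)
    (hd : D.dW ν z ∈ D.GD ν (n * p - 1) (n - 1)) : ∃ m, D.Rel c n z (D.j n m) := by
  obtain ⟨h1, h2, h3⟩ := D.qY_top_cycle deg_of_eq hz hd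
  obtain ⟨m, y, hy, hy', e⟩ := exists_act_add hc h1 h2 h3
  obtain ⟨y', hy1, hy2⟩ := D.exists_reduce_jY O deg_of_eq hz hd hy hy' e
  refine ⟨m, y', hy1, ?_⟩
  rwa [jY, tri_act, show tri (.id _) (.id _) (.id _) (c n) = c n from ?_] at hy2
  exact DFunLike.congr_fun (Y_hom_ext fun _ _ _ => rfl : tri _ _ _ = AddMonoidHom.id _) _

lemma jY_act {n : ℤ} (m : M n) : D.jY ν n (act m (c n)) = act (D.j n m) (c n) := by
  rw [jY, tri_act]
  congr 1
  exact DFunLike.congr_fun (Y_hom_ext fun _ _ _ => rfl : tri _ _ _ = AddMonoidHom.id _) _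

lemma Rel_eig {n : ℤ} {t : V} (ht : D.Eig n t) : D.Rel c n (act t (c n)) (D.j n (D.q n t)) := by
  have hT := D.act_Tp deg_of_eq ht.1 (c_dg hc n)
  obtain ⟨y', hy1, hy2⟩ := D.exists_reduce_jY O deg_of_eq (D.act_GI hc ht) (D.dW_act hc ht)
    (z₀ := act (D.q n t) (c n)) (y₀ := 0) (zero_mem _) (map_zero _) (by
      rw [D.top_Tp hT, qY, tri_act, map_zero, add_zero]
      congr 1
      exact DFunLike.congr_fun (Y_hom_ext fun _ _ _ => rfl : tri _ _ _ = AddMonoidHom.id _) _)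
  exact ⟨y', hy1, by rwa [D.jY_act hc] at hy2⟩

lemma exists_smul_of_rel {n : ℤ} {m : M n} (h : D.Rel c n 0 (D.j n m)) : ∃ m', m = p • m' := by
  let T := chiOps O (M n) (chi_pow (p := p) n)
  obtain ⟨y, hy, h⟩ := h
  rw [zero_sub, ← D.jY_act hc] at h
  have h := neg_mem h
  obtain ⟨y₀, hy₀, hy₀', e⟩ := D.exists_dY_eq deg_of_eq (((hc n).2 (M n)).deg m) (neg_mem hy) (by
    convert h using 1
    rw [map_neg, actHom_apply]; abel)
  refine ((hc n).2 (M n)).rel m (T.d (T.r y₀)) (T.d_deg _ _ rfl _ (T.r_deg _ _ hy₀)) (T.d_d _) ?_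
  refine e.trans ?_
  change _ = T.β (T.d (T.r y₀))
  rw [← T.d_β, T.β_r _ (sub_eq_zero.mpr hy₀'.symm)]; rfl

lemma Rel_smul {n : ℤ} (m : M n) : D.Rel c n 0 (D.j n (p • m)) := by
  let T := chiOps O (M n) (chi_pow (p := p) n)
  have h := (hc n).2 (M n)
  have hα : ν.τ (zs (M n) (chi p n)) (act m (c n)) = act m (c n) :=
    (sub_eq_zero.mp (h.α_C m)).symm
  have e1 : T.d (T.β (T.h (act m (c n)))) = act (p • m) (c n) := by
    rw [T.d_β, T.d_h_of_cycle (show T.d (act m (c n)) = 0 from h.d_C m)]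
    refine (normHom_apply _).trans ?_
    rw [Finset.sum_congr rfl fun i _ => iter_of_fix hα i, Finset.sum_const, Finset.card_range]
    exact (map_nsmul (actHom (M n) (c n)) p m).symm
  obtain ⟨y, hy, hy'⟩ := D.exists_dW (D.jY_Tp (N := n + 1) (by ring)
      (T.β_deg _ _ (T.h_deg _ _ rfl _ (h.deg m))))
    (D.mem_Inv.mpr (by rw [← jY_τ]; exact congrArg _ (sub_eq_zero.mp (T.α_β _)).symm))
  rw [jY, ← tri_dY] at hy'
  change D.jY ν n (T.d (T.β (T.h (act m (c n))))) - _ ∈ _ at hy'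
  rw [e1, D.jY_act hc] at hy'
  refine ⟨-y, neg_mem hy, ?_⟩
  have := neg_mem hy'
  convert this using 1
  rw [map_neg]; abel

lemma Rel_congr {n : ℤ} {z : ν.Y V} {t t' : V} (ht : D.Eig n t) (ht' : D.Eig n t')
    (h : D.q n t = D.q n t') (hz : D.Rel c n z t) : D.Rel c n z t' := by
  have h1 := ((D.Rel_self n t').sub (D.Rel_eig hc ht')).sub
    ((D.Rel_self n t).sub (D.Rel_eig hc ht))
  have := hz.add h1
  rw [h] at this
  simpa using this

lemma Rel_unique {n : ℤ} {z : ν.Y V} {m m' : M n} (h : D.Rel c n z (D.j n m))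
    (h' : D.Rel c n z (D.j n m')) : ∃ m'', m - m' = p • m'' := by
  have := h.sub h'
  rw [sub_self, ← map_sub] at this
  exact D.exists_smul_of_rel hc this

/-- The correction of an invariant element by lower terms. -/
lemma exists_lift {n : ℤ} (m : M n) : ∃ z ∈ D.GI ν (n * p) n,
    D.dW ν z ∈ D.GI ν ((n - 1) * p) (n - 1) ∧ D.Rel c n z (D.j n m) := by
  have h1 := D.act_GI hc (D.Eig_j n m)
  have hp : (0 : ℤ) < p := by exact_mod_cast (Fact.out : p.Prime).pos
  obtain ⟨y, hy, hy'⟩ := D.exists_reduce_mul O (m := n) (J := n * p - 1) (n := n - 1)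
    (by rw [sub_mul]; omega) (by omega)
    ⟨D.dW_act hc (D.Eig_j n m), D.dW_Inv h1.2⟩ (by rw [dW_dW]; exact zero_mem _)
  rw [sub_add_cancel] at hy
  refine ⟨act (D.j n m) (c n) - y, sub_mem h1 (D.GI_mono (by omega) hy), by rwa [map_sub], ?_⟩
  have := (D.Rel_self (c := c) n (D.j n m)).sub (D.Rel_of_mem hy.1)
  rwa [sub_zero] at this

omit hc in
include O in
lemma exists_of_rel_zero {n : ℤ} {z : ν.Y V} (hz : z ∈ D.GI ν (n * p) n)
    (hd : D.dW ν z ∈ D.GD ν ((n - 1) * p) (n - 1)) (h : D.Rel c n z 0) :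
    ∃ y ∈ D.GI ν (n * p) (n + 1), z - D.dW ν y ∈ D.GI ν ((n - 1) * p) n := by
  obtain ⟨y, hy, h⟩ := D.Rel_zero_right.mp h
  have hp : (0 : ℤ) < p := by exact_mod_cast (Fact.out : p.Prime).pos
  obtain ⟨y', hy', h'⟩ := D.exists_reduce_mul O (m := n) (J := n * p - 1) (n := n)
    (by rw [sub_mul]; omega) (by omega)
    ⟨h, AddSubgroup.sub_mem (D.Inv ν) hz.2 (D.dW_Inv hy.2)⟩ (by rwa [map_sub, dW_dW, sub_zero])
  exact ⟨y + y', add_mem hy (D.GI_mono (by omega) hy'), by rwa [map_add, ← sub_sub]⟩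

/-- The invariant elements of filtration `n p` and degree `n + 1` that are cycles modulo lower terms. -/
lemma exists_torsion {n : ℤ} {w : ν.Y V} (hw : w ∈ D.GI ν (n * p) (n + 1))
    (hd : D.dW ν w ∈ D.GD ν (n * p - 1) n) : ∃ m : M n, p • m = 0 ∧
      ∃ y ∈ D.GI ν (n * p) (n + 1 + 1), w - D.jY ν n ((chiOps O (M n) (chi_pow (p := p) n)).β
        ((chiOps O (M n) (chi_pow (p := p) n)).h (act m (c n)))) - D.dW ν y ∈
          D.GD ν (n * p - 1) (n + 1) := by
  let T := chiOps O (M n) (chi_pow (p := p) n)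
  have hk : -n * ((p : ℤ) - 1) + 1 + n * p = n + 1 := by ring
  have hd' : D.dW ν w ∈ D.GD ν (n * p - 1) (n + 1 - 1) := by rwa [add_sub_cancel_right]
  obtain ⟨h1, h2, h3⟩ := D.qY_top_cycle hk hw hd'
  generalize hz : D.qY ν n (D.top ν (n * p) w) = z at h1 h2 h3
  change T.d z = 0 at h2
  have e1 : T.β (T.r z) = z := T.β_r _ (sub_eq_zero.mpr h3.symm)
  have hrz := T.r_deg _ _ h1
  obtain ⟨m, hm, v, hv, hdv, e2⟩ := ((hc n).2 (M n)).gen' (T.d (T.r z))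
    (T.d_deg _ _ rfl _ hrz) (T.d_d _) (by rw [← T.d_β, e1]; exact h2)
  refine ⟨m, hm, ?_⟩
  have hC := T.h_deg _ _ rfl _ (((hc n).2 (M n)).deg m)
  have hr : T.r z - T.h (act m (c n)) - T.α (T.h v) ∈ T.deg (-n * (p - 1) + 1) :=
    sub_mem (sub_mem hrz hC) (T.α_deg _ _ (T.h_deg _ _ rfl _ hv))
  have hdr : T.d (T.r z - T.h (act m (c n)) - T.α (T.h v)) = 0 := by
    rw [map_sub, map_sub, T.d_α, T.d_h_of_cycle hdv, T.d_h_of_cycle (show T.d (act m (c n)) = 0 from ((hc n).2 (M n)).d_C m), e2]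
    rw [actHom_apply, add_sub_cancel_left]; exact sub_self _
  refine D.exists_reduce_jY O hk hw hd' (y₀ := T.β (T.h (T.r z - T.h (act m (c n)) - T.α (T.h v))))
    (T.β_deg _ _ (T.h_deg _ _ rfl _ hr)) (sub_eq_zero.mp (T.α_β (T.h _))).symm ?_
  rw [hz]
  change z = T.β (T.h (act m (c n))) + T.d (T.β (T.h (T.r z - T.h (act m (c n)) - T.α (T.h v))))
  rw [T.d_β, T.d_h_of_cycle hdr, map_sub, map_sub, T.β_α, e1]; abel

end CycData

end CyclicPower

namespace CyclicPower

section rotation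

lemma inversions_finRotate_succ (n : ℕ) (e : Fin (n + 1) → ZMod 2) :
    SuperDG.inversions (finRotate (n + 1)) e = e (Fin.last n) * (∑ l, e l + 1) := by
  rw [SuperDG.inversions, Finset.sum_eq_single (Fin.last n)]
  · rw [Fin.sum_univ_castSucc, Fin.sum_univ_castSucc, finRotate_last, if_neg (by simp), add_zero]
    have h2 : ∀ x y : ZMod 2, x * (y + x + 1) = y * x := by decide
    rw [h2, Finset.sum_mul]
    refine Finset.sum_congr rfl fun i _ => if_pos ⟨Fin.castSucc_lt_last i, ?_⟩
    rw [Fin.lt_def, coe_finRotate_of_ne_last (Fin.castSucc_lt_last i).ne]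
    simp
  · intro j _ hj
    refine Finset.sum_eq_zero fun i _ => if_neg ?_
    rintro ⟨h1, h2⟩
    have hi : i ≠ Fin.last n := (h1.trans_le (Fin.le_last j)).ne
    rw [Fin.lt_def] at h1 h2
    rw [coe_finRotate_of_ne_last hi, coe_finRotate_of_ne_last hj] at h2
    omega
  · simp

variable {p : ℕ} [NeZero p]

lemma inversions_finRotate (e : Fin p → ZMod 2) :
    SuperDG.inversions (finRotate p) e = e (-1) * (∑ l, e l + 1) := by
  obtain ⟨n, rfl⟩ := Nat.exists_eq_succ_of_ne_zero (NeZero.ne p)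
  rw [inversions_finRotate_succ]
  congr 2
  rw [eq_neg_iff_add_eq_zero]
  exact Fin.last_add_one n

variable {X : Type w}

/-- The rotation of a word. -/
def rot (f : Fin p → X) : Fin p → X := fun l => f ((finRotate p).symm l)

open Fin.CommRing in
lemma rot_iterate (m : ℕ) (f : Fin p → X) (l : Fin p) : rot^[m] f l = f (l - (m : Fin p)) := by
  induction m generalizing l with
  | zero => simp
  | succ m ih =>
    rw [Function.iterate_succ_apply', rot, ih, show (finRotate p).symm l = l - 1 by
      rw [Equiv.symm_apply_eq, finRotate_apply]; simp]
    congr 1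
    push_cast
    ring

open Fin.CommRing in
lemma rot_iterate_self (f : Fin p → X) : rot^[p] f = f := by
  funext l
  rw [rot_iterate, Fin.natCast_self, sub_zero]

open Fin.CommRing in
lemma rot_eq_iff {f : Fin p → X} : rot f = f ↔ ∀ l, f l = f 0 := by
  refine ⟨fun h l => ?_, fun h => funext fun l => by rw [rot, h, h l]⟩
  have h1 : rot^[l.val] f = f := Function.IsFixedPt.iterate h _
  have := congrFun h1 l
  rwa [rot_iterate, Fin.cast_val_eq_self, sub_self, eq_comm] at this

lemma sum_rot_iterate {Y : Type*} [AddCommMonoid Y] (f : Fin p → Y) (l : Fin p) :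
    ∑ i ∈ Finset.range p, rot^[i] f l = ∑ l, f l := by
  rw [← Fin.sum_univ_eq_sum_range (fun i => rot^[i] f l) p, ← Equiv.sum_comp (Equiv.subLeft l) f]
  refine Finset.sum_congr rfl fun i _ => ?_
  rw [rot_iterate, Fin.cast_val_eq_self]; rfl

lemma sum_rot {Y : Type*} [AddCommMonoid Y] (f : Fin p → Y) : ∑ l, rot f l = ∑ l, f l :=
  Equiv.sum_comp (finRotate p).symm f

lemma sum_rot_iter {Y : Type*} [AddCommMonoid Y] (i : ℕ) (f : Fin p → Y) :
    ∑ l, rot^[i] f l = ∑ l, f l := by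
  induction i with
  | zero => rfl
  | succ i ih => rw [Function.iterate_succ_apply', sum_rot, ih]

lemma comp_rot_iter {Y : Type*} (g : X → Y) (i : ℕ) (f : Fin p → X) :
    rot^[i] (g ∘ f) = g ∘ rot^[i] f := by
  induction i with
  | zero => rfl
  | succ i ih => rw [Function.iterate_succ_apply', ih, Function.iterate_succ_apply']; rfl

/-- The orbits of the rotation. -/
def rotSetoid (p : ℕ) [NeZero p] (X : Type w) : Setoid (Fin p → X) where
  r f g := ∃ i, rot^[i] f = g
  iseqv :=
    { refl := fun f => ⟨0, rfl⟩
      symm := by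
        rintro f _ ⟨i, rfl⟩
        refine ⟨i * (p - 1), ?_⟩
        rw [← Function.iterate_add_apply, show i * (p - 1) + i = p * i by
          obtain ⟨n, rfl⟩ := Nat.exists_eq_succ_of_ne_zero (NeZero.ne p)
          simp only [Nat.succ_eq_add_one, Nat.add_sub_cancel]; ring]
        rw [Function.iterate_mul]
        exact Function.IsFixedPt.iterate (f := rot^[p]) (rot_iterate_self f) i
      trans := by
        rintro f _ _ ⟨i, rfl⟩ ⟨j, rfl⟩
        exact ⟨j + i, Function.iterate_add_apply _ _ _ _⟩ }

/-- Representatives of the free orbits of the rotation. -/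
def rotRep (f : Fin p → X) : Prop :=
  rot f ≠ f ∧ (Quotient.mk (rotSetoid p X) f).out = f

lemma rot_iter_injective (i : ℕ) : Function.Injective (rot^[i] : (Fin p → X) → Fin p → X) := by
  refine Function.Injective.iterate (fun f g h => funext fun l => ?_) i
  have := congrFun h (finRotate p l)
  change f ((finRotate p).symm (finRotate p l)) = g ((finRotate p).symm (finRotate p l)) at this
  rwa [(finRotate p).symm_apply_apply l] at this

lemma not_rotRep_of_fix {f : Fin p → X} (h : rot f = f) (i : ℕ) : ¬ rotRep (rot^[i] f) := by
  intro h'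
  exact h'.1 (by rw [Function.IsFixedPt.iterate h i, h])

/-- A free orbit of the rotation contains exactly one representative. -/
lemma exists_rotRep [hp : Fact p.Prime] {f : Fin p → X} (h : rot f ≠ f) :
    ∃ i ∈ Finset.range p, ∀ j ∈ Finset.range p, rotRep (rot^[p - j] f) ↔ j = i := by
  have fix_of : ∀ a, 0 < a → a < p → rot^[a] f ≠ f := fun a h0 ha h' => h <| by
    have := Function.IsPeriodicPt.gcd (show Function.IsPeriodicPt rot a f from h')
      (show Function.IsPeriodicPt rot p f from rot_iterate_self f)
    rw [Nat.gcd_comm, Nat.Coprime.gcd_eq_one ((Nat.coprime_of_lt_prime h0.ne' ha hp.1))] at this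
    exact this
  have free : ∀ i, rot (rot^[i] f) ≠ rot^[i] f := fun i h' => h <| rot_iter_injective i (by
    rw [← Function.iterate_succ_apply, Function.iterate_succ_apply', h'])
  have cls : ∀ i, Quotient.mk (rotSetoid p X) (rot^[i] f) = Quotient.mk (rotSetoid p X) f :=
    fun i => (Quotient.sound (show (rotSetoid p X).r _ _ from ⟨i, rfl⟩)).symm
  obtain ⟨a, ha⟩ : (rotSetoid p X).r f (Quotient.mk (rotSetoid p X) f).out :=
    (rotSetoid p X).symm (Quotient.mk_out f)
  have rep : ∀ i, rotRep (rot^[i] f) ↔ rot^[i] f = rot^[a] f := fun i => by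
    rw [rotRep, cls, ← ha]
    exact ⟨fun h' => h'.2.symm, fun h' => ⟨free i, h'.symm⟩⟩
  have modp : rot^[a % p] f = rot^[a] f := by
    conv_rhs => rw [← Nat.mod_add_div a p, Function.iterate_add_apply, Function.iterate_mul]
    rw [Function.IsFixedPt.iterate (f := rot^[p]) (rot_iterate_self f)]
  have hlt := Nat.mod_lt a hp.1.pos
  have inj : ∀ i j, i ≤ p → j ≤ p → i < j → rot^[i] f = rot^[j] f → i = 0 ∧ j = p := by
    intro i j hi hj hij he
    by_contra hne
    have : rot^[i] (rot^[j - i] f) = rot^[i] f := by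
      rw [← Function.iterate_add_apply, he]; congr 2; omega
    exact fix_of (j - i) (by omega) (by omega) (rot_iter_injective i this)
  refine ⟨if a % p = 0 then 0 else p - a % p, ?_, fun j hj => ?_⟩
  · rw [Finset.mem_range]; split_ifs <;> omega
  · rw [Finset.mem_range] at hj
    rw [rep, ← modp]
    constructor
    · intro h'
      rcases lt_trichotomy (p - j) (a % p) with h1 | h1 | h1
      · have := inj _ _ (by omega) (by omega) h1 h'; omega
      · split_ifs <;> omega
      · have := inj _ _ (by omega) (by omega) h1 h'.symm
        rw [if_pos this.1]; omega
    · rintro rfl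
      split_ifs with h0
      · rw [h0, Nat.sub_zero, rot_iterate_self]; rfl
      · congr 2; omega

end rotation

namespace DGAlgebra

variable {k : Type u} [CommRing k] {A : DGAlgebra.{u, v} k} {ι : ℤ → Type v}
  (b : ∀ n, Module.Basis (ι n) k (A.X n))

/-- The basis of the direct sum of the terms given by bases of the terms. -/
noncomputable def totBasis : Module.Basis (Σ n, ι n) k A.Tot := DFinsupp.basis b

lemma totBasis_repr_self (n : ℤ) (x : A.X n) (i : ι n) :
    (totBasis b).repr (A.ι n x) ⟨n, i⟩ = (b n).repr x i := by
  simp only [totBasis, DFinsupp.basis, DGAlgebra.ι, DirectSum.lof]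
  simp
  change (b n).repr ((DFinsupp.single n x : Π₀ i, A.X i) n) i = _
  rw [DFinsupp.single_eq_same]

lemma totBasis_repr_ne {n : ℤ} (x : A.X n) (i : Σ n, ι n) (h : i.1 ≠ n) :
    (totBasis b).repr (A.ι n x) i = 0 := by
  obtain ⟨m, i⟩ := i
  simp only [totBasis, DFinsupp.basis, DGAlgebra.ι, DirectSum.lof]
  simp
  change (b m).repr ((DFinsupp.single n x : Π₀ i, A.X i) m) i = _
  rw [DFinsupp.single_eq_of_ne (by exact h), map_zero]; rfl

lemma totBasis_apply (n : ℤ) (i : ι n) : totBasis b ⟨n, i⟩ = A.ι n (b n i) := by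
  classical
  refine (totBasis b).repr.injective (Finsupp.ext fun ⟨m, j⟩ => ?_)
  rw [Module.Basis.repr_self]
  by_cases h : m = n
  · subst h
    rw [totBasis_repr_self, Module.Basis.repr_self, Finsupp.single_apply, Finsupp.single_apply]
    simp
  · rw [totBasis_repr_ne _ _ _ h, Finsupp.single_eq_of_ne (by rintro h'; exact h (congrArg Sigma.fst h'))]

variable (p : ℕ)

/-- The basis of the tensor power given by bases of the terms. -/
noncomputable def powBasis : Module.Basis (Fin p → Σ n, ι n) k (SuperDG.TPow k A.Tot p) :=
  Basis.piTensorProduct fun _ => totBasis b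

variable {p}

lemma powBasis_apply (f : Fin p → Σ n, ι n) :
    powBasis b p f = SuperDG.pureTensor k fun l => totBasis b (f l) :=
  Basis.piTensorProduct_apply _ f

lemma powBasis_repr (a : Fin p → A.Tot) (f : Fin p → Σ n, ι n) :
    (powBasis b p).repr (SuperDG.pureTensor k a) f = ∏ l, (totBasis b).repr (a l) (f l) :=
  Basis.piTensorProduct_repr_tprod_apply _ a f

lemma totBasis_mem (i : Σ n, ι n) : totBasis b i ∈ A.deg i.1 := ⟨_, (totBasis_apply b _ _).symm⟩

lemma powBasis_mem (f : Fin p → Σ n, ι n) : powBasis b p f ∈ A.powDeg p (∑ l, (f l).1) := by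
  rw [powBasis_apply]
  exact Submodule.subset_span ⟨_, _, fun l => totBasis_mem b (f l), rfl, rfl⟩

lemma repr_of_powDeg {n : ℤ} {x : SuperDG.TPow k A.Tot p} (hx : x ∈ A.powDeg p n)
    (f : Fin p → Σ n, ι n) (hf : ∑ l, (f l).1 ≠ n) : (powBasis b p).repr x f = 0 := by
  induction hx using Submodule.span_induction with
  | zero => rw [map_zero]; rfl
  | add x y _ _ hx hy => rw [map_add, Finsupp.add_apply, hx, hy, add_zero]
  | smul r x _ hx => rw [map_smul, Finsupp.smul_apply, hx, smul_zero]
  | mem x hx =>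
    obtain ⟨i, a, ha, hi, rfl⟩ := hx
    rw [powBasis_repr]
    obtain ⟨l, hl⟩ : ∃ l, (f l).1 ≠ i l := by
      by_contra! h
      exact hf (by rw [← hi]; exact Finset.sum_congr rfl fun l _ => h l)
    refine Finset.prod_eq_zero (Finset.mem_univ l) ?_
    obtain ⟨x, hx⟩ := ha l
    rw [← hx]
    exact totBasis_repr_ne b x _ hl

/-- Linear maps that agree on the basis elements of degree `n` agree in degree `n`. -/
lemma powDeg_ext {n : ℤ} {Y : Type*} [AddCommGroup Y] [Module k Y]
    {F G : SuperDG.TPow k A.Tot p →ₗ[k] Y}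
    (h : ∀ f, ∑ l, (f l).1 = n → F (powBasis b p f) = G (powBasis b p f))
    {x : SuperDG.TPow k A.Tot p} (hx : x ∈ A.powDeg p n) : F x = G x := by
  rw [← (powBasis b p).linearCombination_repr x, Finsupp.linearCombination_apply, Finsupp.sum, map_sum,
    map_sum]
  refine Finset.sum_congr rfl fun f _ => ?_
  rw [map_smul, map_smul]
  by_cases hf : ∑ l, (f l).1 = n
  · rw [h f hf]
  · rw [repr_of_powDeg b hx f hf, zero_smul, zero_smul]

open Classical in
variable (p) in
/-- The projection to the span of a part of the basis. -/
noncomputable def powProj (S : (Fin p → Σ n, ι n) → Prop) :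
    SuperDG.TPow k A.Tot p →ₗ[k] SuperDG.TPow k A.Tot p :=
  (powBasis b p).constr k fun f => if S f then powBasis b p f else 0

open Classical in
lemma powProj_basis (S : (Fin p → Σ n, ι n) → Prop) (f : Fin p → Σ n, ι n) :
    powProj b p S (powBasis b p f) = if S f then powBasis b p f else 0 :=
  (powBasis b p).constr_basis k _ f

lemma powProj_mem (S : (Fin p → Σ n, ι n) → Prop) {n : ℤ} {x : SuperDG.TPow k A.Tot p}
    (hx : x ∈ A.powDeg p n) : powProj b p S x ∈ A.powDeg p n := by
  classical
  refine (Submodule.Quotient.mk_eq_zero _).mp (powDeg_ext b (F := (A.powDeg p n).mkQ ∘ₗ powProj b p S)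
    (G := 0) (fun f hf => (Submodule.Quotient.mk_eq_zero _).mpr ?_) hx)
  rw [powProj_basis]
  split_ifs
  · exact hf ▸ powBasis_mem b f
  · exact zero_mem _

section action

variable [NeZero p]

lemma powPerm_basis (f : Fin p → Σ n, ι n) :
    A.super.powPerm p (finRotate p) (powBasis b p f) =
      koszul k (((f (-1)).1 : ZMod 2) * ((∑ l, (f l).1 : ℤ) + 1)) • powBasis b p (rot f) := by
  have h := A.super.powPerm_tprod (finRotate p) (e := fun l => ((f l).1 : ZMod 2))
    (a := fun l => totBasis b (f l)) (fun l => par_of_deg (totBasis_mem b (f l)))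
  rw [inversions_finRotate] at h
  rw [powBasis_apply, powBasis_apply]
  refine h.trans ?_
  push_cast
  rfl

variable (A p) in
/-- The action of the generator, as an additive map. -/
noncomputable def powRot : SuperDG.TPow k A.Tot p →+ SuperDG.TPow k A.Tot p :=
  (A.super.powPerm p (finRotate p)).toAddMonoidHom

lemma powRot_smul (r : k) (x : SuperDG.TPow k A.Tot p) : A.powRot p (r • x) = r • A.powRot p x :=
  (A.super.powPerm p (finRotate p)).map_smul r x

lemma iter_powRot_basis (m : ℕ) (f : Fin p → Σ n, ι n) :
    iter (A.powRot p) m (powBasis b p f) =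
      koszul k ((∑ i ∈ Finset.range m, ((rot^[i] f (-1)).1 : ZMod 2)) * ((∑ l, (f l).1 : ℤ) + 1)) •
        powBasis b p (rot^[m] f) := by
  induction m with
  | zero => rw [Finset.sum_range_zero, zero_mul, koszul_zero, one_smul]; rfl
  | succ m ih =>
    have hs : ∑ l, (rot^[m] f l).1 = ∑ l, (f l).1 := by
      have := sum_rot_iter m fun l => (f l).1
      rwa [show (fun l => (f l).1) = Sigma.fst ∘ f from rfl, comp_rot_iter] at this
    rw [iter_succ, ih, powRot_smul]
    have h := powPerm_basis b (rot^[m] f)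
    rw [hs] at h
    rw [show A.powRot p (powBasis b p (rot^[m] f)) = _ from h, smul_smul, ← koszul_add,
      Finset.sum_range_succ, add_mul, Function.iterate_succ_apply']

lemma iter_powRot_self (x : SuperDG.TPow k A.Tot p) (b : ∀ n, Module.Basis (ι n) k (A.X n)) :
    iter (A.powRot p) p x = x := by
  have hk : ∀ (m : ℕ) (r : k) (x : SuperDG.TPow k A.Tot p),
      iter (A.powRot p) m (r • x) = r • iter (A.powRot p) m x := fun m r x => by
    induction m with
    | zero => rfl
    | succ m ih => rw [iter_succ, ih, powRot_smul, iter_succ]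
  rw [← (powBasis b p).linearCombination_repr x, Finsupp.linearCombination_apply, Finsupp.sum, map_sum]
  refine Finset.sum_congr rfl fun f _ => ?_
  rw [hk, iter_powRot_basis, rot_iterate_self]
  have h := sum_rot_iterate (fun l => ((f l).1 : ZMod 2)) (-1)
  rw [show (fun l => ((f l).1 : ZMod 2)) = (fun i : Σ n, ι n => (i.1 : ZMod 2)) ∘ f from rfl] at h
  simp only [comp_rot_iter] at h
  change (∑ i ∈ Finset.range p, ((rot^[i] f (-1)).1 : ZMod 2)) = _ at h
  rw [h]
  push_cast
  change _ • koszul k ((∑ l, ((f l).1 : ZMod 2)) * _) • _ = _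
  rw [(by decide : ∀ x : ZMod 2, x * (x + 1) = 0), koszul_zero, one_smul]

end action

end DGAlgebra

end CyclicPower

namespace CyclicPower

open ResolutionData

namespace DGAlgebra

variable {k : Type u} [CommRing k] {A : DGAlgebra.{u, v} k} {ι : ℤ → Type v}
  (b : ∀ n, Module.Basis (ι n) k (A.X n)) {p : ℕ} [hp : Fact p.Prime]

instance neZero_of_prime : NeZero p := ⟨hp.1.ne_zero⟩

/-- The constant words. -/
def cst (n : ℤ) (i : ι n) : Fin p → Σ n, ι n := fun _ => ⟨n, i⟩

lemma cst_injective (n : ℤ) : Function.Injective (cst (p := p) n : ι n → _) := fun _ _ h =>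
  eq_of_heq (Sigma.mk.inj (congrFun h 0)).2

lemma rot_cst (n : ℤ) (i : ι n) : rot (cst (p := p) n i) = cst n i := rfl

lemma sum_cst (n : ℤ) (i : ι n) : ∑ l, (cst (p := p) n i l).1 = n * p := by
  simp [cst, mul_comm]

lemma exists_cst {f : Fin p → Σ n, ι n} (h : rot f = f) : ∃ n i, f = cst n i :=
  ⟨(f 0).1, (f 0).2, funext fun l => rot_eq_iff.mp h l⟩

variable (p)

/-- The inclusion of the span of the powers of the basis elements. -/
noncomputable def powJ (n : ℤ) : (ι n →₀ k) →ₗ[k] SuperDG.TPow k A.Tot p :=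
  Finsupp.linearCombination k fun i => powBasis b p (cst n i)

/-- The coefficients at the powers of the basis elements. -/
noncomputable def powQ (n : ℤ) : SuperDG.TPow k A.Tot p →ₗ[k] (ι n →₀ k) :=
  Finsupp.lcomapDomain (cst n) (cst_injective n) ∘ₗ (powBasis b p).repr.toLinearMap

variable {p}

lemma powJ_single (n : ℤ) (i : ι n) : powJ b p n (Finsupp.single i 1) = powBasis b p (cst n i) := by
  rw [powJ, Finsupp.linearCombination_single, one_smul]

lemma powQ_apply (n : ℤ) (x : SuperDG.TPow k A.Tot p) (i : ι n) :
    powQ b p n x i = (powBasis b p).repr x (cst n i) := rfl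

lemma powQ_cst (n : ℤ) (i : ι n) : powQ b p n (powBasis b p (cst n i)) = Finsupp.single i 1 := by
  classical
  ext j
  rw [powQ_apply, Module.Basis.repr_self, Finsupp.single_apply, Finsupp.single_apply]
  simp only [(cst_injective n).eq_iff]

lemma powQ_powJ (n : ℤ) (m : ι n →₀ k) : powQ b p n (powJ b p n m) = m := by
  have : powQ b p n ∘ₗ powJ b p n = LinearMap.id := Finsupp.lhom_ext' fun i => LinearMap.ext_ring (by
    rw [LinearMap.comp_apply, LinearMap.comp_apply, Finsupp.lsingle_apply, powJ_single, powQ_cst]; rfl)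
  exact LinearMap.congr_fun this m

lemma powQ_eq_zero {f : Fin p → Σ n, ι n} (h : rot f ≠ f) (n : ℤ) :
    powQ b p n (powBasis b p f) = 0 := by
  ext i
  rw [powQ_apply, Module.Basis.repr_self, Finsupp.single_eq_of_ne]
  · rfl
  · rintro rfl; exact h (rot_cst n i)

lemma koszul_zsmul {Y : Type*} [AddCommGroup Y] [Module k Y] (e : ZMod 2) (x : Y) :
    koszul ℤ e • x = koszul k e • x := by
  rw [← koszul_cast k, Int.cast_smul_eq_zsmul]

lemma powRot_cst (n : ℤ) (i : ι n) :
    A.powRot p (powBasis b p (cst n i)) = chi p n • powBasis b p (cst n i) := by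
  refine (powPerm_basis b _).trans ?_
  rw [rot_cst, sum_cst, chi, koszul_zsmul (k := k)]
  congr 2
  change (n : ZMod 2) * _ = _
  push_cast
  generalize (n : ZMod 2) = x
  generalize (p : ZMod 2) = y
  revert x y; decide

lemma traceHom_fix {f : Fin p → Σ n, ι n} (h : rot f = f) :
    traceHom p (A.powRot p) (powProj b p rotRep).toAddMonoidHom (powBasis b p f) = 0 := by
  rw [traceHom_apply]
  refine Finset.sum_eq_zero fun i _ => ?_
  rw [iter_powRot_basis]
  change iter _ i (powProj b p rotRep _) = 0
  rw [map_smul, powProj_basis, if_neg (not_rotRep_of_fix h _), smul_zero, map_zero]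

lemma traceHom_free {f : Fin p → Σ n, ι n} (h : rot f ≠ f) :
    traceHom p (A.powRot p) (powProj b p rotRep).toAddMonoidHom (powBasis b p f) =
      powBasis b p f := by
  obtain ⟨i, hi, hf⟩ := exists_rotRep h
  have key : ∀ j, (powProj b p rotRep).toAddMonoidHom (iter (A.powRot p) (p - j) (powBasis b p f)) =
      powProj b p rotRep (iter (A.powRot p) (p - j) (powBasis b p f)) := fun _ => rfl
  rw [traceHom_apply, Finset.sum_eq_single i]
  · rw [key]
    conv_rhs => rw [← iter_cancel (ς := A.powRot p) (fun x => iter_powRot_self x b) hi (powBasis b p f)]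
    rw [iter_powRot_basis, map_smul, powProj_basis, if_pos ((hf i hi).mpr rfl)]
  · intro j hj hij
    rw [key, iter_powRot_basis, map_smul, powProj_basis, if_neg fun h' => hij ((hf j hj).mp h'),
      smul_zero, map_zero]
  · exact fun h' => (h' hi).elim

variable (A p) in
/-- The action of the generator, as a linear map. -/
noncomputable def powRotL : SuperDG.TPow k A.Tot p →ₗ[k] SuperDG.TPow k A.Tot p :=
  A.super.powPerm p (finRotate p)

lemma powRotL_basis (f : Fin p → Σ n, ι n) : A.powRotL p (powBasis b p f) =
    koszul k (((f (-1)).1 : ZMod 2) * ((∑ l, (f l).1 : ℤ) + 1)) • powBasis b p (rot f) :=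
  powPerm_basis b f

include b in
lemma powRot_powDeg {n : ℤ} {x : SuperDG.TPow k A.Tot p} (hx : x ∈ A.powDeg p n) :
    A.powRot p x ∈ A.powDeg p n := by
  refine (Submodule.Quotient.mk_eq_zero _).mp (powDeg_ext b (F := (A.powDeg p n).mkQ ∘ₗ
    A.powRotL p) (G := 0)
      (fun f hf => (Submodule.Quotient.mk_eq_zero _).mpr ?_) hx)
  rw [powRotL_basis]
  refine Submodule.smul_mem _ _ ?_
  have h := powBasis_mem (p := p) b (rot f)
  rwa [show ∑ l, (rot f l).1 = n from (sum_rot fun l => (f l).1).trans hf] at h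

lemma linear_trace (x : SuperDG.TPow k A.Tot p) (r : k) (π : SuperDG.TPow k A.Tot p →ₗ[k] _) :
    traceHom p (A.powRot p) π.toAddMonoidHom (r • x) =
      r • traceHom p (A.powRot p) π.toAddMonoidHom x := by
  have hk : ∀ (m : ℕ) (r : k) (x : SuperDG.TPow k A.Tot p),
      iter (A.powRot p) m (r • x) = r • iter (A.powRot p) m x := fun m r x => by
    induction m with
    | zero => rfl
    | succ m ih => rw [iter_succ, ih, powRot_smul, iter_succ]
  rw [traceHom_apply, traceHom_apply, Finset.smul_sum]
  refine Finset.sum_congr rfl fun i _ => ?_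
  have e : ∀ z, π.toAddMonoidHom (r • z) = r • π.toAddMonoidHom z := π.map_smul r
  rw [hk, e, hk]

/-- The trace, as a linear map. -/
noncomputable def powTr : SuperDG.TPow k A.Tot p →ₗ[k] SuperDG.TPow k A.Tot p where
  toFun := traceHom p (A.powRot p) (powProj b p rotRep).toAddMonoidHom
  map_add' := map_add _
  map_smul' r x := linear_trace x r _

/-- The tensor power of a complex of free modules, as a graded complex with a cyclic action. -/
noncomputable def cycData : CycData p (SuperDG.TPow k A.Tot p) fun n => ι n →₀ k where
  gr n := (A.powDeg p n).toAddSubgroup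
  σ := A.powRot p
  dE := (A.super.pow p).d.toAddMonoidHom
  sE := (A.super.pow p).s.toAddMonoidHom
  pr n := (powProj b p fun f => ∑ l, (f l).1 = n).toAddMonoidHom
  π := (powProj b p rotRep).toAddMonoidHom
  j n := (powJ b p n).toAddMonoidHom
  q n := (powQ b p n).toAddMonoidHom
  σ_gr n x hx := powRot_powDeg b hx
  σ_iter x := iter_powRot_self x b
  dE_gr n x hx := powDeg_d (sub_add_cancel n 1) hx
  sE_gr n x hx := (powDeg_s hx).trans (koszul_zsmul _ _).symm
  dE_dE := (A.super.pow p).d_d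
  dE_sE := (A.super.pow p).d_s
  sE_sE := (A.super.pow p).s_s
  σ_dE := fun x => A.super.powPerm_powD (finRotate p) x
  σ_sE := fun x => A.super.powPerm_powS (finRotate p) x
  pr_self n x hx := powDeg_ext b (F := powProj b p _) (G := LinearMap.id)
    (fun f hf => (powProj_basis b _ f).trans (if_pos hf)) hx
  pr_ne n m h x hx := powDeg_ext b (F := powProj b p _) (G := 0)
    (fun f hf => (powProj_basis b _ f).trans (if_neg fun h' => h (hf.symm.trans h'))) hx
  σ_pr n x := by
    have : A.powRotL p ∘ₗ (powProj b p fun f => ∑ l, (f l).1 = n) =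
        (powProj b p fun f => ∑ l, (f l).1 = n) ∘ₗ A.powRotL p :=
      (powBasis b p).ext fun f => by
        rw [LinearMap.comp_apply, LinearMap.comp_apply, powRotL_basis, map_smul, powProj_basis,
          powProj_basis, show ∑ l, (rot f l).1 = ∑ l, (f l).1 from sum_rot fun l => (f l).1]
        split_ifs
        · rw [powRotL_basis]
        · rw [map_zero, smul_zero]
    exact LinearMap.congr_fun this x
  π_gr n x hx := powProj_mem b _ hx
  tr_π n hn x hx := powDeg_ext b (F := powTr b) (G := LinearMap.id) (fun f hf => by
    refine traceHom_free b fun h => hn ?_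
    obtain ⟨m, i, rfl⟩ := exists_cst h
    exact ⟨m, by rw [← hf, sum_cst, mul_comm]⟩) hx
  tr_π_mul n x hx := powDeg_ext b (F := powJ b p n ∘ₗ powQ b p n + powTr b) (G := LinearMap.id)
    (fun f hf => by
      rw [LinearMap.add_apply, LinearMap.comp_apply, LinearMap.id_apply]
      by_cases h : rot f = f
      · obtain ⟨m, i, rfl⟩ := exists_cst h
        have hpz : (p : ℤ) ≠ 0 := by exact_mod_cast hp.1.ne_zero
        obtain rfl : m = n := by
          rw [sum_cst] at hf
          exact mul_right_cancel₀ hpz hf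
        rw [powQ_cst, powJ_single, show powTr b (powBasis b p (cst m i)) = 0 from traceHom_fix b h,
          add_zero]
      · rw [powQ_eq_zero b h, map_zero, zero_add]
        exact traceHom_free b h) hx
  j_gr n m := by
    change powJ b p n m ∈ A.powDeg p (n * p)
    induction m using Finsupp.induction_linear with
    | zero => rw [map_zero]; exact zero_mem _
    | add x y hx hy => rw [map_add]; exact add_mem hx hy
    | single i r =>
      have e : Finsupp.single i r = r • Finsupp.single i (1 : k) := by
        rw [Finsupp.smul_single, smul_eq_mul, _root_.mul_one]
      rw [e, map_smul, powJ_single]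
      have h := powBasis_mem (p := p) b (cst n i)
      rw [sum_cst] at h
      exact Submodule.smul_mem _ _ h
  σ_j n m := by
    change A.powRot p (powJ b p n m) = chi p n • powJ b p n m
    induction m using Finsupp.induction_linear with
    | zero => rw [map_zero, map_zero, smul_zero]
    | add x y hx hy => rw [map_add, map_add, hx, hy, smul_add]
    | single i r =>
      have e : Finsupp.single i r = r • Finsupp.single i (1 : k) := by
        rw [Finsupp.smul_single, smul_eq_mul, _root_.mul_one]
      rw [e, map_smul, powJ_single, powRot_smul, powRot_cst, smul_comm]
  q_σ n x := by
    have : powQ b p n ∘ₗ A.powRotL p = (koszul k ((n * (p - 1) : ℤ) : ZMod 2)) •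
        powQ b p n := (powBasis b p).ext fun f => by
      rw [LinearMap.comp_apply, LinearMap.smul_apply]
      by_cases h : rot f = f
      · obtain ⟨m, i, rfl⟩ := exists_cst h
        by_cases hm : m = n
        · subst hm
          rw [← koszul_zsmul, ← map_zsmul]
          exact congrArg _ (powRot_cst b m i)
        · have : powQ b p n (powBasis b p (cst m i)) = 0 := by
            ext j
            rw [powQ_apply, Module.Basis.repr_self, Finsupp.single_eq_of_ne]
            · rfl
            · exact fun h' => hm (congrArg Sigma.fst (congrFun h' 0)).symm
          rw [powRotL_basis, rot_cst, map_smul, this, smul_zero, smul_zero]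
      · rw [powRotL_basis, map_smul, powQ_eq_zero b h, powQ_eq_zero b fun h' => h
          (rot_iter_injective 1 h'), smul_zero, smul_zero]
    refine (LinearMap.congr_fun this x).trans ?_
    change koszul k _ • powQ b p n x = koszul ℤ _ • powQ b p n x
    exact (koszul_zsmul (k := k) _ _).symm
  q_j n m := powQ_powJ b n m

end DGAlgebra

end CyclicPower

namespace CyclicPower

open ResolutionData

namespace DGAlgebra

variable {k : Type u} [CommRing k] {p : ℕ} {ν : ResolutionData.{u} p}

section fil

variable {A : DGAlgebra.{u, v} k}

variable (A ν) in
/-- The elements of degree `n` of the Tate complex whose degree in the tensor power is at most `J`. -/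
noncomputable def lowFil (J n : ℤ) : AddSubgroup (ν.Y (SuperDG.TPow k A.Tot p)) :=
  triDeg (fun n => (A.powDeg p n).toAddSubgroup) fun j b c => j ≤ J ∧ j + b + c = n

lemma smul_pt (r : k) (t : SuperDG.TPow k A.Tot p) (x y) :
    r • ν.pt t x y = ν.pt (r • t) x y := rfl

lemma lowFil_smul {J n : ℤ} (r : k) {z : ν.Y (SuperDG.TPow k A.Tot p)} (hz : z ∈ A.lowFil ν J n) :
    r • z ∈ A.lowFil ν J n :=
  map_triDeg (DistribSMul.toAddMonoidHom (ν.Y (SuperDG.TPow k A.Tot p)) r) _ (fun _ _ _ h _ _ t ht _ hx _ hy =>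
    pt_mem_triDeg (t := r • t) h ((A.powDeg p _).smul_mem r ht) hx hy) hz

lemma cech_d_pt (t : SuperDG.TPow k A.Tot p) (x y) : (A.cechSigned ν).d (ν.pt t x y) =
    ν.pt ((A.super.pow p).d t) x y + (ν.pt ((A.super.pow p).s t) (ν.dP x) y +
      ν.pt ((A.super.pow p).s t) (ν.sP x) (ν.dI y)) := by
  change (A.cechSigned ν).d (tens (tens t x) y) = _
  refine (tensor_d _ _ _ _).trans ?_
  rw [tensor_d, ← add_assoc]
  exact congrArg (· + _) (TensorProduct.add_tmul _ _ _)

lemma lowFil_mono {J J' n : ℤ} (h : J ≤ J') : A.lowFil ν J n ≤ A.lowFil ν J' n :=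
  triDeg_mono fun _ _ _ h' _ _ => by omega

lemma mem_cechFil_iff {m n : ℤ} {w : A.CechTot ν} :
    w ∈ A.cechFil ν m n ↔ w ∈ A.lowFil ν (-m * p) n := by
  constructor
  · intro hw
    induction hw using Submodule.span_induction with
    | zero => exact zero_mem _
    | add x y _ _ hx hy => exact add_mem hx hy
    | smul r x _ hx => exact lowFil_smul r hx
    | mem w hw =>
      obtain ⟨j, b, c, t, ht, x, hx, y, hy, h1, h2, rfl⟩ := hw
      exact pt_mem_triDeg (t := t) ⟨h1, h2⟩ ht hx hy
  · intro hw
    exact map_triDeg (AddMonoidHom.id _) (A.cechFil ν m n).toAddSubgroup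
      (fun j b c h _ _ t ht x hx y hy => Submodule.subset_span
        ⟨j, b, c, t, ht, x, hx, y, hy, h.1, h.2, rfl⟩) hw

lemma cech_F_le {m n : ℤ} {w : A.CechTot ν} (hw : w ∈ (A.cech ν).F m n) :
    w ∈ A.lowFil ν (-m * p) n := mem_cechFil_iff.mp hw.1

lemma lowFil_mul {i j n m : ℤ} {w z : A.CechTot ν} (hw : w ∈ A.lowFil ν i n)
    (hz : z ∈ A.lowFil ν j m) : (A.cechSigned ν).mul w z ∈ A.lowFil ν (i + j) (n + m) := by
  refine map_triDeg ((A.cechSigned ν).mul.flip z).toAddMonoidHom _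
    (fun d b c h _ _ t ht x hx y hy => ?_) hw
  refine map_triDeg ((A.cechSigned ν).mul (ν.pt t x y)).toAddMonoidHom _
    (fun d' b' c' h' _ _ t' ht' x' hx' y' hy' => ?_) hz
  have e1 := tensor_mul_of_s _ ν.I.superInt (par_of_deg_int hy) (tens t x)
    (tensor_s _ ν.P.superInt (powDeg_s ht') (par_of_deg_int hx')) y'
  rw [tensor_mul_of_s _ ν.P.superInt (par_of_deg_int hx) _ (powDeg_s ht'), tens_smul] at e1
  refine (congrArg (· ∈ A.lowFil ν (i + j) (n + m)) e1).mpr (lowFil_smul _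
    (lowFil_smul _ ?_))
  exact pt_mem_triDeg (j := d + d') (b := b + b') (c := c + c') (by omega)
    (powDeg_mul rfl ht ht') (mul_deg_int rfl hx hx') (mul_deg_int rfl hy hy')

variable (p) in
/-- The tensor power of an element. -/
noncomputable def powElt (n : ℤ) (v : A.X n) : SuperDG.TPow k A.Tot p :=
  SuperDG.pureTensor k fun _ => A.ι n v

lemma powElt_mem (n : ℤ) (v : A.X n) : A.powElt p n v ∈ A.powDeg p (n * p) :=
  Submodule.subset_span ⟨fun _ => n, _, fun _ => ⟨v, rfl⟩, by simp [mul_comm], rfl⟩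

lemma powElt_smul (n : ℤ) (r : k) (v : A.X n) : A.powElt p n (r • v) = r ^ p • A.powElt p n v := by
  have h : (fun _ : Fin p => A.ι n (r • v)) = fun l => (fun _ : Fin p => r) l • A.ι n v := by
    simp only [map_smul]
  rw [powElt, h]
  refine ((PiTensorProduct.tprod k).map_smul_univ _ _).trans ?_
  rw [Finset.prod_const, Finset.card_univ, Fintype.card_fin]; rfl

lemma powElt_zero [NeZero p] (n : ℤ) : A.powElt p n 0 = 0 := by
  have h := powElt_smul (p := p) n 0 (0 : A.X n)
  rwa [zero_pow (NeZero.ne p), smul_zero, zero_smul] at h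

/-- The class of `z` in the truncation of the Tate complex corresponds to the element `v`. -/
def PowRel (c : ℤ → ν.Y ℤ) (n : ℤ) (z : ν.Y (SuperDG.TPow k A.Tot p)) (v : A.X n) : Prop :=
  ∃ y ∈ (A.cech ν).F (-n) (n + 1), z - act (A.powElt p n v) (c n) - (A.cechSigned ν).d y ∈
    A.lowFil ν (n * p - 1) n

lemma PowRel_smul {c : ℤ → ν.Y ℤ} {n : ℤ} {z : ν.Y (SuperDG.TPow k A.Tot p)} {v : A.X n}
    (h : PowRel c n z v) (r : k) : PowRel c n (r ^ p • z) (r • v) := by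
  obtain ⟨y, hy, h⟩ := h
  refine ⟨r ^ p • y, Submodule.smul_mem _ _ hy, ?_⟩
  have := lowFil_smul (r ^ p) h
  have e : ∀ (r : k) (t : SuperDG.TPow k A.Tot p), r • act t (c n) = act (r • t) (c n) := fun r t => by
    generalize c n = w
    induction w using Y_induction with
    | pt m x y => rw [act_pt, act_pt, smul_pt, smul_comm]
    | add w z hw hz => rw [map_add, map_add, smul_add, hw, hz]
  rw [smul_sub, smul_sub, e, ← powElt_smul] at this
  rwa [map_smul]

end fil

section basis

variable {A : DGAlgebra.{u, v} k} {ι : ℤ → Type v} (b : ∀ n, Module.Basis (ι n) k (A.X n))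
  [hp : Fact p.Prime]

lemma cech_d_eq (w : A.CechTot ν) : (A.cechSigned ν).d w = (cycData b).dW ν w := by
  have : (A.cechSigned ν).d.toAddMonoidHom = (cycData b).dW ν := Y_hom_ext fun t x y => by
    rw [CycData.dW_pt]
    exact cech_d_pt t x y
  exact DFunLike.congr_fun this w

lemma cech_action_eq (w : A.CechTot ν) : (A.cechAction ν).f w = ν.τ (cycData (p := p) b).σ w := by
  have : (A.cechAction ν).f.toAddMonoidHom = ν.τ (cycData (p := p) b).σ :=
    Y_hom_ext fun t x y => rfl
  exact DFunLike.congr_fun this w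

lemma mem_cech_F {m n : ℤ} {w : A.CechTot ν} :
    w ∈ (A.cech ν).F m n ↔ w ∈ (cycData b).GI ν (-m * p) n := by
  have h : w ∈ (cycData b).Inv ν ↔ (A.cechAction ν).f w = w := by
    rw [CycData.mem_Inv, ← cech_action_eq]
  exact and_congr mem_cechFil_iff h.symm

lemma mem_cech_F_neg {n N : ℤ} {w : A.CechTot ν} :
    w ∈ (A.cech ν).F (-n) N ↔ w ∈ (cycData b).GI ν (n * p) N := by
  rw [mem_cech_F b, neg_neg]

lemma mem_cech_F_one_sub {n N : ℤ} {w : A.CechTot ν} :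
    w ∈ (A.cech ν).F (1 - n) N ↔ w ∈ (cycData b).GI ν ((n - 1) * p) N := by
  rw [mem_cech_F b, neg_sub]

lemma PowRel_iff {c : ℤ → ν.Y ℤ} {n : ℤ} {z : ν.Y (SuperDG.TPow k A.Tot p)} {v : A.X n} :
    PowRel c n z v ↔ (cycData b).Rel c n z (A.powElt p n v) :=
  exists_congr fun y => and_congr (mem_cech_F_neg b) (by rw [cech_d_eq b]; rfl)

lemma powQ_powElt (n : ℤ) (v : A.X n) (i : ι n) :
    powQ b p n (A.powElt p n v) i = (b n).repr v i ^ p := by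
  rw [powQ_apply, powElt, powBasis_repr]
  simp only [cst, totBasis_repr_self, Finset.prod_const, Finset.card_univ, Fintype.card_fin]

lemma Eig_powElt (n : ℤ) (v : A.X n) : (cycData b).Eig n (A.powElt p n v) := by
  refine ⟨powElt_mem n v, ?_⟩
  have h := A.super.powPerm_tprod (finRotate p) (e := fun _ => (n : ZMod 2))
    (a := fun _ => A.ι n v) fun _ => par_of_deg ⟨v, rfl⟩
  refine h.trans ?_
  rw [inversions_finRotate, chi, koszul_zsmul (k := k)]
  refine congrArg (fun c => koszul k c • A.powElt p n v) ?_
  rw [Finset.sum_const, Finset.card_univ, Fintype.card_fin, nsmul_eq_mul]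
  push_cast
  generalize (n : ZMod 2) = x
  generalize (p : ZMod 2) = y
  revert x y; decide

end basis

/-- A map of the complexes underlying DG algebras. -/
structure ChainMap (A B : DGAlgebra.{u, v} k) where
  f : ∀ i, A.X i →ₗ[k] B.X i
  map_d : ∀ i j x, f j (A.d i j x) = B.d i j (f i x)

/-- The map of complexes underlying a morphism of DG algebras. -/
def Hom.chain {A B : DGAlgebra.{u, v} k} (φ : A.Hom B) : ChainMap A B := ⟨φ.f, φ.map_d⟩

namespace ChainMap

variable {A B : DGAlgebra.{u, v} k} (φ : ChainMap A B)

/-- The map of direct sums. -/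
noncomputable def tot : A.Tot →ₗ[k] B.Tot := DirectSum.lmap φ.f

lemma tot_ι (i : ℤ) (x : A.X i) : φ.tot (A.ι i x) = B.ι i (φ.f i x) := DirectSum.lmap_lof φ.f i x

lemma tot_d (x : A.Tot) : φ.tot (A.super.d x) = B.super.d (φ.tot x) := by
  have : φ.tot ∘ₗ A.totD = B.totD ∘ₗ φ.tot := DGAlgebra.tot_ext fun i x => by
    rw [LinearMap.comp_apply, LinearMap.comp_apply, tot_ι, A.totD_ι (sub_add_cancel i 1), tot_ι,
      B.totD_ι (sub_add_cancel i 1), φ.map_d]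
  exact LinearMap.congr_fun this x

lemma tot_par (e : ZMod 2) (x : A.Tot) : φ.tot (A.super.par e x) = B.super.par e (φ.tot x) := by
  have : φ.tot ∘ₗ A.totPar e = B.totPar e ∘ₗ φ.tot := DGAlgebra.tot_ext fun i x => by
    rw [LinearMap.comp_apply, LinearMap.comp_apply, tot_ι, A.totPar_ι, B.totPar_ι]
    split_ifs
    · rw [tot_ι]
    · rw [map_zero]
  exact LinearMap.congr_fun this x

lemma tot_par_eq {e : ZMod 2} {x : A.Tot} (hx : A.super.par e x = x) :
    B.super.par e (φ.tot x) = φ.tot x := by rw [← φ.tot_par, hx]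

variable (p) in
/-- The map of tensor powers. -/
noncomputable def tpow : SuperDG.TPow k A.Tot p →ₗ[k] SuperDG.TPow k B.Tot p := tpowMap p φ.tot

lemma tpow_pure (a : Fin p → A.Tot) : φ.tpow p (SuperDG.pureTensor k a) =
    SuperDG.pureTensor k fun l => φ.tot (a l) := tpowMap_tprod p _ a

lemma tpow_d (x : SuperDG.TPow k A.Tot p) :
    φ.tpow p ((A.super.pow p).d x) = (B.super.pow p).d (φ.tpow p x) := by
  have : tpowMap p φ.tot ∘ₗ A.super.powD p = B.super.powD p ∘ₗ tpowMap p φ.tot := by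
    refine A.super.pow_ext fun e a ha => ?_
    rw [LinearMap.comp_apply, LinearMap.comp_apply, tpowMap_tprod, A.super.powD_tprod ha,
      B.super.powD_tprod (fun l => φ.tot_par_eq (ha l)), map_sum]
    refine Finset.sum_congr rfl fun j _ => ?_
    rw [map_smul, tpowMap_tprod]
    congr 2; funext l
    by_cases h : l = j
    · subst h; simp [φ.tot_d]
    · simp [h]
  exact LinearMap.congr_fun this x

lemma tpow_s (x : SuperDG.TPow k A.Tot p) :
    φ.tpow p ((A.super.pow p).s x) = (B.super.pow p).s (φ.tpow p x) := by
  have : tpowMap p φ.tot ∘ₗ A.super.powS p = B.super.powS p ∘ₗ tpowMap p φ.tot := by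
    refine A.super.pow_ext fun e a ha => ?_
    rw [LinearMap.comp_apply, LinearMap.comp_apply, tpowMap_tprod, A.super.powS_tprod ha,
      B.super.powS_tprod (fun l => φ.tot_par_eq (ha l)), map_smul, tpowMap_tprod]
  exact LinearMap.congr_fun this x

lemma tpow_perm (x : SuperDG.TPow k A.Tot p) :
    φ.tpow p (A.powRot p x) = B.powRot p (φ.tpow p x) := by
  have : tpowMap p φ.tot ∘ₗ A.super.powPerm p (finRotate p) =
      B.super.powPerm p (finRotate p) ∘ₗ tpowMap p φ.tot := by
    refine A.super.pow_ext fun e a ha => ?_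
    rw [LinearMap.comp_apply, LinearMap.comp_apply, tpowMap_tprod, A.super.powPerm_tprod _ ha,
      B.super.powPerm_tprod _ (fun l => φ.tot_par_eq (ha l)), map_smul, tpowMap_tprod]
  exact LinearMap.congr_fun this x

lemma tpow_powDeg {n : ℤ} {t : SuperDG.TPow k A.Tot p} (ht : t ∈ A.powDeg p n) :
    φ.tpow p t ∈ B.powDeg p n := by
  induction ht using Submodule.span_induction with
  | zero => rw [map_zero]; exact zero_mem _
  | add x x' _ _ hx hx' => rw [map_add]; exact add_mem hx hx'
  | smul r x _ hx => rw [map_smul]; exact Submodule.smul_mem _ _ hx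
  | mem x hx =>
    obtain ⟨e, a, ha, hi, rfl⟩ := hx
    refine Submodule.subset_span ⟨e, _, fun l => ?_, hi, φ.tpow_pure a⟩
    obtain ⟨x, hx⟩ := ha l
    exact ⟨_, by rw [← hx]; exact (φ.tot_ι _ _).symm⟩

lemma tpow_powElt (n : ℤ) (v : A.X n) : φ.tpow p (A.powElt p n v) = B.powElt p n (φ.f n v) := by
  rw [powElt, tpow_pure]; simp only [tot_ι]; rfl

variable (ν) in
/-- The map of Tate complexes. -/
noncomputable def cech : A.CechTot ν →+ B.CechTot ν :=
  tri (φ.tpow p).toAddMonoidHom (.id _) (.id _)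

lemma cech_pt (t : SuperDG.TPow k A.Tot p) (x y) :
    φ.cech ν (ν.pt t x y) = ν.pt (φ.tpow p t) x y := rfl

lemma cech_act (t : SuperDG.TPow k A.Tot p) (z : ν.Y ℤ) :
    φ.cech ν (act t z) = act (φ.tpow p t) z := by
  induction z using Y_induction with
  | pt m x y => rw [act_pt, act_pt, cech_pt, map_zsmul]
  | add w z hw hz => rw [map_add, map_add, map_add, hw, hz]

lemma cech_d (w : A.CechTot ν) :
    φ.cech ν ((A.cechSigned ν).d w) = (B.cechSigned ν).d (φ.cech ν w) := by
  induction w using Y_induction with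
  | add w z hw hz => rw [map_add, map_add, map_add, map_add, hw, hz]
  | pt t x y =>
    rw [cech_pt, cech_d_pt, cech_d_pt, map_add, map_add, cech_pt, cech_pt, cech_pt, tpow_d, tpow_s]

lemma cech_action (w : A.CechTot ν) :
    φ.cech ν ((A.cechAction ν).f w) = (B.cechAction ν).f (φ.cech ν w) := by
  induction w using Y_induction with
  | add w z hw hz => rw [map_add, map_add, map_add, map_add, hw, hz]
  | pt t x y => exact congrArg (fun t => ν.pt t (ν.σP x) (ν.σI y)) (φ.tpow_perm t)

lemma cech_lowFil {J n : ℤ} {w : A.CechTot ν} (hw : w ∈ A.lowFil ν J n) :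
    φ.cech ν w ∈ B.lowFil ν J n :=
  map_triDeg _ _ (fun _ _ _ h _ _ _ ht _ hx _ hy => pt_mem_triDeg h (φ.tpow_powDeg ht) hx hy) hw

lemma cech_F {m n : ℤ} {w : A.CechTot ν} (hw : w ∈ (A.cech ν).F m n) :
    φ.cech ν w ∈ (B.cech ν).F m n := by
  refine ⟨mem_cechFil_iff.mpr (φ.cech_lowFil (mem_cechFil_iff.mp hw.1)), ?_⟩
  have h : (A.cechAction ν).f w = w := hw.2
  change (B.cechAction ν).f (φ.cech ν w) = φ.cech ν w
  rw [← φ.cech_action, h]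

lemma cech_Z {n : ℤ} {w : A.CechTot ν} (hw : w ∈ (A.cech ν).Z n) : φ.cech ν w ∈ (B.cech ν).Z n := by
  refine ⟨φ.cech_F hw.1, ?_⟩
  have := φ.cech_F hw.2
  rw [SetLike.mem_coe, Submodule.mem_comap]
  exact (φ.cech_d w) ▸ this

lemma cech_powRel {c : ℤ → ν.Y ℤ} {n : ℤ} {z : ν.Y (SuperDG.TPow k A.Tot p)} {v : A.X n}
    (h : PowRel c n z v) : PowRel c n (φ.cech ν z) (φ.f n v) := by
  obtain ⟨y, hy, h⟩ := h
  refine ⟨φ.cech ν y, φ.cech_F hy, ?_⟩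
  have := φ.cech_lowFil h
  rwa [map_sub, map_sub, cech_act, cech_d, tpow_powElt] at this

end ChainMap

lemma Hom.cech_eq {A B : DGAlgebra.{u, v} k} (φ : A.Hom B) (w : A.CechTot ν) :
    (φ.cech ν).f w = φ.chain.cech ν w := by
  have : (φ.cech ν).f.toAddMonoidHom = φ.chain.cech ν := Y_hom_ext fun t x y => rfl
  exact DFunLike.congr_fun this w

end DGAlgebra

end CyclicPower

namespace CyclicPower

open ResolutionData

namespace DGAlgebra

section

variable {p : ℕ} [hp : Fact p.Prime] {k : Type u} [CommRing k] {ν : ResolutionData.{u} p}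
  {A : DGAlgebra.{u, u} k} {n : ℤ}

lemma lowFil_of_F {z : A.CechTot ν} {N : ℤ} (hz : z ∈ (A.cech ν).F (1 - n) N) :
    z ∈ A.lowFil ν (n * p - 1) N := by
  have h0 : (0 : ℤ) < p := by exact_mod_cast hp.1.pos
  have h := cech_F_le hz
  rw [neg_sub, sub_mul] at h
  exact lowFil_mono (by omega) h

lemma Rel_zero_iff {c : ℤ → ν.Y ℤ} (O : ν.Ops) {ι : ℤ → Type u}
    (b : ∀ n, Module.Basis (ι n) k (A.X n)) {z : A.CechTot ν} (hz : z ∈ (A.cech ν).Z n) :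
    (cycData b).Rel c n z 0 ↔
      z ∈ (A.cech ν).F (1 - n) n ⊔ ((A.cech ν).F (-n) (n + 1)).map (A.cech ν).d := by
  constructor
  · intro h
    have hd := hz.2
    rw [SetLike.mem_coe, Submodule.mem_comap] at hd
    obtain ⟨y, hy, h⟩ := (cycData b).exists_of_rel_zero (O := O)
      ((mem_cech_F_neg b).mp hz.1) (by
        have := (mem_cech_F_one_sub b).mp hd
        rw [← cech_d_eq]; exact this.1) h
    rw [← mem_cech_F_one_sub, ← cech_d_eq] at h
    rw [← mem_cech_F_neg] at hy
    exact Submodule.mem_sup.mpr ⟨_, h, _, ⟨y, hy, rfl⟩, sub_add_cancel _ _⟩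
  · intro h
    obtain ⟨x, hx, _, ⟨y, hy, rfl⟩, rfl⟩ := Submodule.mem_sup.mp h
    have h1 := (cycData b).Rel_of_mem (c := c) (n := n) (z := x) (lowFil_of_F hx)
    have h2 := h1.add ((cycData b).Rel_dW (c := c) ((mem_cech_F_neg b).mp hy))
    rw [add_zero, ← cech_d_eq b] at h2
    exact h2

end

section field

variable {p : ℕ} [hp : Fact p.Prime] {R : Type u} [Field R] [CharP R p] [PerfectField R]
  {ν : ResolutionData.{u} p} {O : ν.Ops} {c : ℤ → ν.Y ℤ} (hc : IsGenSeq.{u, u} O c)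
  {A : DGAlgebra.{u, u} R} {n : ℤ}

variable (A) in
/-- A basis of a term of a DG algebra over a field. -/
noncomputable def fieldBasis (n : ℤ) :
    Module.Basis (Module.Basis.ofVectorSpaceIndex R (A.X n)) R (A.X n) :=
  Module.Basis.ofVectorSpace R (A.X n)

lemma p_smul_eq_zero {X : Type*} [AddCommGroup X] [Module R X] (x : X) : p • x = 0 := by
  rw [← Nat.cast_smul_eq_nsmul R, CharP.cast_eq_zero, zero_smul]

lemma powQ_powElt_injective (n : ℤ) :
    Function.Injective fun v : A.X n => powQ A.fieldBasis p n (A.powElt p n v) := fun v v' h => by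
  refine (A.fieldBasis n).repr.injective (Finsupp.ext fun i => frobenius_inj R p ?_)
  have := DFunLike.congr_fun h i
  rw [frobenius_def, frobenius_def]
  simpa only [powQ_powElt] using this

lemma powQ_powElt_surjective (n : ℤ) :
    Function.Surjective fun v : A.X n => powQ A.fieldBasis p n (A.powElt p n v) := fun m => by
  refine ⟨(A.fieldBasis n).repr.symm (m.mapRange (frobeniusEquiv R p).symm (map_zero _)),
    Finsupp.ext fun i => ?_⟩
  simp only [powQ_powElt]
  rw [LinearEquiv.apply_symm_apply, Finsupp.mapRange_apply]
  exact frobenius_apply_frobeniusEquiv_symm R p (m i)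

lemma powQ_powElt_add (v v' : A.X n) : powQ A.fieldBasis p n (A.powElt p n (v + v')) =
    powQ A.fieldBasis p n (A.powElt p n v) + powQ A.fieldBasis p n (A.powElt p n v') :=
  Finsupp.ext fun i => by
    rw [Finsupp.add_apply, powQ_powElt, powQ_powElt, powQ_powElt, map_add, Finsupp.add_apply,
      add_pow_expChar]

lemma PowRel_zero_of_mem {z : A.CechTot ν} (hz : z ∈ A.lowFil ν (n * p - 1) n) :
    PowRel c n z (0 : A.X n) :=
  (PowRel_iff A.fieldBasis).mpr (by rw [powElt_zero]; exact (cycData A.fieldBasis).Rel_of_mem hz)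

lemma PowRel_d {y : A.CechTot ν} (hy : y ∈ (A.cech ν).F (-n) (n + 1)) :
    PowRel c n ((A.cechSigned ν).d y) (0 : A.X n) :=
  (PowRel_iff A.fieldBasis).mpr (by
    rw [powElt_zero, cech_d_eq A.fieldBasis]
    exact (cycData A.fieldBasis).Rel_dW ((mem_cech_F_neg A.fieldBasis).mp hy))

lemma PowRel_zero_of_F {z : A.CechTot ν} (hz : z ∈ (A.cech ν).F (1 - n) n) :
    PowRel c n z (0 : A.X n) := PowRel_zero_of_mem (lowFil_of_F hz)

include hc

lemma PowRel.add {z z' : A.CechTot ν} {v v' : A.X n} (h : PowRel c n z v) (h' : PowRel c n z' v') :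
    PowRel c n (z + z') (v + v') := by
  have h1 := ((PowRel_iff A.fieldBasis).mp h).add ((PowRel_iff A.fieldBasis).mp h')
  have e1 := Eig_powElt (p := p) A.fieldBasis n v
  have e2 := Eig_powElt (p := p) A.fieldBasis n v'
  refine (PowRel_iff A.fieldBasis).mpr ((cycData A.fieldBasis).Rel_congr hc
    ⟨add_mem e1.1 e2.1, ?_⟩ (Eig_powElt (p := p) A.fieldBasis n (v + v')) ?_ h1)
  · rw [map_add, e1.2, e2.2, smul_add]
  · rw [map_add]; exact (powQ_powElt_add v v').symm

lemma PowRel.neg {z : A.CechTot ν} {v : A.X n} (h : PowRel c n z v) : PowRel c n (-z) (-v) := by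
  have h1 := ((PowRel_iff A.fieldBasis).mp h).neg
  have e1 := Eig_powElt (p := p) A.fieldBasis n v
  refine (PowRel_iff A.fieldBasis).mpr ((cycData A.fieldBasis).Rel_congr hc
    ⟨neg_mem e1.1, ?_⟩ (Eig_powElt (p := p) A.fieldBasis n (-v)) ?_ h1)
  · rw [map_neg, e1.2, smul_neg]
  · rw [map_neg]
    have := powQ_powElt_add (p := p) v (-v)
    rw [add_neg_cancel, powElt_zero, map_zero] at this
    exact neg_eq_of_add_eq_zero_right this.symm

lemma PowRel.sub {z z' : A.CechTot ν} {v v' : A.X n} (h : PowRel c n z v) (h' : PowRel c n z' v') :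
    PowRel c n (z - z') (v - v') := by
  rw [sub_eq_add_neg, sub_eq_add_neg]; exact h.add hc (h'.neg hc)

lemma Rel_powQ {z : A.CechTot ν} {v : A.X n} (h : PowRel c n z v) : (cycData A.fieldBasis).Rel c n z
    (powJ A.fieldBasis p n (powQ A.fieldBasis p n (A.powElt p n v))) :=
  (cycData A.fieldBasis).Rel_congr hc (Eig_powElt A.fieldBasis n v)
    ((cycData A.fieldBasis).Eig_j n _) (powQ_powJ A.fieldBasis n _).symm
    ((PowRel_iff A.fieldBasis).mp h)

lemma PowRel_of_powQ {z : A.CechTot ν} {v : A.X n} (h : (cycData A.fieldBasis).Rel c n z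
    (powJ A.fieldBasis p n (powQ A.fieldBasis p n (A.powElt p n v)))) : PowRel c n z v :=
  (PowRel_iff A.fieldBasis).mpr ((cycData A.fieldBasis).Rel_congr hc
    ((cycData A.fieldBasis).Eig_j n _) (Eig_powElt A.fieldBasis n v)
    (powQ_powJ A.fieldBasis n _) h)

lemma PowRel.unique {z : A.CechTot ν} {v v' : A.X n} (h : PowRel c n z v) (h' : PowRel c n z v') :
    v = v' := by
  obtain ⟨m, hm⟩ := (cycData A.fieldBasis).Rel_unique hc (Rel_powQ hc h) (Rel_powQ hc h')
  rw [p_smul_eq_zero (R := R)] at hm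
  exact powQ_powElt_injective n (sub_eq_zero.mp hm)

lemma exists_powRel {z : A.CechTot ν} (hz : z ∈ (A.cech ν).Z n) : ∃ v, PowRel c n z v := by
  obtain ⟨m, hm⟩ := (cycData A.fieldBasis).exists_rel hc ((mem_cech_F_neg A.fieldBasis).mp hz.1)
    (by rw [← cech_d_eq]; exact lowFil_of_F hz.2)
  obtain ⟨v, rfl⟩ := powQ_powElt_surjective (p := p) n m
  exact ⟨v, PowRel_of_powQ hc hm⟩

lemma exists_of_powElt (v : A.X n) : ∃ z ∈ (A.cech ν).Z n, PowRel c n z v := by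
  obtain ⟨z, hz, hd, h⟩ := (cycData A.fieldBasis).exists_lift hc
    (powQ A.fieldBasis p n (A.powElt p n v))
  exact ⟨z, ⟨(mem_cech_F_neg A.fieldBasis).mpr hz, by
    rw [← cech_d_eq, ← mem_cech_F_one_sub] at hd; exact hd⟩, PowRel_of_powQ hc h⟩

lemma PowRel_zero_iff {z : A.CechTot ν} (hz : z ∈ (A.cech ν).Z n) : PowRel c n z (0 : A.X n) ↔
    z ∈ (A.cech ν).F (1 - n) n ⊔ ((A.cech ν).F (-n) (n + 1)).map (A.cech ν).d := by
  rw [PowRel_iff A.fieldBasis, powElt_zero]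
  exact Rel_zero_iff O A.fieldBasis hz

end field

end DGAlgebra

end CyclicPower

namespace CyclicPower

namespace ResolutionData

variable {p : ℕ} (ν : ResolutionData.{u} p)

section

variable {k : Type v} [CommRing k] {V : Type w} [AddCommGroup V] [Module k V] (L : SignedDG k V)

/-- The differential algebra `L ⊗ P ⊗ I`. -/
noncomputable def alg : SignedDG k (ν.Y V) := (L.tensor ν.P.superInt).tensor ν.I.superInt

variable {ν}

lemma alg_mul_pt {b c b' : ℤ} {ε : ZMod 2} {t t' : V} (ht : L.s t' = koszul k ε • t') {x y x' y'}
    (hx : x ∈ ν.P.deg b) (hy : y ∈ ν.I.deg c) (hx' : x' ∈ ν.P.deg b') :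
    (ν.alg L).mul (ν.pt t x y) (ν.pt t' x' y') = koszul k ((c : ZMod 2) * (ε + b')) •
      koszul k ((b : ZMod 2) * ε) •
        ν.pt (L.mul t t') (ν.P.superInt.mul x x') (ν.I.superInt.mul y y') := by
  have e1 := tensor_mul_of_s _ ν.I.superInt (DGAlgebra.par_of_deg_int hy) (tens t x)
    (tensor_s _ ν.P.superInt ht (DGAlgebra.par_of_deg_int hx')) y'
  rwa [tensor_mul_of_s _ ν.P.superInt (DGAlgebra.par_of_deg_int hx) _ ht, tens_smul] at e1

end

/-- The ring of integers, as a differential algebra. -/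
def intSigned : SignedDG ℤ ℤ where
  mul := LinearMap.mul ℤ ℤ
  one := 1
  s := LinearMap.id
  d := 0
  mul_assoc := mul_assoc
  one_mul := one_mul
  mul_one := mul_one
  s_mul _ _ := rfl
  s_one := rfl
  s_s _ := rfl
  d_d _ := rfl
  d_s _ := by simp
  leibniz _ _ := by simp

/-- The differential algebra `P ⊗ I`. -/
noncomputable def algQ : SignedDG ℤ (ν.Y ℤ) := ν.alg intSigned

variable {ν}

lemma algQ_d (z : ν.Y ℤ) : ν.algQ.d z = ν.dY ℤ z := by
  have : ν.algQ.d.toAddMonoidHom = ν.dY ℤ := Y_hom_ext fun t x y => by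
    change ν.algQ.d (tens (tens t x) y) = _
    refine (tensor_d _ _ _ _).trans ?_
    rw [tensor_d, show intSigned.d t = 0 from rfl, zero_tens, zero_add]; rfl
  exact DFunLike.congr_fun this z

/-- The product of elements of `P ⊗ I` is defined up to signs on pure tensors. -/
lemma algQ_mul_pt {b c b' : ℤ} {t t' : ℤ} {x y x' y'} (hx : x ∈ ν.P.deg b) (hy : y ∈ ν.I.deg c)
    (hx' : x' ∈ ν.P.deg b') : ν.algQ.mul (ν.pt t x y) (ν.pt t' x' y') =
      koszul ℤ ((c : ZMod 2) * b') • ν.pt (t * t') (ν.P.superInt.mul x x') (ν.I.superInt.mul y y') := by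
  have h := alg_mul_pt (ν := ν) intSigned (ε := 0) (t := t) (t' := t')
    (by rw [koszul_zero, one_smul]; rfl) hx hy hx' (y' := y')
  rw [zero_add, mul_zero, koszul_zero] at h
  exact h.trans ((int_smul_eq_zsmul _ _ _).trans (congrArg _ ((int_smul_eq_zsmul _ _ _).trans
    (one_smul ℤ _))))

lemma algQ_mul_dg {K K' : ℤ} {z z' : ν.Y ℤ} (hz : z ∈ ν.dg ℤ K) (hz' : z' ∈ ν.dg ℤ K') :
    ν.algQ.mul z z' ∈ ν.dg ℤ (K + K') := by
  refine map_triDeg (ν.algQ.mul.flip z').toAddMonoidHom _ (fun _ b c h _ _ t _ x hx y hy => ?_) hz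
  refine map_triDeg (ν.algQ.mul (ν.pt t x y)).toAddMonoidHom _
    (fun _ b' c' h' _ _ t' _ x' hx' y' hy' => ?_) hz'
  refine (congrArg (· ∈ ν.dg ℤ (K + K')) (algQ_mul_pt hx hy hx')).mpr (zsmul_mem ?_ _)
  exact pt_mem_triDeg (j := 0) (b := b + b') (c := c + c') (by omega) (AddSubgroup.mem_top _)
    (DGAlgebra.mul_deg_int rfl hx hx') (DGAlgebra.mul_deg_int rfl hy hy')

lemma algQ_mul_τ {K K' : ℤ} {z z' : ν.Y ℤ} (hz : z ∈ ν.dg ℤ K) (hz' : z' ∈ ν.dg ℤ K') (χ χ' : ℤ) :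
    ν.τ (zs ℤ (χ * χ')) (ν.algQ.mul z z') =
      ν.algQ.mul (ν.τ (zs ℤ χ) z) (ν.τ (zs ℤ χ') z') := by
  refine sub_eq_zero.mp (AddSubgroup.mem_bot.mp (map_triDeg
    ((ν.τ (zs ℤ (χ * χ'))).comp (ν.algQ.mul.flip z').toAddMonoidHom -
    (ν.algQ.mul.flip (ν.τ (zs ℤ χ') z')).toAddMonoidHom.comp (ν.τ (zs ℤ χ))) ⊥
    (fun _ b c h _ _ t _ x hx y hy => ?_) hz))
  refine map_triDeg
    ((ν.τ (zs ℤ (χ * χ'))).comp (ν.algQ.mul (ν.pt t x y)).toAddMonoidHom -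
    (ν.algQ.mul (ν.τ (zs ℤ χ) (ν.pt t x y))).toAddMonoidHom.comp (ν.τ (zs ℤ χ'))) ⊥
    (fun _ b' c' h' _ _ t' _ x' hx' y' hy' => ?_) hz'
  refine AddSubgroup.mem_bot.mpr (sub_eq_zero.mpr ?_)
  change ν.τ _ (ν.algQ.mul (ν.pt t x y) (ν.pt t' x' y')) =
    ν.algQ.mul (ν.τ (zs ℤ χ) (ν.pt t x y)) (ν.τ (zs ℤ χ') (ν.pt t' x' y'))
  have hP : ν.σP (ν.P.superInt.mul x x') = ν.P.superInt.mul (ν.σP x) (ν.σP x') :=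
    (ν.homP (.ofAdd 1)).superInt.map_mul x x'
  have hI : ν.σI (ν.I.superInt.mul y y') = ν.I.superInt.mul (ν.σI y) (ν.σI y') :=
    (ν.homI (.ofAdd 1)).superInt.map_mul y y'
  rw [algQ_mul_pt hx hy hx', map_zsmul, τ_pt, τ_pt, τ_pt,
    algQ_mul_pt (ν.σP_deg hx) (ν.σI_deg hy) (ν.σP_deg hx'), hP, hI, zs_apply, zs_apply, zs_apply,
    smul_eq_mul, smul_eq_mul, smul_eq_mul, mul_mul_mul_comm]

lemma chi_add (p : ℕ) (n m : ℤ) : chi p (n + m) = chi p n * chi p m := by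
  rw [chi, chi, chi, ← koszul_add, ← Int.cast_add, add_mul]

lemma act_eq_smul (m : ℤ) (z : ν.Y ℤ) : act m z = m • z := by
  induction z using Y_induction with
  | pt t x y => rw [act_pt, smul_eq_mul, mul_comm, ← smul_eq_mul, map_zsmul]; rfl
  | add w z hw hz => rw [map_add, hw, hz, smul_add]

/-- The structure constants of the products of the classes `c`. -/
lemma exists_mul_gen [Fact p.Prime] {O : ν.Ops} {c : ℤ → ν.Y ℤ} (hc : IsGenSeq.{u, w} O c)
    (n m : ℤ) : ∃ μ : ℤ, ∃ y ∈ ν.dg ℤ (-(n + m) * (p - 1) + 1),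
      ν.τ (zs ℤ (chi p (n + m))) y = y ∧ ν.algQ.mul (c n) (c m) = μ • c (n + m) + ν.dY ℤ y := by
  let T := chiOps O ℤ (chi_pow (p := p) (n + m))
  have hn := CycData.c_dg hc n
  have hm := CycData.c_dg hc m
  have h1 : ν.algQ.mul (c n) (c m) ∈ ν.dg ℤ (-(n + m) * (p - 1)) := by
    have := algQ_mul_dg hn hm
    rwa [← add_mul, ← neg_add] at this
  obtain ⟨μ, w, hw, hdw, e⟩ := (hc (n + m)).1.gen _ h1 (by
    change ν.dY ℤ _ = 0
    rw [← algQ_d, ν.algQ.leibniz, algQ_d, algQ_d, CycData.dY_c hc, CycData.dY_c hc, map_zero,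
      LinearMap.zero_apply, map_zero, add_zero]) (by
    refine sub_eq_zero.mpr ?_
    change _ = ν.τ _ _
    rw [chi_add, algQ_mul_τ hn hm, CycData.τ_c hc, CycData.τ_c hc]; rfl)
  refine ⟨μ, T.β (T.h w), T.β_deg _ _ (T.h_deg _ _ rfl _ hw),
    (sub_eq_zero.mp (T.α_β (T.h w))).symm, ?_⟩
  have e2 : T.d (T.β (T.h w)) = T.β w := by rw [T.d_β, T.d_h_of_cycle hdw]
  rw [e, actHom_apply, act_eq_smul]
  exact congrArg (_ + ·) e2.symm

end ResolutionData

open ResolutionData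

namespace DGAlgebra

variable {p : ℕ} {k : Type u} [CommRing k] {ν : ResolutionData.{u} p} {A : DGAlgebra.{u, v} k}

lemma act_mul {K j : ℤ} {t t' : SuperDG.TPow k A.Tot p} (ht' : t' ∈ A.powDeg p j) {z : ν.Y ℤ}
    (hz : z ∈ ν.dg ℤ K) {K' : ℤ} {z' : ν.Y ℤ} (hz' : z' ∈ ν.dg ℤ K') :
    (A.cechSigned ν).mul (act t z) (act t' z') =
      koszul ℤ ((K : ZMod 2) * j) • act ((A.super.pow p).mul t t') (ν.algQ.mul z z') := by
  refine sub_eq_zero.mp (AddSubgroup.mem_bot.mp (map_triDeg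
    (((A.cechSigned ν).mul.flip (act t' z')).toAddMonoidHom.comp (act t) -
      (zs _ (koszul ℤ ((K : ZMod 2) * j))).comp
        ((act ((A.super.pow p).mul t t')).comp (ν.algQ.mul.flip z').toAddMonoidHom)) ⊥
    (fun _ b c h _ _ a _ x hx y hy => ?_) hz))
  refine map_triDeg
    (((A.cechSigned ν).mul (act t (ν.pt a x y))).toAddMonoidHom.comp (act t') -
      (zs _ (koszul ℤ ((K : ZMod 2) * j))).comp
        ((act ((A.super.pow p).mul t t')).comp (ν.algQ.mul (ν.pt a x y)).toAddMonoidHom)) ⊥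
    (fun _ b' c' h' _ _ a' _ x' hx' y' hy' => ?_) hz'
  refine AddSubgroup.mem_bot.mpr (sub_eq_zero.mpr ?_)
  change (A.cechSigned ν).mul (act t (ν.pt a x y)) (act t' (ν.pt a' x' y')) =
    koszul ℤ ((K : ZMod 2) * j) • act ((A.super.pow p).mul t t')
      (ν.algQ.mul (ν.pt a x y) (ν.pt a' x' y'))
  rw [algQ_mul_pt hx hy hx', map_zsmul, act_pt, act_pt, act_pt]
  refine (alg_mul_pt (ν := ν) (A.super.pow p) (powDeg_s (A.powDeg p j |>.smul_of_tower_mem a' ht'))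
    hx hy hx').trans ?_
  have e : (A.super.pow p).mul (a • t) (a' • t') = (a * a') • (A.super.pow p).mul t t' := by
    rw [map_zsmul, map_zsmul, LinearMap.smul_apply, smul_smul, mul_comm]
  rw [e, koszul_zsmul (k := k),
    koszul_zsmul (k := k), smul_smul, smul_smul, ← koszul_add, ← koszul_add, ← h]
  congr 2
  push_cast; ring

lemma powElt_mul (n m : ℤ) (v : A.X n) (v' : A.X m) :
    (A.super.pow p).mul (A.powElt p n v) (A.powElt p m v') =
      koszul ℤ (SuperDG.crossing (fun _ : Fin p => (n : ZMod 2)) fun _ => (m : ZMod 2)) •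
        A.powElt p (n + m) (A.mul n m (n + m) rfl v v') := by
  refine (A.super.powMul_tprod (fun _ => par_of_deg ⟨v, rfl⟩) fun _ => par_of_deg ⟨v', rfl⟩).trans ?_
  rw [koszul_zsmul (k := k), powElt]
  simp only [← A.totMul_ι rfl]; rfl

end DGAlgebra

end CyclicPower

namespace CyclicPower

open ResolutionData

namespace DGAlgebra

variable {p : ℕ} [hp : Fact p.Prime] {R : Type u} [Field R] [CharP R p] [PerfectField R]
  {ν : ResolutionData.{u} p} {O : ν.Ops} {c : ℤ → ν.Y ℤ} (hc : IsGenSeq.{u, u} O c)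

lemma act_F {A : DGAlgebra.{u, u} R} {n : ℤ} (hc : IsGenSeq.{u, u} O c) (v : A.X n) :
    act (A.powElt p n v) (c n) ∈ (A.cech ν).F (-n) n :=
  (mem_cech_F_neg A.fieldBasis).mpr ((cycData A.fieldBasis).act_GI hc (Eig_powElt A.fieldBasis n v))

lemma d_act_mem {A : DGAlgebra.{u, u} R} {n : ℤ} (hc : IsGenSeq.{u, u} O c) (v : A.X n) :
    (A.cechSigned ν).d (act (A.powElt p n v) (c n)) ∈ A.lowFil ν (n * p - 1) (n - 1) := by
  rw [cech_d_eq A.fieldBasis]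
  exact (cycData A.fieldBasis).dW_act hc (Eig_powElt A.fieldBasis n v)

lemma lowFil_congr {A : DGAlgebra.{u, u} R} {J J' n n' : ℤ} (h : J ≤ J') (h' : n = n')
    {z : A.CechTot ν} (hz : z ∈ A.lowFil ν J n) : z ∈ A.lowFil ν J' n' := by
  subst h'; exact lowFil_mono h hz

lemma powElt_intCast {A : DGAlgebra.{u, u} R} {n : ℤ} (s : ℤ) (v : A.X n) :
    A.powElt p n ((s : R) • v) = s • A.powElt p n v := by
  rw [powElt_smul, ← frobenius_def, map_intCast, Int.cast_smul_eq_zsmul]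

include hc

/-- Products modulo boundaries and lower terms. -/
lemma exists_mul_sub {A : DGAlgebra.{u, u} R} {n m : ℤ} {z z' : A.CechTot ν} {v : A.X n}
    {v' : A.X m} (hz' : z' ∈ (A.cech ν).Z m) (h : PowRel c n z v) (h' : PowRel c m z' v') :
    ∃ y ∈ (A.cech ν).F (-(n + m)) (n + m + 1), (A.cechSigned ν).mul z z' -
      (A.cechSigned ν).mul (act (A.powElt p n v) (c n)) (act (A.powElt p m v') (c m)) -
        (A.cechSigned ν).d y ∈ A.lowFil ν ((n + m) * p - 1) (n + m) := by
  obtain ⟨y, hy, h⟩ := h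
  obtain ⟨y', hy', h'⟩ := h'
  have hz0 := act_F hc v
  have hd0 := d_act_mem hc v
  set z₀ := act (A.powElt p n v) (c n)
  set z₀' := act (A.powElt p m v') (c m)
  have l1 : (A.cechSigned ν).d ((A.cechSigned ν).mul y z') = (A.cechSigned ν).mul
    ((A.cechSigned ν).d y) z' + (n + 1).negOnePow • (A.cechSigned ν).mul y ((A.cechSigned ν).d z') :=
    (A.cech ν).leibniz_F hy z'
  have l2 : (A.cechSigned ν).d ((A.cechSigned ν).mul z₀ y') = (A.cechSigned ν).mul
    ((A.cechSigned ν).d z₀) y' + n.negOnePow • (A.cechSigned ν).mul z₀ ((A.cechSigned ν).d y') :=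
    (A.cech ν).leibniz_F hz0 y'
  have hs : ∀ (e : ℤˣ) {J N} {x : A.CechTot ν}, x ∈ A.lowFil ν J N → e • x ∈ A.lowFil ν J N :=
    fun e J N x hx => by rw [Units.smul_def]; exact zsmul_mem hx _
  have l2' : (A.cechSigned ν).mul z₀ ((A.cechSigned ν).d y') =
      n.negOnePow • (A.cechSigned ν).d ((A.cechSigned ν).mul z₀ y') -
        n.negOnePow • (A.cechSigned ν).mul ((A.cechSigned ν).d z₀) y' := by
    rw [l2, smul_add, smul_smul, Int.units_mul_self, one_smul, add_sub_cancel_left]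
  refine ⟨(A.cechSigned ν).mul y z' + n.negOnePow • (A.cechSigned ν).mul z₀ y', add_mem ?_ ?_, ?_⟩
  · exact (A.cech ν).mul_mem_F hy hz'.1 (by omega) (by omega)
  · exact FilteredDG.smul_units_mem _ ((A.cech ν).mul_mem_F hz0 hy' (by omega) (by omega))
  · have e1 := lowFil_mul h (cech_F_le hz'.1)
    have e2 := lowFil_mul (cech_F_le hz0) h'
    have e3 := hs (n + 1).negOnePow (lowFil_mul (cech_F_le hy) (lowFil_of_F hz'.2))
    have e4 := hs n.negOnePow (lowFil_mul hd0 (cech_F_le hy'))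
    have e1 := lowFil_congr (J' := (n + m) * p - 1) (n' := n + m) (le_of_eq (by ring)) rfl e1
    have e2 := lowFil_congr (J' := (n + m) * p - 1) (n' := n + m) (le_of_eq (by ring)) rfl e2
    have e3 := lowFil_congr (J' := (n + m) * p - 1) (n' := n + m) (le_of_eq (by ring)) (by ring) e3
    have e4 := lowFil_congr (J' := (n + m) * p - 1) (n' := n + m) (le_of_eq (by ring)) (by ring) e4
    have := sub_mem (sub_mem (add_mem e1 e2) e3) e4
    convert this using 1
    have hu : (A.cechSigned ν).d (n.negOnePow • (A.cechSigned ν).mul z₀ y') =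
        n.negOnePow • (A.cechSigned ν).d ((A.cechSigned ν).mul z₀ y') := by
      rw [Units.smul_def, Units.smul_def, map_zsmul]
    rw [map_add, l1, hu]
    simp only [map_sub, LinearMap.sub_apply, l2']
    change _ = _ - (n + 1).negOnePow • (A.cechSigned ν).mul y ((A.cechSigned ν).d z') - _
    abel

/-- The structure constants of the product. -/
lemma exists_powRel_mul (n m : ℤ) : ∃ s : ℤ, ∀ (A : DGAlgebra.{u, u} R) (z z' : A.CechTot ν)
    (v : A.X n) (v' : A.X m), z' ∈ (A.cech ν).Z m → PowRel c n z v → PowRel c m z' v' →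
      PowRel c (n + m) ((A.cechSigned ν).mul z z') ((s : R) • A.mul n m (n + m) rfl v v') := by
  obtain ⟨μ, y₀, hy₀, hτ, e⟩ := exists_mul_gen hc n m
  let s₁ := koszul ℤ (((-n * (p - 1) : ℤ) : ZMod 2) * ((m * p : ℤ) : ZMod 2))
  let s₂ := koszul ℤ (SuperDG.crossing (fun _ : Fin p => (n : ZMod 2)) fun _ => (m : ZMod 2))
  refine ⟨s₁ * s₂ * μ, fun A z z' v v' hz' h h' => ?_⟩
  obtain ⟨y, hy, h1⟩ := exists_mul_sub hc hz' h h'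
  set t := A.powElt p (n + m) (A.mul n m (n + m) rfl v v')
  have hE := Eig_powElt (p := p) A.fieldBasis _ (A.mul n m (n + m) rfl v v')
  have e1 : (A.cechSigned ν).mul (act (A.powElt p n v) (c n)) (act (A.powElt p m v') (c m)) =
      (s₁ * s₂ * μ) • act t (c (n + m)) + (s₁ * s₂) • ν.dY _ (act t y₀) := by
    rw [act_mul (powElt_mem m v') (CycData.c_dg hc n) (CycData.c_dg hc m), powElt_mul, e,
      CycData.act_smul, map_add, map_zsmul, act_dY, smul_smul, smul_add, smul_smul]
  obtain ⟨y', hy', h2⟩ := (cycData A.fieldBasis).exists_dW (n := n + m)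
    ((cycData A.fieldBasis).act_Tp (N := n + m + 1) (by ring) hE.1 hy₀)
    ((cycData A.fieldBasis).mem_Inv.mpr (by rw [(cycData A.fieldBasis).act_τ_eig hE, hτ]))
  refine ⟨y + (s₁ * s₂) • y', add_mem hy (zsmul_mem ((mem_cech_F_neg A.fieldBasis).mpr hy') _), ?_⟩
  rw [powElt_intCast, CycData.act_smul, map_add, map_zsmul, cech_d_eq A.fieldBasis y']
  have h3 := add_mem h1 (zsmul_mem (show _ ∈ A.lowFil ν ((n + m) * p - 1) (n + m) from h2) (s₁ * s₂))
  convert h3 using 1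
  rw [e1, smul_sub]
  abel

end DGAlgebra

end CyclicPower

namespace CyclicPower

open ResolutionData

namespace CycData

variable {p : ℕ} {V : Type v} [AddCommGroup V] {M : ℤ → Type w} [∀ n, AddCommGroup (M n)]
  (D : CycData p V M) {ν : ResolutionData.{u} p}

/-- If the complex `V` is contractible, then an invariant cycle is a boundary modulo the elements of
large degree in `V`. -/
lemma exists_contract (O : ν.Ops) {T : V →+ V} (hT : ∀ j, ∀ t ∈ D.gr j, T t ∈ D.gr (j + 1))
    (hd : ∀ t, D.dE (T t) + T (D.dE t) = t) (hs : ∀ t, T (D.sE t) = - D.sE (T t)) {J n : ℤ}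
    {w : ν.Y V} (hw : w ∈ triDeg D.gr fun j b c => J ≤ j ∧ j + b + c = n) (hw' : w ∈ D.Inv ν)
    (hdw : D.dW ν w = 0) (i : ℕ) : ∃ y ∈ triDeg D.gr fun j b c => j + b + c = n + 1, y ∈ D.Inv ν ∧
      w - D.dW ν y ∈ triDeg D.gr fun j b c => J + i ≤ j ∧ j + b + c = n := by
  induction i with
  | zero =>
    refine ⟨0, zero_mem _, zero_mem _, ?_⟩
    rw [map_zero, sub_zero, Nat.cast_zero, add_zero]; exact hw
  | succ i ih =>
    obtain ⟨y, hy, hy', h⟩ := ih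
    set x := w - D.dW ν y with hx
    have hx' : x ∈ D.Inv ν := AddSubgroup.sub_mem (D.Inv ν) hw' (D.dW_Inv hy')
    have hdx : D.dW ν x = 0 := by rw [hx, map_sub, hdw, dW_dW, sub_zero]
    have hτ := D.τ_dW (ν := ν)
    let Θ : ν.Y V →+ ν.Y V := tri T (.id _) O.πI
    let N : ν.Y V →+ ν.Y V := tri (.id V) (.id _) O.πI - (D.dW ν).comp Θ - Θ.comp (D.dW ν)
    have hΘ : traceHom p (ν.τ D.σ) Θ x ∈ triDeg D.gr fun j b c => j + b + c = n + 1 :=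
      traceHom_mem (S := triDeg D.gr fun j b c => J + i ≤ j ∧ j + b + c = n)
        (fun z hz => τ_mem D.σ_gr hz) (fun z hz => τ_mem D.σ_gr hz)
        (fun z hz => tri_mem 1 0 0 hT (fun b x hx => by rw [add_zero]; exact hx)
          (fun c y hy => by rw [add_zero]; exact O.πI_deg c y hy) (fun _ _ _ h _ _ => by omega) hz) h
    refine ⟨y + traceHom p (ν.τ D.σ) Θ x, add_mem hy hΘ, add_mem hy' (D.mem_Inv.mpr ?_), ?_⟩
    · rw [map_traceHom_self (τ_iter D.σ_iter), D.mem_Inv.mp hx']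
    · have e : w - D.dW ν (y + traceHom p (ν.τ D.σ) Θ x) = traceHom p (ν.τ D.σ) N x := by
        have e1 := traceHom_τ D.σ_iter O x
        have e2 := traceHom_comp (p := p) (ς := ν.τ D.σ) (π := Θ) (F := D.dW ν)
          (fun x => (hτ x).symm) x
        rw [hdx, map_zero] at e2
        rw [traceHom_sub, traceHom_sub, AddMonoidHom.sub_apply, AddMonoidHom.sub_apply, e1, ← e2,
          ← comp_traceHom (fun x => (hτ x).symm), map_add, sub_zero, ← sub_sub]
      rw [e]
      refine traceHom_mem (S := triDeg D.gr fun j b c => J + i ≤ j ∧ j + b + c = n)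
        (fun z hz => τ_mem D.σ_gr hz) (fun z hz => τ_mem D.σ_gr hz) (fun z hz => ?_) h
      refine map_triDeg N _ (fun j b c h _ _ t ht x hx y hy => ?_) hz
      have eN : N (ν.pt t x y) = ν.pt (D.sE (T t)) (ν.sP x) (O.πI (ν.dI y)) -
          ν.pt (D.sE (T t)) (ν.sP x) (ν.dI (O.πI y)) := by
        change ν.pt t x (O.πI y) - D.dW ν (ν.pt (T t) x (O.πI y)) - Θ (D.dW ν (ν.pt t x y)) = _
        rw [dW_pt, dW_pt, map_add, map_add]
        change _ - _ - (ν.pt (T (D.dE t)) x (O.πI y) + (ν.pt (T (D.sE t)) (ν.dP x) (O.πI y) +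
          ν.pt (T (D.sE t)) (ν.sP x) (O.πI (ν.dI y)))) = _
        have e3 : ν.pt t x (O.πI y) = ν.pt (D.dE (T t)) x (O.πI y) + ν.pt (T (D.dE t)) x (O.πI y) := by
          conv_lhs => rw [← hd t]
          rw [map_add]; rfl
        rw [e3, hs, map_neg]
        simp only [AddMonoidHom.neg_apply]
        abel
      have ht' : D.sE (T t) ∈ D.gr (j + 1) := by
        rw [D.sE_gr _ _ (hT _ _ ht)]; exact zsmul_mem (hT _ _ ht) _
      push_cast
      rw [eN]
      exact sub_mem
        (pt_mem_triDeg (j := j + 1) (b := b) (c := c - 1) (by omega) ht' (sP_deg hx)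
          (O.πI_deg _ _ (dI_deg (by omega) hy)))
        (pt_mem_triDeg (j := j + 1) (b := b) (c := c - 1) (by omega) ht' (sP_deg hx)
          (dI_deg (by omega) (O.πI_deg _ _ hy)))

end CycData

namespace SuperDG

variable {k : Type u} [CommRing k] {V : Type v} [AddCommGroup V] [Module k V] (S : SuperDG k V)
  (s : V →ₗ[k] V) (n : ℕ) [NeZero n]

/-- The action of an operator on the first factor of a tensor power. -/
noncomputable def powFirst : TPow k V n →ₗ[k] TPow k V n :=
  (PiTensorProduct.map fun l => if l = 0 then s else LinearMap.id : (⨂[k] _ : Fin n, V) →ₗ[k] _)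

variable {s n}

lemma powFirst_pure (a : Fin n → V) :
    powFirst s n (pureTensor k a) = pureTensor k (Function.update a 0 (s (a 0))) := by
  refine (PiTensorProduct.map_tprod _ _).trans ?_
  rw [pureTensor]
  congr 1; funext l
  by_cases h : l = 0
  · subst h; simp
  · simp [h]

variable (hs : ∀ e x, S.par e x = x → S.par (e + 1) (s x) = s x)

include hs

lemma par_first {e : Fin n → ZMod 2} {a : Fin n → V} (ha : ∀ l, S.par (e l) (a l) = a l) (l : Fin n) :
    S.par ((e + Pi.single 0 1 : Fin n → ZMod 2) l) (Function.update a 0 (s (a 0)) l) =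
      Function.update a 0 (s (a 0)) l := by
  by_cases h : l = 0
  · subst h; simp [hs _ _ (ha 0)]
  · simp [h, ha l]

lemma powS_powFirst (x : TPow k V n) :
    powFirst s n ((S.pow n).s x) = -(S.pow n).s (powFirst s n x) := by
  have : powFirst s n ∘ₗ (S.pow n).s = -((S.pow n).s ∘ₗ powFirst s n) :=
    S.pow_ext fun e a ha => by
      have h1 : (S.pow n).s (pureTensor k a) = koszul k (∑ l, e l) • pureTensor k a :=
        S.powS_tprod ha
      have h2 : (S.pow n).s (pureTensor k (Function.update a 0 (s (a 0)))) =
          koszul k (∑ l, (e + Pi.single 0 1 : Fin n → ZMod 2) l) •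
            pureTensor k (Function.update a 0 (s (a 0))) := S.powS_tprod (S.par_first hs ha)
      change powFirst s n ((S.pow n).s (pureTensor k a)) =
        -((S.pow n).s (powFirst s n (pureTensor k a)))
      rw [h1, powFirst_pure, h2, sum_add_single, koszul_add, koszul_one, mul_neg_one, neg_smul, neg_neg,
        map_smul, powFirst_pure]
  exact LinearMap.congr_fun this x

lemma powD_powFirst (hd : ∀ x, S.d (s x) + s (S.d x) = x) (x : TPow k V n) :
    (S.pow n).d (powFirst s n x) + powFirst s n ((S.pow n).d x) = x := by
  have : (S.pow n).d ∘ₗ powFirst s n + powFirst s n ∘ₗ (S.pow n).d = LinearMap.id :=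
    S.pow_ext fun e a ha => by
      have h1 : (S.pow n).d (pureTensor k a) = ∑ j, koszul k (∑ i, if i < j then e i else 0) •
        pureTensor k (Function.update a j (S.d (a j))) := S.powD_tprod ha
      have h2 : (S.pow n).d (pureTensor k (Function.update a 0 (s (a 0)))) =
        ∑ j, koszul k (∑ i, if i < j then (e + Pi.single 0 1 : Fin n → ZMod 2) i else 0) •
          pureTensor k (Function.update (Function.update a 0 (s (a 0))) j
            (S.d (Function.update a 0 (s (a 0)) j))) := S.powD_tprod (S.par_first hs ha)
      change (S.pow n).d (powFirst s n (pureTensor k a)) +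
        powFirst s n ((S.pow n).d (pureTensor k a)) = pureTensor k a
      rw [powFirst_pure, h1, h2, map_sum, ← Finset.sum_add_distrib, Finset.sum_eq_single 0]
      · have h0 : ∀ e : Fin n → ZMod 2, (∑ i, if i < 0 then e i else 0) = 0 := fun e =>
          Finset.sum_eq_zero fun i _ => if_neg (Fin.not_lt_zero i)
        rw [h0, h0, koszul_zero, one_smul, one_smul, powFirst_pure, Function.update_idem,
          Function.update_idem, Function.update_self, Function.update_self]
        refine ((PiTensorProduct.tprod k).map_update_add a 0 _ _).symm.trans ?_
        rw [hd, Function.update_eq_self]; rfl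
      · intro j _ hj
        rw [sum_lt_single, if_pos (Fin.pos_iff_ne_zero.mpr hj), koszul_add, koszul_one, mul_neg_one,
          neg_smul, map_smul, powFirst_pure, Function.update_of_ne hj, Function.update_of_ne hj.symm,
          Function.update_comm hj.symm, neg_add_cancel]
      · simp
  exact LinearMap.congr_fun this x

end SuperDG

end CyclicPower

namespace CyclicPower

open ResolutionData

namespace DGAlgebra

section contractible

variable (k : Type u) [CommRing k]

lemma negOnePow_smul_eq {X : Type*} [AddCommGroup X] [Module k X] (i : ℤ) (x : X) :
    i.negOnePow • x = koszul k (i : ZMod 2) • x := (koszul_smul_eq i x).symm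

/-- The algebra of the Laurent polynomials in a cycle of degree `1` with an element `h` of degree `1`
adjoined, such that `d h = 1`: the pair `(a, b)` in degree `i` stands for `a T ^ i + b h T ^ (i - 1)`. -/
noncomputable def laurent : DGAlgebra.{u, u} k where
  X _ := k × k
  d i j := if j + 1 = i then LinearMap.inl k k k ∘ₗ LinearMap.snd k k k else 0
  mul i j n h := LinearMap.mk₂ k
    (fun x y => (x.1 * y.1, x.2 * y.1 + koszul k (i : ZMod 2) * (x.1 * y.2)))
    (fun x x' y => by ext <;> simp <;> ring) (fun r x y => by ext <;> simp <;> ring)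
    (fun x x' y => by ext <;> simp <;> ring) (fun r x y => by ext <;> simp <;> ring)
  one := (1, 0)
  shape i j h := if_neg h
  d_d i j l x := by split_ifs <;> simp
  mul_assoc i j l ij jl n hij hjl h h' x y z := by
    subst hij
    ext
    · simp; ring
    · simp [koszul_add]; ring
  one_mul i x := by ext <;> simp [koszul_zero]
  mul_one i x := by ext <;> simp
  leibniz i j n i' j' n' h h₁ h₂ hn x y := by
    rw [negOnePow_smul_eq k, if_pos hn, if_pos (by omega : i' + 1 = i), if_pos (by omega : j' + 1 = j)]
    have hi : ((i' : ℤ) : ZMod 2) = i + 1 := by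
      rw [show i = i' + 1 by omega]; push_cast; rw [add_assoc, CharTwo.add_self_eq_zero, add_zero]
    ext
    · simp
    · simp [hi, koszul_add, koszul_one]

variable {k}

/-- The element `a T ^ i + b h T ^ (i - 1)`. -/
def laurentMk (i : ℤ) (a b : k) : (laurent k).X i := (a, b)

lemma laurent_exists (i : ℤ) (x : (laurent k).X i) : ∃ a b, x = laurentMk i a b := ⟨x.1, x.2, rfl⟩

lemma laurentMk_zero (i : ℤ) : laurentMk (k := k) i 0 0 = 0 := rfl

lemma laurentMk_inj {i : ℤ} {a b a' b' : k} (h : laurentMk i a b = laurentMk i a' b') :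
    a = a' ∧ b = b' := Prod.mk.inj h

lemma laurent_add (i : ℤ) (a b a' b' : k) :
    laurentMk i a b + laurentMk i a' b' = laurentMk i (a + a') (b + b') := rfl

lemma laurent_smul (i : ℤ) (r a b : k) : r • laurentMk i a b = laurentMk i (r * a) (r * b) := rfl

lemma laurent_d {i j : ℤ} (h : j + 1 = i) (a b : k) :
    (laurent k).d i j (laurentMk i a b) = laurentMk j b 0 := by
  change (if j + 1 = i then LinearMap.inl k k k ∘ₗ LinearMap.snd k k k else 0 : k × k →ₗ[k] k × k)
    (a, b) = _
  rw [if_pos h]; rfl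

lemma laurent_mul {i j n : ℤ} (h : i + j = n) (a b a' b' : k) :
    (laurent k).mul i j n h (laurentMk i a b) (laurentMk j a' b') =
      laurentMk n (a * a') (b * a' + koszul k (i : ZMod 2) * (a * b')) := rfl

variable (k) in
/-- The contraction of the algebra `laurent`. -/
noncomputable def laurentH : (laurent k).Tot →ₗ[k] (laurent k).Tot :=
  DirectSum.toModule k ℤ _ fun i => (laurent k).ι (i + 1) ∘ₗ
    (LinearMap.inr k k k ∘ₗ LinearMap.fst k k k : k × k →ₗ[k] k × k)

lemma laurentH_ι (i : ℤ) (a b : k) : laurentH k ((laurent k).ι i (laurentMk i a b)) =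
    (laurent k).ι (i + 1) (laurentMk (i + 1) 0 a) :=
  DirectSum.toModule_lof k i (laurentMk i a b)

lemma laurentH_d (x : (laurent k).Tot) :
    (laurent k).super.d (laurentH k x) + laurentH k ((laurent k).super.d x) = x := by
  have : (laurent k).totD ∘ₗ laurentH k + laurentH k ∘ₗ (laurent k).totD = LinearMap.id :=
    tot_ext fun i x => by
      obtain ⟨a, b, rfl⟩ := laurent_exists i x
      rw [LinearMap.add_apply, LinearMap.comp_apply, LinearMap.comp_apply, laurentH_ι,
        totD_ι _ rfl, totD_ι _ (sub_add_cancel i 1), laurent_d rfl, laurent_d (sub_add_cancel i 1),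
        laurentH_ι, sub_add_cancel, ← map_add, laurent_add, add_zero, zero_add]
      rfl
  exact LinearMap.congr_fun this x

lemma laurentH_par (e : ZMod 2) (x : (laurent k).Tot) (hx : (laurent k).super.par e x = x) :
    (laurent k).super.par (e + 1) (laurentH k x) = laurentH k x := by
  have : (laurent k).totPar (e + 1) ∘ₗ laurentH k ∘ₗ (laurent k).totPar e =
      laurentH k ∘ₗ (laurent k).totPar e := tot_ext fun i x => by
    obtain ⟨a, b, rfl⟩ := laurent_exists i x
    simp only [LinearMap.comp_apply, totPar_ι]
    split_ifs with h
    · rw [laurentH_ι, totPar_ι, if_pos (by rw [← h]; push_cast; rfl)]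
    · simp
  have := LinearMap.congr_fun this x
  change (laurent k).totPar (e + 1) (laurentH k ((laurent k).super.par e x)) =
    laurentH k ((laurent k).super.par e x) at this
  rwa [hx] at this

lemma powFirst_laurent {p : ℕ} [NeZero p] {j : ℤ} {t : SuperDG.TPow k (laurent k).Tot p}
    (ht : t ∈ (laurent k).powDeg p j) :
    SuperDG.powFirst (laurentH k) p t ∈ (laurent k).powDeg p (j + 1) := by
  induction ht using Submodule.span_induction with
  | zero => rw [map_zero]; exact zero_mem _
  | add x x' _ _ hx hx' => rw [map_add]; exact add_mem hx hx'
  | smul r x _ hx => rw [map_smul]; exact Submodule.smul_mem _ _ hx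
  | mem x hx =>
    obtain ⟨i, a, ha, hi, rfl⟩ := hx
    rw [SuperDG.powFirst_pure]
    refine Submodule.subset_span ⟨i + Pi.single 0 1, _, fun l => ?_, ?_, rfl⟩
    · by_cases h : l = 0
      · subst h
        obtain ⟨x, hx⟩ := ha 0
        obtain ⟨a', b, rfl⟩ := laurent_exists _ x
        rw [Function.update_self, ← hx, laurentH_ι]
        rw [show (i + Pi.single 0 1 : Fin p → ℤ) 0 = i 0 + 1 by simp]
        exact ⟨_, rfl⟩
      · simpa [h] using ha l
    · simp [Finset.sum_add_distrib, hi]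

end contractible

section disk

variable {k : Type u} [CommRing k] {A : DGAlgebra.{u, u} k}

/-- The element `v` of degree `n`, placed in degree `i`. -/
noncomputable def place {n : ℤ} (v : A.X n) (i : ℤ) : A.X i := if h : n = i then h ▸ v else 0

lemma place_self {n : ℤ} (v : A.X n) : place v n = v := dif_pos rfl

lemma place_ne {n i : ℤ} (v : A.X n) (h : n ≠ i) : place v i = 0 := dif_neg h

/-- The map of complexes given by an element and its differential. -/
noncomputable def diskMap {n : ℤ} (v : A.X n) : ChainMap (laurent k) A where
  f i := (LinearMap.snd k k k).smulRight (place v i) + (LinearMap.fst k k k).smulRight (A.d n i v)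
  map_d i j x := by
    obtain ⟨a, b, rfl⟩ := laurent_exists i x
    by_cases h : j + 1 = i
    · rw [laurent_d h]
      change (0 : k) • place v j + b • A.d n j v = A.d i j (b • place v i + a • A.d n i v)
      rw [zero_smul, zero_add, map_add, map_smul, map_smul]
      have hdd : A.d i j (A.d n i v) = 0 := A.d_d _ _ _ _
      rw [hdd, smul_zero, add_zero]
      by_cases hn : n = i
      · subst hn; rw [place_self]
      · rw [place_ne v hn, map_zero, A.shape n j (by omega)]; rfl
    · have h0 : (laurent k).d i j (laurentMk i a b) = 0 := by rw [(laurent k).shape i j h]; rfl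
      rw [h0, A.shape i j h, LinearMap.zero_apply]
      exact map_zero ((LinearMap.snd k k k).smulRight (place v j) +
        (LinearMap.fst k k k).smulRight (A.d n j v))

lemma diskMap_f {n : ℤ} (v : A.X n) (i : ℤ) (a b : k) :
    (diskMap v).f i (laurentMk i a b) = b • place v i + a • A.d n i v := rfl

lemma diskMap_self {n : ℤ} (v : A.X n) (a b : k) : (diskMap v).f n (laurentMk n a b) = b • v := by
  rw [diskMap_f, place_self, A.shape n n (by omega), LinearMap.zero_apply, smul_zero, add_zero]

lemma diskMap_pred {n : ℤ} (v : A.X n) (a b : k) :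
    (diskMap v).f (n - 1) (laurentMk (n - 1) a b) = a • A.d n (n - 1) v := by
  rw [diskMap_f, place_ne v (by omega), smul_zero, zero_add]

lemma diskMap_eq_zero {n i : ℤ} (v : A.X n) (h : i ≠ n) (h' : i + 1 ≠ n) (x : (laurent k).X i) :
    (diskMap v).f i x = 0 := by
  obtain ⟨a, b, rfl⟩ := laurent_exists i x
  rw [diskMap_f, place_ne v h.symm, smul_zero, zero_add, A.shape n i h', LinearMap.zero_apply,
    smul_zero]

variable {p : ℕ} {ν : ResolutionData.{u} p}

lemma tpow_diskMap {n j : ℤ} (v : A.X n) (h : j < (n - 1) * p ∨ n * p < j)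
    {t : SuperDG.TPow k (laurent k).Tot p} (ht : t ∈ (laurent k).powDeg p j) :
    (diskMap v).tpow p t = 0 := by
  induction ht using Submodule.span_induction with
  | zero => exact map_zero _
  | add x x' _ _ hx hx' => rw [map_add, hx, hx', add_zero]
  | smul r x _ hx => rw [map_smul, hx, smul_zero]
  | mem x hx =>
    obtain ⟨i, a, ha, hi, rfl⟩ := hx
    rw [ChainMap.tpow_pure]
    have : ∃ l, i l ≠ n ∧ i l + 1 ≠ n := by
      by_contra! H
      have h1 : ∀ l, n - 1 ≤ i l ∧ i l ≤ n := fun l => by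
        by_cases hl : i l = n
        · omega
        · have := H l hl; omega
      have h2 : ∑ l : Fin p, (n - 1) ≤ ∑ l, i l := Finset.sum_le_sum fun l _ => (h1 l).1
      have h3 : ∑ l, i l ≤ ∑ l : Fin p, n := Finset.sum_le_sum fun l _ => (h1 l).2
      rw [Finset.sum_const, Finset.card_univ, Fintype.card_fin, nsmul_eq_mul, mul_comm] at h2 h3
      omega
    obtain ⟨l, hl, hl'⟩ := this
    refine (PiTensorProduct.tprod k).map_coord_zero l ?_
    obtain ⟨x, hx⟩ := ha l
    rw [← hx, ChainMap.tot_ι, diskMap_eq_zero v hl hl', map_zero]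

lemma cech_diskMap_zero {n : ℤ} (v : A.X n) {S : ℤ → ℤ → ℤ → Prop}
    (hS : ∀ j b c, S j b c → j < (n - 1) * p ∨ n * p < j) {z : (laurent k).CechTot ν}
    (hz : z ∈ triDeg (fun n => ((laurent k).powDeg p n).toAddSubgroup) S) :
    (diskMap v).cech ν z = 0 := by
  refine AddSubgroup.mem_bot.mp (map_triDeg _ ⊥ (fun j b c h _ _ t ht x hx y hy => ?_) hz)
  rw [ChainMap.cech_pt, tpow_diskMap v (hS _ _ _ h) ht]
  simp

lemma cech_diskMap_band {n N : ℤ} (v : A.X n) {S : ℤ → ℤ → ℤ → Prop}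
    (hS : ∀ j b c, S j b c → j + b + c = N) {z : (laurent k).CechTot ν}
    (hz : z ∈ triDeg (fun n => ((laurent k).powDeg p n).toAddSubgroup) S) :
    (diskMap v).cech ν z ∈ triDeg (fun n => (A.powDeg p n).toAddSubgroup) fun j b c =>
      ((n - 1) * p ≤ j ∧ j + b + c = N) ∧ j ≤ n * p := by
  refine map_triDeg _ _ (fun j b c h _ _ t ht x hx y hy => ?_) hz
  rw [ChainMap.cech_pt]
  by_cases hj : j < (n - 1) * p ∨ n * p < j
  · rw [tpow_diskMap v hj ht]; simp
  · exact pt_mem_triDeg (j := j) (by have := hS _ _ _ h; omega) ((diskMap v).tpow_powDeg ht) hx hy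

end disk

end DGAlgebra

end CyclicPower

namespace CyclicPower

open ResolutionData

namespace DGAlgebra

variable {p : ℕ} [hp : Fact p.Prime] {R : Type u} [Field R] [CharP R p] [PerfectField R]
  {ν : ResolutionData.{u} p} {O : ν.Ops} {c : ℤ → ν.Y ℤ} (hc : IsGenSeq.{u, u} O c)
  {A : DGAlgebra.{u, u} R} {n : ℤ}

lemma d_mem_Z {z : A.CechTot ν} (hz : z ∈ (A.cech ν).Z n) :
    (A.cechSigned ν).d z ∈ (A.cech ν).Z (n - 1) := by
  have h := hz.2
  rw [SetLike.mem_coe, Submodule.mem_comap] at h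
  refine ⟨by rw [neg_sub]; exact h, ?_⟩
  rw [SetLike.mem_coe, Submodule.mem_comap]
  change (A.cechSigned ν).d ((A.cechSigned ν).d z) ∈ _
  rw [(A.cechSigned ν).d_d]; exact zero_mem _

include hc

lemma PowRel_zero_d {z : A.CechTot ν} (hz : z ∈ (A.cech ν).Z n) (h : PowRel c n z (0 : A.X n)) :
    PowRel c (n - 1) ((A.cechSigned ν).d z) (0 : A.X (n - 1)) := by
  obtain ⟨f, hf, _, ⟨y, hy, rfl⟩, rfl⟩ := Submodule.mem_sup.mp ((PowRel_zero_iff hc hz).mp h)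
  rw [map_add]
  change PowRel c (n - 1) (_ + (A.cechSigned ν).d ((A.cechSigned ν).d y)) _
  rw [(A.cechSigned ν).d_d, add_zero]
  exact PowRel_d (by rw [neg_sub, sub_add_cancel]; exact hf)

/-- An element that is close to the power of the universal element of the algebra `laurent` is not
close to a cycle. -/
lemma laurent_not_PowRel_zero {z : (laurent R).CechTot ν} (hz : z ∈ ((laurent R).cech ν).Z n)
    (h : PowRel c n z (laurentMk (k := R) n 0 1)) :
    ¬ PowRel c (n - 1) (((laurent R).cechSigned ν).d z) (0 : (laurent R).X (n - 1)) := by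
  intro h0
  have hpp : (0 : ℤ) < p := by exact_mod_cast hp.1.pos
  have : NeZero p := ⟨hp.1.ne_zero⟩
  let e : ChainMap (laurent R) (laurent R) := diskMap (laurentMk (k := R) n 0 1)
  have hev : e.f n (laurentMk n 0 1) = laurentMk n 0 1 :=
    (diskMap_self _ 0 1).trans (one_smul R _)
  obtain ⟨f, hf, _, ⟨g, hg, rfl⟩, hfg⟩ := Submodule.mem_sup.mp
    ((PowRel_zero_iff hc (d_mem_Z hz)).mp h0)
  rw [neg_sub, sub_add_cancel] at hg
  have hfg : f + ((laurent R).cechSigned ν).d g = ((laurent R).cechSigned ν).d z := hfg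
  have h2 : PowRel c n (z - g) (laurentMk (k := R) n 0 1) := by
    have := h.sub hc (PowRel_zero_of_F hg)
    rwa [sub_zero] at this
  have h3 := e.cech_powRel h2
  rw [hev] at h3
  have hd : ((laurent R).cechSigned ν).d (e.cech ν (z - g)) = 0 := by
    rw [← e.cech_d, map_sub, ← hfg, add_sub_cancel_right]
    refine cech_diskMap_zero _ (S := fun j b c => j ≤ -(1 - (n - 1)) * p ∧ j + b + c = n - 1)
      (fun j b c hS => Or.inl ?_) (cech_F_le hf)
    nlinarith [hS.1]
  have hband := cech_diskMap_band (N := n) (laurentMk (k := R) n 0 1)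
    (S := fun j b c => j ≤ - -n * p ∧ j + b + c = n) (fun j b c hS => hS.2)
    (z := z - g) (cech_F_le (sub_mem hz.1 (((laurent R).cech ν).anti _ _ _ (by omega) hg)))
  have hinv : (((laurent R).cechAction ν).f (z - g)) = z - g := by
    have h1 : ((laurent R).cechAction ν).f z = z := hz.1.2
    have h2 : ((laurent R).cechAction ν).f g = g := hg.2
    rw [map_sub, h1, h2]
  let D := cycData (p := p) (laurent R).fieldBasis
  obtain ⟨y, hy, hy', hyd⟩ := D.exists_contract O (T := (SuperDG.powFirst (laurentH R) p).toAddMonoidHom)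
    (fun j t ht => powFirst_laurent ht)
    (fun t => (laurent R).super.powD_powFirst laurentH_par laurentH_d t)
    (fun t => (laurent R).super.powS_powFirst laurentH_par t)
    (J := (n - 1) * p) (n := n) (w := e.cech ν (z - g))
    (triDeg_mono (fun j b c hS _ _ => hS.1) hband)
    (D.mem_Inv.mpr (by rw [← cech_action_eq, ← e.cech_action, hinv]))
    (by rw [← cech_d_eq, hd]) (p + 1)
  have h4 : e.cech ν (e.cech ν (z - g) - D.dW ν y) = 0 :=
    cech_diskMap_zero _ (fun j b c hS => Or.inr (by
      have := hS.1; push_cast at this; linarith)) hyd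
  rw [map_sub, sub_eq_zero, ← cech_d_eq, e.cech_d] at h4
  have h5 := e.cech_powRel h3
  rw [hev, h4] at h5
  have h6 := h5.unique hc (PowRel_d ⟨mem_cechFil_iff.mpr ?_, ?_⟩)
  · rw [← laurentMk_zero] at h6
    exact one_ne_zero (laurentMk_inj h6).2
  · exact triDeg_mono (fun j b c hS _ _ => ⟨by rw [neg_neg]; exact hS.2, hS.1.2⟩)
      (cech_diskMap_band (N := n + 1) _ (fun j b c hS => hS) hy)
  · have h7 : ((laurent R).cechAction ν).f y = y := by
      rw [cech_action_eq (laurent R).fieldBasis]; exact D.mem_Inv.mp hy'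
    change ((laurent R).cechAction ν).f (e.cech ν y) = e.cech ν y
    rw [← e.cech_action, h7]

/-- The structure constants of the differential. -/
lemma exists_powRel_d (n : ℤ) : ∃ κ : R, κ ≠ 0 ∧ ∀ (A : DGAlgebra.{u, u} R) (z : A.CechTot ν)
    (v : A.X n), z ∈ (A.cech ν).Z n → PowRel c n z v →
      PowRel c (n - 1) ((A.cechSigned ν).d z) (κ • A.d n (n - 1) v) := by
  obtain ⟨z₀, hz₀, h₀⟩ := exists_of_powElt hc (A := laurent R) (ν := ν) (laurentMk n 0 1)
  obtain ⟨w, hw⟩ := exists_powRel hc (d_mem_Z hz₀)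
  obtain ⟨α, β, rfl⟩ := laurent_exists _ w
  have key : ∀ (A : DGAlgebra.{u, u} R) (z : A.CechTot ν)
    (v : A.X n), z ∈ (A.cech ν).Z n → PowRel c n z v →
      PowRel c (n - 1) ((A.cechSigned ν).d z) (α • A.d n (n - 1) v) := fun A z v hz h => by
    let e : ChainMap (laurent R) A := diskMap v
    have h1 := e.cech_powRel h₀
    have hev : e.f n (laurentMk n 0 1) = v := (diskMap_self _ 0 1).trans (one_smul R _)
    have hew : e.f (n - 1) (laurentMk (n - 1) α β) = α • A.d n (n - 1) v := diskMap_pred _ α β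
    rw [hev] at h1
    have h2 := e.cech_powRel hw
    rw [hew, e.cech_d] at h2
    have h3 := h.sub hc h1
    rw [sub_self] at h3
    have h4 := (PowRel_zero_d hc (sub_mem hz (e.cech_Z hz₀)) h3).add hc h2
    rwa [map_sub, sub_add_cancel, zero_add] at h4
  refine ⟨α, fun hα => laurent_not_PowRel_zero hc hz₀ h₀ ?_, key⟩
  have := key (laurent R) z₀ _ hz₀ h₀
  rwa [hα, zero_smul] at this

end DGAlgebra

end CyclicPower

namespace CyclicPower

open ResolutionData

lemma exists_int_prod {G : Type*} [CommGroup G] (κ : ℤ → G) :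
    ∃ ρ : ℤ → G, ρ 0 = 1 ∧ ∀ n, ρ n = ρ (n - 1) * κ n := by
  let ρ : ℤ → G
    | .ofNat n => ∏ i ∈ Finset.range n, κ (i + 1)
    | .negSucc n => ∏ i ∈ Finset.range (n + 1), (κ (-i))⁻¹
  refine ⟨ρ, Finset.prod_range_zero _, fun n => ?_⟩
  rcases n with (_ | n) | n
  · change ∏ i ∈ Finset.range 0, κ (i + 1) = (∏ i ∈ Finset.range (0 + 1), (κ (-i))⁻¹) * κ 0
    simp
  · have : ((Int.ofNat (n + 1)) - 1 : ℤ) = Int.ofNat n := by simp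
    rw [this]
    exact Finset.prod_range_succ (fun i : ℕ => κ (i + 1)) n
  · have : ((Int.negSucc n) - 1 : ℤ) = Int.negSucc (n + 1) := by omega
    rw [this]
    change _ = (∏ i ∈ Finset.range (n + 1 + 1), (κ (-i))⁻¹) * _
    rw [Finset.prod_range_succ, mul_assoc, show (Int.negSucc n) = -((n + 1 : ℕ) : ℤ) from rfl,
      inv_mul_cancel, mul_one]
    rfl

namespace DGAlgebra

variable {p : ℕ} [hp : Fact p.Prime] {R : Type u} [Field R] [CharP R p] [PerfectField R]
  {ν : ResolutionData.{u} p} {O : ν.Ops} {c : ℤ → ν.Y ℤ} (hc : IsGenSeq.{u, u} O c)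
  {A B : DGAlgebra.{u, u} R} {n : ℤ}

/-- A normalization of the relation between the elements of the Tate complex and those of the
algebra, compatible with the differentials. -/
structure IsScale (c : ℤ → ν.Y ℤ) (ρ : ℤ → R) : Prop where
  ne_zero : ∀ n, ρ n ≠ 0
  zero : ρ 0 = 1
  rel_d : ∀ (n : ℤ) (A : DGAlgebra.{u, u} R) (z : A.CechTot ν) (v : A.X n), z ∈ (A.cech ν).Z n →
    PowRel c n z ((ρ n)⁻¹ • v) →
      PowRel c (n - 1) ((A.cechSigned ν).d z) ((ρ (n - 1))⁻¹ • A.d n (n - 1) v)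

lemma exists_isScale (hc : IsGenSeq.{u, u} O c) : ∃ ρ : ℤ → R, IsScale c ρ := by
  choose κ hκ h using fun n => exists_powRel_d (R := R) hc n
  obtain ⟨ρ, h0, hρ⟩ := exists_int_prod fun n => Units.mk0 (κ n) (hκ n)
  refine ⟨fun n => ρ n, fun n => (ρ n).ne_zero, by rw [h0]; rfl, fun n A z v hz hz' => ?_⟩
  have := h n A z _ hz hz'
  rw [map_smul, smul_smul] at this
  convert this using 2
  rw [hρ n, Units.val_mul, Units.val_mk0, mul_inv, mul_comm, _root_.mul_assoc,
    inv_mul_cancel₀ (hκ n), _root_.mul_one]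

section scale

variable {ρ : ℤ → R} (hρ : IsScale (ν := ν) c ρ)

variable (ρ) in
/-- The relation between the elements of the Tate complex and those of the algebra, scaled. -/
def ScaledRel (c : ℤ → ν.Y ℤ) (n : ℤ) (z : A.CechTot ν) (v : A.X n) : Prop :=
  PowRel c n z ((ρ n)⁻¹ • v)

lemma powRel_one (h0 : c 0 = ν.unitY) (v : A.X 0) : PowRel c 0 (A.cechPow ν v) v := by
  refine ⟨0, zero_mem _, ?_⟩
  have e : act (A.powElt p 0 v) (c 0) = A.cechPow ν v := by
    rw [h0, unitY, act_pt, one_smul]; rfl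
  rw [e, sub_self, map_zero, sub_zero]
  exact zero_mem _

include hρ in
lemma ScaledRel.d {z : A.CechTot ν} {v : A.X n} (hz : z ∈ (A.cech ν).Z n)
    (h : ScaledRel ρ c n z v) :
    ScaledRel ρ c (n - 1) ((A.cechSigned ν).d z) (A.d n (n - 1) v) := hρ.rel_d n A z v hz h

lemma ScaledRel.map (φ : ChainMap A B) {z : A.CechTot ν} {v : A.X n} (h : ScaledRel ρ c n z v) :
    ScaledRel ρ c n (φ.cech ν z) (φ.f n v) := by
  have := φ.cech_powRel h
  rwa [map_smul] at this

lemma ScaledRel.smul {z : A.CechTot ν} {v : A.X n} (h : ScaledRel ρ c n z v) (r : R) :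
    ScaledRel ρ c n (r ^ p • z) (r • v) := by
  have := PowRel_smul h r
  rwa [smul_comm] at this

include hρ in
lemma scaledRel_one (h0 : c 0 = ν.unitY) (v : A.X 0) : ScaledRel ρ c 0 (A.cechPow ν v) v := by
  rw [ScaledRel, hρ.zero, inv_one, one_smul]; exact powRel_one h0 v

include hc

lemma ScaledRel.add {z z' : A.CechTot ν} {v v' : A.X n} (h : ScaledRel ρ c n z v)
    (h' : ScaledRel ρ c n z' v') : ScaledRel ρ c n (z + z') (v + v') := by
  rw [ScaledRel, smul_add]; exact PowRel.add hc h h'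

lemma ScaledRel.neg {z : A.CechTot ν} {v : A.X n} (h : ScaledRel ρ c n z v) :
    ScaledRel ρ c n (-z) (-v) := by
  rw [ScaledRel, smul_neg]; exact PowRel.neg hc h

lemma scaledRel_zero_iff {z : A.CechTot ν} (hz : z ∈ (A.cech ν).Z n) :
    ScaledRel ρ c n z (0 : A.X n) ↔
      z ∈ (A.cech ν).F (1 - n) n ⊔ ((A.cech ν).F (-n) (n + 1)).map (A.cech ν).d := by
  rw [ScaledRel, smul_zero, PowRel_zero_iff hc hz]

lemma ScaledRel.negOnePow_smul {z : A.CechTot ν} {v : A.X n} (h : ScaledRel ρ c n z v) (m : ℤ) :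
    ScaledRel ρ c n (m.negOnePow • z) (m.negOnePow • v) := by
  rcases Int.even_or_odd m with hm | hm
  · rwa [Int.negOnePow_even m hm, one_smul, one_smul]
  · rw [Int.negOnePow_odd m hm, Units.neg_smul, Units.neg_smul, one_smul, one_smul]; exact h.neg hc

include hρ

lemma ScaledRel.unique {z : A.CechTot ν} {v v' : A.X n} (h : ScaledRel ρ c n z v)
    (h' : ScaledRel ρ c n z v') : v = v' :=
  (smul_right_inj (inv_ne_zero (hρ.ne_zero n))).mp (PowRel.unique hc h h')

lemma exists_scaledRel {z : A.CechTot ν} (hz : z ∈ (A.cech ν).Z n) : ∃ v, ScaledRel ρ c n z v := by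
  obtain ⟨v, h⟩ := exists_powRel hc hz
  exact ⟨ρ n • v, by rwa [ScaledRel, smul_smul, inv_mul_cancel₀ (hρ.ne_zero n), one_smul]⟩

lemma exists_of_scaled (v : A.X n) : ∃ z ∈ (A.cech ν).Z n, ScaledRel ρ c n z v :=
  exists_of_powElt hc _

lemma exists_scaledRel_mul : ∃ t : ℤ → ℤ → R, ∀ (n m : ℤ) (A : DGAlgebra.{u, u} R)
    (z z' : A.CechTot ν) (v : A.X n) (v' : A.X m), z' ∈ (A.cech ν).Z m → ScaledRel ρ c n z v →
      ScaledRel ρ c m z' v' → ScaledRel ρ c (n + m) ((A.cechSigned ν).mul z z')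
        (t n m • A.mul n m (n + m) rfl v v') := by
  choose s hs using fun n m => exists_powRel_mul (R := R) hc n m
  refine ⟨fun n m => ρ (n + m) * (s n m * ((ρ n)⁻¹ * (ρ m)⁻¹)), fun n m A z z' v v' hz' h h' => ?_⟩
  have := hs n m A z z' _ _ hz' h h'
  rw [map_smul, map_smul, LinearMap.smul_apply, smul_smul, smul_smul] at this
  rw [ScaledRel, smul_smul, inv_mul_cancel_left₀ (hρ.ne_zero _)]
  convert this using 2
  ring

/-- The scaled relation is compatible with the products. -/
lemma ScaledRel.mul (h0 : c 0 = ν.unitY) {m : ℤ} {z z' : A.CechTot ν} {v : A.X n} {v' : A.X m}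
    (hz' : z' ∈ (A.cech ν).Z m) (h : ScaledRel ρ c n z v) (h' : ScaledRel ρ c m z' v') :
    ScaledRel ρ c (n + m) ((A.cechSigned ν).mul z z') (A.mul n m (n + m) rfl v v') := by
  obtain ⟨t, ht⟩ := exists_scaledRel_mul hc hρ
  have cast : ∀ {A : DGAlgebra.{u, u} R} {i j : ℤ} {z : A.CechTot ν} (hij : i = j)
      (v : ∀ i, A.X i), ScaledRel ρ c i z (v i) → ScaledRel ρ c j z (v j) := by
    rintro A i j z rfl v h; exact h
  have hd : ∀ i j (v w : R), i = j + 1 → (laurent R).d i j (laurentMk i v w) = laurentMk j w 0 :=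
    fun i j v w h => laurent_d h.symm v w
  have key : ∀ (n m : ℤ) (a b a' b' : R), a * a' = 0 → b * b' = 0 →
      t n m * (b * a' + koszul R (n : ZMod 2) * (a * b')) = t (n - 1) m * (b * a') +
        koszul R (n : ZMod 2) * (t n (m - 1) * (a * b')) := by
    intro n m a b a' b' haa hbb
    obtain ⟨z, hz, h⟩ := exists_of_scaled hc hρ (laurentMk (k := R) n a b)
    obtain ⟨z', hz', h'⟩ := exists_of_scaled hc hρ (laurentMk (k := R) m a' b')
    have e1 := (ht n m _ z z' _ _ hz' h h').d hρ
      (((laurent R).cech ν).mul_mem_Z rfl hz hz')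
    have e2 := ht (n - 1) m _ _ z' _ _ hz' (h.d hρ hz) h'
    have e3 := ht n (m - 1) _ z _ _ _ (d_mem_Z hz') h (h'.d hρ hz')
    rw [laurent_mul, laurent_smul, hd _ _ _ _ (by ring)] at e1
    rw [hd _ _ _ _ (by ring), laurent_mul, laurent_smul] at e2 e3
    have e2 := cast (show n - 1 + m = n + m - 1 by ring) (fun i => laurentMk i _ _) e2
    have e3 := (cast (show n + (m - 1) = n + m - 1 by ring) (fun i => laurentMk i _ _)
      e3).negOnePow_smul hc n
    have l : ((laurent R).cechSigned ν).d (((laurent R).cechSigned ν).mul z z') = _ :=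
      ((laurent R).cech ν).leibniz_F hz.1 z'
    have e4 := e2.add hc e3
    rw [negOnePow_smul_eq R n (laurentMk _ _ _), laurent_smul, laurent_add] at e4
    have e5 := e1.unique hc hρ (l ▸ e4)
    exact (laurentMk_inj e5).1
  have t1 : ∀ n m, t n m = t (n - 1) m := fun n m => by
    simpa using key n m 0 1 1 0 (by simp) (by simp)
  have t2 : ∀ n m, t n m = t n (m - 1) := fun n m => by
    have := key n m 1 0 0 1 (by simp) (by simp)
    simp only [mul_zero, zero_add, _root_.mul_one] at this
    have h := congrArg (koszul R (n : ZMod 2) * ·) this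
    rw [mul_comm (t n m), ← _root_.mul_assoc, ← _root_.mul_assoc, koszul_mul_self, _root_.one_mul,
      _root_.one_mul] at h
    exact h
  have t3 : ∀ n m, t n m = t 0 m := fun n m => by
    induction n using Int.induction_on with
    | zero => rfl
    | succ i ih => rw [t1, add_sub_cancel_right, ih]
    | pred i ih => rw [← t1, ih]
  have t4 : ∀ n m, t n m = t 0 0 := fun n m => by
    rw [t3]
    induction m using Int.induction_on with
    | zero => rfl
    | succ i ih => rw [t2, add_sub_cancel_right, ih]
    | pred i ih => rw [← t2, ih]
  have t5 : t 0 0 = 1 := by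
    have h1 := scaledRel_one hρ h0 (laurent R).one
    have hone : (laurent R).cechPow ν (laurent R).one = ((laurent R).cechSigned ν).one := rfl
    rw [hone] at h1
    have h2 := ht 0 0 (laurent R) ((laurent R).cechSigned ν).one ((laurent R).cechSigned ν).one _ _
      ((laurent R).cech ν).one_mem_Z h1 h1
    have h3 : ((laurent R).cechSigned ν).mul ((laurent R).cechSigned ν).one
      ((laurent R).cechSigned ν).one = ((laurent R).cechSigned ν).one :=
      ((laurent R).cechSigned ν).one_mul _
    have h4 : t 0 0 • (laurent R).one = (laurent R).one := by
      refine ScaledRel.unique hc hρ ?_ h1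
      rw [h3] at h2
      rwa [show (laurent R).mul 0 0 (0 + 0) rfl (laurent R).one (laurent R).one = (laurent R).one from
        (laurent R).one_mul 0 _] at h2
    have h5 : laurentMk (k := R) 0 (t 0 0 * 1) (t 0 0 * 0) = laurentMk 0 1 0 := h4
    simpa using (laurentMk_inj h5).1
  have := ht n m A z z' v v' hz' h h'
  rwa [t4, t5, one_smul] at this

end scale

end DGAlgebra

end CyclicPower

namespace CyclicPower

open ResolutionData

namespace DGAlgebra

variable {p : ℕ} [hp : Fact p.Prime] {R : Type u} [Field R] [CharP R p] [PerfectField R]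
  {ν : ResolutionData.{u} p} {O : ν.Ops} {c : ℤ → ν.Y ℤ} (hc : IsGenSeq.{u, u} O c)
  {ρ : ℤ → R} (hρ : IsScale (ν := ν) c ρ) {A B : DGAlgebra.{u, u} R} {n : ℤ}

include hc hρ

lemma exists_scaledVal (q : (A.cech ν).Q n) : ∃ v : A.X n, ∀ z hz, (A.cech ν).cls z hz = q →
    ScaledRel ρ c n z v := by
  induction q using FilteredDG.Q_ind with | h z hz =>
  obtain ⟨v, hv⟩ := exists_scaledRel hc hρ hz
  refine ⟨v, fun z' hz' h => ?_⟩
  have h1 : z' - z ∈ (A.cech ν).B n := ((A.cech ν).cls_eq_iff hz' hz).mp h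
  have h2 : ScaledRel ρ c n (z' - z) (0 : A.X n) := by
    rw [scaledRel_zero_iff hc (sub_mem hz' hz)]
    obtain ⟨f, hf, _, ⟨y, hy, rfl⟩, h⟩ := Submodule.mem_sup.mp h1
    rw [← h]
    exact Submodule.mem_sup.mpr ⟨f, (A.cech ν).anti _ _ _ (by omega) hf, _,
      ⟨y, (A.cech ν).anti _ _ _ (by omega) hy, rfl⟩, rfl⟩
  have := h2.add hc hv
  rwa [sub_add_cancel, zero_add] at this

/-- The value of an augmentation at a class. -/
noncomputable def scaledVal (q : (A.cech ν).Q n) : A.X n := (exists_scaledVal hc hρ q).choose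

lemma scaledVal_spec (z : A.CechTot ν) (hz : z ∈ (A.cech ν).Z n) :
    ScaledRel ρ c n z (scaledVal hc hρ ((A.cech ν).cls z hz)) :=
  (exists_scaledVal hc hρ _).choose_spec z hz rfl

lemma scaledVal_eq {z : A.CechTot ν} (hz : z ∈ (A.cech ν).Z n) {v : A.X n}
    (h : ScaledRel ρ c n z v) : scaledVal hc hρ ((A.cech ν).cls z hz) = v :=
  (scaledVal_spec hc hρ z hz).unique hc hρ h

/-- The augmentation of a DG algebra given by the leading coefficients of cycles. -/
noncomputable def scaledHom (h0 : c 0 = ν.unitY) (A : DGAlgebra.{u, u} R) :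
    (A.cyclic p ν).Hom A where
  f n :=
    { toFun := fun q => scaledVal hc hρ q
      map_add' := fun q q' => by
        induction q using FilteredDG.Q_ind with | h z hz =>
        induction q' using FilteredDG.Q_ind with | h z' hz' =>
        exact scaledVal_eq hc hρ (add_mem hz hz')
          ((scaledVal_spec hc hρ z hz).add hc (scaledVal_spec hc hρ z' hz'))
      map_smul' := fun r q => by
        induction q using FilteredDG.Q_ind with | h z hz =>
        exact scaledVal_eq hc hρ (Submodule.smul_mem _ (r ^ p) hz)
          ((scaledVal_spec hc hρ z hz).smul r) }
  map_d i j q := by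
    induction q using FilteredDG.Q_ind with | h z hz =>
    by_cases h : j + 1 = i
    · obtain rfl : j = i - 1 := by omega
      have e : (A.cyclic p ν).d i (i - 1) ((A.cech ν).cls z hz) =
        (A.cech ν).cls ((A.cechSigned ν).d z) ((A.cech ν).d_mem_Z h hz) := (A.cech ν).dQ_cls h z hz
      rw [e]
      exact scaledVal_eq hc hρ _ ((scaledVal_spec hc hρ z hz).d hρ hz)
    · have e : (A.cyclic p ν).d i j ((A.cech ν).cls z hz) = 0 := by
        rw [(A.cyclic p ν).shape i j h]; rfl
      rw [A.shape i j h, LinearMap.zero_apply, e]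
      exact scaledVal_eq hc hρ (zero_mem _)
        ((scaledRel_zero_iff hc (zero_mem _)).mpr (zero_mem _))
  map_mul i j n h q q' := by
    subst h
    induction q using FilteredDG.Q_ind with | h z hz =>
    induction q' using FilteredDG.Q_ind with | h z' hz' =>
    exact scaledVal_eq hc hρ ((A.cech ν).mul_mem_Z rfl hz hz')
      ((scaledVal_spec hc hρ z hz).mul hc hρ h0 hz' (scaledVal_spec hc hρ z' hz'))
  map_one := scaledVal_eq hc hρ (A.cech ν).one_mem_Z (scaledRel_one hρ h0 A.one)

lemma scaledHom_eq (h0 : c 0 = ν.unitY) (z : A.CechTot ν) (hz : z ∈ (A.cech ν).Z n) {v : A.X n}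
    (h : ScaledRel ρ c n z v) : (scaledHom hc hρ h0 A).f n (A.cyclicCls p ν n ⟨z, hz⟩) = v :=
  scaledVal_eq hc hρ hz h

end DGAlgebra

open DGAlgebra in
lemma exists_augmentation (p : ℕ) [Fact p.Prime] (R : Type u) [Field R] [CharP R p] [PerfectField R]
    (ν : ResolutionData.{u} p) : Nonempty (Augmentation p R ν) := by
  obtain ⟨O⟩ := exists_ops ν
  obtain ⟨c, h0, hc⟩ := exists_gen_seq.{u, u} O
  have hc : IsGenSeq.{u, u} O c := hc
  obtain ⟨ρ, hρ⟩ := exists_isScale (R := R) hc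
  refine ⟨⟨scaledHom hc hρ h0, fun A B φ n q => ?_, fun A n v => ?_, fun A n z => ?_,
    fun A v hv => ?_⟩⟩
  · induction q using FilteredDG.Q_ind with | h z hz =>
    have := (scaledVal_spec hc hρ z hz).map φ.chain
    refine scaledVal_eq hc hρ ((φ.cech ν).map_Z hz) ?_
    rw [φ.cech_eq]
    exact this
  · obtain ⟨z, hz, h⟩ := exists_of_scaled hc hρ v
    exact ⟨A.cyclicCls p ν n ⟨z, hz⟩, scaledHom_eq hc hρ h0 z hz h⟩
  · rw [← scaledRel_zero_iff (ρ := ρ) hc z.2]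
    exact ⟨fun h => h ▸ scaledVal_spec hc hρ z.1 z.2, fun h => scaledHom_eq hc hρ h0 _ z.2 h⟩
  · exact scaledHom_eq hc hρ h0 _ _ (scaledRel_one hρ h0 v)

end CyclicPower

namespace CyclicPower

open CategoryTheory

namespace DGAlgebra

section quasiIso

variable {k : Type u} [CommRing k] {A B : DGAlgebra.{u, v} k}

/-- The kernel of a map of complexes. -/
noncomputable def Hom.kerComplex (f : A.Hom B) : ChainComplex (ModuleCat.{v} k) ℤ where
  X i := ModuleCat.of k (LinearMap.ker (f.f i))
  d i j := ModuleCat.ofHom ((A.d i j).restrict fun x hx => by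
    rw [LinearMap.mem_ker] at hx ⊢
    rw [f.map_d, hx, map_zero])
  shape i j h := by ext x; exact LinearMap.congr_fun (A.shape i j h) x.1
  d_comp_d' i j l _ _ := by ext x; exact A.d_d i j l x.1

/-- The inclusion of the kernel. -/
noncomputable def Hom.kerι (f : A.Hom B) : f.kerComplex ⟶ A.toComplex where
  f _ := ModuleCat.ofHom (Submodule.subtype _)
  comm' _ _ _ := rfl

/-- A surjective map of complexes is a quasiisomorphism if its kernel is acyclic. -/
lemma Hom.quasiIso (f : A.Hom B) (hs : ∀ i, Function.Surjective (f.f i))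
    (hk : ∀ i (x : A.X i), f.f i x = 0 → A.d i (i - 1) x = 0 →
      ∃ y : A.X (i + 1), f.f (i + 1) y = 0 ∧ A.d (i + 1) i y = x) : QuasiIso f.toComplex := by
  have h0 : f.kerι ≫ f.toComplex = 0 := by
    ext i x; exact x.2
  let S := ShortComplex.mk f.kerι f.toComplex h0
  have hS : S.ShortExact := HomologicalComplex.shortExact_of_degreewise_shortExact S fun i =>
    { exact := by
        rw [ShortComplex.moduleCat_exact_iff]
        exact fun x hx => ⟨⟨x, hx⟩, rfl⟩
      mono_f := (ModuleCat.mono_iff_injective _).mpr Subtype.val_injective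
      epi_g := (ModuleCat.epi_iff_surjective _).mpr (hs i) }
  have hK : ∀ i, Limits.IsZero (S.X₁.homology i) := fun i => by
    rw [← HomologicalComplex.exactAt_iff_isZero_homology,
      HomologicalComplex.exactAt_iff' _ (i + 1) i (i - 1) (by simp) (by simp),
      ShortComplex.moduleCat_exact_iff]
    intro x hx
    obtain ⟨y, hy, e⟩ := hk i x.1 x.2 (congrArg Subtype.val hx)
    exact ⟨⟨y, hy⟩, Subtype.ext e⟩
  rw [quasiIso_iff]
  intro i
  rw [quasiIsoAt_iff_isIso_homologyMap]
  have h1 : Mono (HomologicalComplex.homologyMap f.toComplex i) :=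
    (hS.homology_exact₂ i).mono_g ((hK i).eq_of_src _ _)
  have h2 : Epi (HomologicalComplex.homologyMap f.toComplex i) :=
    (hS.homology_exact₃ i (i - 1) (by simp)).epi_f ((hK (i - 1)).eq_of_tgt _ _)
  exact isIso_of_mono_of_epi _

end quasiIso

section semi

variable {k k' : Type u} [CommRing k] [CommRing k']

/-- A semilinear morphism of DG algebras. -/
structure SemiHom (σ : k' →+* k) (X : DGAlgebra.{u, v} k') (B : DGAlgebra.{u, v} k) where
  f : ∀ n, X.X n →+ B.X n
  map_smul : ∀ n r x, f n (r • x) = σ r • f n x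
  map_d : ∀ i j x, f j (X.d i j x) = B.d i j (f i x)
  map_mul : ∀ i j n (h : i + j = n) x y, f n (X.mul i j n h x y) = B.mul i j n h (f i x) (f j y)
  map_one : f 0 X.one = B.one

/-- The composition of a semilinear morphism with a morphism. -/
def SemiHom.comp {σ : k' →+* k} {X : DGAlgebra.{u, v} k'} {B C : DGAlgebra.{u, v} k} (g : B.Hom C)
    (f : SemiHom σ X B) : SemiHom σ X C where
  f n := (g.f n).toAddMonoidHom.comp (f.f n)
  map_smul n r x := (congrArg (g.f n) (f.map_smul n r x)).trans (_root_.map_smul _ _ _)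
  map_d i j x := (congrArg (g.f j) (f.map_d i j x)).trans (g.map_d _ _ _)
  map_mul i j n h x y := (congrArg (g.f n) (f.map_mul i j n h x y)).trans (g.map_mul _ _ _ _ _ _)
  map_one := (congrArg (g.f 0) f.map_one).trans g.map_one

section pullback

variable {σ : k' →+* k} {X Y : DGAlgebra.{u, v} k'} {B : DGAlgebra.{u, v} k}
  (f : SemiHom σ X B) (g : SemiHom σ Y B)

/-- The terms of the fibre product. -/
def pullbackX (n : ℤ) : Submodule k' (X.X n × Y.X n) where
  carrier := {x | f.f n x.1 = g.f n x.2}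
  add_mem' {x y} hx hy := by
    change f.f n (x.1 + y.1) = g.f n (x.2 + y.2)
    rw [map_add, map_add]; exact congrArg₂ (· + ·) hx hy
  zero_mem' := by
    change f.f n 0 = g.f n 0
    rw [map_zero, map_zero]
  smul_mem' r x hx := by
    change f.f n (r • x.1) = g.f n (r • x.2)
    rw [f.map_smul, g.map_smul]; exact congrArg _ hx

/-- The fibre product of two DG algebras. -/
noncomputable def pullback : DGAlgebra.{u, v} k' where
  X n := pullbackX f g n
  d i j := ((X.d i j).prodMap (Y.d i j)).restrict fun x hx => by
    change f.f j (X.d i j x.1) = g.f j (Y.d i j x.2)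
    rw [f.map_d, g.map_d]; exact congrArg _ hx
  mul i j n h := LinearMap.mk₂ k' (fun x y => ⟨(X.mul i j n h x.1.1 y.1.1, Y.mul i j n h x.1.2 y.1.2), by
      change f.f n _ = g.f n _
      rw [f.map_mul, g.map_mul, show f.f i x.1.1 = g.f i x.1.2 from x.2,
        show f.f j y.1.1 = g.f j y.1.2 from y.2]⟩)
    (fun x x' y => Subtype.ext (Prod.ext (LinearMap.map_add₂ _ _ _ _) (LinearMap.map_add₂ _ _ _ _)))
    (fun r x y => Subtype.ext (Prod.ext (LinearMap.map_smul₂ _ _ _ _) (LinearMap.map_smul₂ _ _ _ _)))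
    (fun x y y' => Subtype.ext (Prod.ext (map_add _ _ _) (map_add _ _ _)))
    (fun r x y => Subtype.ext (Prod.ext (_root_.map_smul _ _ _) (_root_.map_smul _ _ _)))
  one := ⟨(X.one, Y.one), f.map_one.trans g.map_one.symm⟩
  shape i j h := LinearMap.ext fun x => Subtype.ext (Prod.ext
    (LinearMap.congr_fun (X.shape i j h) _) (LinearMap.congr_fun (Y.shape i j h) _))
  d_d i j l x := Subtype.ext (Prod.ext (X.d_d _ _ _ _) (Y.d_d _ _ _ _))
  mul_assoc i j l ij jl n hij hjl h h' x y z := Subtype.ext (Prod.ext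
    (X.mul_assoc _ _ _ _ _ _ hij hjl h h' _ _ _) (Y.mul_assoc _ _ _ _ _ _ hij hjl h h' _ _ _))
  one_mul i x := Subtype.ext (Prod.ext (X.one_mul _ _) (Y.one_mul _ _))
  mul_one i x := Subtype.ext (Prod.ext (X.mul_one _ _) (Y.mul_one _ _))
  leibniz i j n i' j' n' h h₁ h₂ hn x y := by
    have e : ∀ z : pullbackX f g n', ((i.negOnePow • z : pullbackX f g n') : X.X n' × Y.X n') =
        (i.negOnePow • z.1.1, i.negOnePow • z.1.2) := fun z => rfl
    exact Subtype.ext (Prod.ext (X.leibniz i j n i' j' n' h h₁ h₂ hn _ _)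
      (Y.leibniz i j n i' j' n' h h₁ h₂ hn _ _))

/-- The map of the fibre product to an algebra, given by a map of the first factor. -/
noncomputable def pullbackFst {C : DGAlgebra.{u, v} k} (r : SemiHom σ X C) : SemiHom σ (pullback f g) C where
  f n := (r.f n).comp ((AddMonoidHom.fst _ _).comp (pullbackX f g n).subtype.toAddMonoidHom)
  map_smul n c _ := r.map_smul n c _
  map_d i j _ := r.map_d i j _
  map_mul i j n h _ _ := r.map_mul i j n h _ _
  map_one := r.map_one

end pullback

section reduce

variable {σ : k' →+* k} (hσ : Function.Surjective σ)

variable (σ) in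
/-- The scalars act on a module killed by the kernel of a surjection. -/
@[reducible] noncomputable def descModule {M : Type v} [AddCommGroup M] [Module k' M]
    (h : ∀ r, σ r = 0 → ∀ x : M, r • x = 0) : Module k M :=
  letI : SMul k M := ⟨fun r x => (Function.surjInv hσ r) • x⟩
  Function.Surjective.moduleLeft σ hσ fun r x => by
    change Function.surjInv hσ (σ r) • x = r • x
    rw [← sub_eq_zero, ← sub_smul]
    exact h _ (by rw [map_sub, Function.surjInv_eq hσ, sub_self]) x

/-- A DG algebra killed by the kernel of a surjection, as a DG algebra over the quotient ring. -/
noncomputable def desc (P : DGAlgebra.{u, v} k')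
    (h : ∀ r, σ r = 0 → ∀ n (x : P.X n), r • x = 0) : DGAlgebra.{u, v} k :=
  letI := fun n => descModule σ hσ (M := P.X n) fun r hr => h r hr n
  { X := P.X
    d := fun i j =>
      { toFun := P.d i j
        map_add' := map_add _
        map_smul' := fun r => (P.d i j).map_smul (Function.surjInv hσ r) }
    mul := fun i j n hn => LinearMap.mk₂ k (fun x y => P.mul i j n hn x y)
      (LinearMap.map_add₂ _)
      (fun r x y => LinearMap.map_smul₂ (P.mul i j n hn) (Function.surjInv hσ r) x y)
      (fun _ _ _ => map_add _ _ _)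
      (fun r x y => (P.mul i j n hn x).map_smul (Function.surjInv hσ r) y)
    one := P.one
    shape := fun i j h => LinearMap.ext fun x => LinearMap.congr_fun (P.shape i j h) x
    d_d := P.d_d
    mul_assoc := P.mul_assoc
    one_mul := P.one_mul
    mul_one := P.mul_one
    leibniz := P.leibniz }

/-- The morphism from a DG algebra over the quotient ring. -/
noncomputable def descHom {P : DGAlgebra.{u, v} k'} (h : ∀ r, σ r = 0 → ∀ n (x : P.X n), r • x = 0)
    {B : DGAlgebra.{u, v} k} (f : SemiHom σ P B) : (desc hσ P h).Hom B where
  f n := letI := descModule σ hσ (M := P.X n) fun r hr => h r hr n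
    { toFun := f.f n
      map_add' := map_add _
      map_smul' := fun r x => (f.map_smul n (Function.surjInv hσ r) x).trans
        (by rw [Function.surjInv_eq hσ]; rfl) }
  map_d := f.map_d
  map_mul := f.map_mul
  map_one := f.map_one

variable (P : DGAlgebra.{u, v} k') (c : k')

/-- The multiples of a scalar. -/
abbrev mulBy (n : ℤ) : Submodule k' (P.X n) := LinearMap.range (LinearMap.lsmul k' (P.X n) c)

/-- The product on the quotient by the multiples of a scalar. -/
noncomputable def quotMul (i j n : ℤ) (h : i + j = n) :
    (P.X i ⧸ P.mulBy c i) →ₗ[k'] (P.X j ⧸ P.mulBy c j) →ₗ[k'] (P.X n ⧸ P.mulBy c n) :=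
  Submodule.liftQ _ (Submodule.liftQ _ ((P.mul i j n h).compr₂ (P.mulBy c n).mkQ).flip (by
    rintro _ ⟨y, rfl⟩
    refine LinearMap.ext fun x => (Submodule.Quotient.mk_eq_zero _).mpr ⟨P.mul i j n h x y, ?_⟩
    exact ((P.mul i j n h x).map_smul c y).symm)).flip (by
    rintro _ ⟨x, rfl⟩
    refine LinearMap.ext fun y => ?_
    induction y using Submodule.Quotient.induction_on with | H y =>
    exact (Submodule.Quotient.mk_eq_zero _).mpr ⟨P.mul i j n h x y,
      (LinearMap.map_smul₂ (P.mul i j n h) c x y).symm⟩)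

/-- The quotient of a DG algebra by the multiples of a scalar. -/
noncomputable def quot : DGAlgebra.{u, v} k' where
  X n := P.X n ⧸ P.mulBy c n
  d i j := Submodule.mapQ _ _ (P.d i j) (by
    rintro _ ⟨x, rfl⟩
    exact ⟨P.d i j x, ((P.d i j).map_smul c x).symm⟩)
  mul := P.quotMul c
  one := Submodule.Quotient.mk P.one
  shape i j h := LinearMap.ext fun x => by
    induction x using Submodule.Quotient.induction_on with | H x =>
    exact congrArg Submodule.Quotient.mk (LinearMap.congr_fun (P.shape i j h) x)
  d_d i j l x := by
    induction x using Submodule.Quotient.induction_on with | H x =>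
    exact congrArg Submodule.Quotient.mk (P.d_d i j l x)
  mul_assoc i j l ij jl n hij hjl h h' x y z := by
    induction x using Submodule.Quotient.induction_on with | H x =>
    induction y using Submodule.Quotient.induction_on with | H y =>
    induction z using Submodule.Quotient.induction_on with | H z =>
    exact congrArg Submodule.Quotient.mk (P.mul_assoc _ _ _ _ _ _ hij hjl h h' x y z)
  one_mul i x := by
    induction x using Submodule.Quotient.induction_on with | H x =>
    exact congrArg Submodule.Quotient.mk (P.one_mul i x)
  mul_one i x := by
    induction x using Submodule.Quotient.induction_on with | H x =>
    exact congrArg Submodule.Quotient.mk (P.mul_one i x)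
  leibniz i j n i' j' n' h h₁ h₂ hn x y := by
    induction x using Submodule.Quotient.induction_on with | H x =>
    induction y using Submodule.Quotient.induction_on with | H y =>
    exact congrArg Submodule.Quotient.mk (P.leibniz i j n i' j' n' h h₁ h₂ hn x y)

variable {P c}

/-- The map from the quotient induced by a semilinear morphism. -/
noncomputable def quotHom (hc : σ c = 0) {B : DGAlgebra.{u, v} k} (f : SemiHom σ P B) :
    SemiHom σ (P.quot c) B where
  f n := QuotientAddGroup.lift (P.mulBy c n).toAddSubgroup (f.f n) (by
    rintro _ ⟨x, rfl⟩
    exact (f.map_smul n c x).trans (by rw [hc, zero_smul]))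
  map_smul n r x := by
    induction x using Submodule.Quotient.induction_on with | H x =>
    exact f.map_smul n r x
  map_d i j x := by
    induction x using Submodule.Quotient.induction_on with | H x =>
    exact f.map_d i j x
  map_mul i j n h x y := by
    induction x using Submodule.Quotient.induction_on with | H x =>
    induction y using Submodule.Quotient.induction_on with | H y =>
    exact f.map_mul i j n h x y
  map_one := f.map_one

lemma quot_smul (hσ' : ∀ r, σ r = 0 → ∃ s, r = c * s) (r : k') (hr : σ r = 0) (n : ℤ)
    (x : (P.quot c).X n) : r • x = 0 := by
  obtain ⟨s, rfl⟩ := hσ' r hr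
  induction x using Submodule.Quotient.induction_on with | H x =>
  exact (Submodule.Quotient.mk_eq_zero _).mpr ⟨s • x, smul_smul c s x⟩

end reduce

end semi

end DGAlgebra

end CyclicPower

namespace CyclicPower

section witt

variable {p : ℕ} [hp : Fact p.Prime] {R : Type u} [CommRing R]

/-- The reduction of the Witt vectors of length two. -/
noncomputable def wittRes : TruncatedWittVector p 2 R →+* R :=
  RingHom.liftOfRightInverse (WittVector.truncate 2) TruncatedWittVector.out
    TruncatedWittVector.truncateFun_out ⟨WittVector.constantCoeff, fun x hx => by
      exact (WittVector.mem_ker_truncate 2 x).mp hx 0 (by norm_num)⟩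

lemma wittRes_truncate (x : WittVector p R) : wittRes (WittVector.truncate 2 x) = x.coeff 0 :=
  RingHom.liftOfRightInverse_comp_apply _ _ _ _ x

lemma wittRes_apply (w : TruncatedWittVector p 2 R) : wittRes w = w.coeff 0 := by
  obtain ⟨x, rfl⟩ := WittVector.truncate_surjective p 2 R w
  rw [wittRes_truncate, WittVector.coeff_truncate]; rfl

lemma wittRes_surjective : Function.Surjective (wittRes (p := p) (R := R)) := fun r =>
  ⟨WittVector.truncate 2 (WittVector.teichmuller p r), by
    rw [wittRes_truncate, WittVector.teichmuller_coeff_zero]⟩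

variable [CharP R p]

/-- The Frobenius endomorphism of the Witt vectors of length two. -/
noncomputable def wittFrob : TruncatedWittVector p 2 R →+* TruncatedWittVector p 2 R :=
  RingHom.liftOfRightInverse (WittVector.truncate 2) TruncatedWittVector.out
    TruncatedWittVector.truncateFun_out ⟨(WittVector.truncate 2).comp WittVector.frobenius,
      fun x hx => by
        rw [RingHom.mem_ker, RingHom.comp_apply, ← RingHom.mem_ker, WittVector.mem_ker_truncate]
        intro i hi
        rw [WittVector.coeff_frobenius_charP, (WittVector.mem_ker_truncate 2 x).mp hx i hi,
          zero_pow hp.1.ne_zero]⟩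

lemma wittRes_wittFrob (w : TruncatedWittVector p 2 R) : wittRes (wittFrob w) = wittRes w ^ p := by
  obtain ⟨x, rfl⟩ := WittVector.truncate_surjective p 2 R w
  have : wittFrob (WittVector.truncate 2 x) = WittVector.truncate 2 (WittVector.frobenius x) :=
    RingHom.liftOfRightInverse_comp_apply _ _ _ _ x
  rw [this, wittRes_truncate, wittRes_truncate, WittVector.coeff_frobenius_charP]

lemma coeff_p_mul (w : TruncatedWittVector p 2 R) :
    ((p : TruncatedWittVector p 2 R) * w).coeff 0 = 0 ∧
      ((p : TruncatedWittVector p 2 R) * w).coeff 1 = w.coeff 0 ^ p := by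
  obtain ⟨x, rfl⟩ := WittVector.truncate_surjective p 2 R w
  have e : (p : TruncatedWittVector p 2 R) * WittVector.truncate 2 x =
      WittVector.truncate 2 (WittVector.verschiebung (WittVector.frobenius x)) := by
    rw [WittVector.verschiebung_frobenius, map_mul, map_natCast, mul_comm]
  rw [e, WittVector.coeff_truncate, WittVector.coeff_truncate, WittVector.coeff_truncate]
  refine ⟨WittVector.verschiebung_coeff_zero _, ?_⟩
  exact (WittVector.verschiebung_coeff_succ _ 0).trans (WittVector.coeff_frobenius_charP _ x 0)

lemma wittRes_p : wittRes (p : TruncatedWittVector p 2 R) = 0 := by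
  rw [map_natCast, CharP.cast_eq_zero]

lemma p_mul_p_mul (w : TruncatedWittVector p 2 R) :
    (p : TruncatedWittVector p 2 R) * ((p : TruncatedWittVector p 2 R) * w) = 0 := by
  refine TruncatedWittVector.ext fun i => ?_
  rw [TruncatedWittVector.coeff_zero]
  fin_cases i
  · exact (coeff_p_mul _).1
  · exact (coeff_p_mul _).2.trans (by rw [(coeff_p_mul w).1, zero_pow hp.1.ne_zero])

lemma wittRes_eq_zero_of_p_mul [IsReduced R] {w : TruncatedWittVector p 2 R}
    (h : (p : TruncatedWittVector p 2 R) * w = 0) : wittRes w = 0 := by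
  have := (coeff_p_mul w).2
  rw [h, TruncatedWittVector.coeff_zero] at this
  rw [wittRes_apply]
  exact eq_zero_of_pow_eq_zero this.symm

lemma exists_eq_p_mul [PerfectRing R p] {w : TruncatedWittVector p 2 R} (h : wittRes w = 0) :
    ∃ s, w = (p : TruncatedWittVector p 2 R) * s := by
  obtain ⟨s, hs⟩ := wittRes_surjective (p := p) ((frobeniusEquiv R p).symm (w.coeff 1))
  refine ⟨s, TruncatedWittVector.ext fun i => ?_⟩
  rw [wittRes_apply] at h hs
  fin_cases i
  · exact h.trans (coeff_p_mul s).1.symm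
  · exact Eq.symm ((coeff_p_mul s).2.trans (by
      rw [hs]; exact frobenius_apply_frobeniusEquiv_symm R p _))

end witt

section basis

variable {k k' : Type u} [CommRing k] [CommRing k'] {σ : k' →+* k} {c : k'}
  {M' : Type v} [AddCommGroup M'] [Module k' M'] {M : Type v} [AddCommGroup M] [Module k M]

/-- An element of a flat module killed by a scalar is a multiple of any scalar that divides the
annihilator of that scalar. -/
lemma exists_smul_of_flat [Module.Flat k' M'] (h : ∀ r : k', c * r = 0 → ∃ s, r = c * s) {y : M'}
    (hy : c • y = 0) : ∃ z, y = c • z := by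
  obtain ⟨l, a, z, h1, h2⟩ := (Module.Flat.isTrivialRelation_of_sum_smul_eq_zero (R := k')
    (ι := Unit) (f := fun _ => c) (x := fun _ => y) (by simpa using hy))
  choose s hs using fun j => h (a () j) (by simpa using h2 j)
  refine ⟨∑ j, s j • z j, ?_⟩
  rw [Finset.smul_sum]
  refine (h1 ()).trans ?_
  exact Finset.sum_congr rfl fun j _ => by rw [hs j, smul_smul]

lemma exists_finsupp {ι A B : Type*} [Zero A] [Zero B] {P : A → B → Prop} (h0 : P 0 0)
    (h : ∀ a, ∃ b, P a b) (m : ι →₀ A) : ∃ m' : ι →₀ B, ∀ i, P (m i) (m' i) := by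
  classical
  choose f hf using h
  refine ⟨m.mapRange (fun a => if a = 0 then 0 else f a) (if_pos rfl), fun i => ?_⟩
  rw [Finsupp.mapRange_apply]
  split_ifs with h
  · rwa [h]
  · exact hf _

lemma exists_finsupp_eq_smul (h : ∀ r, σ r = 0 → ∃ s, r = c * s) {ι : Type*} {m : ι →₀ k'}
    (hm : ∀ i, σ (m i) = 0) : ∃ m', m = c • m' := by
  obtain ⟨m', hm'⟩ := exists_finsupp (P := fun r s => σ r = 0 → r = c * s)
    (fun _ => (mul_zero c).symm) (fun r => by
      by_cases hr : σ r = 0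
      · obtain ⟨s, hs⟩ := h r hr
        exact ⟨s, fun _ => hs⟩
      · exact ⟨0, fun h => absurd h hr⟩) m
  exact ⟨m', Finsupp.ext fun i => hm' i (hm i)⟩

/-- The lifting of bases. -/
lemma exists_lift_basis [Module.Flat k' M'] (hσ : Function.Surjective σ) (hc : σ c = 0)
    (hcc : c * c = 0)
    (h : ∀ r, σ r = 0 → ∃ s, r = c * s) (h' : ∀ r, c * r = 0 → σ r = 0) (π : M' →+ M)
    (hπ : ∀ r x, π (r • x) = σ r • π x) (hs : Function.Surjective π)
    (hk : ∀ x, π x = 0 → ∃ y, x = c • y) {ι : Type v} (b : Module.Basis ι k M) :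
    ∃ b' : Module.Basis ι k' M', ∀ i, π (b' i) = b i := by
  choose e he using fun i => hs (b i)
  have hsum : ∀ m : ι →₀ k', π (Finsupp.linearCombination k' e m) =
      Finsupp.linearCombination k b (m.mapRange σ (map_zero σ)) := fun m => by
    induction m using Finsupp.induction_linear with
    | zero => simp
    | add x y hx hy => rw [map_add, map_add, hx, hy, Finsupp.mapRange_add (by simp), map_add]
    | single i r => simp [hπ, he]
  have hli : LinearIndependent k' e := by
    rw [linearIndependent_iff]
    intro m hm
    have key : ∀ m : ι →₀ k', π (Finsupp.linearCombination k' e m) = 0 → ∃ m', m = c • m' :=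
      fun m hm => exists_finsupp_eq_smul h fun i => DFunLike.congr_fun
        (linearIndependent_iff.mp b.linearIndependent _ ((hsum m).symm.trans hm)) i
    obtain ⟨m', rfl⟩ := key m (by rw [hm, map_zero])
    rw [map_smul] at hm
    obtain ⟨z, hz⟩ := exists_smul_of_flat (fun r hr => h r (h' r hr)) hm
    obtain ⟨m'', rfl⟩ := key m' (by rw [hz, hπ, hc, zero_smul])
    rw [smul_smul, hcc, zero_smul]
  have hsp : ∀ x : M', ∃ m y, x = Finsupp.linearCombination k' e m + c • y := fun x => by
    obtain ⟨m, hm⟩ := exists_finsupp (P := fun r s => σ s = r) (map_zero σ) hσ (b.repr (π x))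
    have hm : m.mapRange σ (map_zero σ) = b.repr (π x) := Finsupp.ext hm
    obtain ⟨y, hy⟩ := hk (x - Finsupp.linearCombination k' e m) (by
      rw [map_sub, hsum, hm, b.linearCombination_repr, sub_self])
    exact ⟨m, y, by rw [← hy, add_sub_cancel]⟩
  refine ⟨Module.Basis.mk hli fun x _ => ?_, fun i => by rw [Module.Basis.mk_apply, he]⟩
  obtain ⟨m, y, hx⟩ := hsp x
  obtain ⟨m', z, hy⟩ := hsp y
  rw [← Finsupp.range_linearCombination]
  refine ⟨m + c • m', ?_⟩
  rw [hx, hy, map_add, map_smul, smul_add, smul_smul, hcc, zero_smul, add_zero]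

end basis

namespace FilteredDG

variable {k : Type u} [CommRing k] {W : Type v} [AddCommGroup W] [Module k W] (E : FilteredDG k W)

/-- The elements of the first term of the filtration whose differential lies in the second term. -/
def N (n : ℤ) : Submodule k W := E.F (1 - n) n ⊓ (E.F (2 - n) (n - 1)).comap E.d

lemma mem_N {n : ℤ} {x : W} : x ∈ E.N n ↔ x ∈ E.F (1 - n) n ∧ E.d x ∈ E.F (2 - n) (n - 1) := Iff.rfl

lemma mem_Z {n : ℤ} {x : W} : x ∈ E.Z n ↔ x ∈ E.F (-n) n ∧ E.d x ∈ E.F (1 - n) (n - 1) := Iff.rfl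

lemma N_le_Z (n : ℤ) : E.N n ≤ E.Z n := fun _ hx =>
  ⟨E.mem_F (by omega) rfl hx.1, E.mem_F (by omega) rfl hx.2⟩

lemma d_mem_N {i j : ℤ} (h : j + 1 = i) {x : W} (hx : x ∈ E.N i) : E.d x ∈ E.N j := by
  refine ⟨E.mem_F (by omega) (by omega) hx.2, ?_⟩
  rw [SetLike.mem_coe, Submodule.mem_comap, E.d_d]; exact zero_mem _

/-- The filtered differential algebra whose truncation is the quotient of the cycles `Z` by the
submodule `N`. -/
noncomputable def refine : FilteredDG k W where
  toSignedDG := E.toSignedDG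
  F i n := if i + n ≤ 0 then E.Z n else E.N n
  anti i j n h := by
    split_ifs
    · exact le_rfl
    · omega
    · exact E.N_le_Z n
    · exact le_rfl
  s_mem i n x hx := by
    split_ifs at hx
    · exact E.s_mem _ _ x hx.1
    · exact E.s_mem _ _ x hx.1
  d_mem i n n' h x hx := by
    split_ifs at hx ⊢
    · exact E.d_mem_Z h hx
    · exact E.N_le_Z _ (E.d_mem_N h hx)
    · exact absurd (show i + n' ≤ 0 by omega) ‹_›
    · exact E.d_mem_N h hx
  mul_mem i j n m x hx y hy := by
    have hN : ∀ {x y : W}, (x ∈ E.N n ∧ y ∈ E.Z m ∨ x ∈ E.Z n ∧ y ∈ E.N m) →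
        E.mul x y ∈ E.N (n + m) := by
      rintro x y (⟨hx, hy⟩ | ⟨hx, hy⟩) <;>
      · refine ⟨E.mul_mem_F hx.1 hy.1 (by omega) rfl, ?_⟩
        rw [SetLike.mem_coe, Submodule.mem_comap, E.leibniz_F hx.1]
        exact add_mem (E.mul_mem_F hx.2 hy.1 (by omega) (by omega))
          (smul_units_mem _ (E.mul_mem_F hx.1 hy.2 (by omega) (by omega)))
    have hle : ∀ {i n : ℤ} {x : W}, x ∈ (if i + n ≤ 0 then E.Z n else E.N n) → x ∈ E.Z n := by
      intro i n x hx
      split_ifs at hx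
      · exact hx
      · exact E.N_le_Z n hx
    by_cases h : i + j + (n + m) ≤ 0
    · rw [if_pos h]
      exact E.mul_mem_Z rfl (hle hx) (hle hy)
    · rw [if_neg h]
      by_cases h' : i + n ≤ 0
      · rw [if_neg (by omega)] at hy
        exact hN (Or.inr ⟨hle hx, hy⟩)
      · rw [if_neg h'] at hx
        exact hN (Or.inl ⟨hx, hle hy⟩)
  one_mem := by rw [if_pos (by norm_num)]; exact E.one_mem_Z

lemma mem_refine_Z {n : ℤ} {x : W} : x ∈ E.refine.Z n ↔ x ∈ E.Z n := by
  rw [mem_Z]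
  change x ∈ (if -n + n ≤ 0 then E.Z n else E.N n) ∧
    E.d x ∈ (if 1 - n + (n - 1) ≤ 0 then E.Z (n - 1) else E.N (n - 1)) ↔ _
  rw [if_pos (by omega), if_pos (by omega)]
  exact ⟨fun h => h.1, fun h => ⟨h, E.d_mem_Z (by omega) h⟩⟩

lemma mem_refine_B {n : ℤ} {x : W} : x ∈ E.refine.B n ↔ x ∈ E.N n := by
  change x ∈ (if 2 - n + n ≤ 0 then E.Z n else E.N n) ⊔
    (if 1 - n + (n + 1) ≤ 0 then E.Z (n + 1) else E.N (n + 1)).map E.d ↔ _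
  rw [if_neg (by omega), if_neg (by omega), sup_eq_left.mpr]
  rintro _ ⟨y, hy, rfl⟩
  exact E.d_mem_N rfl hy

end FilteredDG

end CyclicPower

namespace CyclicPower

open ResolutionData

section semilinear

variable {k k' : Type u} [CommRing k] [CommRing k'] (σ : k' →+* k) {V : Type v} [AddCommGroup V]
  [Module k' V] {N : Type w} [AddCommGroup N] [Module k N] {n : ℕ}

lemma map_koszul (e : ZMod 2) : σ (koszul k' e) = koszul k e := by
  rw [← koszul_cast k', map_intCast, koszul_cast]

variable {σ}

lemma SuperDG.pow_ext_semi (S : SuperDG k' V) {F G : TPow k' V n →+ N}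
    (hF : ∀ (r : k') x, F (r • x) = σ r • F x) (hG : ∀ (r : k') x, G (r • x) = σ r • G x)
    (h : ∀ (e : Fin n → ZMod 2) (a : Fin n → V), (∀ l, S.par (e l) (a l) = a l) →
      F (pureTensor k' a) = G (pureTensor k' a)) : F = G := by
  let _ := Module.compHom N σ
  let F' : (⨂[k'] _ : Fin n, V) →ₗ[k'] N := { F with map_smul' := hF }
  let G' : (⨂[k'] _ : Fin n, V) →ₗ[k'] N := { G with map_smul' := hG }
  have : F' = G' := S.pow_ext h
  exact AddMonoidHom.ext fun x => LinearMap.congr_fun this x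

lemma comp_update (f : V →+ N) (a : Fin n → V) (i : Fin n) (z : V) :
    (fun l => f (Function.update a i z l)) = Function.update (fun l => f (a l)) i (f z) := by
  funext l
  by_cases hl : l = i
  · subst hl; simp
  · simp [hl]

/-- The pure tensors with factors in the image of a semilinear map. -/
noncomputable def tpowSemiMulti (n : ℕ) (f : V →+ N) (hf : ∀ (r : k') x, f (r • x) = σ r • f x) :
    letI := Module.compHom (SuperDG.TPow k N n) σ
    MultilinearMap k' (fun _ : Fin n => V) (SuperDG.TPow k N n) :=
  letI := Module.compHom (SuperDG.TPow k N n) σ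
  { toFun := fun a => SuperDG.pureTensor k fun l => f (a l)
    map_update_add' := fun {inst} a i x y => by
      obtain rfl : inst = instDecidableEqFin n := Subsingleton.elim _ _
      rw [comp_update, comp_update, comp_update, map_add]
      exact (PiTensorProduct.tprod k).map_update_add _ _ _ _
    map_update_smul' := fun {inst} a i r x => by
      obtain rfl : inst = instDecidableEqFin n := Subsingleton.elim _ _
      rw [comp_update, comp_update, hf]
      exact (PiTensorProduct.tprod k).map_update_smul _ _ _ _ }

/-- The tensor power of a semilinear map. -/
noncomputable def tpowSemi (n : ℕ) (f : V →+ N) (hf : ∀ (r : k') x, f (r • x) = σ r • f x) :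
    SuperDG.TPow k' V n →+ SuperDG.TPow k N n :=
  letI := Module.compHom (SuperDG.TPow k N n) σ
  (PiTensorProduct.lift (tpowSemiMulti n f hf) :
      (⨂[k'] _ : Fin n, V) →ₗ[k'] SuperDG.TPow k N n).toAddMonoidHom

variable {f : V →+ N} {hf : ∀ (r : k') x, f (r • x) = σ r • f x}

lemma tpowSemi_pure (a : Fin n → V) : tpowSemi n f hf (SuperDG.pureTensor k' a) =
    SuperDG.pureTensor k fun l => f (a l) :=
  let _ := Module.compHom (SuperDG.TPow k N n) σ
  PiTensorProduct.lift.tprod (φ := tpowSemiMulti n f hf) a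

lemma tpowSemi_smul (r : k') (x : SuperDG.TPow k' V n) :
    tpowSemi n f hf (r • x) = σ r • tpowSemi n f hf x :=
  let _ := Module.compHom (SuperDG.TPow k N n) σ
  (PiTensorProduct.lift (tpowSemiMulti n f hf)).map_smul r x

variable {S : SuperDG k' V} {S' : SuperDG k N} (hpar : ∀ e x, f (S.par e x) = S'.par e (f x))

include hpar in
lemma semi_par_eq {e : ZMod 2} {x : V} (hx : S.par e x = x) : S'.par e (f x) = f x := by
  rw [← hpar, hx]

include hpar

lemma tpowSemi_d (hd : ∀ x, f (S.d x) = S'.d (f x)) (x : SuperDG.TPow k' V n) :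
    tpowSemi n f hf ((S.pow n).d x) = (S'.pow n).d (tpowSemi n f hf x) := by
  have : (tpowSemi n f hf).comp (S.pow n).d.toAddMonoidHom =
      (S'.pow n).d.toAddMonoidHom.comp (tpowSemi n f hf) := by
    refine S.pow_ext_semi (σ := σ) (N := SuperDG.TPow k N n) (fun r x => ?_) (fun r x => ?_) fun e a ha => ?_
    · exact (congrArg _ ((S.pow n).d.map_smul r x)).trans (tpowSemi_smul (hf := hf) r _)
    · exact (congrArg _ (tpowSemi_smul (hf := hf) r x)).trans ((S'.pow n).d.map_smul _ _)
    · have h1 : (S.pow n).d (SuperDG.pureTensor k' a) =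
          ∑ j, koszul k' (∑ i, if i < j then e i else 0) •
            SuperDG.pureTensor k' (Function.update a j (S.d (a j))) := S.powD_tprod ha
      have h2 : (S'.pow n).d (SuperDG.pureTensor k fun l => f (a l)) =
          ∑ j, koszul k (∑ i, if i < j then e i else 0) •
            SuperDG.pureTensor k (Function.update (fun l => f (a l)) j (S'.d (f (a j)))) :=
        S'.powD_tprod fun l => semi_par_eq hpar (ha l)
      change tpowSemi n f hf ((S.pow n).d _) = (S'.pow n).d (tpowSemi n f hf _)
      rw [h1, tpowSemi_pure, h2, map_sum]
      refine Finset.sum_congr rfl fun j _ => ?_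
      rw [tpowSemi_smul, tpowSemi_pure, map_koszul]
      congr 2; funext l
      by_cases h : l = j
      · subst h; simp [hd]
      · simp [h]
  exact DFunLike.congr_fun this x

lemma tpowSemi_s (x : SuperDG.TPow k' V n) :
    tpowSemi n f hf ((S.pow n).s x) = (S'.pow n).s (tpowSemi n f hf x) := by
  have : (tpowSemi n f hf).comp (S.pow n).s.toAddMonoidHom =
      (S'.pow n).s.toAddMonoidHom.comp (tpowSemi n f hf) := by
    refine S.pow_ext_semi (σ := σ) (N := SuperDG.TPow k N n) (fun r x => ?_) (fun r x => ?_) fun e a ha => ?_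
    · exact (congrArg _ ((S.pow n).s.map_smul r x)).trans (tpowSemi_smul (hf := hf) r _)
    · exact (congrArg _ (tpowSemi_smul (hf := hf) r x)).trans ((S'.pow n).s.map_smul _ _)
    · have h1 : (S.pow n).s (SuperDG.pureTensor k' a) =
          koszul k' (∑ l, e l) • SuperDG.pureTensor k' a := S.powS_tprod ha
      have h2 : (S'.pow n).s (SuperDG.pureTensor k fun l => f (a l)) =
          koszul k (∑ l, e l) • SuperDG.pureTensor k fun l => f (a l) :=
        S'.powS_tprod fun l => semi_par_eq hpar (ha l)
      change tpowSemi n f hf ((S.pow n).s (SuperDG.pureTensor k' a)) =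
        (S'.pow n).s (tpowSemi n f hf (SuperDG.pureTensor k' a))
      rw [h1, tpowSemi_smul, tpowSemi_pure, h2, map_koszul]
  exact DFunLike.congr_fun this x

lemma tpowSemi_perm (τ : Equiv.Perm (Fin n)) (x : SuperDG.TPow k' V n) :
    tpowSemi n f hf (S.powPerm n τ x) = S'.powPerm n τ (tpowSemi n f hf x) := by
  let P : SuperDG.TPow k' V n →ₗ[k'] SuperDG.TPow k' V n := S.powPerm n τ
  let P' : SuperDG.TPow k N n →ₗ[k] SuperDG.TPow k N n := S'.powPerm n τ
  have : (tpowSemi n f hf).comp P.toAddMonoidHom = P'.toAddMonoidHom.comp (tpowSemi n f hf) := by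
    refine S.pow_ext_semi (σ := σ) (N := SuperDG.TPow k N n) (fun r x => ?_) (fun r x => ?_) fun e a ha => ?_
    · exact (congrArg _ (P.map_smul r x)).trans (tpowSemi_smul (hf := hf) r _)
    · exact (congrArg _ (tpowSemi_smul (hf := hf) r x)).trans (P'.map_smul _ _)
    · have h1 : P (SuperDG.pureTensor k' a) = koszul k' (SuperDG.inversions τ e) •
          SuperDG.pureTensor k' fun l => a (τ.symm l) := S.powPerm_tprod τ ha
      have h2 : P' (SuperDG.pureTensor k fun l => f (a l)) = koszul k (SuperDG.inversions τ e) •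
          SuperDG.pureTensor k fun l => f (a (τ.symm l)) :=
        S'.powPerm_tprod τ fun l => semi_par_eq hpar (ha l)
      change tpowSemi n f hf (P _) = P' (tpowSemi n f hf _)
      rw [h1, tpowSemi_smul, tpowSemi_pure, tpowSemi_pure, h2, map_koszul]
  exact DFunLike.congr_fun this x

lemma tpowSemi_mul (hm : ∀ x y, f (S.mul x y) = S'.mul (f x) (f y)) (x y : SuperDG.TPow k' V n) :
    tpowSemi n f hf ((S.pow n).mul x y) =
      (S'.pow n).mul (tpowSemi n f hf x) (tpowSemi n f hf y) := by
  have : (tpowSemi n f hf).comp ((S.pow n).mul.flip y).toAddMonoidHom =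
      ((S'.pow n).mul.flip (tpowSemi n f hf y)).toAddMonoidHom.comp (tpowSemi n f hf) := by
    refine S.pow_ext_semi (σ := σ) (N := SuperDG.TPow k N n) (fun r x => ?_) (fun r x => ?_) fun e a ha => ?_
    · exact (congrArg _ (((S.pow n).mul.flip y).map_smul r x)).trans (tpowSemi_smul (hf := hf) r _)
    · exact (congrArg _ (tpowSemi_smul (hf := hf) r x)).trans (((S'.pow n).mul.flip _).map_smul _ _)
    · have : (tpowSemi n f hf).comp ((S.pow n).mul (SuperDG.pureTensor k' a)).toAddMonoidHom =
        ((S'.pow n).mul (tpowSemi n f hf (SuperDG.pureTensor k' a))).toAddMonoidHom.comp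
          (tpowSemi n f hf) := by
        refine S.pow_ext_semi (σ := σ) (N := SuperDG.TPow k N n) (fun r x => ?_) (fun r x => ?_) fun e' a' ha' => ?_
        · exact (congrArg _ (((S.pow n).mul _).map_smul r x)).trans (tpowSemi_smul (hf := hf) r _)
        · exact (congrArg _ (tpowSemi_smul (hf := hf) r x)).trans (((S'.pow n).mul _).map_smul _ _)
        · have h1 : (S.pow n).mul (SuperDG.pureTensor k' a) (SuperDG.pureTensor k' a') =
              koszul k' (SuperDG.crossing e e') • SuperDG.pureTensor k' fun l => S.mul (a l) (a' l) :=
            S.powMul_tprod ha ha'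
          have h2 : (S'.pow n).mul (SuperDG.pureTensor k fun l => f (a l))
              (SuperDG.pureTensor k fun l => f (a' l)) = koszul k (SuperDG.crossing e e') •
                SuperDG.pureTensor k fun l => S'.mul (f (a l)) (f (a' l)) :=
            S'.powMul_tprod (fun l => semi_par_eq hpar (ha l)) fun l => semi_par_eq hpar (ha' l)
          change tpowSemi n f hf ((S.pow n).mul _ _) =
            (S'.pow n).mul (tpowSemi n f hf _) (tpowSemi n f hf _)
          rw [h1, tpowSemi_smul, tpowSemi_pure, tpowSemi_pure, tpowSemi_pure, h2, map_koszul]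
          simp only [hm]
      exact DFunLike.congr_fun this y
  exact DFunLike.congr_fun this x

end semilinear

namespace DGAlgebra

namespace SemiHom

variable {k k' : Type u} [CommRing k] [CommRing k'] {σ : k' →+* k} {X : DGAlgebra.{u, v} k'}
  {B : DGAlgebra.{u, v} k} (r : SemiHom σ X B)

/-- The map of direct sums. -/
noncomputable def tot : X.Tot →+ B.Tot := DirectSum.map r.f

lemma tot_ι (i : ℤ) (x : X.X i) : r.tot (X.ι i x) = B.ι i (r.f i x) := DirectSum.map_of r.f i x

lemma addHom_ext {M : Type*} [AddCommGroup M] {F G : X.Tot →+ M}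
    (h : ∀ i x, F (X.ι i x) = G (X.ι i x)) : F = G := DirectSum.addHom_ext h

lemma tot_smul (c : k') (x : X.Tot) : r.tot (c • x) = σ c • r.tot x := by
  have : r.tot.comp (DistribSMul.toAddMonoidHom X.Tot c) =
      (DistribSMul.toAddMonoidHom B.Tot (σ c)).comp r.tot := addHom_ext fun i x => by
    change r.tot (c • X.ι i x) = σ c • r.tot (X.ι i x)
    rw [← _root_.map_smul, tot_ι, tot_ι, r.map_smul, _root_.map_smul]
  exact DFunLike.congr_fun this x

lemma tot_d (x : X.Tot) : r.tot (X.super.d x) = B.super.d (r.tot x) := by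
  have : r.tot.comp X.totD.toAddMonoidHom = B.totD.toAddMonoidHom.comp r.tot :=
    addHom_ext fun i x => by
      change r.tot (X.totD (X.ι i x)) = B.totD (r.tot (X.ι i x))
      rw [tot_ι, X.totD_ι (sub_add_cancel i 1), B.totD_ι (sub_add_cancel i 1), tot_ι, r.map_d]
  exact DFunLike.congr_fun this x

lemma tot_par (e : ZMod 2) (x : X.Tot) : r.tot (X.super.par e x) = B.super.par e (r.tot x) := by
  have : r.tot.comp (X.totPar e).toAddMonoidHom = (B.totPar e).toAddMonoidHom.comp r.tot :=
    addHom_ext fun i x => by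
      change r.tot (X.totPar e (X.ι i x)) = B.totPar e (r.tot (X.ι i x))
      rw [tot_ι, X.totPar_ι, B.totPar_ι]
      split_ifs
      · rw [tot_ι]
      · rw [map_zero]
  exact DFunLike.congr_fun this x

lemma tot_mul (x y : X.Tot) : r.tot (X.super.mul x y) = B.super.mul (r.tot x) (r.tot y) := by
  have : r.tot.comp (X.totMul.flip y).toAddMonoidHom =
      (B.totMul.flip (r.tot y)).toAddMonoidHom.comp r.tot := addHom_ext fun i x => by
    have : r.tot.comp (X.totMul (X.ι i x)).toAddMonoidHom =
        (B.totMul (r.tot (X.ι i x))).toAddMonoidHom.comp r.tot := addHom_ext fun j y => by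
      change r.tot (X.totMul (X.ι i x) (X.ι j y)) = B.totMul (r.tot (X.ι i x)) (r.tot (X.ι j y))
      rw [tot_ι, tot_ι, X.totMul_ι rfl, B.totMul_ι rfl, tot_ι, r.map_mul]
    exact DFunLike.congr_fun this y
  exact DFunLike.congr_fun this x

variable (p : ℕ)

/-- The map of tensor powers. -/
noncomputable def tpow : SuperDG.TPow k' X.Tot p →+ SuperDG.TPow k B.Tot p :=
  tpowSemi p r.tot r.tot_smul

variable {p}

lemma tpow_powDeg {n : ℤ} {t : SuperDG.TPow k' X.Tot p} (ht : t ∈ X.powDeg p n) :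
    r.tpow p t ∈ B.powDeg p n := by
  induction ht using Submodule.span_induction with
  | zero => rw [map_zero]; exact zero_mem _
  | add x x' _ _ hx hx' => rw [map_add]; exact add_mem hx hx'
  | smul c x _ hx => rw [tpow, tpowSemi_smul]; exact Submodule.smul_mem _ _ hx
  | mem x hx =>
    obtain ⟨e, a, ha, hi, rfl⟩ := hx
    refine Submodule.subset_span ⟨e, _, fun l => ?_, hi, tpowSemi_pure a⟩
    obtain ⟨x, hx⟩ := ha l
    exact ⟨_, by rw [← hx]; exact (r.tot_ι _ _).symm⟩

variable (ν : ResolutionData.{u} p)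

/-- The map of Tate complexes. -/
noncomputable def cech : X.CechTot ν →+ B.CechTot ν := tri (r.tpow p) (.id _) (.id _)

variable {ν}

lemma cech_pt (t : SuperDG.TPow k' X.Tot p) (x y) :
    r.cech ν (ν.pt t x y) = ν.pt (r.tpow p t) x y := rfl

lemma cech_smul (c : k') (w : X.CechTot ν) : r.cech ν (c • w) = σ c • r.cech ν w := by
  induction w using Y_induction with
  | add w z hw hz => rw [smul_add, map_add, map_add, smul_add, hw, hz]
  | pt t x y => rw [smul_pt, cech_pt, cech_pt, smul_pt, tpow, tpowSemi_smul]

lemma cech_act (t : SuperDG.TPow k' X.Tot p) (z : ν.Y ℤ) :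
    r.cech ν (act t z) = act (r.tpow p t) z := by
  induction z using Y_induction with
  | pt m x y => rw [act_pt, act_pt, cech_pt, map_zsmul]
  | add w z hw hz => rw [map_add, map_add, map_add, hw, hz]

lemma cech_d (w : X.CechTot ν) :
    r.cech ν ((X.cechSigned ν).d w) = (B.cechSigned ν).d (r.cech ν w) := by
  induction w using Y_induction with
  | add w z hw hz => rw [map_add, map_add, map_add, map_add, hw, hz]
  | pt t x y =>
    rw [cech_pt, cech_d_pt, cech_d_pt, map_add, map_add, cech_pt, cech_pt, cech_pt, tpow,
      tpowSemi_d r.tot_par r.tot_d, tpowSemi_s r.tot_par]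

lemma cech_action (w : X.CechTot ν) :
    r.cech ν ((X.cechAction ν).f w) = (B.cechAction ν).f (r.cech ν w) := by
  induction w using Y_induction with
  | add w z hw hz => rw [map_add, map_add, map_add, map_add, hw, hz]
  | pt t x y => exact congrArg (fun t => ν.pt t (ν.σP x) (ν.σI y)) (tpowSemi_perm (hf := r.tot_smul) r.tot_par _ t)

lemma cech_lowFil {J n : ℤ} {w : X.CechTot ν} (hw : w ∈ X.lowFil ν J n) :
    r.cech ν w ∈ B.lowFil ν J n :=
  map_triDeg _ _ (fun _ _ _ h _ _ _ ht _ hx _ hy => pt_mem_triDeg h (r.tpow_powDeg ht) hx hy) hw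

lemma cech_F {m n : ℤ} {w : X.CechTot ν} (hw : w ∈ (X.cech ν).F m n) :
    r.cech ν w ∈ (B.cech ν).F m n := by
  refine ⟨mem_cechFil_iff.mpr (r.cech_lowFil (mem_cechFil_iff.mp hw.1)), ?_⟩
  have h : (X.cechAction ν).f w = w := hw.2
  change (B.cechAction ν).f (r.cech ν w) = r.cech ν w
  rw [← r.cech_action, h]

lemma cech_Z {n : ℤ} {w : X.CechTot ν} (hw : w ∈ (X.cech ν).Z n) : r.cech ν w ∈ (B.cech ν).Z n := by
  refine ⟨r.cech_F hw.1, ?_⟩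
  have := r.cech_F hw.2
  rw [SetLike.mem_coe, Submodule.mem_comap]
  exact (r.cech_d w) ▸ this

lemma cech_one : r.cech ν (X.cechSigned ν).one = (B.cechSigned ν).one := by
  change ν.pt (tpowSemi p r.tot r.tot_smul (SuperDG.pureTensor k' fun _ => X.ι 0 X.one)) _ _ =
    ν.pt (SuperDG.pureTensor k fun _ => B.ι 0 B.one) _ _
  rw [tpowSemi_pure]
  simp only [tot_ι, r.map_one]
  rfl

lemma cech_mul {i j n m : ℤ} {w z : X.CechTot ν} (hw : w ∈ X.lowFil ν i n) (hz : z ∈ X.lowFil ν j m) :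
    r.cech ν ((X.cechSigned ν).mul w z) = (B.cechSigned ν).mul (r.cech ν w) (r.cech ν z) := by
  let F (z : X.CechTot ν) : X.CechTot ν →+ B.CechTot ν :=
    (r.cech ν).comp ((X.cechSigned ν).mul.flip z).toAddMonoidHom -
      ((B.cechSigned ν).mul.flip (r.cech ν z)).toAddMonoidHom.comp (r.cech ν)
  let G (w : X.CechTot ν) : X.CechTot ν →+ B.CechTot ν :=
    (r.cech ν).comp ((X.cechSigned ν).mul w).toAddMonoidHom -
      ((B.cechSigned ν).mul (r.cech ν w)).toAddMonoidHom.comp (r.cech ν)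
  refine sub_eq_zero.mp (AddSubgroup.mem_bot.mp (map_triDeg (F z) ⊥
    (fun d b c h _ _ t ht x hx y hy => ?_) hw))
  refine map_triDeg (G (ν.pt t x y)) ⊥ (fun d' b' c' h' _ _ t' ht' x' hx' y' hy' => ?_) hz
  refine AddSubgroup.mem_bot.mpr (sub_eq_zero.mpr ?_)
  have e1 : (X.cechSigned ν).mul (ν.pt t x y) (ν.pt t' x' y') = _ :=
    alg_mul_pt (X.super.pow p) (powDeg_s ht') hx hy hx'
  have e2 : (B.cechSigned ν).mul (ν.pt (r.tpow p t) x y) (ν.pt (r.tpow p t') x' y') = _ :=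
    alg_mul_pt (B.super.pow p) (powDeg_s (r.tpow_powDeg ht')) hx hy hx'
  change r.cech ν ((X.cechSigned ν).mul (ν.pt t x y) (ν.pt t' x' y')) =
    (B.cechSigned ν).mul (ν.pt (r.tpow p t) x y) (ν.pt (r.tpow p t') x' y')
  rw [e1, e2, cech_smul, cech_smul, cech_pt, map_koszul, map_koszul, tpow,
    tpowSemi_mul r.tot_par r.tot_mul]

end SemiHom

end DGAlgebra

end CyclicPower

namespace CyclicPower

open ResolutionData

lemma CycData.exists_torsion_act {p : ℕ} [Fact p.Prime] {V : Type v} [AddCommGroup V] {M : ℤ → Type w}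
    [∀ n, AddCommGroup (M n)] (D : CycData p V M) {ν : ResolutionData.{u} p} {O : ν.Ops}
    {c : ℤ → ν.Y ℤ} (hc : IsGenSeq.{u, w} O c) {n : ℤ} {w : ν.Y V} (hw : w ∈ D.GI ν (n * p) (n + 1))
    (hd : D.dW ν w ∈ D.GD ν (n * p - 1) n) : ∃ m : M n, p • m = 0 ∧
      ∃ e : ν.Y ℤ, ∃ y ∈ D.GI ν (n * p) (n + 1 + 1), w - act (D.j n m) e - D.dW ν y ∈
          D.GD ν (n * p - 1) (n + 1) := by
  obtain ⟨m, hm, y, hy, h⟩ := D.exists_torsion hc hw hd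
  rw [← act_h, ← act_β, CycData.jY, CycData.tri_act] at h
  exact ⟨m, hm, _, y, hy, h⟩

lemma CycData.mem_of_sub_act {p : ℕ} {V : Type v} [AddCommGroup V] {M : ℤ → Type w}
    [∀ n, AddCommGroup (M n)] (D : CycData p V M) {ν : ResolutionData.{u} p} {J n : ℤ} {w y : ν.Y V}
    {t : V} {e : ν.Y ℤ} (h : w - act t e - D.dW ν y ∈ D.GD ν J n) (ht : t = 0) :
    w - D.dW ν y ∈ D.GD ν J n := by
  rwa [ht, show act (0 : V) e = 0 from map_zero (actHom V e), sub_zero] at h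

namespace DGAlgebra

lemma exists_lift_Z {p : ℕ} [hp : Fact p.Prime] {k : Type u} [CommRing k] {ν : ResolutionData.{u} p}
    {O : ν.Ops} {c : ℤ → ν.Y ℤ} (hc : IsGenSeq.{u, u} O c) {A : DGAlgebra.{u, u} k} {ι : ℤ → Type u}
    (b : ∀ n, Module.Basis (ι n) k (A.X n)) {n : ℤ} (m : ι n →₀ k) :
    ∃ z ∈ (A.cech ν).Z n, (cycData b).Rel c n z (powJ b p n m) := by
  obtain ⟨z, hz, hd, h⟩ := (cycData b).exists_lift hc m
  rw [← cech_d_eq, ← mem_cech_F_one_sub] at hd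
  exact ⟨z, ⟨(mem_cech_F_neg b).mpr hz, hd⟩, h⟩

lemma exists_rel_Z {p : ℕ} [hp : Fact p.Prime] {k : Type u} [CommRing k] {ν : ResolutionData.{u} p}
    {O : ν.Ops} {c : ℤ → ν.Y ℤ} (hc : IsGenSeq.{u, u} O c) {A : DGAlgebra.{u, u} k} {ι : ℤ → Type u}
    (b : ∀ n, Module.Basis (ι n) k (A.X n)) {n : ℤ} {z : A.CechTot ν} (hz : z ∈ (A.cech ν).Z n) :
    ∃ m, (cycData b).Rel c n z (powJ b p n m) := by
  have hd := hz.2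
  rw [SetLike.mem_coe, Submodule.mem_comap] at hd
  exact (cycData b).exists_rel hc ((mem_cech_F_neg b).mp hz.1)
    (by rw [← cech_d_eq]; exact lowFil_of_F hd)

namespace SemiHom

variable {p : ℕ} [hp : Fact p.Prime] {k k' : Type u} [CommRing k] [CommRing k'] {σ : k' →+* k}
  {X : DGAlgebra.{u, u} k'} {B : DGAlgebra.{u, u} k} (r : SemiHom σ X B) {ι : ℤ → Type u}
  {b' : ∀ n, Module.Basis (ι n) k' (X.X n)} {b : ∀ n, Module.Basis (ι n) k (B.X n)}
  (hb : ∀ n i, r.f n (b' n i) = b n i) {ν : ResolutionData.{u} p} {O : ν.Ops} {c : ℤ → ν.Y ℤ}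

lemma cech_GI {n N : ℤ} {y : X.CechTot ν} (hy : y ∈ (cycData b').GI ν (n * p) N) :
    r.cech ν y ∈ (cycData b).GI ν (n * p) N :=
  (mem_cech_F_neg b).mp (r.cech_F ((mem_cech_F_neg b').mpr hy))

lemma cech_Rel {n : ℤ} {z : X.CechTot ν} {t} (h : (cycData b').Rel c n z t) :
    (cycData b).Rel c n (r.cech ν z) (r.tpow p t) := by
  obtain ⟨y, hy, h⟩ := h
  refine ⟨r.cech ν y, r.cech_GI hy, ?_⟩
  have := r.cech_lowFil h
  rw [map_sub, map_sub, ← cech_d_eq, r.cech_d, r.cech_act, cech_d_eq b] at this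
  exact this

include hb

lemma tpow_powBasis (f : Fin p → Σ n, ι n) : r.tpow p (powBasis b' p f) = powBasis b p f := by
  rw [powBasis_apply, powBasis_apply, tpow, tpowSemi_pure]
  congr 1
  funext l
  rw [totBasis_apply, totBasis_apply, tot_ι, hb]

lemma tpow_powJ (n : ℤ) (m : ι n →₀ k') : r.tpow p (powJ b' p n m) =
    powJ b p n (m.mapRange σ (map_zero σ)) := by
  induction m using Finsupp.induction_linear with
  | zero => simp
  | add x y hx hy => rw [map_add, map_add, hx, hy, Finsupp.mapRange_add (by simp), map_add]
  | single i s =>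
    rw [Finsupp.mapRange_single, ← _root_.mul_one s, ← smul_eq_mul, ← Finsupp.smul_single, _root_.map_smul,
      powJ_single, tpow, tpowSemi_smul, smul_eq_mul, _root_.map_mul, _root_.map_one, ← smul_eq_mul,
      ← Finsupp.smul_single, _root_.map_smul, powJ_single]
    exact congrArg _ (r.tpow_powBasis hb _)

variable (hc : IsGenSeq.{u, u} O c)

include hc

lemma mem_of_cech_mem (hpk : (p : k) = 0) (hσ : ∀ s, σ s = 0 → ∃ s', s = p * s') {n : ℤ}
    {z : X.CechTot ν} (hz : z ∈ (X.cech ν).Z n)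
    (h : r.cech ν z ∈ (B.cech ν).F (1 - n) n ⊔ ((B.cech ν).F (-n) (n + 1)).map (B.cech ν).d) :
    z ∈ (X.cech ν).F (1 - n) n ⊔ ((X.cech ν).F (-n) (n + 1)).map (X.cech ν).d := by
  have h0 := (Rel_zero_iff (c := c) O b (r.cech_Z hz)).mpr h
  obtain ⟨m, hm⟩ := exists_rel_Z hc b' hz
  have h1 := r.cech_Rel (b := b) hm
  rw [r.tpow_powJ hb] at h1
  obtain ⟨m'', hm''⟩ := (cycData b).Rel_unique hc h1 (m' := 0) (by rwa [map_zero])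
  have e : m.mapRange σ (map_zero σ) = 0 := by
    rw [sub_zero, ← Nat.cast_smul_eq_nsmul k, hpk, zero_smul] at hm''
    exact hm''
  obtain ⟨m', rfl⟩ := exists_finsupp_eq_smul hσ (m := m) fun i => DFunLike.congr_fun e i
  refine (Rel_zero_iff (c := c) O b' hz).mp ?_
  have := hm.sub ((cycData b').Rel_smul hc m')
  rw [← Nat.cast_smul_eq_nsmul k', sub_zero,
    show powJ b' p n ((p : k') • m') - (cycData b').j n ((p : k') • m') = 0 from sub_self _] at this
  exact this

lemma exists_cech_sub_mem (hσ : Function.Surjective σ) {n : ℤ} {y : B.CechTot ν}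
    (hy : y ∈ (B.cech ν).Z n) : ∃ z ∈ (X.cech ν).Z n, y - r.cech ν z ∈
      (B.cech ν).F (1 - n) n ⊔ ((B.cech ν).F (-n) (n + 1)).map (B.cech ν).d := by
  obtain ⟨m, hm⟩ := exists_rel_Z hc b hy
  obtain ⟨m', hm'⟩ := exists_finsupp (P := fun s s' => σ s' = s) (map_zero σ) hσ m
  obtain ⟨z, hz, h⟩ := exists_lift_Z hc b' m'
  have hZ : y - r.cech ν z ∈ (B.cech ν).Z n := sub_mem hy (r.cech_Z hz)
  refine ⟨z, hz, (Rel_zero_iff (c := c) O b hZ).mp ?_⟩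
  have e : m'.mapRange σ (map_zero σ) = m := Finsupp.ext hm'
  have h1 := r.cech_Rel (b := b) h
  rw [r.tpow_powJ hb, e] at h1
  have h2 := hm.sub h1
  rwa [sub_self (powJ b p n m)] at h2

lemma cech_N (hσ : ∀ s, (p : k') * s = 0 → σ s = 0) {n : ℤ} {x : X.CechTot ν}
    (hx : x ∈ (X.cech ν).N n) : r.cech ν x ∈ (B.cech ν).B n := by
  obtain ⟨N, rfl⟩ : ∃ N, n = N + 1 := ⟨n - 1, by ring⟩
  have e1 : (1 : ℤ) - (N + 1) = -N := by ring
  have e2 : (2 : ℤ) - (N + 1) = 1 - N := by ring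
  have hp0 : (0 : ℤ) < p := by exact_mod_cast (Fact.out : p.Prime).pos
  obtain ⟨h1, h2⟩ := (X.cech ν).mem_N.mp hx
  rw [e1] at h1
  rw [e2, add_sub_cancel_right] at h2
  have hB1 := (mem_cech_F_neg b).mp (r.cech_F h1)
  have hB2 := (mem_cech_F_one_sub b).mp (r.cech_F h2)
  obtain ⟨m, hm, e, y, hy, h⟩ := (cycData b').exists_torsion_act hc ((mem_cech_F_neg b').mp h1)
    (by rw [← cech_d_eq]; exact lowFil_of_F h2)
  have hm0 : m.mapRange σ (map_zero σ) = 0 := Finsupp.ext fun i => hσ _ (by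
    have := DFunLike.congr_fun hm i
    rwa [Finsupp.smul_apply, nsmul_eq_mul] at this)
  have hj : r.tpow p ((cycData b').j N m) = 0 := (r.tpow_powJ hb N m).trans (by rw [hm0, map_zero])
  have h := r.cech_lowFil h
  rw [map_sub, map_sub, r.cech_act, ← cech_d_eq, r.cech_d, cech_d_eq b] at h
  have h := (cycData b).mem_of_sub_act h hj
  have hy := r.cech_GI (b := b) hy
  obtain ⟨y', hy', h'⟩ := (cycData b).exists_reduce_mul O (m := N) (J := N * p - 1) (n := N + 1)
    (by rw [sub_mul]; omega) (by omega)
    ⟨h, AddSubgroup.sub_mem ((cycData b).Inv ν) hB1.2 ((cycData b).dW_Inv hy.2)⟩ (by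
      rw [map_sub, CycData.dW_dW, sub_zero, ← cech_d_eq, ← r.cech_d, add_sub_cancel_right]
      exact hB2.1)
  rw [sub_sub, ← map_add, ← cech_d_eq, ← mem_cech_F_one_sub] at h'
  have hyy := add_mem hy ((cycData b).GI_mono (show (N : ℤ) * p - 1 ≤ N * p by omega) hy')
  rw [← mem_cech_F_neg] at hyy
  rw [FilteredDG.B, e1, e2, ← sub_add_cancel (r.cech ν x) ((B.cechSigned ν).d (r.cech ν y + y'))]
  exact add_mem (Submodule.mem_sup_left h') (Submodule.mem_sup_right ⟨_, hyy, rfl⟩)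

end SemiHom

end DGAlgebra

end CyclicPower

namespace CyclicPower

open ResolutionData

namespace DGAlgebra

section pullback

variable {k k' : Type u} [CommRing k] [CommRing k'] {σ : k' →+* k} (hσ : Function.Surjective σ)
  {c : k'} {Y X : DGAlgebra.{u, v} k'} {A : DGAlgebra.{u, v} k} {f : SemiHom σ Y A} {r : SemiHom σ X A}

/-- The reduction of a fibre product is quasiisomorphic to the base. -/
lemma quasiIso_pullback
    (h : ∀ s, σ s = 0 → ∀ n (x : ((pullback f r).quot c).X n), s • x = 0)
    (φ : (desc hσ ((pullback f r).quot c) h).Hom A)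
    (hφ : ∀ n (x : pullbackX f r n), φ.f n (Submodule.Quotient.mk x) = f.f n x.1.1)
    (hf : ∀ n, Function.Surjective (f.f n)) (hr : ∀ n, Function.Surjective (r.f n))
    (hk : ∀ n x, r.f n x = 0 → ∃ y, x = c • y) (ht : ∀ n y, c • y = 0 → r.f n y = 0)
    (hK : ∀ n x z, f.f n x = 0 → f.f (n - 1) z = 0 → Y.d n (n - 1) x = c • z →
      ∃ y g, f.f (n + 1) y = 0 ∧ f.f n g = 0 ∧ x = Y.d (n + 1) n y + c • g) :
    QuasiIso φ.toComplex := by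
  refine φ.quasiIso (fun n v => ?_) fun n q => ?_
  · obtain ⟨y, hy⟩ := hf n v
    obtain ⟨x, hx⟩ := hr n v
    exact ⟨Submodule.Quotient.mk ⟨(y, x), hy.trans hx.symm⟩, (hφ n _).trans hy⟩
  · change (pullbackX f r n ⧸ (pullback f r).mulBy c n) at q
    induction q using Submodule.Quotient.induction_on with | H q =>
    obtain ⟨⟨x, y⟩, hxy⟩ := q
    intro h0 hd
    have hx : f.f n x = 0 := (hφ n _).symm.trans h0
    have hxy : f.f n x = r.f n y := hxy
    obtain ⟨y₁, rfl⟩ := hk n y (hxy.symm.trans hx)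
    obtain ⟨x₁, hx₁⟩ := hf n (r.f n y₁)
    obtain ⟨⟨⟨z, w⟩, hzw⟩, e⟩ := (Submodule.Quotient.mk_eq_zero _).mp hd
    have hzw : f.f (n - 1) z = r.f (n - 1) w := hzw
    have e1 : c • z = Y.d n (n - 1) x := congrArg (fun q => q.1.1) e
    have e2 : c • w = X.d n (n - 1) (c • y₁) := congrArg (fun q => q.1.2) e
    have hc : σ c • r.f n y₁ = 0 := by rw [← r.map_smul, ← hxy, hx]
    have hw : r.f (n - 1) (w - X.d n (n - 1) y₁) = 0 := ht _ _ (by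
      rw [smul_sub, e2, _root_.map_smul, sub_self])
    obtain ⟨g₁, g, hg₁, hg, e⟩ := hK n (x - c • x₁) (z - Y.d n (n - 1) x₁)
      (by rw [map_sub, f.map_smul, hx₁, hc, hx, sub_zero])
      (by rw [map_sub, f.map_d, hx₁, hzw, ← r.map_d, ← map_sub, hw])
      (by rw [map_sub, _root_.map_smul, smul_sub, e1])
    refine ⟨Submodule.Quotient.mk ⟨(g₁, 0), hg₁.trans (map_zero _).symm⟩, (hφ _ _).trans hg₁, ?_⟩
    have hm : (x₁ + g, y₁) ∈ pullbackX f r n := by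
      change f.f n (x₁ + g) = r.f n y₁
      rw [map_add, hg, add_zero, hx₁]
    refine (Submodule.Quotient.eq _).mpr ⟨-⟨(x₁ + g, y₁), hm⟩, ?_⟩
    refine Subtype.ext (Prod.ext ?_ ?_)
    · change c • -(x₁ + g) = Y.d (n + 1) n g₁ - x
      rw [eq_add_of_sub_eq e, smul_neg, smul_add]; abel
    · change c • -y₁ = X.d (n + 1) n 0 - c • y₁
      rw [map_zero, zero_sub, smul_neg]

end pullback

section lift

variable {p : ℕ} [hp : Fact p.Prime] {R : Type u} [Field R] [CharP R p] [PerfectField R]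
  (ν : ResolutionData.{u} p) (X : DGAlgebra.{u, u} (TruncatedWittVector p 2 R)) {A : DGAlgebra.{u, u} R}

/-- The quotient of the cycles `Z` of the Tate complex by the submodule `N`. -/
noncomputable def cyclicLift : DGAlgebra.{u, u} (TruncatedWittVector p 2 R) :=
  (X.cech ν).refine.trunc.restrictScalars wittFrob

variable {ν X} {n : ℤ}

/-- The class of a cycle. -/
noncomputable def liftCls (z : X.CechTot ν) (hz : z ∈ (X.cech ν).Z n) : (X.cyclicLift ν).X n :=
  (X.cech ν).refine.cls z ((X.cech ν).mem_refine_Z.mpr hz)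

lemma liftCls_eq_iff {z w : X.CechTot ν} (hz : z ∈ (X.cech ν).Z n) (hw : w ∈ (X.cech ν).Z n) :
    liftCls z hz = liftCls w hw ↔ z - w ∈ (X.cech ν).N n :=
  ((X.cech ν).refine.cls_eq_iff _ _).trans (X.cech ν).mem_refine_B

lemma liftCls_surjective (q : (X.cyclicLift ν).X n) : ∃ z hz, q = liftCls z hz :=
  FilteredDG.Q_ind (P := fun q => ∃ z hz, q = liftCls z hz)
    (fun z hz => ⟨z, (X.cech ν).mem_refine_Z.mp hz, rfl⟩) q

lemma liftCls_smul (s : TruncatedWittVector p 2 R) {z : X.CechTot ν} (hz : z ∈ (X.cech ν).Z n) :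
    s • liftCls z hz = liftCls (wittFrob s • z) (Submodule.smul_mem _ _ hz) := rfl

lemma liftCls_p_smul {z : X.CechTot ν} (hz : z ∈ (X.cech ν).Z n) :
    (p : TruncatedWittVector p 2 R) • liftCls z hz =
      liftCls ((p : TruncatedWittVector p 2 R) • z) (Submodule.smul_mem _ _ hz) := by
  rw [liftCls_smul, (liftCls_eq_iff _ _), map_natCast, sub_self]
  exact zero_mem _

lemma liftCls_add {z w : X.CechTot ν} (hz : z ∈ (X.cech ν).Z n) (hw : w ∈ (X.cech ν).Z n) :
    liftCls z hz + liftCls w hw = liftCls (z + w) (add_mem hz hw) := rfl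

lemma liftCls_d {z : X.CechTot ν} {m : ℤ} (h : m + 1 = n) (hz : z ∈ (X.cech ν).Z n) :
    (X.cyclicLift ν).d n m (liftCls z hz) =
      liftCls ((X.cech ν).d z) ((X.cech ν).d_mem_Z h hz) :=
  (X.cech ν).refine.dQ_cls h z _

lemma cyclicCls_smul (s : R) {z : A.CechTot ν} (hz : z ∈ (A.cech ν).Z n) :
    s • A.cyclicCls p ν n ⟨z, hz⟩ = A.cyclicCls p ν n ⟨s ^ p • z, Submodule.smul_mem _ _ hz⟩ := rfl

lemma cyclicCls_d {m : ℤ} (h : m + 1 = n) {z : A.CechTot ν} (hz : z ∈ (A.cech ν).Z n) :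
    (A.cyclic p ν).d n m (A.cyclicCls p ν n ⟨z, hz⟩) =
      A.cyclicCls p ν m ⟨(A.cech ν).d z, (A.cech ν).d_mem_Z h hz⟩ :=
  (A.cech ν).dQ_cls h z hz

lemma cyclicCls_congr {z w : A.CechTot ν} (hz : z ∈ (A.cech ν).Z n) (hw : w ∈ (A.cech ν).Z n)
    (h : z = w) : A.cyclicCls p ν n ⟨z, hz⟩ = A.cyclicCls p ν n ⟨w, hw⟩ :=
  (A.cech ν).cls_congr hz hw h

variable (r : SemiHom wittRes X A)

/-- The map of cycles given by a semilinear morphism. -/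
noncomputable def SemiHom.cyclicZ (n : ℤ) : (X.cech ν).refine.Z n →+ (A.cyclic p ν).X n :=
  AddMonoidHom.mk' (fun z => A.cyclicCls p ν n
    ⟨r.cech ν z.1, r.cech_Z ((X.cech ν).mem_refine_Z.mp z.2)⟩)
    fun z w => cyclicCls_congr _ (add_mem (r.cech_Z ((X.cech ν).mem_refine_Z.mp z.2))
      (r.cech_Z ((X.cech ν).mem_refine_Z.mp w.2))) (map_add (r.cech ν) z.1 w.1)

variable (hN : ∀ n, ∀ x ∈ (X.cech ν).N n, r.cech ν x ∈ (A.cech ν).B n)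

/-- The map of the quotients of the cycles given by a semilinear morphism. -/
noncomputable def SemiHom.cyclicMap (n : ℤ) : (X.cyclicLift ν).X n →+ (A.cyclic p ν).X n :=
  QuotientAddGroup.lift
    (((X.cech ν).refine.B n).submoduleOf ((X.cech ν).refine.Z n)).toAddSubgroup
    (r.cyclicZ n) fun z hz =>
        (Submodule.Quotient.mk_eq_zero _).mpr (hN n z.1 ((X.cech ν).mem_refine_B.mp hz))

lemma SemiHom.cyclicMap_cls {z : X.CechTot ν} (hz : z ∈ (X.cech ν).Z n) :
    r.cyclicMap hN n (liftCls z hz) = A.cyclicCls p ν n ⟨r.cech ν z, r.cech_Z hz⟩ := rfl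

/-- The morphism of the quotients of the cycles given by a semilinear morphism. -/
noncomputable def SemiHom.cyclic : SemiHom wittRes (X.cyclicLift ν) (A.cyclic p ν) where
  f := r.cyclicMap hN
  map_smul n s q := by
    obtain ⟨z, hz, rfl⟩ := liftCls_surjective q
    rw [liftCls_smul, r.cyclicMap_cls, r.cyclicMap_cls, cyclicCls_smul]
    exact cyclicCls_congr _ _ (by rw [r.cech_smul, wittRes_wittFrob])
  map_d i j q := by
    obtain ⟨z, hz, rfl⟩ := liftCls_surjective q
    by_cases h : j + 1 = i
    · rw [liftCls_d h, r.cyclicMap_cls, r.cyclicMap_cls, cyclicCls_d h]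
      exact cyclicCls_congr _ _ (r.cech_d z)
    · rw [DGAlgebra.shape _ i j h, DGAlgebra.shape _ i j h, LinearMap.zero_apply,
        LinearMap.zero_apply, map_zero]
  map_mul i j n h q q' := by
    subst h
    obtain ⟨z, hz, rfl⟩ := liftCls_surjective q
    obtain ⟨w, hw, rfl⟩ := liftCls_surjective q'
    exact cyclicCls_congr (r.cech_Z ((X.cech ν).mul_mem_Z rfl hz hw))
      ((A.cech ν).mul_mem_Z rfl (r.cech_Z hz) (r.cech_Z hw))
      (r.cech_mul (mem_cechFil_iff.mp hz.1.1) (mem_cechFil_iff.mp hw.1.1))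
  map_one := cyclicCls_congr (r.cech_Z (X.cech ν).one_mem_Z) (A.cech ν).one_mem_Z r.cech_one

include hN in
lemma exists_lift_quasiIso
    (hZ : ∀ n, ∀ z ∈ (X.cech ν).Z n,
      r.cech ν z ∈ (A.cech ν).F (1 - n) n ⊔ ((A.cech ν).F (-n) (n + 1)).map (A.cech ν).d →
      z ∈ (X.cech ν).F (1 - n) n ⊔ ((X.cech ν).F (-n) (n + 1)).map (X.cech ν).d)
    (hS : ∀ n, ∀ y ∈ (A.cech ν).Z n, ∃ z ∈ (X.cech ν).Z n, y - r.cech ν z ∈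
      (A.cech ν).F (1 - n) n ⊔ ((A.cech ν).F (-n) (n + 1)).map (A.cech ν).d)
    (hr : ∀ n, Function.Surjective (r.f n))
    (hk : ∀ n x, r.f n x = 0 → ∃ y, x = (p : TruncatedWittVector p 2 R) • y)
    (ht : ∀ n y, (p : TruncatedWittVector p 2 R) • y = 0 → r.f n y = 0) (a : Augmentation p R ν) :
    ∃ (C : DGAlgebra.{u, u} R) (l : C.Hom (A.cyclic p ν)), QuasiIso ((a.a A).comp l).toComplex := by
  let f : SemiHom wittRes (X.cyclicLift ν) A := (r.cyclic hN).comp (a.a A)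
  have hf : ∀ {n : ℤ} {z : X.CechTot ν} (hz : z ∈ (X.cech ν).Z n), f.f n (liftCls z hz) =
    (a.a A).f n (A.cyclicCls p ν n ⟨r.cech ν z, r.cech_Z hz⟩) := fun _ => rfl
  have hf0 : ∀ {n : ℤ} {z : X.CechTot ν} (hz : z ∈ (X.cech ν).Z n), z ∈ (X.cech ν).F (1 - n) n →
      f.f n (liftCls z hz) = 0 := fun hz h =>
    (hf hz).trans ((a.ker A _ _).mpr (Submodule.mem_sup_left (r.cech_F h)))
  refine ⟨desc wittRes_surjective ((pullback f r).quot (p : TruncatedWittVector p 2 R))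
    (quot_smul fun s hs => exists_eq_p_mul hs), descHom _ _ (quotHom wittRes_p
      (pullbackFst f r (r.cyclic hN))), quasiIso_pullback _ _ _ (fun _ _ => rfl) (fun n v => ?_) hr hk ht
      fun n x z hx hz hd => ?_⟩
  · obtain ⟨q, rfl⟩ := a.surjective A n v
    induction q using FilteredDG.Q_ind with | h y hy =>
    obtain ⟨z, hz, h⟩ := hS n y hy
    refine ⟨liftCls z hz, (hf hz).trans ?_⟩
    have := (a.ker A n ⟨_, sub_mem hy (r.cech_Z hz)⟩).mpr h
    exact (sub_eq_zero.mp ((map_sub ((a.a A).f n) (A.cyclicCls p ν n ⟨y, hy⟩)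
      (A.cyclicCls p ν n ⟨r.cech ν z, r.cech_Z hz⟩)).symm.trans this)).symm
  · obtain ⟨x, hx', rfl⟩ := liftCls_surjective x
    obtain ⟨z, hz', rfl⟩ := liftCls_surjective z
    obtain ⟨x₁, hx₁, _, ⟨g₁, hg₁, rfl⟩, rfl⟩ := Submodule.mem_sup.mp
      (hZ n x hx' ((a.ker A n ⟨_, r.cech_Z hx'⟩).mp hx))
    obtain ⟨z₁, hz₁, _, ⟨g, hg, rfl⟩, rfl⟩ := Submodule.mem_sup.mp
      (hZ (n - 1) z hz' ((a.ker A (n - 1) ⟨_, r.cech_Z hz'⟩).mp hz))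
    rw [show (1 : ℤ) - (n - 1) = 2 - n by ring] at hz₁
    rw [show -(n - 1) = 1 - n by ring, sub_add_cancel] at hg
    rw [liftCls_d (sub_add_cancel n 1), liftCls_p_smul, liftCls_eq_iff] at hd
    have hgZ : g ∈ (X.cech ν).Z n := ⟨(X.cech ν).mem_F (by omega) rfl hg, (X.cech ν).d_mem _ _ _ (by omega) _ hg⟩
    have hg₁Z : g₁ ∈ (X.cech ν).Z (n + 1) := ⟨(X.cech ν).mem_F (by omega) rfl hg₁,
      (X.cech ν).mem_F (i := -n) (by omega) (by omega) ((X.cech ν).d_mem _ _ n (by omega) _ hg₁)⟩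
    refine ⟨liftCls g₁ hg₁Z, liftCls g hgZ, hf0 _ ((X.cech ν).mem_F (by omega) rfl hg₁), hf0 _ hg, ?_⟩
    rw [liftCls_d rfl, liftCls_p_smul, liftCls_add, liftCls_eq_iff]
    have e : x₁ + (X.cech ν).d g₁ - ((X.cech ν).d g₁ + (p : TruncatedWittVector p 2 R) • g) =
      x₁ - (p : TruncatedWittVector p 2 R) • g := by abel
    rw [e]
    refine ⟨sub_mem hx₁ (Submodule.smul_mem _ _ hg), ?_⟩
    have h1 := hd.1
    rw [show (1 : ℤ) - (n - 1) = 2 - n by ring] at h1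
    have h2 := add_mem h1 (Submodule.smul_mem _ (p : TruncatedWittVector p 2 R) hz₁)
    rw [SetLike.mem_coe, Submodule.mem_comap, map_sub, _root_.map_smul]
    convert h2 using 1
    rw [map_add, smul_add, (X.cech ν).d_d]; abel

end lift

end DGAlgebra

namespace Reduction

variable {p : ℕ} [hp : Fact p.Prime] {R : Type u} [CommRing R]
  {X : DGAlgebra.{u, v} (TruncatedWittVector p 2 R)} {A : DGAlgebra.{u, v} R}

/-- A reduction, as a semilinear morphism. -/
def semiHom (ρ : Reduction X A) : DGAlgebra.SemiHom wittRes X A where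
  f := ρ.π
  map_smul n w x := by rw [ρ.map_smul, wittRes_apply]
  map_d := ρ.map_d
  map_mul := ρ.map_mul
  map_one := ρ.map_one

end Reduction

open DGAlgebra in
lemma exists_quasiIso_of_reduction {p : ℕ} [Fact p.Prime] {R : Type u} [Field R] [CharP R p]
    [PerfectField R] {ν : ResolutionData.{u} p} (a : Augmentation p R ν) {A : DGAlgebra.{u, u} R}
    {X : DGAlgebra.{u, u} (TruncatedWittVector p 2 R)}
    [∀ n, Module.Flat (TruncatedWittVector p 2 R) (X.X n)] (ρ : Reduction X A) :
    ∃ (C : DGAlgebra.{u, u} R) (l : C.Hom (A.cyclic p ν)), QuasiIso ((a.a A).comp l).toComplex := by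
  obtain ⟨O⟩ := exists_ops ν
  obtain ⟨c, -, hc⟩ := exists_gen_seq.{u, u} O
  have hc : IsGenSeq.{u, u} O c := hc
  have hk : ∀ n x, ρ.semiHom.f n x = 0 → ∃ y, x = (p : TruncatedWittVector p 2 R) • y :=
    fun n x => (ρ.ker n x).mp
  choose b' hb using fun n => exists_lift_basis (σ := wittRes) (c := (p : TruncatedWittVector p 2 R))
    wittRes_surjective wittRes_p (by have := p_mul_p_mul (1 : TruncatedWittVector p 2 R); simpa using this)
    (fun _ => exists_eq_p_mul) (fun _ => wittRes_eq_zero_of_p_mul) (ρ.semiHom.f n)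
    (ρ.semiHom.map_smul n) (ρ.surjective n) (hk n) (A.fieldBasis n)
  refine exists_lift_quasiIso ρ.semiHom
    (fun n x hx => ρ.semiHom.cech_N hb hc (fun _ => wittRes_eq_zero_of_p_mul) hx)
    (fun n z hz => ρ.semiHom.mem_of_cech_mem hb hc (CharP.cast_eq_zero R p) (fun _ => exists_eq_p_mul) hz)
    (fun n y hy => ρ.semiHom.exists_cech_sub_mem hb hc wittRes_surjective hy)
    ρ.surjective hk (fun n y hy => ?_) a
  obtain ⟨z, rfl⟩ := exists_smul_of_flat (fun s hs => exists_eq_p_mul (wittRes_eq_zero_of_p_mul hs)) hy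
  rw [ρ.semiHom.map_smul, wittRes_p, zero_smul]

end CyclicPower

theorem mainTheorem11 (p : ℕ) [Fact p.Prime] (R : Type u) [Field R] [CharP R p] [PerfectField R]
    (ν : CyclicPower.ResolutionData.{u} p) :
    Nonempty (CyclicPower.Augmentation p R ν) ∧
    ∀ (a : CyclicPower.Augmentation p R ν) (A : CyclicPower.DGAlgebra.{u, u} R)
      (A' : CyclicPower.DGAlgebra.{u, u} (TruncatedWittVector p 2 R)),
      (∀ n, Module.Flat (TruncatedWittVector p 2 R) (A'.X n)) →
      Nonempty (CyclicPower.Reduction A' A) →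
      ∃ (C : CyclicPower.DGAlgebra.{u, u} R) (l : C.Hom (A.cyclic p ν)),
        QuasiIso ((a.a A).comp l).toComplex :=
  ⟨CyclicPower.exists_augmentation p R ν, fun a _ _ _ ⟨ρ⟩ => CyclicPower.exists_quasiIso_of_reduction a ρ⟩
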